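/- **Setting.** Let $\Lambda$ be a front diagram over the $x$-line of an oriented Legendrian link in $J^1(\mathbb R)$, with $\mathbb Z$-valued Maslov potential $\mu$ (so all rotation numbers are $0$; a strand is oriented to the right iff $\mu$ is even on it) and with base points, in which every right cusp joins the two lowest strands over its $x$-coordinate, as in preferred plat position after listing right cusps over the same point from the bottom up. Let $\mathbb k$ be a commutative ring. Strands are numbered from top to bottom. **Algebras.** For a nonempty open interval $U\subset\mathbb R$ and $m\ge 1$, let $\mathcal A^m(U)$ be the DGA of the part over $U$ of the front projection $m$-copy of $\Lambda$ (copies numbered from top to bottom): it is freely generated over $\mathbb Z$ by chords $a_{ij}$ ($i<j$ strands at the left end of $U$), by the crossings and right cusps over $U$, and by invertible generators $t_*^{\pm1}$, one for each base point over $U$; here $|a_{ij}|=\mu(i)-\mu(j)-1$, $|c|=\mu(\mathrm{over})-\mu(\mathrm{under})$ for a crossing, $|c|=1$ for a right cusp, $|t_*|=0$. The differential is $\partial t_*^{\pm 1}=0$, $\partial a_{ij}=\sum_{i<k<j}(-1)^{|a_{ik}|+1}a_{ik}a_{kj}$, and for a crossing or right cusp it is the signed count of disks with right end $c$ and with left end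 at a left cusp or at a segment $[i,j]$ of the left border (contributing $a_{ij}$), including the invisible disk at a right cusp. For $V\subset U$ the corestriction $\mathcal A^m(V)\to\mathcal A^m(U)$ is the identity on crossings, right cusps and base points, and sends $b_{ij}$ to the signed count of disks over the part of $U$ left of $V$ which are bounded on the right by the segment $[i,j]$ of the left border of $V$. **Categories.** $\mathcal{A}ug_+(\Lambda|_{J^1(U)})$ is the $A_\infty$ category over $\mathbb k$ whose objects are the augmentations $\epsilon:\mathcal A^1(U)\to\mathbb k$ (unital ring homomorphisms vanishing on generators of nonzero degree with $\epsilon\circ\partial=0$), whose morphism spaces $\mathrm{Hom}_+(\epsilon_1,\epsilon_2)$ are the duals of the free module on the chords $c$ from copy 1 to copy 2 in the two-copy, the dual of $c$ having degree $|c|+1$, and whose operations $m_k$ on $\mathrm{Hom}_+(\epsilon_k,\epsilon_{k+1})\otimes\cdots\otimes\mathrm{Hom}_+(\epsilon_1,\epsilon_2)$ are dual to the differential of $\mathcal A^{k+1}(U)$ twisted by $(\epsilon_1,\dots,\epsilon_{k+1})$ on the copies. The restriction $A_\infty$ functor to $V\subset U$ is precomposition with the corestriction on objects, and its components on morphisms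 are dual to the twisted corestrictions of the multicopies. **Theorem.** Assume that there is a base point at every right cusp of $\Lambda$. Then $U\mapsto \mathcal{A}ug_+(\Lambda|_{J^1(U)})$ is a (constructible) sheaf of $A_\infty$ categories on the base of open intervals of $\mathbb R$. That is: 1. each $\mathcal{A}ug_+(\Lambda|_{J^1(U)})$ is a strictly unital $A_\infty$ category, the restrictions are strictly unital $A_\infty$ functors, and they compose strictly: $\rho_{UU}=\mathrm{id}$ and $\rho_{UW}=\rho_{VW}\circ\rho_{UV}$ for $W\subset V\subset U$; 2. for open intervals $L,R$ with $V=L\cap R\ne\emptyset$ and $U=L\cup R$, the natural functor $$\mathcal{A}ug_+(\Lambda|_{J^1(U)})\longrightarrow \mathcal{A}ug_+(\Lambda|_{J^1(L)})\times_{\mathcal{A}ug_+(\Lambda|_{J^1(V)})}\mathcal{A}ug_+(\Lambda|_{J^1(R)}),\qquad \epsilon\mapsto(\epsilon|_L,\epsilon|_R,\mathrm{id}),$$ is an equivalence (bijective on the cohomology of morphism complexes, and essentially surjective up to isomorphism). Here the target is the (homotopy) fibre product of $A_\infty$ categories: its objects are triples $(\xi,\eta,\varphi)$ with $\varphi:\xi|_V\to\eta|_V$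 an isomorphism, i.e. a closed morphism of degree $0$ that is invertible in cohomology, and the complex of morphisms $(\xi,\eta,\varphi)\to(\xi',\eta',\varphi')$ is $\mathrm{Hom}(\xi,\xi')\oplus\mathrm{Hom}(\eta,\eta')\oplus\mathrm{Hom}(\xi|_V,\eta'|_V)[-1]$ with its usual twisted $A_\infty$ structure; 3. if $V\subset U$ are open intervals and all crossings, cusps and base points over $U$ lie over $V$, then the restriction from $U$ to $V$ is an equivalence. -/

import Mathlib

noncomputable section

universe u

/-! ## Strictly unital A-infinity categories, in the bar (shifted) convention -/

namespace AInf

/-- A composable string of morphisms from `x` to `y`.  The head of the string is its leftmost entry,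
that is, the morphism which is composed last. -/
inductive Str {O : Type u} (H : O → O → Type u) : O → O → Type u
  | nil (x : O) : Str H x x
  | cons {x y z : O} (f : H y z) (s : Str H x y) : Str H x z

namespace Str

variable {O : Type u} {H : O → O → Type u}

def single {x y : O} (f : H x y) : Str H x y := cons f (nil x)

def append : {x y z : O} → Str H y z → Str H x y → Str H x z
  | _, _, _, nil _, s => s
  | _, _, _, cons f r, s => cons f (append r s)

def length : {x y : O} → Str H x y → ℕ
  | _, _, nil _ => 0
  | _, _, cons _ s => length s + 1

/-- The `i`-th object along the string, counted from the source (which has index `0`). -/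
def objAt : {x y : O} → Str H x y → ℕ → O
  | x, _, nil _, _ => x
  | _, y, cons _ s, i => if i ≤ length s then objAt s i else y

/-- If all morphism spaces are one and the same type: the morphisms of the string, in order of
composition (first composed first). -/
def vals {V : Type u} : {x y : O} → Str (fun _ _ : O => V) x y → List V
  | _, _, nil _ => []
  | _, _, cons f s => vals s ++ [f]

def map {O' : Type u} {H' : O' → O' → Type u} (φ : O → O')
    (F : ∀ x y : O, H x y → H' (φ x) (φ y)) : {x y : O} → Str H x y → Str H' (φ x) (φ y)
  | x, _, nil _ => nil (φ x)
  | _, _, cons f s => cons (F _ _ f) (map φ F s)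

/-- All ways of writing a string as a left part followed by a right part (either may be empty). -/
def splits : {x y : O} → Str H x y → List (Σ w : O, Str H w y × Str H x w)
  | x, _, nil _ => [⟨x, nil x, nil x⟩]
  | _, y, cons f s =>
      ⟨y, nil y, cons f s⟩ :: (splits s).map fun p => ⟨p.1, cons f p.2.1, p.2.2⟩

end Str

end AInf

open AInf

/-- The data of an A-infinity category over `𝕜`: objects, graded morphism modules
(`gr x y d` is the degree `d` part), the operators `par f = (-1)^{|f|} f`, the structure maps
`b` (all `b_k` at once, as one function on composable strings; `b_k = s ∘ m_k ∘ (s⁻¹)^{⊗ k}`), and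
units.  The laws are in `AInfCat.IsAInf`. -/
structure AInfCat (𝕜 : Type u) [CommRing 𝕜] where
  Obj : Type u
  Hom : Obj → Obj → Type u
  grp : ∀ x y, AddCommGroup (Hom x y)
  mod : ∀ x y, Module 𝕜 (Hom x y)
  gr : ∀ x y, ℤ → Submodule 𝕜 (Hom x y)
  par : ∀ x y, Hom x y → Hom x y
  b : ∀ {x y}, Str Hom x y → Hom x y
  one : ∀ x, Hom x x

attribute [instance] AInfCat.grp AInfCat.mod

namespace AInfCat

variable {𝕜 : Type u} [CommRing 𝕜] (A : AInfCat 𝕜)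

/-- The sign operator of the shifted grading, `f ↦ (-1)^{|f|-1} f`, on all entries of a string. -/
def sgnStr {x y : A.Obj} (s : Str A.Hom x y) : Str A.Hom x y :=
  Str.map id (fun _ _ f => - A.par _ _ f) s

/-- The coderivation extending `b`: the list of strings obtained by applying `b` to one consecutive
substring, with the Koszul sign of moving `b` (of degree one) past the entries to the left of it. -/
def bHat {x y : A.Obj} (s : Str A.Hom x y) : List (Str A.Hom x y) :=
  (Str.splits s).flatMap fun p => (Str.splits p.2.2).map fun q =>
    Str.append (A.sgnStr p.2.1) (Str.cons (A.b q.2.1) q.2.2)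

/-- `s` is homogeneous of total degree `d` in the shifted grading `‖f‖ = |f| - 1`. -/
def HasDeg : {x y : A.Obj} → Str A.Hom x y → ℤ → Prop
  | _, _, Str.nil _, d => d = 0
  | _, _, Str.cons f s, d => ∃ d₁ d₂ : ℤ, f ∈ A.gr _ _ (d₁ + 1) ∧ HasDeg s d₂ ∧ d = d₁ + d₂

/-- The laws of a strictly unital A-infinity category. -/
structure IsAInf : Prop where
  graded : ∀ x y, DirectSum.IsInternal (A.gr x y)
  par_eq : ∀ x y (d : ℤ) (f : A.Hom x y), f ∈ A.gr x y d →
    A.par x y f = ((d.negOnePow : ℤˣ) : ℤ) • f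
  par_add : ∀ x y (f g : A.Hom x y), A.par x y (f + g) = A.par x y f + A.par x y g
  b_add : ∀ {x y z w} (u : Str A.Hom z w) (f g : A.Hom y z) (v : Str A.Hom x y),
    A.b (u.append (.cons (f + g) v)) = A.b (u.append (.cons f v)) + A.b (u.append (.cons g v))
  b_smul : ∀ {x y z w} (u : Str A.Hom z w) (a : 𝕜) (f : A.Hom y z) (v : Str A.Hom x y),
    A.b (u.append (.cons (a • f) v)) = a • A.b (u.append (.cons f v))
  b_nil : ∀ x, A.b (.nil x) = 0
  b_deg : ∀ {x y} (s : Str A.Hom x y) (d : ℤ), A.HasDeg s d → A.b s ∈ A.gr x y (d + 2)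
  b_b : ∀ {x y} (s : Str A.Hom x y), ((A.bHat s).map A.b).sum = 0
  one_deg : ∀ x, A.one x ∈ A.gr x x 0
  b_one : ∀ x, A.b (.single (A.one x)) = 0
  one_left : ∀ {x y} (f : A.Hom x y), A.b (.cons (A.one y) (.single f)) = f
  one_right : ∀ {x y} (f : A.Hom x y), A.b (.cons f (.single (A.one x))) = A.par x y f
  one_long : ∀ {x y z} (u : Str A.Hom y z) (v : Str A.Hom x y), 2 ≤ u.length + v.length →
    A.b (u.append (.cons (A.one y) v)) = 0

variable {A}

def Closed {x y : A.Obj} (f : A.Hom x y) : Prop := A.b (.single f) = 0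

def Exact {x y : A.Obj} (f : A.Hom x y) : Prop := ∃ h : A.Hom x y, A.b (.single h) = f

/-- A closed morphism of degree zero which is invertible in the cohomology category. -/
def IsIso {x y : A.Obj} (f : A.Hom x y) : Prop :=
  f ∈ A.gr x y 0 ∧ Closed f ∧ ∃ g : A.Hom y x, g ∈ A.gr y x 0 ∧ Closed g ∧
    Exact (A.b (.cons g (.single f)) - A.one x) ∧ Exact (A.b (.cons f (.single g)) - A.one y)

variable (A) in
/-- The unit of `x`, as a morphism `x → y` for `y = x`. -/
def transOne {x y : A.Obj} (h : x = y) : A.Hom x y := h ▸ A.one x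

theorem isIso_transOne (hA : A.IsAInf) {x y : A.Obj} (h : x = y) : IsIso (A.transOne h) := by
  subst h
  have h0 : A.b (.single (0 : A.Hom x x)) = 0 := by
    have := hA.b_smul (.nil x) (0 : 𝕜) (0 : A.Hom x x) (.nil x)
    simpa [Str.append, Str.single] using this
  refine ⟨hA.one_deg x, hA.b_one x, A.one x, hA.one_deg x, hA.b_one x, ⟨0, ?_⟩, ⟨0, ?_⟩⟩ <;>
    simp [transOne, h0, hA.one_left]

end AInfCat

/-- The data of an A-infinity functor: a map on objects, and all Taylor components at once. -/
@[ext]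
structure AInfFunctor {𝕜 : Type u} [CommRing 𝕜] (A B : AInfCat 𝕜) where
  obj : A.Obj → B.Obj
  map : ∀ x y, Str A.Hom x y → B.Hom (obj x) (obj y)

namespace AInfFunctor

variable {𝕜 : Type u} [CommRing 𝕜] {A B C : AInfCat 𝕜}

def blocksAux (F : AInfFunctor A B) : {x y z : A.Obj} → Str A.Hom y z → Str A.Hom x y →
    List (Str B.Hom (F.obj x) (F.obj z))
  | _, _, _, acc, .nil _ => [.single (F.map _ _ acc)]
  | _, _, _, acc, .cons f s =>
      blocksAux F (acc.append (.single f)) s ++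
        (blocksAux F (.single f) s).map fun r => .cons (F.map _ _ acc) r

/-- All strings obtained by cutting a string into nonempty consecutive blocks and applying the
components of the functor to each block. -/
def blocks (F : AInfFunctor A B) : {x y : A.Obj} → Str A.Hom x y →
    List (Str B.Hom (F.obj x) (F.obj y))
  | x, _, .nil _ => [.nil (F.obj x)]
  | _, _, .cons f s => blocksAux F (.single f) s

/-- The laws of a strictly unital A-infinity functor. -/
structure IsFunctor (F : AInfFunctor A B) : Prop where
  map_add : ∀ {x y z w} (u : Str A.Hom z w) (f g : A.Hom y z) (v : Str A.Hom x y),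
    F.map _ _ (u.append (.cons (f + g) v)) =
      F.map _ _ (u.append (.cons f v)) + F.map _ _ (u.append (.cons g v))
  map_smul : ∀ {x y z w} (u : Str A.Hom z w) (a : 𝕜) (f : A.Hom y z) (v : Str A.Hom x y),
    F.map _ _ (u.append (.cons (a • f) v)) = a • F.map _ _ (u.append (.cons f v))
  map_nil : ∀ x, F.map _ _ (.nil x) = 0
  map_deg : ∀ {x y} (s : Str A.Hom x y) (d : ℤ), A.HasDeg s d → F.map _ _ s ∈ B.gr _ _ (d + 1)
  map_b : ∀ {x y} (s : Str A.Hom x y),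
    ((A.bHat s).map (F.map x y)).sum = ((F.blocks s).map B.b).sum
  map_one : ∀ x, F.map _ _ (.single (A.one x)) = B.one (F.obj x)
  map_one_long : ∀ {x y z} (u : Str A.Hom y z) (v : Str A.Hom x y), 1 ≤ u.length + v.length →
    F.map _ _ (u.append (.cons (A.one y) v)) = 0

def id (A : AInfCat 𝕜) : AInfFunctor A A where
  obj := fun x => x
  map := fun _ _ s => match s with
    | .nil _ => 0
    | .cons f (.nil _) => f
    | .cons _ (.cons _ _) => 0

/-- First `F`, then `G`. -/
def comp (F : AInfFunctor A B) (G : AInfFunctor B C) : AInfFunctor A C where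
  obj := fun x => G.obj (F.obj x)
  map := fun _ _ s => ((F.blocks s).map (G.map _ _)).sum

/-- Quasi-equivalence: bijective on the cohomology of all morphism complexes, and every object of
the target is isomorphic to one in the image. -/
structure IsEquivalence (F : AInfFunctor A B) : Prop where
  inj : ∀ {x y} (f : A.Hom x y), AInfCat.Closed f →
    AInfCat.Exact (F.map _ _ (.single f)) → AInfCat.Exact f
  surj : ∀ {x y} (g : B.Hom (F.obj x) (F.obj y)), AInfCat.Closed g →
    ∃ f : A.Hom x y, AInfCat.Closed f ∧ AInfCat.Exact (F.map _ _ (.single f) - g)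
  ess_surj : ∀ y : B.Obj, ∃ (x : A.Obj) (φ : B.Hom (F.obj x) y), AInfCat.IsIso φ

end AInfFunctor

/-! ## The fibre product of A-infinity categories

For `P : A → C` and `Q : B → C`, the objects are triples `(x, y, φ)`, `φ : P x → Q y` an isomorphism
in `C`. -/

namespace AInf

variable {𝕜 : Type u} [CommRing 𝕜] {A B C : AInfCat 𝕜}

structure FibObj (P : AInfFunctor A C) (Q : AInfFunctor B C) : Type u where
  fst : A.Obj
  snd : B.Obj
  iso : C.Hom (P.obj fst) (Q.obj snd)
  isIso : AInfCat.IsIso iso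

abbrev FibHom (P : AInfFunctor A C) (Q : AInfFunctor B C) (X Y : FibObj P Q) : Type u :=
  A.Hom X.fst Y.fst × B.Hom X.snd Y.snd × C.Hom (P.obj X.fst) (Q.obj Y.snd)

variable (P : AInfFunctor A C) (Q : AInfFunctor B C)

def fstStr {X Y : FibObj P Q} (s : Str (FibHom P Q) X Y) : Str A.Hom X.fst Y.fst :=
  Str.map FibObj.fst (fun _ _ f => f.1) s

def sndStr {X Y : FibObj P Q} (s : Str (FibHom P Q) X Y) : Str B.Hom X.snd Y.snd :=
  Str.map FibObj.snd (fun _ _ f => f.2.1) s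

/-- The sum of `b_C (Q̂ u, g, P̂ v)`, with the sign of the string `u`. -/
def fibTerm {X W W' Y : FibObj P Q} (u : Str (FibHom P Q) W' Y)
    (g : C.Hom (P.obj W.fst) (Q.obj W'.snd)) (v : Str (FibHom P Q) X W) :
    C.Hom (P.obj X.fst) (Q.obj Y.snd) :=
  ((Q.blocks (B.sgnStr (sndStr P Q u))).map fun U =>
    ((P.blocks (fstStr P Q v)).map fun V => C.b (U.append (.cons g V))).sum).sum

/-- The structure maps in the third component: insert the isomorphism of one object, or the third
component of one of the morphisms, with `Q` applied on the left of it and `P` on the right. -/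
def fibB {X Y : FibObj P Q} (s : Str (FibHom P Q) X Y) : C.Hom (P.obj X.fst) (Q.obj Y.snd) :=
  - ((Str.splits s).map fun p =>
      fibTerm P Q p.2.1 p.1.iso p.2.2 +
      match p with
      | ⟨_, _, .nil _⟩ => 0
      | ⟨_, u, .cons f v⟩ => fibTerm P Q u f.2.2 v).sum

end AInf

/-- The fibre product of A-infinity categories; the third component of a morphism is a morphism
of `C` of degree one less. -/
def AInfCat.fibre {𝕜 : Type u} [CommRing 𝕜] {A B C : AInfCat 𝕜}
    (P : AInfFunctor A C) (Q : AInfFunctor B C) : AInfCat 𝕜 where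
  Obj := FibObj P Q
  Hom := FibHom P Q
  grp := fun _ _ => inferInstance
  mod := fun _ _ => inferInstance
  gr := fun X Y d => (A.gr X.fst Y.fst d).prod
    ((B.gr X.snd Y.snd d).prod (C.gr (P.obj X.fst) (Q.obj Y.snd) (d - 1)))
  par := fun _ _ f => (A.par _ _ f.1, B.par _ _ f.2.1, - C.par _ _ f.2.2)
  b := fun s => (A.b (fstStr P Q s), B.b (sndStr P Q s), fibB P Q s)
  one := fun X => (A.one X.fst, B.one X.snd, 0)

/-! ## Presheaves of A-infinity categories over the line -/

/-- Nonempty open intervals of the line (bounded or not). -/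
structure OpenInterval where
  carrier : Set ℝ
  isOpen : IsOpen carrier
  ordConnected : carrier.OrdConnected
  nonempty : carrier.Nonempty

/-- The data of a presheaf of A-infinity categories on the base of open intervals of the line. -/
structure AInfPresheaf (𝕜 : Type u) [CommRing 𝕜] where
  cat : OpenInterval → AInfCat 𝕜
  res : ∀ {U V : OpenInterval}, V.carrier ⊆ U.carrier → AInfFunctor (cat U) (cat V)

namespace AInfPresheaf

variable {𝕜 : Type u} [CommRing 𝕜] (S : AInfPresheaf 𝕜)

structure IsPresheaf : Prop where
  isAInf : ∀ U, (S.cat U).IsAInf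
  isFunctor : ∀ {U V : OpenInterval} (h : V.carrier ⊆ U.carrier), (S.res h).IsFunctor
  res_refl : ∀ U : OpenInterval, S.res (subset_refl U.carrier) = AInfFunctor.id (S.cat U)
  res_trans : ∀ {U V W : OpenInterval} (h : V.carrier ⊆ U.carrier) (h' : W.carrier ⊆ V.carrier),
    S.res (h'.trans h) = (S.res h).comp (S.res h')

variable {S}

theorem IsPresheaf.obj_eq (hS : S.IsPresheaf) {U L R V : OpenInterval}
    (hL : L.carrier ⊆ U.carrier) (hR : R.carrier ⊆ U.carrier)
    (hVL : V.carrier ⊆ L.carrier) (hVR : V.carrier ⊆ R.carrier) (x : (S.cat U).Obj) :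
    (S.res hVL).obj ((S.res hL).obj x) = (S.res hVR).obj ((S.res hR).obj x) := by
  have h1 := hS.res_trans hL hVL
  have h2 := hS.res_trans hR hVR
  exact congrArg (fun F => AInfFunctor.obj F x) (h1.symm.trans h2)

/-- The canonical functor from sections over `U` to pairs of sections over `L` and `R` which are
identified over `V`. -/
def glue (hS : S.IsPresheaf) {U L R V : OpenInterval}
    (hL : L.carrier ⊆ U.carrier) (hR : R.carrier ⊆ U.carrier)
    (hVL : V.carrier ⊆ L.carrier) (hVR : V.carrier ⊆ R.carrier) :
    AInfFunctor (S.cat U) (AInfCat.fibre (S.res hVL) (S.res hVR)) where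
  obj := fun x => ⟨(S.res hL).obj x, (S.res hR).obj x,
    (S.cat V).transOne (hS.obj_eq hL hR hVL hVR x), AInfCat.isIso_transOne (hS.isAInf V) _⟩
  map := fun x y s => ((S.res hL).map x y s, (S.res hR).map x y s, 0)

variable (S)

/-- The sheaf property on the base of open intervals: `S` is a presheaf, and for overlapping
intervals `L`, `R` the sections over `L ∪ R` are the fibre product, over the
sections on `L ∩ R`, of the sections over `L` and over `R`. -/
def IsSheaf : Prop :=
  ∃ hS : S.IsPresheaf, ∀ (U L R V : OpenInterval)
    (hL : L.carrier ⊆ U.carrier) (hR : R.carrier ⊆ U.carrier)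
    (hVL : V.carrier ⊆ L.carrier) (hVR : V.carrier ⊆ R.carrier),
    U.carrier = L.carrier ∪ R.carrier → V.carrier = L.carrier ∩ R.carrier →
    (glue hS hL hR hVL hVR).IsEquivalence

/-- `S` is constructible with respect to the subset `Z` of the line: restriction from `U` to `V` is
an equivalence whenever all points of `Z` in `U` lie in `V`. -/
def IsConstructible (Z : Set ℝ) : Prop :=
  ∀ (U V : OpenInterval) (h : V.carrier ⊆ U.carrier), Z ∩ U.carrier ⊆ V.carrier →
    (S.res h).IsEquivalence

end AInfPresheaf

/-! ## Front diagrams -/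

/-- An event of a front diagram, read from left to right.  Strands over a point of the line are
numbered from top to bottom, starting with `0`. -/
inductive FrontEvent
  /-- A crossing of the strands `k` and `k + 1`. -/
  | cross (k : ℕ)
  /-- A base point on the strand `k`. -/
  | base (k : ℕ)
  /-- A left cusp, creating the strands `k` and `k + 1`, of Maslov potential `v + 1` and `v`. -/
  | lcusp (k : ℕ) (v : ℤ)
  /-- A right cusp joining the two lowest strands, with or without a base point on it. -/
  | rcusp (marked : Bool)

/-- The strands over a generic point of the line: their number, and their Maslov potentials
(relevant for indices less than `n`). -/
structure Slice where
  n : ℕ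
  pot : ℕ → ℤ

namespace FrontEvent

/-- The event can happen immediately to the right of the slice. -/
def Legal : FrontEvent → Slice → Prop
  | cross k, S => k + 1 < S.n
  | base k, S => k < S.n
  | lcusp k _, S => k ≤ S.n
  | rcusp _, S => 2 ≤ S.n ∧ S.pot (S.n - 2) = S.pot (S.n - 1) + 1

/-- The slice to the right of the event. -/
def next : FrontEvent → Slice → Slice
  | cross k, S => ⟨S.n, fun i => S.pot (Equiv.swap k (k + 1) i)⟩
  | base _, S => S
  | lcusp k v, S => ⟨S.n + 2, fun i =>
      if i < k then S.pot i else if i = k then v + 1 else if i = k + 1 then v else S.pot (i - 2)⟩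
  | rcusp _, S => ⟨S.n - 2, S.pot⟩

end FrontEvent

/-- The slice to the left of the event `e` of a sequence of events. -/
def sliceSeq (ev : ℕ → FrontEvent) : ℕ → Slice
  | 0 => ⟨0, fun _ => 0⟩
  | e + 1 => (ev e).next (sliceSeq ev e)

/-- A front diagram of a Legendrian link with base points and integral Maslov potential, in which
the region to the right of every right cusp is the lowest one.  The events are those with
index less than `size`, listed from left to right, and `pos e` is the `x`-coordinate of the event `e`
(different events may lie over the same point of the line).  The strands are oriented; a strand is
oriented to the right if and only if its Maslov potential is even. -/
structure Front where
  size : ℕ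
  event : ℕ → FrontEvent
  pos : ℕ → ℝ
  legal : ∀ e < size, (event e).Legal (sliceSeq event e)
  closed : (sliceSeq event size).n = 0
  pos_mono : ∀ e e', e ≤ e' → e' < size → pos e ≤ pos e'

/-! ## Names of the generators of the bordered algebras -/

/-- `line i j` is the chord between the strands `i` and `j` at the left border; `ev e` is the chord
at the event `e`. -/
inductive Chord
  | line (i j : ℕ)
  | ev (e : ℕ)

/-- A chord in the `m`-copy: from the copy `row` (of the upper or overcrossing strand) to the
copy `col`.  Copies are numbered from top to bottom, starting with `0`. -/
structure Letter where
  chord : Chord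
  row : ℕ
  col : ℕ

namespace Front

variable (Λ : Front)

/-- The slice to the left of the event `e`. -/
def slice (e : ℕ) : Slice := sliceSeq Λ.event e

/-- The letters which are generators for the `m`-copy of the part of the front with the
events `e`, `s ≤ e < t`.  At a crossing all pairs of copies occur.  The chords at the left border, and
the crossings of the copies close to a left cusp, need the first copy above the second one; at a
right cusp there are the cusps of the copies themselves, and crossings of the copies. -/
def IsReeb (s t m : ℕ) (l : Letter) : Prop :=
  l.row < m ∧ l.col < m ∧
  match l.chord with
  | .line i j => i < (Λ.slice s).n ∧ j < (Λ.slice s).n ∧ (i < j ∨ (i = j ∧ l.row < l.col))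
  | .ev e => s ≤ e ∧ e < t ∧
    match Λ.event e with
    | .cross _ => True
    | .base _ => False
    | .lcusp _ _ => l.row < l.col
    | .rcusp _ => l.col ≤ l.row

/-- The base points (event, copy) of the `m`-copy. -/
def IsMark (s t m : ℕ) (x : ℕ × ℕ) : Prop :=
  x.2 < m ∧ s ≤ x.1 ∧ x.1 < t ∧
  match Λ.event x.1 with
  | .base _ => True
  | .rcusp marked => marked = true
  | _ => False

abbrev Reeb (s t m : ℕ) : Type := {l : Letter // Λ.IsReeb s t m l}

abbrev Mark (s t m : ℕ) : Type := {x : ℕ × ℕ // Λ.IsMark s t m x}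

/-- The degree of a chord in the algebra of a part of the front with left border at the slice `s`. -/
def deg (s : ℕ) : Chord → ℤ
  | .line i j => (Λ.slice s).pot i - (Λ.slice s).pot j - 1
  | .ev e => match Λ.event e with
    | .cross k => (Λ.slice e).pot k - (Λ.slice e).pot (k + 1)
    | .base _ => 0
    | .lcusp _ _ => -1
    | .rcusp _ => 1

/-- `(-1)^d`, as an integer. -/
def sgn (d : ℤ) : ℤ := ((d.negOnePow : ℤˣ) : ℤ)

/-! ### The algebra -/

/-- The algebra of the `m`-copy of the part of the front with the events `e`, `s ≤ e < t`: it is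
freely generated by the letters and by the invertible elements for the base points. -/
abbrev Alg (s t m : ℕ) : Type :=
  MonoidAlgebra ℤ (Monoid.Coprod (FreeMonoid (Λ.Reeb s t m)) (FreeGroup (Λ.Mark s t m)))

variable {Λ} in
/-- The ring homomorphism with prescribed values on the generators. -/
def lift {s t m : ℕ} {B : Type*} [Ring B] (g : Λ.Reeb s t m → B) (τ : Λ.Mark s t m → Bˣ) :
    Λ.Alg s t m →+* B :=
  ((MonoidAlgebra.lift ℤ B _) (Monoid.Coprod.lift (FreeMonoid.lift g)
    ((Units.coeHom B).comp (FreeGroup.lift τ)))).toRingHom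

open Classical in
/-- The generator with a given name, and zero if there is none. -/
def gen (s t m : ℕ) (l : Letter) : Λ.Alg s t m :=
  if h : Λ.IsReeb s t m l then
    MonoidAlgebra.of ℤ _ (Monoid.Coprod.inl (FreeMonoid.of ⟨l, h⟩)) else 0

open Classical in
/-- The invertible generator of the copy `p` of the base point at the event `e`, and one if there
is none. -/
def tgen (s t m : ℕ) (e p : ℕ) : (Λ.Alg s t m)ˣ :=
  if h : Λ.IsMark s t m (e, p) then
    Units.map (MonoidAlgebra.of ℤ _) (Units.map Monoid.Coprod.inr (toUnits (FreeGroup.of ⟨(e, p), h⟩)))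
  else 1

/-! ### The events of the `m`-copy -/

/-- An event of the `m`-copy; `k` is the index of the uppermost strand involved, `e` the event of
the front it belongs to, and `p`, `q` are copies. -/
inductive Elem
  /-- A crossing with overstrand in the copy `p` and understrand in the copy `q`. -/
  | cross (k e p q : ℕ)
  /-- A base point on the copy `p`. -/
  | base (k e p : ℕ)
  /-- A left cusp. -/
  | lcusp (k : ℕ)
  /-- The right cusp of the copy `p`. -/
  | rcusp (k e p : ℕ)

/-- The events of the front projection `m`-copy coming from the event `e`, from left to right.  The
copy `p` of the strand `i` is the strand `m * i + p` before and after these events. -/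
def block (m e : ℕ) : List Elem :=
  match Λ.event e with
  | .cross k => (List.range m).flatMap fun q =>
      (List.range m).reverse.map fun p => Elem.cross (m * k + q + p) e p q
  | .base k => (List.range m).map fun p => Elem.base (m * k + p) e p
  | .lcusp k _ =>
      ((List.range m).map fun p => Elem.lcusp (m * k + 2 * p)) ++
      (List.range m).flatMap fun q =>
        ((List.range m).reverse.filter fun p => p < q).map fun p =>
          Elem.cross (m * k + q + p) e p q
  | .rcusp _ =>
      ((List.range m).flatMap fun q =>
        ((List.range m).reverse.filter fun p => q < p).map fun p =>
          Elem.cross (m * ((Λ.slice e).n - 2) + q + p) e p q) ++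
      (List.range m).reverse.map fun p => Elem.rcusp (m * ((Λ.slice e).n - 2) + 2 * p) e p

/-- The events of the `m`-copy coming from the events `e'` with `s ≤ e' < e`. -/
def elems (m s e : ℕ) : List Elem := (List.range' s (e - s)).flatMap fun e' => Λ.block m e'

/-! ### Disks

A disk which is bounded on the right by the strands `a < b` over some point of the line, and continues
to the left, is recorded by the word of its corners, its base points, and its left end.  The sum of
all these words is the entry `D a b` of a matrix `D`; we follow how this matrix changes as the right
boundary moves to the right through the events.  The letters are read counterclockwise: first those on
the upper boundary, from right to left. -/

section Disks

variable {B : Type*} [Ring B] (g : Letter → B) (τ : ℕ → ℕ → Bˣ)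

/-- The contribution of the copy `p` of the event `e` to the word of a disk having the base point of
this event on its upper boundary, resp. at its right end if the event is a right cusp. -/
def markFactor (e p : ℕ) : Bˣ :=
  open Classical in
  match Λ.event e with
  | .base k => if Even ((Λ.slice e).pot k) then (τ e p)⁻¹ else τ e p
  | .rcusp _ => if Even ((Λ.slice e).pot ((Λ.slice e).n - 2)) then τ e p else (τ e p)⁻¹
  | _ => 1

/-- The ways in which the upper boundary of a disk, which is on the strand `i` to the right of an
event, continues to the left of it: pairs of a factor and the new strand. -/
def upper (el : Elem) (i : ℕ) : List (B × ℕ) :=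
  match el with
  | .cross k e p q =>
      if i = k then [(1, k + 1)]
      else if i = k + 1 then [(1, k), ((- sgn (Λ.deg 0 (.ev e))) • g ⟨.ev e, p, q⟩, k + 1)]
      else [(1, i)]
  | .base k e p => if i = k then [((Λ.markFactor τ e p : Bˣ), k)] else [(1, i)]
  | .lcusp k => if i < k then [(1, i)] else if k + 2 ≤ i then [(1, i - 2)] else []
  | .rcusp k _ _ => if i < k then [(1, i)] else []

/-- The same for the lower boundary. -/
def lower (el : Elem) (j : ℕ) : List (B × ℕ) :=
  match el with
  | .cross k e p q =>
      if j = k then [(1, k + 1), (g ⟨.ev e, p, q⟩, k)]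
      else if j = k + 1 then [(1, k)]
      else [(1, j)]
  | .base k e p => if j = k then [(((Λ.markFactor τ e p)⁻¹ : Bˣ), k)] else [(1, j)]
  | .lcusp k => if j < k then [(1, j)] else if k + 2 ≤ j then [(1, j - 2)] else []
  | .rcusp k _ _ => if j < k then [(1, j)] else []

/-- The disk ending at a left cusp. -/
def tip (el : Elem) (i j : ℕ) : B :=
  match el with
  | .lcusp k => if i = k ∧ j = k + 1 then 1 else 0
  | _ => 0

/-- The matrix of disks to the right of an event, in terms of the one to the left of it. -/
def slide (D : ℕ → ℕ → B) (el : Elem) (i j : ℕ) : B :=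
  if i < j then
    tip el i j +
      ((Λ.upper g τ el i).map fun x =>
        ((Λ.lower g τ el j).map fun y => x.1 * D x.2 y.2 * y.1).sum).sum
  else 0

def sweep (D : ℕ → ℕ → B) (els : List Elem) : ℕ → ℕ → B :=
  els.foldl (fun D' el => Λ.slide g τ D' el) D

/-- The disks at the left border. -/
def border (m : ℕ) (a b : ℕ) : B := g ⟨.line (a / m) (b / m), a % m, b % m⟩

end Disks

/-! ### The differential -/

/-- `el` is the event of the `m`-copy with the crossing or right cusp named `(e, p, q)`. -/
def Elem.Names (el : Elem) (e p q : ℕ) : Bool :=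
  match el with
  | .cross _ e' p' q' => e' = e ∧ p' = p ∧ q' = q
  | .rcusp _ e' p' => e' = e ∧ p' = p ∧ q = p
  | _ => false

def Elem.strand : Elem → ℕ
  | .cross k _ _ _ => k
  | .base k _ _ => k
  | .lcusp k => k
  | .rcusp k _ _ => k

/-- The sum of the words of all disks with right end at the crossing or right cusp `(e, p, q)`; for a
right cusp this includes the invisible disk. -/
def chordDisks {B : Type*} [Ring B] (g : Letter → B) (τ : ℕ → ℕ → Bˣ) (s m e p q : ℕ) : B :=
  match (Λ.block m e).find? fun el => el.Names e p q with
  | none => 0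
  | some el =>
      Λ.sweep g τ (border g m)
        (Λ.elems m s e ++ (Λ.block m e).takeWhile fun el' => !el'.Names e p q)
        el.strand (el.strand + 1) +
      match el with
      | .rcusp _ e p => (Λ.markFactor τ e p : Bˣ)
      | _ => 0

/-- The differential of a generator. -/
def dgen (s t m : ℕ) (l : Letter) : Λ.Alg s t m :=
  match l.chord with
  | .line i j => ∑ c ∈ Finset.Ioo (m * i + l.row) (m * j + l.col),
      sgn (Λ.deg s (.line i (c / m)) + 1) •
        (Λ.gen s t m ⟨.line i (c / m), l.row, c % m⟩ * Λ.gen s t m ⟨.line (c / m) j, c % m, l.col⟩)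
  | .ev e => Λ.chordDisks (Λ.gen s t m) (Λ.tgen s t m) s m e l.row l.col

/-- The ring homomorphism `a ↦ ((-1)^{|a|} a, ∂ a; 0, a)`, which encodes the graded Leibniz rule
`∂ (a b) = (∂ a) b + (-1)^{|a|} a (∂ b)`; the generators of base points have degree zero and
differential zero. -/
def diffHom (s t m : ℕ) : Λ.Alg s t m →+* Matrix (Fin 2) (Fin 2) (Λ.Alg s t m) :=
  lift (fun r => !![sgn (Λ.deg s r.1.chord) • Λ.gen s t m r.1, Λ.dgen s t m r.1;
      0, Λ.gen s t m r.1])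
    (fun x => Units.map (Matrix.scalar (Fin 2)).toMonoidHom (Λ.tgen s t m x.1.1 x.1.2))

/-- The differential. -/
def diff (s t m : ℕ) (a : Λ.Alg s t m) : Λ.Alg s t m := Λ.diffHom s t m a 0 1

/-- The corestriction homomorphism from the algebra of a smaller part of the front, with the
events `e`, `s' ≤ e < t'`: a chord at the left border goes to the sum of the disks which are bounded
on the right by this chord. -/
def corestrict (s t s' t' m : ℕ) : Λ.Alg s' t' m →+* Λ.Alg s t m :=
  lift
    (fun r => match r.1.chord with
      | .line i j => Λ.sweep (Λ.gen s t m) (Λ.tgen s t m) (border (Λ.gen s t m) m)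
          (Λ.elems m s s') (m * i + r.1.row) (m * j + r.1.col)
      | .ev _ => Λ.gen s t m r.1)
    (fun x => Λ.tgen s t m x.1.1 x.1.2)

/-! ## Augmentations -/

/-- Augmentations: ring homomorphisms to `𝕜` which vanish on generators of nonzero degree, and on
boundaries. -/
def IsAug {𝕜 : Type u} [CommRing 𝕜] {s t : ℕ} (ε : Λ.Alg s t 1 →+* 𝕜) : Prop :=
  (∀ r : Λ.Reeb s t 1, Λ.deg s r.1.chord ≠ 0 → ε (Λ.gen s t 1 r.1) = 0) ∧
  ∀ a, ε (Λ.diff s t 1 a) = 0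

abbrev AugObj (𝕜 : Type u) [CommRing 𝕜] (s t : ℕ) : Type u :=
  {ε : Λ.Alg s t 1 →+* 𝕜 // Λ.IsAug ε}

/-! ### Augmentations restrict to smaller parts of the front -/

theorem lift_gen {s t m : ℕ} {B : Type*} [Ring B] (g : Λ.Reeb s t m → B)
    (τ : Λ.Mark s t m → Bˣ) (r : Λ.Reeb s t m) : lift g τ (Λ.gen s t m r.1) = g r := by
  simp [lift, gen, r.2]

theorem lift_tgen {s t m : ℕ} {B : Type*} [Ring B] (g : Λ.Reeb s t m → B)
    (τ : Λ.Mark s t m → Bˣ) (x : Λ.Mark s t m) :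
    lift g τ (Λ.tgen s t m x.1.1 x.1.2 : Λ.Alg s t m) = τ x := by
  have hx : Λ.IsMark s t m (x.1.1, x.1.2) := x.2
  simp [lift, tgen, hx]

theorem alg_hom_ext {s t m : ℕ} {B : Type*} [Ring B] {φ ψ : Λ.Alg s t m →+* B}
    (h1 : ∀ r : Λ.Reeb s t m, φ (Λ.gen s t m r.1) = ψ (Λ.gen s t m r.1))
    (h2 : ∀ x : Λ.Mark s t m,
      φ (Λ.tgen s t m x.1.1 x.1.2 : Λ.Alg s t m) = ψ (Λ.tgen s t m x.1.1 x.1.2 : Λ.Alg s t m)) :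
    φ = ψ := by
  have key : (φ : Λ.Alg s t m →* B).comp (MonoidAlgebra.of ℤ _) =
      (ψ : Λ.Alg s t m →* B).comp (MonoidAlgebra.of ℤ _) := by
    apply Monoid.Coprod.hom_ext
    · apply FreeMonoid.hom_eq
      intro r
      have := h1 r
      simpa [gen, r.2] using this
    · apply FreeGroup.ext_hom
      intro x
      have hx : Λ.IsMark s t m (x.1.1, x.1.2) := x.2
      have := h2 x
      simpa [tgen, hx] using this
  apply MonoidAlgebra.ringHom_ext
  · intro n
    rw [show (MonoidAlgebra.single 1 n : Λ.Alg s t m) = algebraMap ℤ _ n from rfl]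
    simp
  · intro w
    exact DFunLike.congr_fun key w

section

set_option linter.unusedTactic false
set_option linter.unreachableTactic false
set_option linter.unnecessarySeqFocus false

section Naturality

variable {B B' : Type*} [Ring B] [Ring B'] (φ : B →+* B')
  (g : Letter → B) (τ : ℕ → ℕ → Bˣ)

theorem map_markFactor (e p : ℕ) :
    (Λ.markFactor (fun e p => Units.map φ.toMonoidHom (τ e p)) e p : B') =
      φ (Λ.markFactor τ e p : B) ∧
    (((Λ.markFactor (fun e p => Units.map φ.toMonoidHom (τ e p)) e p)⁻¹ : B'ˣ) : B') =
      φ (((Λ.markFactor τ e p)⁻¹ : Bˣ) : B) := by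
  unfold markFactor
  split
  · split_ifs <;> simp [← map_inv]
  · split_ifs <;> simp [← map_inv]
  · simp

theorem map_slide (D : ℕ → ℕ → B) (el : Elem) (i j : ℕ) :
    Λ.slide (fun l => φ (g l)) (fun e p => Units.map φ.toMonoidHom (τ e p))
      (fun a b => φ (D a b)) el i j = φ (Λ.slide g τ D el i j) := by
  unfold slide
  by_cases hij : i < j
  · cases el with
    | cross k e p q =>
      simp only [hij, if_true, tip, upper, lower]
      split_ifs <;> simp
    | base k e p =>
      simp only [hij, if_true, tip, upper, lower, Λ.map_markFactor φ τ]
      split_ifs <;> simp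
    | lcusp k =>
      simp only [hij, if_true, tip, upper, lower]
      split_ifs <;> simp
    | rcusp k e p =>
      simp only [hij, if_true, tip, upper, lower]
      split_ifs <;> simp
  · simp [hij]

theorem map_sweep (els : List Elem) (D : ℕ → ℕ → B) (i j : ℕ) :
    Λ.sweep (fun l => φ (g l)) (fun e p => Units.map φ.toMonoidHom (τ e p))
      (fun a b => φ (D a b)) els i j = φ (Λ.sweep g τ D els i j) := by
  induction els generalizing D with
  | nil => rfl
  | cons el els ih =>
    simp only [sweep, List.foldl_cons] at ih ⊢
    rw [← ih]
    have : Λ.slide (fun l => φ (g l)) (fun e p => Units.map φ.toMonoidHom (τ e p))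
        (fun a b => φ (D a b)) el = fun a b => φ (Λ.slide g τ D el a b) := by
      funext a b
      exact Λ.map_slide φ g τ D el a b
    exact congrArg (fun D₀ => List.foldl (fun D' el' => Λ.slide (fun l => φ (g l))
      (fun e p => Units.map φ.toMonoidHom (τ e p)) D' el') D₀ els i j) this

theorem map_chordDisks (s m e p q : ℕ) :
    Λ.chordDisks (fun l => φ (g l)) (fun e p => Units.map φ.toMonoidHom (τ e p)) s m e p q =
      φ (Λ.chordDisks g τ s m e p q) := by
  unfold chordDisks
  split
  · simp
  · rw [map_add, ← Λ.map_sweep φ g τ]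
    congr 1
    split
    · exact (Λ.map_markFactor φ τ _ _).1
    · simp

end Naturality

/-- The properties of the values of an augmentation on the matrix of disks. -/
structure Inv {K : Type*} [CommRing K] (S : Slice) (D : ℕ → ℕ → K) : Prop where
  supp : ∀ i j, D i j ≠ 0 → i < j ∧ j < S.n ∧ S.pot i = S.pot j + 1
  sq : ∀ i j, ∑ l ∈ Finset.range S.n, D i l * D l j = 0

section

variable {K : Type*} [CommRing K] (g : Letter → K) (τ : ℕ → ℕ → Kˣ) {D : ℕ → ℕ → K}

theorem sum_pair_congr {n k : ℕ} (hk : k + 1 < n) {f h : ℕ → K}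
    (h1 : ∀ l, l ≠ k → l ≠ k + 1 → f l = h l) (h2 : f k + f (k + 1) = h k + h (k + 1)) :
    ∑ l ∈ Finset.range n, f l = ∑ l ∈ Finset.range n, h l := by
  have hm : k ∈ Finset.range n := by simp; omega
  have hm' : k + 1 ∈ (Finset.range n).erase k := by simp; omega
  rw [← Finset.add_sum_erase _ _ hm, ← Finset.add_sum_erase _ _ hm',
    ← Finset.add_sum_erase _ h hm, ← Finset.add_sum_erase _ h hm', ← add_assoc, ← add_assoc, h2]
  congr 1
  refine Finset.sum_congr rfl fun l hl => ?_
  simp at hl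
  exact h1 l hl.2.1 hl.1

theorem inv_cross {e k : ℕ} (hev : Λ.event e = .cross k) (hl : k + 1 < (Λ.slice e).n)
    (hD : Inv (Λ.slice e) D) (h0 : D k (k + 1) = 0)
    (hg : Λ.deg 0 (.ev e) ≠ 0 → g ⟨.ev e, 0, 0⟩ = 0) :
    Inv (Λ.slice (e + 1)) (Λ.slide g τ D (.cross k e 0 0)) := by
  obtain ⟨hs, hq⟩ := hD
  set c := g ⟨.ev e, 0, 0⟩ with hc
  have hz : ∀ i j, ¬ i < j → D i j = 0 := fun i j h => by
    by_contra h'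
    exact h (hs i j h').1
  have hcs : (- sgn (Λ.deg 0 (.ev e))) • c = - c := by
    by_cases h : Λ.deg 0 (.ev e) = 0
    · simp [h, sgn]
    · simp [hg h]
  have hcp : c ≠ 0 → (Λ.slice e).pot k = (Λ.slice e).pot (k + 1) := fun h => by
    by_contra h'
    apply h
    apply hg
    simp only [deg, hev]
    omega
  have hnext : Λ.slice (e + 1) = ⟨(Λ.slice e).n, fun i =>
      (Λ.slice e).pot (Equiv.swap k (k + 1) i)⟩ := by
    simp [slice, sliceSeq, hev, FrontEvent.next]
  set L : ℕ → ℕ → K := fun i l => if l = k then D i (k + 1) + D i k * c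
    else if l = k + 1 then D i k else D i l with hL
  have hE : ∀ i j, Λ.slide g τ D (.cross k e 0 0) i j =
      if i = k then L (k + 1) j else if i = k + 1 then L k j - c * L (k + 1) j else L i j := by
    intro i j
    unfold slide
    simp only [tip, upper, lower, hcs, hL, ← hc]
    by_cases hij : i < j
    · simp only [hij, if_true]
      split_ifs <;> (try omega) <;> simp <;> ring
    · simp only [hij, if_false]
      have hz' : ∀ i j, j ≤ i → D i j = 0 := fun i j h => hz i j (by omega)
      split_ifs <;> grind
  have key : ∀ i j, ∑ l ∈ Finset.range (Λ.slice e).n,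
      L i l * (if l = k then D (k + 1) j else if l = k + 1 then D k j - c * D (k + 1) j
        else D l j) = 0 := by
    intro i j
    rw [← hq i j]
    apply sum_pair_congr hl
    · intro l h1 h2
      simp [hL, h1, h2]
    · simp [hL]
      ring
  have key2 : ∀ i j, ∑ l ∈ Finset.range (Λ.slice e).n,
      (if i = k then L (k + 1) l else if i = k + 1 then L k l - c * L (k + 1) l else L i l) *
      (if l = k then D (k + 1) j else if l = k + 1 then D k j - c * D (k + 1) j
        else D l j) = 0 := by
    intro i j
    by_cases h1 : i = k
    · simpa only [h1, if_true] using key (k + 1) j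
    · by_cases h2 : i = k + 1
      · have hk1 := key k j
        have hk2 := key (k + 1) j
        calc _ = ∑ l ∈ Finset.range (Λ.slice e).n, (L k l *
                (if l = k then D (k + 1) j else if l = k + 1 then D k j - c * D (k + 1) j
                  else D l j) - c * (L (k + 1) l *
                (if l = k then D (k + 1) j else if l = k + 1 then D k j - c * D (k + 1) j
                  else D l j))) := Finset.sum_congr rfl fun l _ => by
                    rw [if_neg h1, if_pos h2]; ring
          _ = 0 := by rw [Finset.sum_sub_distrib, ← Finset.mul_sum, hk1, hk2]; simp
      · simpa only [h1, h2, if_false] using key i j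
  rw [hnext]
  constructor
  · intro i j hij
    have hlt : i < j := by
      by_contra h
      exact hij (by simp [slide, h])
    rw [hE] at hij
    simp only [hL] at hij
    have hs' : ∀ i j, D i j ≠ 0 → j < (Λ.slice e).n ∧
      (Λ.slice e).pot i = (Λ.slice e).pot j + 1 := fun i j h => (hs i j h).2
    refine ⟨hlt, ?_⟩
    clear_value c
    clear hE key key2 hq hz hnext hcs hg hs h0
    simp only [Equiv.swap_apply_def]
    rcases eq_or_ne c 0 with h0 | h0
    · simp only [h0, mul_zero, zero_mul, add_zero, sub_zero] at hij
      split_ifs at hij ⊢ <;> have h3 := hs' _ _ hij <;> refine ⟨by omega, ?_⟩ <;>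
        subst_vars <;> first | omega | exact h3.2
    · have hp := hcp h0
      have hor : ∀ {x y z : K}, x + y * z ≠ 0 → x ≠ 0 ∨ y ≠ 0 := by
        intro x y z h
        by_contra h'
        push Not at h'
        exact h (by simp [h'])
      have hor' : ∀ {x y z : K}, x - y * z ≠ 0 → x ≠ 0 ∨ z ≠ 0 := by
        intro x y z h
        by_contra h'
        push Not at h'
        exact h (by simp [h'])
      split_ifs at hij ⊢
      all_goals
        first
        | (exfalso; omega)
        | (have h3 := hs' _ _ hij)
        | (have h3 := hor hij
           rcases h3 with h3 | h3 <;> have h3 := hs' _ _ h3)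
        | (have h3 := hor' hij
           rcases h3 with h3 | h3 <;> have h3 := hs' _ _ h3)
      all_goals
        refine ⟨by omega, ?_⟩
        subst_vars
        first | omega | simp_all
  · intro i j
    have hE2 : ∀ l, Λ.slide g τ D (.cross k e 0 0) l j =
        (if j = k then
          (if l = k then D (k + 1) (k + 1) else if l = k + 1 then D k (k + 1) - c * D (k + 1) (k + 1)
            else D l (k + 1)) +
          (if l = k then D (k + 1) k else if l = k + 1 then D k k - c * D (k + 1) k
            else D l k) * c
        else if j = k + 1 then
          (if l = k then D (k + 1) k else if l = k + 1 then D k k - c * D (k + 1) k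
            else D l k)
        else (if l = k then D (k + 1) j else if l = k + 1 then D k j - c * D (k + 1) j
            else D l j)) := by
      intro l
      rw [hE]
      simp only [hL]
      split_ifs <;> (try omega) <;> ring
    simp only [hE2]
    simp only [hE]
    by_cases h1 : j = k
    · simp only [h1, if_true, mul_add, ← mul_assoc, Finset.sum_add_distrib, ← Finset.sum_mul, key2]
      simp
    · by_cases h2 : j = k + 1
      · simp only [h2, if_true]
        simpa using key2 i k
      · simpa only [h1, h2, if_false] using key2 i j

theorem inv_base {e k : ℕ} (hev : Λ.event e = .base k)
    (hD : Inv (Λ.slice e) D) :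
    Inv (Λ.slice (e + 1)) (Λ.slide g τ D (.base k e 0)) := by
  obtain ⟨hs, hq⟩ := hD
  have hnext : Λ.slice (e + 1) = Λ.slice e := by
    simp [slice, sliceSeq, hev, FrontEvent.next]
  set v : Kˣ := Λ.markFactor τ e 0
  set w : ℕ → Kˣ := fun i => if i = k then v else 1 with hw
  have hE : ∀ i j, Λ.slide g τ D (.base k e 0) i j = w i * D i j * ((w j)⁻¹ : Kˣ) := by
    intro i j
    unfold slide
    by_cases hij : i < j
    · simp only [hij, if_true, tip, upper, lower, hw]
      split_ifs <;> simp_all [v]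
    · have : D i j = 0 := by
        by_contra h
        exact hij (hs i j h).1
      simp [hij, this]
  rw [hnext]
  constructor
  · intro i j h
    rw [hE] at h
    exact hs i j fun h' => h (by simp [h'])
  · intro i j
    have : ∀ l, Λ.slide g τ D (.base k e 0) i l * Λ.slide g τ D (.base k e 0) l j =
        w i * (D i l * D l j) * ((w j)⁻¹ : Kˣ) := by
      intro l
      rw [hE, hE]
      have : (((w l)⁻¹ : Kˣ) : K) * (w l : K) = 1 := by simp
      linear_combination (w i * D i l * D l j * ((w j)⁻¹ : Kˣ) : K) * this
    simp only [this]
    rw [← Finset.sum_mul, ← Finset.mul_sum, hq]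
    simp

theorem sum_shift {n k : ℕ} (hk : k ≤ n) {f : ℕ → K} (h1 : f k = 0) (h2 : f (k + 1) = 0) :
    ∑ l ∈ Finset.range (n + 2), f l =
      ∑ l ∈ Finset.range n, f (if l < k then l else l + 2) := by
  obtain ⟨d, rfl⟩ := Nat.exists_eq_add_of_le hk
  rw [show k + d + 2 = k + 2 + d by omega, Finset.sum_range_add _ (k + 2), Finset.sum_range_add _ k 2,
    Finset.sum_range_succ, Finset.sum_range_one, Nat.add_zero, h1, h2, add_zero, add_zero,
    Finset.sum_range_add]
  congr 1
  · refine Finset.sum_congr rfl fun l hl => ?_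
    simp at hl
    simp [hl]
  · refine Finset.sum_congr rfl fun l _ => ?_
    rw [if_neg (by omega)]
    congr 1
    omega

theorem inv_lcusp {e k : ℕ} {v : ℤ} (hev : Λ.event e = .lcusp k v) (hk : k ≤ (Λ.slice e).n)
    (hD : Inv (Λ.slice e) D) :
    Inv (Λ.slice (e + 1)) (Λ.slide g τ D (.lcusp k)) := by
  obtain ⟨hs, hq⟩ := hD
  have hnext : Λ.slice (e + 1) = ⟨(Λ.slice e).n + 2, fun i =>
      if i < k then (Λ.slice e).pot i else if i = k then v + 1 else if i = k + 1 then v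
        else (Λ.slice e).pot (i - 2)⟩ := by
    simp [slice, sliceSeq, hev, FrontEvent.next]
  have hz : ∀ i j, j ≤ i → D i j = 0 := fun i j h => by
    by_contra h'
    have := (hs i j h').1
    omega
  have hE : ∀ i j, Λ.slide g τ D (.lcusp k) i j =
      if i = k ∧ j = k + 1 then 1
      else if i = k ∨ i = k + 1 ∨ j = k ∨ j = k + 1 then 0
      else D (if i < k then i else i - 2) (if j < k then j else j - 2) := by
    intro i j
    unfold slide
    by_cases hij : i < j
    · simp only [hij, if_true, tip, upper, lower]
      split_ifs <;> (try omega) <;> simp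
    · simp only [hij, if_false]
      split_ifs <;> (try omega) <;> (try rfl) <;> rw [hz _ _ (by omega)]
  rw [hnext]
  constructor
  · intro i j h
    have hlt : i < j := by
      by_contra h'
      exact h (by simp [slide, h'])
    rw [hE] at h
    refine ⟨hlt, ?_⟩
    split_ifs at h with h1 h2 h3 h4 h5
    · obtain ⟨rfl, rfl⟩ := h1
      simp
      omega
    all_goals first
      | exact absurd rfl h
      | (obtain ⟨_, h6, h7⟩ := hs _ _ h
         simp only
         refine ⟨by omega, ?_⟩
         split_ifs <;> first | omega | exact h7)
  · intro i j
    have hk1 : Λ.slide g τ D (.lcusp k) i k * Λ.slide g τ D (.lcusp k) k j = 0 := by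
      rw [hE i k]
      split_ifs <;> (try omega) <;> simp_all
    have hk2 : Λ.slide g τ D (.lcusp k) i (k + 1) * Λ.slide g τ D (.lcusp k) (k + 1) j = 0 := by
      rw [hE (k + 1) j]
      split_ifs <;> (try omega) <;> simp_all
    rw [sum_shift hk hk1 hk2]
    by_cases hi : i = k ∨ i = k + 1
    · refine Finset.sum_eq_zero fun l _ => ?_
      rw [hE i]
      split_ifs <;> (try omega) <;> simp_all <;> omega
    · by_cases hj : j = k ∨ j = k + 1
      · refine Finset.sum_eq_zero fun l _ => ?_
        rw [hE _ j]
        split_ifs <;> (try omega) <;> simp_all <;> omega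
      · rw [← hq (if i < k then i else i - 2) (if j < k then j else j - 2)]
        refine Finset.sum_congr rfl fun l _ => ?_
        have e1 : (if (if l < k then l else l + 2) < k then (if l < k then l else l + 2)
            else (if l < k then l else l + 2) - 2) = l := by
          split_ifs <;> omega
        have e2 : (if l < k then l else l + 2) ≠ k ∧ (if l < k then l else l + 2) ≠ k + 1 := by
          split_ifs <;> omega
        generalize (if l < k then l else l + 2) = l' at e1 e2 ⊢
        have a1 : ¬ (i = k ∧ l' = k + 1) := by tauto
        have a2 : ¬ (i = k ∨ i = k + 1 ∨ l' = k ∨ l' = k + 1) := by tauto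
        have a3 : ¬ (l' = k ∧ j = k + 1) := by tauto
        have a4 : ¬ (l' = k ∨ l' = k + 1 ∨ j = k ∨ j = k + 1) := by tauto
        rw [hE, hE, if_neg a1, if_neg a2, if_neg a3, if_neg a4, e1]

theorem inv_rcusp {e : ℕ} {mk : Bool} (hev : Λ.event e = .rcusp mk)
    (hD : Inv (Λ.slice e) D) :
    Inv (Λ.slice (e + 1)) (Λ.slide g τ D (.rcusp ((Λ.slice e).n - 2) e 0)) := by
  obtain ⟨hs, hq⟩ := hD
  have hnext : Λ.slice (e + 1) = ⟨(Λ.slice e).n - 2, (Λ.slice e).pot⟩ := by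
    simp [slice, sliceSeq, hev, FrontEvent.next]
  set N := (Λ.slice e).n - 2 with hN
  have hz : ∀ i j, j ≤ i → D i j = 0 := fun i j h => by
    by_contra h'
    have := (hs i j h').1
    omega
  have hE : ∀ i j, Λ.slide g τ D (.rcusp N e 0) i j = if i < N ∧ j < N then D i j else 0 := by
    intro i j
    unfold slide
    by_cases hij : i < j
    · simp only [hij, if_true, tip, upper, lower]
      split_ifs <;> (try omega) <;> simp
    · simp [hij, hz i j (by omega)]
  rw [hnext]
  constructor
  · intro i j h
    rw [hE] at h
    split_ifs at h with h1
    · exact ⟨(hs i j h).1, h1.2, (hs i j h).2.2⟩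
    · exact absurd rfl h
  · intro i j
    simp only [hE]
    by_cases h : i < N ∧ j < N
    · rw [← hq i j, ← Finset.sum_subset (Finset.range_subset_range.2 (show N ≤ (Λ.slice e).n by omega))]
      · refine Finset.sum_congr rfl fun l hl => ?_
        simp at hl
        simp [h, hl]
      · intro l _ hl
        simp at hl
        rw [hz l j (by omega), mul_zero]
    · refine Finset.sum_eq_zero fun l _ => ?_
      split_ifs <;> first | omega | simp

end

end

theorem elems_succ {m s e : ℕ} (h : s ≤ e) :
    Λ.elems m s (e + 1) = Λ.elems m s e ++ Λ.block m e := by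
  obtain ⟨d, rfl⟩ := Nat.exists_eq_add_of_le h
  simp [elems, Nat.add_assoc, List.range'_concat]

theorem sweep_succ {B : Type*} [Ring B] (g : Letter → B) (τ : ℕ → ℕ → Bˣ) (D : ℕ → ℕ → B)
    {m s e : ℕ} (h : s ≤ e) : Λ.sweep g τ D (Λ.elems m s (e + 1)) =
      Λ.sweep g τ (Λ.sweep g τ D (Λ.elems m s e)) (Λ.block m e) := by
  rw [elems_succ Λ h, sweep, List.foldl_append]
  rfl

theorem diff_gen {s t m : ℕ} (r : Λ.Reeb s t m) :
    Λ.diff s t m (Λ.gen s t m r.1) = Λ.dgen s t m r.1 := by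
  simp [diff, diffHom, lift_gen]

section

variable {K : Type u} [CommRing K] {s t : ℕ}

/-- The matrix of disks to the left of the event `e`, evaluated by a ring homomorphism. -/
def evalDisks (ε : Λ.Alg s t 1 →+* K) (e : ℕ) : ℕ → ℕ → K :=
  Λ.sweep (fun l => ε (Λ.gen s t 1 l)) (fun e p => Units.map ε.toMonoidHom (Λ.tgen s t 1 e p))
    (border (fun l => ε (Λ.gen s t 1 l)) 1) (Λ.elems 1 s e)

theorem evalDisks_eq (ε : Λ.Alg s t 1 →+* K) (e i j : ℕ) :
    Λ.evalDisks ε e i j = ε (Λ.sweep (Λ.gen s t 1) (Λ.tgen s t 1) (border (Λ.gen s t 1) 1)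
      (Λ.elems 1 s e) i j) := by
  rw [evalDisks, ← Λ.map_sweep ε]
  rfl

theorem gen_eq_zero {m : ℕ} {l : Letter} (h : ¬ Λ.IsReeb s t m l) : Λ.gen s t m l = 0 := by
  simp [gen, h]

theorem aug_gen {ε : Λ.Alg s t 1 →+* K} (hε : Λ.IsAug ε) (l : Letter)
    (hl : Λ.deg s l.chord ≠ 0) : ε (Λ.gen s t 1 l) = 0 := by
  by_cases h : Λ.IsReeb s t 1 l
  · exact hε.1 ⟨l, h⟩ hl
  · simp [Λ.gen_eq_zero h]

theorem aug_dgen {ε : Λ.Alg s t 1 →+* K} (hε : Λ.IsAug ε) {l : Letter}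
    (hl : Λ.IsReeb s t 1 l) : ε (Λ.dgen s t 1 l) = 0 := by
  rw [← Λ.diff_gen ⟨l, hl⟩]
  exact hε.2 _

theorem chordDisks_cross {B : Type*} [Ring B] (g : Letter → B) (τ : ℕ → ℕ → Bˣ) {e k : ℕ}
    (hev : Λ.event e = .cross k) : Λ.chordDisks g τ s 1 e 0 0 =
      Λ.sweep g τ (border g 1) (Λ.elems 1 s e) k (k + 1) := by
  simp [chordDisks, block, hev, Elem.Names, Elem.strand]

theorem chordDisks_rcusp {B : Type*} [Ring B] (g : Letter → B) (τ : ℕ → ℕ → Bˣ) {e : ℕ} {b : Bool}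
    (hev : Λ.event e = .rcusp b) : Λ.chordDisks g τ s 1 e 0 0 =
      Λ.sweep g τ (border g 1) (Λ.elems 1 s e) ((Λ.slice e).n - 2) ((Λ.slice e).n - 2 + 1) +
        (Λ.markFactor τ e 0 : Bˣ) := by
  simp [chordDisks, block, hev, Elem.Names, Elem.strand]

theorem evalDisks_inv (ht : t ≤ Λ.size) {ε : Λ.Alg s t 1 →+* K} (hε : Λ.IsAug ε) {e : ℕ}
    (hse : s ≤ e) (het : e ≤ t) : Inv (Λ.slice e) (Λ.evalDisks ε e) := by
  induction e, hse using Nat.le_induction with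
  | base =>
    have h0 : Λ.evalDisks ε s = fun i j => ε (Λ.gen s t 1 ⟨.line i j, 0, 0⟩) := by
      funext i j
      simp [evalDisks, elems, sweep, border, Nat.mod_one]
    have hsupp : ∀ i j, ε (Λ.gen s t 1 ⟨.line i j, 0, 0⟩) ≠ 0 → i < j ∧ j < (Λ.slice s).n ∧
        (Λ.slice s).pot i = (Λ.slice s).pot j + 1 := by
      intro i j h
      have h1 : Λ.IsReeb s t 1 ⟨.line i j, 0, 0⟩ := by
        by_contra h'
        simp [Λ.gen_eq_zero h'] at h
      have h2 : Λ.deg s (.line i j) = 0 := by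
        by_contra h'
        exact h (Λ.aug_gen hε _ h')
      simp [IsReeb] at h1
      simp [deg] at h2
      omega
    rw [h0]
    refine ⟨hsupp, fun i j => ?_⟩
    by_cases hij : i < j ∧ j < (Λ.slice s).n
    · have h1 : Λ.IsReeb s t 1 ⟨.line i j, 0, 0⟩ := by
        simp [IsReeb]
        omega
      have h2 := Λ.aug_dgen hε h1
      simp only [dgen, map_sum, one_mul, Nat.add_zero, Nat.div_one, Nat.mod_one] at h2
      have h3 : ∑ l ∈ Finset.Ioo i j, ε (Λ.gen s t 1 ⟨.line i l, 0, 0⟩) *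
          ε (Λ.gen s t 1 ⟨.line l j, 0, 0⟩) = 0 := by
        rw [← neg_eq_zero, ← h2, ← Finset.sum_neg_distrib]
        refine Finset.sum_congr rfl fun l _ => ?_
        by_cases hd : Λ.deg s (.line i l) = 0
        · simp [hd, sgn]
        · simp [Λ.aug_gen hε ⟨.line i l, 0, 0⟩ hd]
      rw [← h3]
      symm
      apply Finset.sum_subset
      · intro l hl
        simp at hl ⊢
        omega
      · intro l _ hl
        by_contra h
        have h4 := hsupp _ _ (left_ne_zero_of_mul h)
        have h5 := hsupp _ _ (right_ne_zero_of_mul h)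
        exact hl (by simp; omega)
    · refine Finset.sum_eq_zero fun l _ => ?_
      by_contra h
      have h4 := hsupp _ _ (left_ne_zero_of_mul h)
      have h5 := hsupp _ _ (right_ne_zero_of_mul h)
      omega
  | succ e hse ih =>
    have ih' := ih (by omega)
    have hl := Λ.legal e (by omega)
    rw [evalDisks, Λ.sweep_succ _ _ _ hse]
    change Inv _ (Λ.sweep _ _ (Λ.evalDisks ε e) _)
    rcases hev : Λ.event e with k | k | ⟨k, v⟩ | b
    · have hl' : k + 1 < (Λ.slice e).n := by rw [hev] at hl; exact hl
      have hb : Λ.block 1 e = [.cross k e 0 0] := by simp [block, hev]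
      rw [hb]
      refine Λ.inv_cross _ _ hev hl' ih' ?_ ?_
      · have hr : Λ.IsReeb s t 1 ⟨.ev e, 0, 0⟩ := by
          simp [IsReeb, hev]
          omega
        have := Λ.aug_dgen hε hr
        simp only [dgen] at this
        rw [← Λ.map_chordDisks ε, Λ.chordDisks_cross _ _ hev] at this
        exact this
      · intro h
        exact Λ.aug_gen hε _ h
    · have hb : Λ.block 1 e = [.base k e 0] := by simp [block, hev]
      rw [hb]
      exact Λ.inv_base _ _ hev ih'
    · have hl' : k ≤ (Λ.slice e).n := by rw [hev] at hl; exact hl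
      have hb : Λ.block 1 e = [.lcusp k] := by simp [block, hev]
      rw [hb]
      exact Λ.inv_lcusp _ _ hev hl' ih'
    · have hb : Λ.block 1 e = [.rcusp ((Λ.slice e).n - 2) e 0] := by simp [block, hev]
      rw [hb]
      exact Λ.inv_rcusp _ _ hev ih'

/-- A ring homomorphism is an augmentation if it satisfies the conditions on generators. -/
theorem isAug_of_gen {ε : Λ.Alg s t 1 →+* K}
    (h1 : ∀ r : Λ.Reeb s t 1, Λ.deg s r.1.chord ≠ 0 → ε (Λ.gen s t 1 r.1) = 0)
    (h2 : ∀ r : Λ.Reeb s t 1, ε (Λ.dgen s t 1 r.1) = 0) : Λ.IsAug ε := by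
  refine ⟨h1, fun a => ?_⟩
  have key : (ε.mapMatrix (m := Fin 2)).comp (Λ.diffHom s t 1) = (Matrix.scalar (Fin 2)).comp ε := by
    apply Λ.alg_hom_ext
    · intro r
      simp only [RingHom.comp_apply, diffHom, lift_gen]
      ext i j
      by_cases hd : Λ.deg s r.1.chord = 0
      · fin_cases i <;> fin_cases j <;> simp [h2, hd, sgn]
      · fin_cases i <;> fin_cases j <;> simp [h2, h1 r hd]
    · intro x
      simp only [RingHom.comp_apply, diffHom, lift_tgen]
      ext i j
      fin_cases i <;> fin_cases j <;> simp
  have := congrArg (fun F => F a 0 1) key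
  simpa [diff] using this

theorem slide_congr {g g' : Letter → K} {τ τ' : ℕ → ℕ → Kˣ} {e : ℕ}
    (hg : ∀ p q, g ⟨.ev e, p, q⟩ = g' ⟨.ev e, p, q⟩) (hτ : ∀ p, τ e p = τ' e p)
    {el : Elem} (hel : el ∈ Λ.block 1 e) (D : ℕ → ℕ → K) :
    Λ.slide g τ D el = Λ.slide g' τ' D el := by
  have hm : ∀ p, Λ.markFactor τ e p = Λ.markFactor τ' e p := by
    intro p
    simp only [markFactor, hτ]
  funext i j
  rcases hev : Λ.event e with k | k | ⟨k, v⟩ | b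
  · simp [block, hev] at hel
    subst hel
    simp only [slide, tip, upper, lower, hg]
  · simp [block, hev] at hel
    subst hel
    simp only [slide, tip, upper, lower, hm]
  · simp [block, hev] at hel
    subst hel
    simp only [slide, tip, upper, lower]
  · simp [block, hev] at hel
    subst hel
    simp only [slide, tip, upper, lower]

theorem sweep_congr {g g' : Letter → K} {τ τ' : ℕ → ℕ → Kˣ} {e : ℕ}
    (hg : ∀ p q, g ⟨.ev e, p, q⟩ = g' ⟨.ev e, p, q⟩) (hτ : ∀ p, τ e p = τ' e p)
    {els : List Elem} (hels : ∀ el ∈ els, el ∈ Λ.block 1 e) (D : ℕ → ℕ → K) :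
    Λ.sweep g τ D els = Λ.sweep g' τ' D els := by
  induction els generalizing D with
  | nil => rfl
  | cons el els ih =>
    simp only [sweep, List.foldl_cons] at ih ⊢
    rw [Λ.slide_congr hg hτ (hels el (by simp))]
    exact ih (fun el' h => hels el' (by simp [h])) _

theorem isAug_restrict {s' t' : ℕ} (h : s ≤ s') (hst : s' ≤ t') (h' : t' ≤ t) (ht : t ≤ Λ.size)
    {ε : Λ.Alg s t 1 →+* K} (hε : Λ.IsAug ε) : Λ.IsAug (ε.comp (Λ.corestrict s t s' t' 1)) := by
  set φ := ε.comp (Λ.corestrict s t s' t' 1) with hφ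
  have hinv := Λ.evalDisks_inv ht hε h (hst.trans h')
  have hline : ∀ i j, φ (Λ.gen s' t' 1 ⟨.line i j, 0, 0⟩) = Λ.evalDisks ε s' i j := by
    intro i j
    by_cases hr : Λ.IsReeb s' t' 1 ⟨.line i j, 0, 0⟩
    · have := Λ.lift_gen (s := s') (t := t') (m := 1)
        (fun r => match r.1.chord with
          | .line i j => Λ.sweep (Λ.gen s t 1) (Λ.tgen s t 1) (border (Λ.gen s t 1) 1)
              (Λ.elems 1 s s') (1 * i + r.1.row) (1 * j + r.1.col)
          | .ev _ => Λ.gen s t 1 r.1)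
        (fun x => Λ.tgen s t 1 x.1.1 x.1.2) ⟨_, hr⟩
      simp only [hφ, RingHom.comp_apply, corestrict, evalDisks_eq]
      rw [this]
      simp
    · rw [Λ.gen_eq_zero hr, map_zero]
      by_contra hne
      have := hinv.supp i j (Ne.symm hne)
      apply hr
      simp [IsReeb]
      omega
  have hev : ∀ e, s' ≤ e → e < t' → ∀ p q,
      φ (Λ.gen s' t' 1 ⟨.ev e, p, q⟩) = ε (Λ.gen s t 1 ⟨.ev e, p, q⟩) := by
    intro e h1 h2 p q
    by_cases hr : Λ.IsReeb s' t' 1 ⟨.ev e, p, q⟩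
    · simp only [hφ, RingHom.comp_apply, corestrict]
      rw [Λ.lift_gen _ _ ⟨_, hr⟩]
    · have hr' : ¬ Λ.IsReeb s t 1 ⟨.ev e, p, q⟩ := by
        intro h3
        exact hr ⟨h3.1, h3.2.1, h1, h2, h3.2.2.2.2⟩
      rw [Λ.gen_eq_zero hr, Λ.gen_eq_zero hr', map_zero, map_zero]
  have hmk : ∀ e, s' ≤ e → e < t' → ∀ p,
      Units.map φ.toMonoidHom (Λ.tgen s' t' 1 e p) = Units.map ε.toMonoidHom (Λ.tgen s t 1 e p) := by
    intro e h1 h2 p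
    by_cases hr : Λ.IsMark s' t' 1 (e, p)
    · apply Units.ext
      have := Λ.lift_tgen (s := s') (t := t') (m := 1)
        (fun r => match r.1.chord with
          | .line i j => Λ.sweep (Λ.gen s t 1) (Λ.tgen s t 1) (border (Λ.gen s t 1) 1)
              (Λ.elems 1 s s') (1 * i + r.1.row) (1 * j + r.1.col)
          | .ev _ => Λ.gen s t 1 r.1)
        (fun x => Λ.tgen s t 1 x.1.1 x.1.2) ⟨_, hr⟩
      exact congrArg ε this
    · have hr' : ¬ Λ.IsMark s t 1 (e, p) := by
        intro h3
        exact hr ⟨h3.1, h1, h2, h3.2.2.2⟩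
      simp [tgen, hr, hr']
  have hdisks : ∀ e, s' ≤ e → e ≤ t' → Λ.evalDisks φ e = Λ.evalDisks ε e := by
    intro e h1 h2
    induction e, h1 using Nat.le_induction with
    | base =>
      funext i j
      rw [← hline]
      simp [evalDisks, elems, sweep, border, Nat.mod_one]
    | succ e h1 ih =>
      have ih' := ih (by omega)
      rw [evalDisks, evalDisks, Λ.sweep_succ _ _ _ h1, Λ.sweep_succ _ _ _ (h.trans h1)]
      change Λ.sweep _ _ (Λ.evalDisks φ e) _ = Λ.sweep _ _ (Λ.evalDisks ε e) _
      rw [ih']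
      exact Λ.sweep_congr (hev e h1 (by omega)) (hmk e h1 (by omega)) (fun _ h => h) _
  apply Λ.isAug_of_gen
  · rintro ⟨⟨c, p, q⟩, hr⟩ hd
    have hp : p = 0 := by have := hr.1; simp at this; exact this
    have hq : q = 0 := by have := hr.2.1; simp at this; exact this
    subst hp hq
    cases c with
    | line i j =>
      rw [hline]
      by_contra hne
      have := hinv.supp i j hne
      simp only [deg] at hd
      omega
    | ev e =>
      have h1 := hr.2.2
      rw [hev e h1.1 h1.2.1]
      exact Λ.aug_gen hε _ hd
  · rintro ⟨⟨c, p, q⟩, hr⟩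
    have hp : p = 0 := by have := hr.1; simp at this; exact this
    have hq : q = 0 := by have := hr.2.1; simp at this; exact this
    subst hp hq
    cases c with
    | line i j =>
      simp only [dgen, map_sum, one_mul, Nat.add_zero, Nat.div_one, Nat.mod_one]
      have h2 := hinv.sq i j
      rw [← neg_eq_zero, ← h2, ← Finset.sum_neg_distrib]
      have h3 : i < j ∧ j < (Λ.slice s').n := by
        have := hr.2.2
        simp at this
        omega
      have h4 : ∀ l, - φ (sgn (Λ.deg s' (.line i l) + 1) •
          (Λ.gen s' t' 1 ⟨.line i l, 0, 0⟩ * Λ.gen s' t' 1 ⟨.line l j, 0, 0⟩)) =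
          Λ.evalDisks ε s' i l * Λ.evalDisks ε s' l j := by
        intro l
        rw [map_zsmul, map_mul, hline, hline]
        by_cases h5 : Λ.evalDisks ε s' i l = 0
        · simp [h5]
        · have := hinv.supp i l h5
          have hd : Λ.deg s' (.line i l) = 0 := by
            simp only [deg]
            omega
          simp [hd, sgn]
      simp only [h4]
      apply Finset.sum_subset
      · intro l hl
        simp at hl ⊢
        omega
      · intro l _ hl
        by_contra hne
        have h4 := hinv.supp _ _ (left_ne_zero_of_mul hne)
        have h5 := hinv.supp _ _ (right_ne_zero_of_mul hne)
        exact hl (by simp; omega)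
    | ev e =>
      obtain ⟨_, _, h1, h2, h3⟩ := hr
      have hr' : Λ.IsReeb s t 1 ⟨.ev e, 0, 0⟩ :=
        ⟨by simp, by simp, h.trans h1, h2.trans_le h', h3⟩
      have h4 := Λ.aug_dgen hε hr'
      simp only [dgen] at h4 ⊢
      rw [← Λ.map_chordDisks] at h4 ⊢
      rcases he : Λ.event e with k | k | ⟨k, v⟩ | b
      · rw [Λ.chordDisks_cross _ _ he] at h4 ⊢
        rw [← h4]
        exact congrFun (congrFun (hdisks e h1 h2.le) k) (k + 1)
      · simp [he] at h3
      · simp [he] at h3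
      · rw [Λ.chordDisks_rcusp _ _ he] at h4 ⊢
        rw [← h4]
        congr 1
        · exact congrFun (congrFun (hdisks e h1 h2.le) _) _
        · have : ∀ τ τ' : ℕ → ℕ → Kˣ, τ e 0 = τ' e 0 →
              Λ.markFactor τ e 0 = Λ.markFactor τ' e 0 := by
            intro τ τ' hτ
            simp only [markFactor, hτ]
          exact congrArg Units.val (this (fun e p => Units.map φ.toMonoidHom (Λ.tgen s' t' 1 e p))
            (fun e p => Units.map ε.toMonoidHom (Λ.tgen s t 1 e p)) (hmk e h1 h2 0))

end

/-! ## The augmentation category -/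

/-- The chords from the first to the second copy in the two-copy. -/
abbrev Plus (s t : ℕ) : Type := {c : Chord // Λ.IsReeb s t 2 ⟨c, 0, 1⟩}

variable {𝕜 : Type u} [CommRing 𝕜]

/-- The homomorphism from the algebra of the `m`-copy to the tensor algebra over `𝕜`
obtained by adding to each generator its value under the pure augmentation given by the
augmentation `ε p` on the copy `p`, for all `p`; base points are replaced by their values. -/
def twist (s t m : ℕ) (ε : ℕ → (Λ.Alg s t 1 →+* 𝕜)) :
    Λ.Alg s t m →+* MonoidAlgebra 𝕜 (FreeMonoid (Λ.Reeb s t m)) :=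
  lift
    (fun r => MonoidAlgebra.of 𝕜 _ (FreeMonoid.of r) +
      if r.1.row = r.1.col then
        algebraMap 𝕜 _ (ε r.1.row (Λ.gen s t 1 ⟨r.1.chord, 0, 0⟩)) else 0)
    (fun x => Units.map (algebraMap 𝕜 _).toMonoidHom
      (Units.map (ε x.1.2).toMonoidHom (Λ.tgen s t 1 x.1.1 0)))

open Classical in
def coord (s t : ℕ) (f : Λ.Plus s t → 𝕜) (c : Chord) : 𝕜 :=
  if h : Λ.IsReeb s t 2 ⟨c, 0, 1⟩ then f ⟨c, h⟩ else 0

/-- The pairing of a tensor `f_k ⊗ … ⊗ f_1` (given as the list `[f_1, …, f_k]`) with a word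
`c_1 ⋯ c_k`, where `c_1` goes from the copy `i` to the copy `i + 1`, and so on.  The sign is
`(-1)` to the power `∑_{p < q} |c_p| |c_q|`. -/
def pairing (s t : ℕ) : ℕ → List (Λ.Plus s t → 𝕜) → List Letter → 𝕜
  | _, [], [] => 1
  | i, f :: fs, l :: ls =>
      if l.row = i ∧ l.col = i + 1 then
        (sgn (Λ.deg s l.chord * (ls.map fun l' => Λ.deg s l'.chord).sum) : 𝕜) *
          Λ.coord s t f l.chord * pairing s t (i + 1) fs ls
      else 0
  | _, _, _ => 0

variable (𝕜) in
/-- For a string of morphisms between augmentations: the linear functional on the algebra of the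
multicopy, with one copy for each object, which first twists by the augmentations, and
then pairs with the morphisms. -/
def strEval {s t : ℕ} {x y : Λ.AugObj 𝕜 s t}
    (f : AInf.Str (fun _ _ : Λ.AugObj 𝕜 s t => Λ.Plus s t → 𝕜) x y)
    (a : Λ.Alg s t (f.length + 1)) : 𝕜 :=
  (Λ.twist s t (f.length + 1) (fun p => (f.objAt p).1) a).coeff.sum fun w c =>
    c * Λ.pairing s t 0 f.vals ((FreeMonoid.toList w).map Subtype.val)

variable (𝕜) in
open Classical in
/-- The augmentation category of the part of the front with the events `e`, `s ≤ e < t`.  Morphism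
spaces are dual to the free module on the chords from the first to the second copy, with the dual of
a chord `c` in degree `|c| + 1`; the maps `b_k` are dual to the differential of the `(k+1)`-copy,
twisted by the augmentations on the copies. -/
def augCat (s t : ℕ) : AInfCat 𝕜 where
  Obj := Λ.AugObj 𝕜 s t
  Hom := fun _ _ => Λ.Plus s t → 𝕜
  grp := fun _ _ => inferInstance
  mod := fun _ _ => inferInstance
  gr := fun _ _ d =>
    { carrier := {f | ∀ c, Λ.deg s c.1 + 1 ≠ d → f c = 0}
      add_mem' := fun hf hg c hc => by simp [hf c hc, hg c hc]
      zero_mem' := fun _ _ => rfl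
      smul_mem' := fun a f hf c hc => by simp [hf c hc] }
  par := fun _ _ f c => (sgn (Λ.deg s c.1 + 1) : 𝕜) * f c
  b := fun f c =>
    if f.length = 0 then 0
    else Λ.strEval 𝕜 f (Λ.diff s t _ (Λ.gen s t _ ⟨c.1, 0, f.length⟩))
  one := fun _ c => match c.1 with
    | .line i j => if i = j then -1 else 0
    | .ev e => match Λ.event e with
      | .lcusp _ _ => -1
      | _ => 0


variable (𝕜) in
open Classical in
/-- Restriction to a smaller part of the front: augmentations are composed with the corestriction
homomorphism, and the components on morphisms are dual to the corestriction homomorphisms of the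
multicopies. -/
def augRes {s t s' t' : ℕ} (h : s ≤ s') (hst : s' ≤ t') (h' : t' ≤ t) (ht : t ≤ Λ.size) :
    AInfFunctor (Λ.augCat 𝕜 s t) (Λ.augCat 𝕜 s' t') where
  obj := fun ε => ⟨ε.1.comp (Λ.corestrict s t s' t' 1), Λ.isAug_restrict h hst h' ht ε.2⟩
  map := fun x y f => fun c : Λ.Plus s' t' =>
    if f.length = 0 then 0
    else Λ.strEval 𝕜 (x := x) (y := y) f
      (Λ.corestrict s t s' t' _ (Λ.gen s' t' _ ⟨c.1, 0, f.length⟩))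

/-! ## The presheaf of augmentation categories -/

open Classical in
/-- The number of events to the left of the interval. -/
def lo (U : OpenInterval) : ℕ := ((Finset.range Λ.size).filter fun e => ∀ x ∈ U.carrier, Λ.pos e ≤ x).card

open Classical in
/-- The number of events to the left of the interval or in it. -/
def hi (U : OpenInterval) : ℕ := ((Finset.range Λ.size).filter fun e => ∃ x ∈ U.carrier, Λ.pos e ≤ x).card

theorem lo_mono {U V : OpenInterval} (h : V.carrier ⊆ U.carrier) : Λ.lo U ≤ Λ.lo V := by
  apply Finset.card_le_card
  intro e he
  simp only [Finset.mem_filter] at he ⊢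
  exact ⟨he.1, fun x hx => he.2 x (h hx)⟩

theorem hi_mono {U V : OpenInterval} (h : V.carrier ⊆ U.carrier) : Λ.hi V ≤ Λ.hi U := by
  apply Finset.card_le_card
  intro e he
  simp only [Finset.mem_filter] at he ⊢
  obtain ⟨h1, x, hx, h2⟩ := he
  exact ⟨h1, x, h hx, h2⟩

theorem lo_le_hi (U : OpenInterval) : Λ.lo U ≤ Λ.hi U := by
  apply Finset.card_le_card
  intro e he
  simp only [Finset.mem_filter] at he ⊢
  obtain ⟨x, hx⟩ := U.nonempty
  exact ⟨he.1, x, hx, he.2 x hx⟩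

theorem hi_le (U : OpenInterval) : Λ.hi U ≤ Λ.size := by
  classical
  exact (Finset.card_filter_le _ _).trans (Finset.card_range _).le

variable (𝕜) in
/-- The presheaf which sends an open interval to the augmentation category of the part of the
front over this interval. -/
def augPresheaf : AInfPresheaf 𝕜 where
  cat := fun U => Λ.augCat 𝕜 (Λ.lo U) (Λ.hi U)
  res := fun {U V} h =>
    Λ.augRes 𝕜 (Λ.lo_mono h) (Λ.lo_le_hi V) (Λ.hi_mono h) (Λ.hi_le U)

/-- The positions of the events. -/
def eventPoints : Set ℝ := {x | ∃ e < Λ.size, Λ.pos e = x}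

/-- There is a base point at every right cusp. -/
def BasePointsAtRightCusps : Prop := ∀ e < Λ.size, Λ.event e ≠ .rcusp false

end Front

end

noncomputable section

universe v

open AInf


namespace AInf

/-! ## Sums over the splittings of a string -/

namespace Str

variable {O : Type u} {H : O → O → Type u} {K : Type v}

/-- The sum of `G u v` over all splittings of a string into a left part `u` and a right part `v`. -/
def splitSum [AddCommMonoid K] {x y : O} (s : Str H x y)
    (G : ∀ w, Str H w y → Str H x w → K) : K :=
  ((splits s).map fun p => G p.1 p.2.1 p.2.2).sum

section

variable [AddCommMonoid K]

@[simp] theorem splitSum_nil (x : O) (G : ∀ w, Str H w x → Str H x w → K) :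
    splitSum (nil x) G = G x (nil x) (nil x) := by
  simp [splitSum, splits]

@[simp] theorem splitSum_cons {x y z : O} (f : H y z) (s : Str H x y)
    (G : ∀ w, Str H w z → Str H x w → K) :
    splitSum (cons f s) G = G z (nil z) (cons f s) +
      splitSum s fun w u v => G w (cons f u) v := by
  simp [splitSum, splits, Function.comp_def]

theorem splitSum_congr {x y : O} {s : Str H x y} {G G' : ∀ w, Str H w y → Str H x w → K}
    (h : ∀ w u v, G w u v = G' w u v) : splitSum s G = splitSum s G' := by
  have : G = G' := by funext w u v; exact h w u v
  rw [this]

theorem splitSum_add {x y : O} (s : Str H x y) (G G' : ∀ w, Str H w y → Str H x w → K) :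
    (splitSum s fun w u v => G w u v + G' w u v) = splitSum s G + splitSum s G' := by
  induction s with
  | nil => simp
  | cons f s ih => simp [ih, add_add_add_comm]

@[simp] theorem splitSum_zero {x y : O} (s : Str H x y) :
    (splitSum s fun _ _ _ => (0 : K)) = 0 := by
  simp [splitSum]

@[simp] theorem nil_append {x y : O} (s : Str H x y) : append (nil y) s = s := by
  rw [append]

@[simp] theorem cons_append {x y z w : O} (f : H z w) (r : Str H y z) (s : Str H x y) :
    append (cons f r) s = cons f (append r s) := by
  rw [append]

@[simp] theorem append_nil {x y : O} (s : Str H x y) : append s (nil x) = s := by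
  induction s with
  | nil => simp
  | cons f s ih => simp [ih]

@[simp] theorem map_nil {O' : Type u} {H' : O' → O' → Type u} (φ : O → O')
    (F : ∀ x y : O, H x y → H' (φ x) (φ y)) (x : O) :
    map φ F (nil x : Str H x x) = nil (φ x) := by
  rw [map]

@[simp] theorem map_cons {O' : Type u} {H' : O' → O' → Type u} (φ : O → O')
    (F : ∀ x y : O, H x y → H' (φ x) (φ y)) {x y z : O} (f : H y z) (s : Str H x y) :
    map φ F (cons f s) = cons (F _ _ f) (map φ F s) := by
  rw [map]

@[simp] theorem length_nil (x : O) : length (nil x : Str H x x) = 0 := by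
  rw [length]

@[simp] theorem length_cons {x y z : O} (f : H y z) (s : Str H x y) :
    length (cons f s) = length s + 1 := by
  rw [length]

@[simp] theorem length_append {x y z : O} (r : Str H y z) (s : Str H x y) :
    length (append r s) = length r + length s := by
  induction r with
  | nil => simp
  | cons f r ih => simp [ih]; omega

theorem append_assoc {x y z w : O} (r : Str H z w) (s : Str H y z) (t : Str H x y) :
    append (append r s) t = append r (append s t) := by
  induction r with
  | nil => simp
  | cons f r ih => simp [ih]

theorem splitSum_assoc {x y : O} (s : Str H x y)
    (G : ∀ w w', Str H w y → Str H w' w → Str H x w' → K) :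
    (splitSum s fun w' a r => splitSum a fun w u v => G w w' u v r) =
      splitSum s fun w a r => splitSum r fun w' u v => G w w' a u v := by
  induction s with
  | nil => simp
  | cons f s ih =>
    simp only [splitSum_cons, splitSum_nil, splitSum_add, ih, add_assoc]

/-- The splittings of a string with a marked entry. -/
theorem splitSum_append_cons {x y z w : O} (u : Str H z w) (f : H y z) (v : Str H x y)
    (G : ∀ a, Str H a w → Str H x a → K) :
    splitSum (u.append (cons f v)) G =
      (splitSum u fun a p q => G a p (q.append (cons f v))) +
      splitSum v fun a p q => G a (u.append (cons f p)) q := by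
  induction u with
  | nil => simp
  | cons g u ih => simp [ih, add_assoc]

theorem map_splitSum {K' : Type*} [AddCommMonoid K'] (F : K →+ K') {x y : O} (s : Str H x y)
    (G : ∀ w, Str H w y → Str H x w → K) :
    F (splitSum s G) = splitSum s fun w u v => F (G w u v) := by
  induction s with
  | nil => simp
  | cons f s ih => simp [ih]

theorem splitSum_map {O' : Type u} {H' : O' → O' → Type u} (φ : O → O')
    (F : ∀ x y : O, H x y → H' (φ x) (φ y)) {x y : O} (s : Str H x y)
    (G : ∀ w, Str H' w (φ y) → Str H' (φ x) w → K) :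
    splitSum (map φ F s) G = splitSum s fun w u v => G (φ w) (map φ F u) (map φ F v) := by
  induction s with
  | nil => simp
  | cons f s ih => simp [ih]

end

theorem splitSum_mul [NonUnitalNonAssocSemiring K] {x y : O} (s : Str H x y)
    (G : ∀ w, Str H w y → Str H x w → K) (a : K) :
    splitSum s G * a = splitSum s fun w u v => G w u v * a :=
  map_splitSum (AddMonoidHom.mulRight a) s G

theorem mul_splitSum [NonUnitalNonAssocSemiring K] {x y : O} (s : Str H x y)
    (G : ∀ w, Str H w y → Str H x w → K) (a : K) :
    a * splitSum s G = splitSum s fun w u v => a * G w u v :=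
  map_splitSum (AddMonoidHom.mulLeft a) s G

end Str

/-! ## The ring of cochains on composable strings -/

/-- Functions on composable strings. -/
@[ext]
structure Coch {O : Type u} (H : O → O → Type u) (K : Type v) where
  val : ∀ {x y : O}, Str H x y → K

namespace Coch

open Str

variable {O : Type u} {H : O → O → Type u} {K : Type v}

theorem val_injective : Function.Injective
    (fun (φ : Coch H K) (p : Σ x y : O, Str H x y) => φ.val p.2.2) := by
  intro φ ψ h
  ext x y s
  exact congrFun h ⟨x, y, s⟩

variable [Ring K]

instance : Zero (Coch H K) := ⟨⟨fun _ => 0⟩⟩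
instance : Add (Coch H K) := ⟨fun φ ψ => ⟨fun s => φ.val s + ψ.val s⟩⟩
instance : Neg (Coch H K) := ⟨fun φ => ⟨fun s => - φ.val s⟩⟩
instance : Sub (Coch H K) := ⟨fun φ ψ => ⟨fun s => φ.val s - ψ.val s⟩⟩
instance : SMul ℕ (Coch H K) := ⟨fun n φ => ⟨fun s => n • φ.val s⟩⟩
instance : SMul ℤ (Coch H K) := ⟨fun n φ => ⟨fun s => n • φ.val s⟩⟩
/-- The unit is the characteristic function of the empty strings. -/
instance : One (Coch H K) := ⟨⟨fun s => match s with | .nil _ => 1 | .cons _ _ => 0⟩⟩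
/-- The first factor is evaluated on the right part of the string, which is composed first. -/
instance : Mul (Coch H K) := ⟨fun φ ψ => ⟨fun s => splitSum s fun _ u v => φ.val v * ψ.val u⟩⟩

variable (φ ψ : Coch H K) {x y z w : O}

@[simp] theorem zero_val (s : Str H x y) : (0 : Coch H K).val s = 0 := rfl
@[simp] theorem add_val (s : Str H x y) : (φ + ψ).val s = φ.val s + ψ.val s := rfl
@[simp] theorem neg_val (s : Str H x y) : (-φ).val s = - φ.val s := rfl
@[simp] theorem sub_val (s : Str H x y) : (φ - ψ).val s = φ.val s - ψ.val s := rfl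
@[simp] theorem zsmul_val (n : ℤ) (s : Str H x y) : (n • φ).val s = n • φ.val s := rfl
@[simp] theorem one_nil (x : O) : (1 : Coch H K).val (nil x) = 1 := rfl
@[simp] theorem one_cons (f : H y z) (s : Str H x y) : (1 : Coch H K).val (cons f s) = 0 := rfl
theorem mul_val (s : Str H x y) :
    (φ * ψ).val s = splitSum s fun _ u v => φ.val v * ψ.val u := rfl
@[simp] theorem mul_nil (x : O) :
    (φ * ψ).val (nil x) = φ.val (nil x) * ψ.val (nil x) := by simp [mul_val]

instance : AddCommGroup (Coch H K) :=
  val_injective.addCommGroup _ rfl (fun _ _ => rfl) (fun _ => rfl) (fun _ _ => rfl)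
    (fun _ _ => rfl) (fun _ _ => rfl)

protected theorem mul_assoc (φ ψ χ : Coch H K) : φ * ψ * χ = φ * (ψ * χ) := by
  ext x y s
  simp only [mul_val, splitSum_mul, mul_splitSum, mul_assoc]
  exact (splitSum_assoc s fun _ _ u v r => φ.val r * (ψ.val v * χ.val u)).symm

protected theorem one_mul (φ : Coch H K) : 1 * φ = φ := by
  ext x y s
  have key : ∀ {x y : O} (s : Str H x y) (G : ∀ w, Str H w y → K),
      (splitSum s fun w u v => (1 : Coch H K).val v * G w u) = G x s := by
    intro x y s
    induction s with
    | nil => simp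
    | cons f s ih => intro G; simp [ih]
  exact key s fun _ u => φ.val u

protected theorem mul_one (φ : Coch H K) : φ * 1 = φ := by
  ext x y s
  cases s with
  | nil => simp
  | cons f s => simp [mul_val]

instance : Ring (Coch H K) :=
  { (inferInstance : AddCommGroup (Coch H K)), (inferInstance : Mul (Coch H K)),
    (inferInstance : One (Coch H K)) with
    mul_assoc := Coch.mul_assoc
    one_mul := Coch.one_mul
    mul_one := Coch.mul_one
    zero_mul := fun φ => by ext x y s; simp [mul_val]
    mul_zero := fun φ => by ext x y s; simp [mul_val]
    left_distrib := fun φ ψ χ => by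
      ext x y s; simp [mul_val, mul_add, splitSum_add]
    right_distrib := fun φ ψ χ => by
      ext x y s; simp [mul_val, add_mul, splitSum_add] }

theorem mul_append_cons (u : Str H z w) (f : H y z) (v : Str H x y) :
    (φ * ψ).val (u.append (cons f v)) =
      (splitSum u fun _ p q => φ.val (q.append (cons f v)) * ψ.val p) +
      splitSum v fun _ p q => φ.val q * ψ.val (u.append (cons f p)) := by
  rw [mul_val, splitSum_append_cons]

theorem mul_single (f : H x y) :
    (φ * ψ).val (single f) = φ.val (single f) * ψ.val (nil y) +
      φ.val (nil x) * ψ.val (single f) := by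
  simp [mul_val, single]

theorem mul_pair (g : H y z) (f : H x y) :
    (φ * ψ).val (cons g (single f)) = φ.val (cons g (single f)) * ψ.val (nil z) +
      φ.val (single f) * ψ.val (single g) + φ.val (nil x) * ψ.val (cons g (single f)) := by
  simp [mul_val, single, add_assoc]

/-- Evaluation at a string, as a homomorphism of groups. -/
def evalAt (s : Str H x y) : Coch H K →+ K where
  toFun φ := φ.val s
  map_zero' := rfl
  map_add' _ _ := rfl

@[simp] theorem sum_val {ι : Type*} (S : Finset ι) (F : ι → Coch H K) (s : Str H x y) :
    (∑ i ∈ S, F i).val s = ∑ i ∈ S, (F i).val s :=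
  map_sum (evalAt s) F S

/-- The cochain supported on empty strings with given values. -/
def ofObj (a : O → K) : Coch H K := ⟨fun {x _} s => match s with | .nil _ => a x | .cons _ _ => 0⟩

@[simp] theorem ofObj_nil (a : O → K) (x : O) : (ofObj a : Coch H K).val (nil x) = a x := rfl
@[simp] theorem ofObj_cons (a : O → K) (f : H y z) (s : Str H x y) :
    (ofObj a : Coch H K).val (cons f s) = 0 := rfl

theorem ofObj_mul_val (a : O → K) (s : Str H x y) : (ofObj a * φ).val s = a x * φ.val s := by
  have key : ∀ {x y : O} (s : Str H x y) (G : ∀ w, Str H w y → K),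
      (splitSum s fun w u v => (ofObj a : Coch H K).val v * G w u) = a x * G x s := by
    intro x y s
    induction s with
    | nil => simp
    | cons f s ih => intro G; simp [ih]
  exact key s fun _ u => φ.val u

theorem mul_ofObj_val (a : O → K) (s : Str H x y) : (φ * ofObj a).val s = φ.val s * a y := by
  cases s with
  | nil => simp
  | cons f s => simp [mul_val]

/-- Families of units, as units of the ring of cochains. -/
def unitOfObj (a : O → Kˣ) : (Coch H K)ˣ where
  val := ofObj fun x => (a x : K)
  inv := ofObj fun x => (((a x)⁻¹ : Kˣ) : K)
  val_inv := by
    ext x y s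
    rw [ofObj_mul_val]
    cases s <;> simp
  inv_val := by
    ext x y s
    rw [ofObj_mul_val]
    cases s <;> simp

@[simp] theorem coe_unitOfObj (a : O → Kˣ) :
    ((unitOfObj a : (Coch H K)ˣ) : Coch H K) = ofObj fun x => (a x : K) := rfl
@[simp] theorem coe_unitOfObj_inv (a : O → Kˣ) :
    (((unitOfObj a)⁻¹ : (Coch H K)ˣ) : Coch H K) = ofObj fun x => (((a x)⁻¹ : Kˣ) : K) := rfl

/-! ### Additive conditions on cochains that are stable under products -/

section Conditions

variable {K : Type v} [CommRing K]

theorem val_append_ne_nil (u : Str H z w) (f : H y z) (v : Str H x y) (a : O → K) :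
    (ofObj a : Coch H K).val (u.append (cons f v)) = 0 := by
  cases u <;> simp

theorem one_eq_ofObj : (1 : Coch H K) = ofObj fun _ => 1 := by
  ext x y s
  cases s <;> rfl

/-- The multilinear cochains. -/
def multilinear (H : O → O → Type u) [∀ x y, AddCommGroup (H x y)] (K : Type v) [CommRing K]
    [∀ x y, Module K (H x y)] : AddSubgroup (Coch H K) where
  carrier := {φ | ∀ {x y z w : O} (u : Str H z w) (f g : H y z) (a : K) (v : Str H x y),
    φ.val (u.append (cons (f + a • g) v)) =
      φ.val (u.append (cons f v)) + a * φ.val (u.append (cons g v))}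
  zero_mem' := fun _ _ => by simp
  add_mem' := fun h h' _ _ _ _ u f g a v => by simp only [add_val, h u f g a v, h' u f g a v]; ring
  neg_mem' := fun h _ _ _ _ u f g a v => by simp only [neg_val, h u f g a v]; ring

theorem mem_multilinear [∀ x y, AddCommGroup (H x y)] [∀ x y, Module K (H x y)]
    {φ : Coch H K} : φ ∈ multilinear H K ↔
    ∀ {x y z w : O} (u : Str H z w) (f g : H y z) (a : K) (v : Str H x y),
    φ.val (u.append (cons (f + a • g) v)) =
      φ.val (u.append (cons f v)) + a * φ.val (u.append (cons g v)) := Iff.rfl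

theorem multilinear_mul [∀ x y, AddCommGroup (H x y)] [∀ x y, Module K (H x y)]
    {φ ψ : Coch H K} (h : φ ∈ multilinear H K) (h' : ψ ∈ multilinear H K) :
    φ * ψ ∈ multilinear H K := by
  intro x y z w u f g a v
  simp only [mul_append_cons, mem_multilinear.1 h, mem_multilinear.1 h', add_mul, mul_add,
    splitSum_add, mul_splitSum]
  simp only [mul_assoc, mul_left_comm a]
  abel

theorem ofObj_mem_multilinear [∀ x y, AddCommGroup (H x y)] [∀ x y, Module K (H x y)]
    (a : O → K) : ofObj a ∈ multilinear H K := by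
  intro x y z w u f g b v
  simp [val_append_ne_nil]

end Conditions

end Coch

end AInf


namespace Front

variable (Λ : Front)

/-! ## Signs -/

theorem sgn_eq (d : ℤ) : sgn d = 1 ∨ sgn d = -1 := by
  rcases Int.even_or_odd d with h | h
  · left; simp [sgn, Int.negOnePow_even d h]
  · right; simp [sgn, Int.negOnePow_odd d h]

@[simp] theorem sgn_zero : sgn 0 = 1 := by simp [sgn]

@[simp] theorem sgn_one : sgn 1 = -1 := by simp [sgn]

theorem sgn_add (a b : ℤ) : sgn (a + b) = sgn a * sgn b := by simp [sgn, Int.negOnePow_add]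

@[simp] theorem sgn_neg (a : ℤ) : sgn (-a) = sgn a := by simp [sgn]

theorem sgn_sub (a b : ℤ) : sgn (a - b) = sgn a * sgn b := by
  rw [sub_eq_add_neg, sgn_add, sgn_neg]

theorem sgn_mul_self (a : ℤ) : sgn a * sgn a = 1 := by
  rcases sgn_eq a with h | h <;> simp [h]

/-! ## Block matrices of disks -/

/-- Values in a ring for the chords at the left border, for the chords at the events, and for the
base points. -/
structure SweepData (R : Type*) [Ring R] where
  line : ℕ → ℕ → R
  ev : ℕ → R
  mark : ℕ → Rˣ

/-- The effect of a crossing on the right index of the matrix of disks. -/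
def colOp {R : Type*} [Ring R] (k : ℕ) (C : R) (D : ℕ → ℕ → R) (i j : ℕ) : R :=
  if j = k then D i (k + 1) + D i k * C else if j = k + 1 then D i k else D i j

/-- The effect of a crossing on the left index of the matrix of disks. -/
def rowOp {R : Type*} [Ring R] (k : ℕ) (C : R) (D : ℕ → ℕ → R) (i j : ℕ) : R :=
  if i = k then D (k + 1) j else if i = k + 1 then D k j - C * D (k + 1) j else D i j

/-- The effect of an event on the block matrix of disks. -/
def blockStep {R : Type*} [Ring R] (X : SweepData R) (e : ℕ) (D : ℕ → ℕ → R) (i j : ℕ) : R :=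
  match Λ.event e with
  | .cross k =>
      if j < i then 0 else rowOp k (sgn (Λ.deg 0 (.ev e)) • X.ev e) (colOp k (X.ev e) D) i j
  | .base k =>
      (if i = k then X.mark e else 1 : Rˣ) * D i j * ((if j = k then X.mark e else 1 : Rˣ)⁻¹ : Rˣ)
  | .lcusp k _ =>
      if i = k ∧ j = k + 1 then 1
      else if (i = k ∧ j = k) ∨ (i = k + 1 ∧ j = k + 1) then X.ev e
      else if i = k ∨ i = k + 1 ∨ j = k ∨ j = k + 1 then 0
      else D (if i < k then i else i - 2) (if j < k then j else j - 2)
  | .rcusp _ => if i < (Λ.slice e).n - 2 ∧ j < (Λ.slice e).n - 2 then D i j else 0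

/-- The block matrix of disks to the left of the event `e`, for the part of the front starting with
the event `s`. -/
def blockDisks {R : Type*} [Ring R] (X : SweepData R) (s : ℕ) : ℕ → ℕ → ℕ → R
  | 0 => X.line
  | e + 1 => if e + 1 ≤ s then X.line else Λ.blockStep X e (blockDisks X s e)

/-- The expression for the differential of a chord in terms of the blocks. -/
def blockDiff {R : Type*} [Ring R] (X : SweepData R) (s : ℕ) : Chord → R
  | .line i j => - ∑ l ∈ Finset.range (j + 1), sgn (Λ.deg s (.line i l)) •
      (X.line i l * X.line l j)
  | .ev e => match Λ.event e with
    | .cross k => Λ.blockDisks X s e k (k + 1) + Λ.blockDisks X s e k k * X.ev e -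
        sgn (Λ.deg 0 (.ev e)) • (X.ev e * Λ.blockDisks X s e (k + 1) (k + 1))
    | .lcusp _ _ => X.ev e * X.ev e
    | _ => 0

section

variable {R : Type*} [Ring R] (X : SweepData R) {s : ℕ}

theorem blockDisks_of_le {e : ℕ} (h : e ≤ s) : Λ.blockDisks X s e = X.line := by
  cases e with
  | zero => rfl
  | succ e => simp [blockDisks, h]

theorem blockDisks_succ {e : ℕ} (h : s ≤ e) :
    Λ.blockDisks X s (e + 1) = Λ.blockStep X e (Λ.blockDisks X s e) := by
  rw [blockDisks, if_neg (by omega)]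

theorem blockDisks_append {s' e : ℕ} (hs : s ≤ s') (he : s' ≤ e) :
    Λ.blockDisks X s e = Λ.blockDisks ⟨Λ.blockDisks X s s', X.ev, X.mark⟩ s' e := by
  induction e, he using Nat.le_induction with
  | base => rw [Λ.blockDisks_of_le ⟨_, X.ev, X.mark⟩ le_rfl]
  | succ e he ih =>
    rw [blockDisks_succ _ _ he, blockDisks_succ _ _ (hs.trans he), ih]
    rfl

theorem blockDisks_congr {X Y : SweepData R} {e : ℕ} (h : X.line = Y.line)
    (h1 : ∀ e', s ≤ e' → e' < e → X.ev e' = Y.ev e')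
    (h2 : ∀ e', s ≤ e' → e' < e → X.mark e' = Y.mark e') :
    Λ.blockDisks X s e = Λ.blockDisks Y s e := by
  rcases le_total e s with he | he
  · rw [blockDisks_of_le _ _ he, blockDisks_of_le _ _ he, h]
  induction e, he using Nat.le_induction with
  | base => rw [blockDisks_of_le _ _ le_rfl, blockDisks_of_le _ _ le_rfl, h]
  | succ e he ih =>
    rw [blockDisks_succ _ _ he, blockDisks_succ _ _ he,
      ih (fun e' h h' => h1 e' h (by omega)) (fun e' h h' => h2 e' h (by omega))]
    funext i j
    simp only [blockStep, h1 e he (by omega), h2 e he (by omega)]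

theorem blockDisks_lower (h : ∀ i j, j < i → X.line i j = 0) (e : ℕ) {i j : ℕ} (hij : j < i) :
    Λ.blockDisks X s e i j = 0 := by
  rcases le_total e s with he | he
  · rw [blockDisks_of_le _ _ he, h _ _ hij]
  induction e, he using Nat.le_induction generalizing i j with
  | base => rw [blockDisks_of_le _ _ le_rfl, h _ _ hij]
  | succ e he ih =>
    rw [blockDisks_succ _ _ he, blockStep]
    split
    · rw [if_pos hij]
    · rw [ih hij]; simp
    · split_ifs <;> first | omega | rfl | (exact ih (by omega))
    · rw [ih hij]; simp

/-- The image of sweep data under a ring homomorphism. -/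
def SweepData.map {R' : Type*} [Ring R'] (h : R →+* R') : SweepData R' where
  line i j := h (X.line i j)
  ev e := h (X.ev e)
  mark e := Units.map h.toMonoidHom (X.mark e)

theorem map_blockDisks {R' : Type*} [Ring R'] (h : R →+* R') (e i j : ℕ) :
    Λ.blockDisks (X.map h) s e i j = h (Λ.blockDisks X s e i j) := by
  rcases le_total e s with he | he
  · rw [blockDisks_of_le _ _ he, blockDisks_of_le _ _ he]; rfl
  induction e, he using Nat.le_induction generalizing i j with
  | base => rw [blockDisks_of_le _ _ le_rfl, blockDisks_of_le _ _ le_rfl]; rfl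
  | succ e he ih =>
    rw [blockDisks_succ _ _ he, blockDisks_succ _ _ he]
    have ih' : Λ.blockDisks (X.map h) s e = fun i j => h (Λ.blockDisks X s e i j) := by
      funext i j; exact ih i j
    rw [ih', blockStep, blockStep]
    split
    · simp only [rowOp, colOp, SweepData.map]
      split_ifs <;> simp
    · simp only [SweepData.map]
      split_ifs <;> simp [← map_inv]
    · simp only [SweepData.map]
      split_ifs <;> simp
    · split_ifs <;> simp

theorem map_blockDiff {R' : Type*} [Ring R'] (h : R →+* R') (c : Chord) :
    Λ.blockDiff (X.map h) s c = h (Λ.blockDiff X s c) := by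
  cases c with
  | line i j => simp [blockDiff, SweepData.map]
  | ev e =>
    simp only [blockDiff, Λ.map_blockDisks]
    split <;> simp [SweepData.map]

theorem deg_line (i j : ℕ) :
    Λ.deg s (.line i j) = (Λ.slice s).pot i - (Λ.slice s).pot j - 1 := rfl

theorem slice_succ (e : ℕ) : Λ.slice (e + 1) = (Λ.event e).next (Λ.slice e) := rfl

/-- Grading of the blocks, for any multiplicative family of additive subgroups. -/
theorem blockDisks_mem {𝒢 : ℤ → AddSubgroup R} (h1 : 1 ∈ 𝒢 0)
    (hmul : ∀ {a b x y}, x ∈ 𝒢 a → y ∈ 𝒢 b → x * y ∈ 𝒢 (a + b)) {e : ℕ} (he : s ≤ e)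
    (hline : ∀ i j, X.line i j ∈ 𝒢 (Λ.deg s (.line i j)))
    (hev : ∀ e', s ≤ e' → e' < e → X.ev e' ∈ 𝒢 (Λ.deg 0 (.ev e')))
    (hmk : ∀ e', s ≤ e' → e' < e → ((X.mark e' : Rˣ) : R) ∈ 𝒢 0 ∧ (((X.mark e')⁻¹ : Rˣ) : R) ∈ 𝒢 0)
    (i j : ℕ) : Λ.blockDisks X s e i j ∈ 𝒢 (Λ.deg e (.line i j)) := by
  induction e, he using Nat.le_induction generalizing i j with
  | base => rw [blockDisks_of_le _ _ le_rfl]; exact hline i j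
  | succ e he ih =>
    have ih' := ih (fun e' h h' => hev e' h (by omega)) (fun e' h h' => hmk e' h (by omega))
    have hc := hev e he (by omega)
    have hm := hmk e he (by omega)
    have cast : ∀ {a b : ℤ} {x : R}, x ∈ 𝒢 a → a = b → x ∈ 𝒢 b := by
      rintro a b x h rfl; exact h
    clear ih hev hmk
    rw [blockDisks_succ _ _ he, deg_line, slice_succ, blockStep]
    simp only [deg_line] at ih'
    rcases hE : Λ.event e with k | k | ⟨k, v⟩ | b
    · have hd : Λ.deg 0 (.ev e) = (Λ.slice e).pot k - (Λ.slice e).pot (k + 1) := by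
        simp [deg, hE]
      simp only [FrontEvent.next]
      split_ifs with hij
      · exact zero_mem _
      have hcol : ∀ i, colOp k (X.ev e) (Λ.blockDisks X s e) i j ∈
          𝒢 ((Λ.slice e).pot i - (Λ.slice e).pot (Equiv.swap k (k + 1) j) - 1) := by
        intro i
        rw [colOp]
        split_ifs with h h'
        · subst h
          refine add_mem (cast (ih' _ _) (by simp)) (cast (hmul (ih' _ _) hc) ?_)
          rw [hd]; simp; ring
        · subst h'; exact cast (ih' _ _) (by simp)
        · exact cast (ih' _ _) (by rw [Equiv.swap_apply_of_ne_of_ne h h'])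
      rw [rowOp]
      split_ifs with h h'
      · subst h; exact cast (hcol _) (by simp)
      · subst h'
        refine sub_mem (cast (hcol _) (by simp)) (cast (hmul (zsmul_mem hc _) (hcol _)) ?_)
        rw [hd]; simp; ring
      · exact cast (hcol _) (by rw [Equiv.swap_apply_of_ne_of_ne h h'])
    · simp only [FrontEvent.next]
      have := hmul (hmul (a := 0) (b := _) (x := ((if i = k then X.mark e else 1 : Rˣ) : R))
        (by split_ifs; exacts [hm.1, h1]) (ih' i j))
        (show (((if j = k then X.mark e else 1 : Rˣ)⁻¹ : Rˣ) : R) ∈ 𝒢 0 by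
          split_ifs; exacts [hm.2, by simpa using h1])
      exact cast this (by ring)
    · have hd : Λ.deg 0 (.ev e) = -1 := by simp [deg, hE]
      rw [hd] at hc
      simp only [FrontEvent.next]
      by_cases h1' : i = k ∧ j = k + 1
      · obtain ⟨rfl, rfl⟩ := h1'
        simpa using h1
      rw [if_neg h1']
      by_cases h2 : (i = k ∧ j = k) ∨ (i = k + 1 ∧ j = k + 1)
      · rw [if_pos h2]
        rcases h2 with ⟨rfl, rfl⟩ | ⟨rfl, rfl⟩ <;> simpa using hc
      rw [if_neg h2]
      by_cases h3 : i = k ∨ i = k + 1 ∨ j = k ∨ j = k + 1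
      · rw [if_pos h3]; exact zero_mem _
      rw [if_neg h3]
      refine cast (ih' _ _) ?_
      push Not at h3
      rw [if_neg h3.1, if_neg h3.2.1, if_neg h3.2.2.1, if_neg h3.2.2.2]
      split_ifs <;> rfl
    · simp only [FrontEvent.next]
      split_ifs
      · exact ih' i j
      · exact zero_mem _

theorem blockDiff_mem {𝒢 : ℤ → AddSubgroup R} (h1 : 1 ∈ 𝒢 0)
    (hmul : ∀ {a b x y}, x ∈ 𝒢 a → y ∈ 𝒢 b → x * y ∈ 𝒢 (a + b)) (c : Chord)
    (hline : ∀ i j, X.line i j ∈ 𝒢 (Λ.deg s (.line i j)))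
    (hev : ∀ e, s ≤ e → c = .ev e → ∀ e', s ≤ e' → e' ≤ e → X.ev e' ∈ 𝒢 (Λ.deg 0 (.ev e')))
    (hmk : ∀ e, s ≤ e → c = .ev e → ∀ e', s ≤ e' → e' < e →
      ((X.mark e' : Rˣ) : R) ∈ 𝒢 0 ∧ (((X.mark e')⁻¹ : Rˣ) : R) ∈ 𝒢 0)
    (hc : ∀ e, c = .ev e → s ≤ e) :
    Λ.blockDiff X s c ∈ 𝒢 (Λ.deg s c - 1) := by
  have cast : ∀ {a b : ℤ} {x : R}, x ∈ 𝒢 a → a = b → x ∈ 𝒢 b := by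
    rintro a b x h rfl; exact h
  cases c with
  | line i j =>
    refine neg_mem (sum_mem fun l _ => zsmul_mem (cast (hmul (hline _ _) (hline _ _)) ?_) _)
    simp only [deg]; ring
  | ev e =>
    have hse := hc e rfl
    have hD := Λ.blockDisks_mem X h1 hmul hse hline
      (fun e' h h' => hev e hse rfl e' h h'.le) (hmk e hse rfl)
    have hC := hev e hse rfl e hse le_rfl
    simp only [blockDiff]
    rcases hE : Λ.event e with k | k | ⟨k, v⟩ | b <;> simp only
    · have hd : ∀ s, Λ.deg s (.ev e) = (Λ.slice e).pot k - (Λ.slice e).pot (k + 1) := by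
        intro s
        simp [deg, hE]
      rw [hd] at hC
      rw [hd, hd]
      refine sub_mem (add_mem (cast (hD _ _) ?_) (cast (hmul (hD _ _) hC) ?_))
        (zsmul_mem (cast (hmul hC (hD _ _)) ?_) _) <;> simp only [deg] <;> ring
    · exact zero_mem _
    · have hd : ∀ s, Λ.deg s (.ev e) = -1 := by intro s; simp [deg, hE]
      rw [hd] at hC ⊢
      exact cast (hmul hC hC) (by ring)
    · exact zero_mem _

end

end Front


namespace Front

variable (Λ : Front)

/-! ## The differential of the blocks -/

theorem sum_range_pair_congr {R : Type*} [AddCommMonoid R] {n k : ℕ} (hk : k + 1 < n)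
    {f h : ℕ → R} (h1 : ∀ l, l ≠ k → l ≠ k + 1 → f l = h l)
    (h2 : f k + f (k + 1) = h k + h (k + 1)) :
    ∑ l ∈ Finset.range n, f l = ∑ l ∈ Finset.range n, h l := by
  have hm : k ∈ Finset.range n := by simp; omega
  have hm' : k + 1 ∈ (Finset.range n).erase k := by simp; omega
  rw [← Finset.add_sum_erase _ _ hm, ← Finset.add_sum_erase _ _ hm',
    ← Finset.add_sum_erase _ h hm, ← Finset.add_sum_erase _ h hm', ← add_assoc, ← add_assoc, h2]
  congr 1
  refine Finset.sum_congr rfl fun l hl => ?_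
  simp at hl
  exact h1 l hl.2.1 hl.1

theorem sum_range_shift {R : Type*} [AddCommMonoid R] {n k : ℕ} (hk : k ≤ n) {f : ℕ → R} :
    ∑ l ∈ Finset.range (n + 2), f l =
      f k + f (k + 1) + ∑ l ∈ Finset.range n, f (if l < k then l else l + 2) := by
  obtain ⟨d, rfl⟩ := Nat.exists_eq_add_of_le hk
  rw [show k + d + 2 = k + 2 + d by omega, Finset.sum_range_add _ (k + 2), Finset.sum_range_add _ k 2,
    Finset.sum_range_succ (fun x => f (k + x)), Finset.sum_range_one, Nat.add_zero,
    Finset.sum_range_add, add_comm (∑ x ∈ Finset.range k, f x), add_assoc]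
  congr 1
  congr 1
  · refine Finset.sum_congr rfl fun l hl => ?_
    simp at hl
    simp [hl]
  · refine Finset.sum_congr rfl fun l _ => ?_
    rw [if_neg (by omega)]
    congr 1
    omega

theorem sum_range_eq_of_lt {R : Type*} [AddCommMonoid R] {f : ℕ → R} {j : ℕ}
    (hf : ∀ l, j < l → f l = 0) {N N' : ℕ} (hN : j < N) (hN' : j < N') :
    ∑ l ∈ Finset.range N, f l = ∑ l ∈ Finset.range N', f l := by
  have : ∀ M, j < M → ∑ l ∈ Finset.range M, f l = ∑ l ∈ Finset.range (j + 1), f l := by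
    intro M hM
    symm
    apply Finset.sum_subset
    · intro l hl
      simp at hl ⊢
      omega
    · intro l _ hl
      simp at hl
      exact hf l (by omega)
  rw [this N hN, this N' hN']

section

variable {R : Type*} [Ring R] {X : SweepData R} {s : ℕ} {α : R →+* R} {δ : R →+ R}

/-- `δ` is a derivation, twisted by the endomorphism `α`. -/
def IsTwistedDer (α : R →+* R) (δ : R →+ R) : Prop := ∀ x y, δ (x * y) = x * δ y + δ x * α y

theorem IsTwistedDer.one (h : IsTwistedDer α δ) : δ 1 = 0 := by
  have := h 1 1
  simpa using this

theorem IsTwistedDer.inv (h : IsTwistedDer α δ) {v : Rˣ} (hv : δ v = 0) :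
    δ ((v⁻¹ : Rˣ) : R) = 0 := by
  have h1 := h v ((v⁻¹ : Rˣ) : R)
  simp only [Units.mul_inv, h.one, hv, zero_mul, add_zero] at h1
  have h2 := congrArg (fun x => ((v⁻¹ : Rˣ) : R) * x) h1
  simpa using h2.symm

/-- The matrix of blocks satisfies the structure equation. -/
def StructureEq (α : R →+* R) (δ : R →+ R) (D : ℕ → ℕ → R) : Prop :=
  ∀ i j N, j < N → δ (D i j) = - ∑ l ∈ Finset.range N, D i l * α (D l j)

theorem structureEq_cross (h : IsTwistedDer α δ) {D : ℕ → ℕ → R} {k : ℕ} {C : R} {p : ℕ → ℤ}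
    (hup : ∀ i j, j < i → D i j = 0)
    (hα : ∀ i j, α (D i j) = sgn (p i - p j - 1) • D i j)
    (hC : α C = sgn (p k - p (k + 1)) • C)
    (hδC : δ C = - (sgn (p k - p (k + 1)) • (D k (k + 1) + D k k * C -
      sgn (p k - p (k + 1)) • (C * D (k + 1) (k + 1)))))
    (hD : StructureEq α δ D) :
    StructureEq α δ fun i j => if j < i then 0 else
      rowOp k (sgn (p k - p (k + 1)) • C) (colOp k C D) i j := by
  set q := sgn (p k - p (k + 1)) with hq
  have hqq : q = 1 ∨ q = -1 := sgn_eq _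
  have a1 : α (D k k) = - D k k := by rw [hα]; simp
  have a2 : α (D (k + 1) (k + 1)) = - D (k + 1) (k + 1) := by rw [hα]; simp
  have a3 : α (D k (k + 1)) = - (q • D k (k + 1)) := by
    rw [hα, sgn_sub, ← hq]; simp
  have a0 : D (k + 1) k = 0 := hup _ _ (by omega)
  set D' : ℕ → ℕ → R := fun i j => if j < i then 0 else rowOp k (q • C) (colOp k C D) i j with hD'
  have hup' : ∀ i j, j < i → D' i j = 0 := fun i j hij => by simp [hD', hij]
  obtain ⟨L, hL⟩ : ∃ L, L = colOp k C D := ⟨_, rfl⟩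
  obtain ⟨M, hM⟩ : ∃ M, M = rowOp k (q • C) D := ⟨_, rfl⟩
  -- the entries of the new matrix
  set π : ℕ → ℕ := fun i => if i = k then k + 1 else if i = k + 1 then k else i with hπ
  have e1 : ∀ i l, i ≠ k + 1 → D' i l = L (π i) l := by
    intro i l hi
    simp only [hD', hL, rowOp, hπ, if_neg hi]
    by_cases hik : i = k
    · subst hik
      simp only [if_true]
      split_ifs with h
      · rw [colOp]
        split_ifs
        · omega
        · omega
        · rw [hup _ _ (by omega)]
      · rfl
    · simp only [if_neg hik]
      split_ifs with h
      · rw [colOp]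
        split_ifs
        · subst_vars
          rw [hup i (l + 1) (by omega), hup i l (by omega)]; simp
        · rw [hup _ _ (by omega)]
        · rw [hup _ _ (by omega)]
      · rfl
  have e2 : ∀ l j, j ≠ k → D' l j = M l (π j) := by
    intro l j hj
    simp only [hD', hM, rowOp, colOp, hπ, if_neg hj]
    by_cases hjk : j = k + 1
    · subst hjk
      simp only [if_true]
      split_ifs <;> (try omega) <;> (try rfl)
      rw [hup _ _ (by omega)]
    · simp only [if_neg hjk]
      split_ifs <;> (try rfl)
      · rw [hup _ _ (by omega)]
      · rw [hup k j (by omega), hup (k + 1) j (by omega)]; simp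
      · rw [hup _ _ (by omega)]
  have key : ∀ i j N, k + 1 < N → ∑ l ∈ Finset.range N, L i l * α (M l j) =
      ∑ l ∈ Finset.range N, D i l * α (D l j) := by
    intro i j N hN
    apply sum_range_pair_congr hN
    · intro l h1 h2
      simp [hL, hM, colOp, rowOp, h1, h2]
    · simp only [hL, hM, colOp, rowOp, if_true, if_neg (Nat.succ_ne_self k), map_sub, map_mul,
        map_zsmul, hC]
      rcases hqq with hq' | hq' <;> simp only [hq', one_smul, neg_smul, neg_neg] <;> noncomm_ring
  suffices hs : ∀ i j N, k + 1 < N → j < N → δ (D' i j) =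
      - ∑ l ∈ Finset.range N, D' i l * α (D' l j) by
    intro i j N hN
    rw [hs i j (N + k + 2) (by omega) (by omega)]
    congr 1
    apply sum_range_eq_of_lt (j := j) _ (by omega) hN
    intro l hl
    simp [hup' l j hl]
  intro i j N hN hjN
  have hkk : D' k k = D (k + 1) (k + 1) := by
    simp [hD', rowOp, colOp, a0]
  have hkk' : D' (k + 1) (k + 1) = D k k := by
    simp [hD', rowOp, colOp, a0]
  by_cases hi : i = k + 1
  · subst hi
    by_cases hj : j = k
    · subst hj
      rw [hup' _ _ (by omega)]
      rw [Finset.sum_eq_zero]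
      · simp
      · intro l _
        rcases le_or_gt l j with h' | h'
        · rw [hup' _ _ (by omega)]; simp
        · rw [hup' l j h']; simp
    · have hr : δ (D' (k + 1) j) = δ (D k (π j) - (q • C) * D (k + 1) (π j)) := by
        rw [e2 _ _ hj]; simp [hM, rowOp]
      have hpj : π j < N := by simp only [hπ]; split_ifs <;> omega
      have hsum : ∑ l ∈ Finset.range N, D' (k + 1) l * α (D' l j) =
          ∑ l ∈ Finset.range N, (D k l * α (D l (π j)) - q • (C * (D (k + 1) l * α (D l (π j))))
            - if l = k then D k (k + 1) * α (D (k + 1) (π j)) +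
                D k k * (C * α (D (k + 1) (π j))) - q • (C * (D (k + 1) (k + 1) *
                  α (D (k + 1) (π j)))) else 0) := by
        apply sum_range_pair_congr hN
        · intro l h1 h2
          rw [e2 _ _ hj, if_neg h1, sub_zero]
          have e3 : D' (k + 1) l = D k l - (q • C) * D (k + 1) l := by
            rw [e2 _ _ h1]; simp [hM, rowOp, hπ, h1, h2]
          rw [e3]
          simp [hM, rowOp, h1, h2, sub_mul, mul_assoc]
        · rw [hup' (k + 1) k (by omega), hkk', e2 k _ hj, e2 (k + 1) _ hj]
          simp only [hM, rowOp, if_true, if_neg (Nat.succ_ne_self k), a0, map_sub, map_mul,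
            map_zsmul, hC]
          rcases hqq with hq' | hq' <;> simp only [hq', one_smul, neg_smul, neg_neg] <;>
            noncomm_ring
      rw [hr, hsum, Finset.sum_sub_distrib, Finset.sum_sub_distrib, Finset.sum_ite_eq' _ k,
        if_pos (by simp; omega), ← Finset.smul_sum, ← Finset.mul_sum, map_sub, smul_mul_assoc,
        map_zsmul, h, hD k _ N hpj, hD (k + 1) _ N hpj, hδC]
      rcases hqq with hq' | hq' <;> simp only [hq', one_smul, neg_smul, neg_neg] <;>
        noncomm_ring
  · by_cases hj : j = k
    · subst hj
      have hr : δ (D' i j) = δ (D (π i) (j + 1) + D (π i) j * C) := by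
        rw [e1 _ _ hi]; simp [hL, colOp]
      have hsum : ∑ l ∈ Finset.range N, D' i l * α (D' l j) =
          ∑ l ∈ Finset.range N, (D (π i) l * α (D l (j + 1)) + D (π i) l * α (D l j) * (q • C)
            + if l = j then q • (D (π i) j * (D j (j + 1) + D j j * C -
                q • (C * D (j + 1) (j + 1)))) else 0) := by
        apply sum_range_pair_congr hN
        · intro l h1 h2
          rw [e1 _ _ hi, if_neg h1, add_zero]
          have e3 : D' l j = D l (j + 1) + D l j * C := by
            rw [e1 _ _ h2]; simp [hL, colOp, hπ, h1, h2]
          rw [e3]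
          simp [hL, colOp, h1, h2, mul_add, mul_assoc, hC]
        · rw [hup' (j + 1) j (by omega), hkk, e1 _ j hi, e1 _ (j + 1) hi]
          simp only [hL, colOp, if_true, if_neg (Nat.succ_ne_self j), a0, map_zero, a1, a2, a3]
          rcases hqq with hq' | hq' <;> simp only [hq', one_smul, neg_smul, neg_neg] <;>
            noncomm_ring
      rw [hr, hsum, Finset.sum_add_distrib, Finset.sum_add_distrib, Finset.sum_ite_eq' _ j,
        if_pos (by simp; omega), ← Finset.sum_mul, map_add, h, hD _ _ N hN, hD _ _ N hjN, hδC, hC]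
      rcases hqq with hq' | hq' <;> simp only [hq', one_smul, neg_smul, neg_neg] <;>
        noncomm_ring
    · have hpj : π j < N := by simp only [hπ]; split_ifs <;> omega
      have : D' i j = D (π i) (π j) := by
        rw [e1 _ _ hi]
        simp only [hL, colOp, if_neg hj, hπ]
        split_ifs <;> rfl
      rw [this, hD _ _ N hpj, ← key _ _ N hN]
      congr 1
      refine Finset.sum_congr rfl fun l _ => ?_
      rw [e1 _ _ hi, e2 _ _ hj]

theorem structureEq_base (h : IsTwistedDer α δ) {D : ℕ → ℕ → R} {k : ℕ} {v : Rˣ}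
    (hα : α v = v) (hδ : δ v = 0) (hD : StructureEq α δ D) :
    StructureEq α δ fun i j => ((if i = k then v else 1 : Rˣ) : R) * D i j *
      ((if j = k then v else 1 : Rˣ)⁻¹ : Rˣ) := by
  have hα' : α ((v⁻¹ : Rˣ) : R) = ((v⁻¹ : Rˣ) : R) := by
    have h1 : Units.map α.toMonoidHom v = v := Units.ext hα
    have h2 : Units.map α.toMonoidHom v⁻¹ = v⁻¹ := by rw [map_inv, h1]
    exact congrArg Units.val h2
  obtain ⟨w, hw⟩ : ∃ w : ℕ → Rˣ, w = fun i => if i = k then v else 1 := ⟨_, rfl⟩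
  have w1 : ∀ i, α (w i) = w i := by intro i; rw [hw]; dsimp only; split_ifs <;> simp [hα]
  have w2 : ∀ i, α ((w i)⁻¹ : Rˣ) = ((w i)⁻¹ : Rˣ) := by
    intro i; rw [hw]; dsimp only; split_ifs <;> simp [hα']
  have w3 : ∀ i, δ (w i) = 0 := by intro i; rw [hw]; dsimp only; split_ifs <;> simp [hδ, h.one]
  have w4 : ∀ i, δ ((w i)⁻¹ : Rˣ) = 0 := fun i => h.inv (w3 i)
  have hw' : ∀ i, (if i = k then v else 1) = w i := fun i => by rw [hw]
  intro i j N hN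
  simp only [hw']
  rw [h, w4, h, w3, hD i j N hN]
  simp only [map_mul, w1, w2, zero_mul, mul_zero, add_zero, zero_add, mul_neg, neg_mul,
    Finset.mul_sum, Finset.sum_mul]
  congr 1
  refine Finset.sum_congr rfl fun l _ => ?_
  simp only [← mul_assoc, Units.inv_mul_cancel_right]

theorem structureEq_lcusp (h : IsTwistedDer α δ) {D : ℕ → ℕ → R} {k : ℕ} {Y : R}
    (hα : α Y = - Y) (hδ : δ Y = Y * Y) (hD : StructureEq α δ D)
    (hup : ∀ i j, j < i → D i j = 0) :
    StructureEq α δ fun i j => if i = k ∧ j = k + 1 then 1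
      else if (i = k ∧ j = k) ∨ (i = k + 1 ∧ j = k + 1) then Y
      else if i = k ∨ i = k + 1 ∨ j = k ∨ j = k + 1 then 0
      else D (if i < k then i else i - 2) (if j < k then j else j - 2) := by
  obtain ⟨D', hD'⟩ : ∃ D' : ℕ → ℕ → R, D' = fun i j => if i = k ∧ j = k + 1 then 1
      else if (i = k ∧ j = k) ∨ (i = k + 1 ∧ j = k + 1) then Y
      else if i = k ∨ i = k + 1 ∨ j = k ∨ j = k + 1 then 0
      else D (if i < k then i else i - 2) (if j < k then j else j - 2) := ⟨_, rfl⟩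
  rw [← hD']
  have up : ∀ i j, j < i → D' i j = 0 := by
    intro i j hij
    simp only [hD']
    split_ifs <;> first | omega | rfl | (exact hup _ _ (by omega))
  have o1 : ∀ i, i ≠ k → i ≠ k + 1 → D' i k = 0 ∧ D' i (k + 1) = 0 ∧ D' k i = 0 ∧
      D' (k + 1) i = 0 := by
    intro i h1 h2
    simp [hD', h1, h2]
  have o2 : D' k k = Y ∧ D' (k + 1) (k + 1) = Y ∧ D' k (k + 1) = 1 ∧ D' (k + 1) k = 0 := by
    simp [hD']
  have o3 : ∀ i j, D' (if i < k then i else i + 2) (if j < k then j else j + 2) = D i j := by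
    intro i j
    simp only [hD']
    split_ifs <;> first | omega | rfl
  have sh : ∀ i, i ≠ k → i ≠ k + 1 → ∃ i', i = if i' < k then i' else i' + 2 := by
    intro i h1 h2
    by_cases h3 : i < k
    · exact ⟨i, by simp [h3]⟩
    · exact ⟨i - 2, by rw [if_neg (by omega)]; omega⟩
  suffices hs : ∀ i j N, k ≤ N → j < N + 2 → δ (D' i j) =
      - ∑ l ∈ Finset.range (N + 2), D' i l * α (D' l j) by
    intro i j N hN
    rw [hs i j (N + k) (by omega) (by omega)]
    congr 1
    apply sum_range_eq_of_lt (j := j) _ (by omega) hN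
    intro l hl
    simp [up l j hl]
  intro i j N hN hj
  rw [sum_range_shift hN]
  by_cases hi : i = k ∨ i = k + 1
  · rw [Finset.sum_eq_zero, add_zero]
    · by_cases hjk : j = k ∨ j = k + 1
      · rcases hi with rfl | rfl <;> rcases hjk with rfl | rfl <;>
          simp [o2, hα, hδ, h.one]
      · push Not at hjk
        have := o1 j hjk.1 hjk.2
        rcases hi with rfl | rfl <;> simp [this]
    · intro l _
      have := o1 (if l < k then l else l + 2) (by split_ifs <;> omega) (by split_ifs <;> omega)
      rcases hi with rfl | rfl <;> simp [this]
  · push Not at hi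
    rw [(o1 i hi.1 hi.2).1, (o1 i hi.1 hi.2).2.1]
    by_cases hjk : j = k ∨ j = k + 1
    · rw [Finset.sum_eq_zero]
      · rcases hjk with rfl | rfl <;> simp [o1 i hi.1 hi.2]
      · intro l _
        have := o1 (if l < k then l else l + 2) (by split_ifs <;> omega) (by split_ifs <;> omega)
        rcases hjk with rfl | rfl <;> simp [this]
    · push Not at hjk
      obtain ⟨i, rfl⟩ := sh i hi.1 hi.2
      obtain ⟨j, rfl⟩ := sh j hjk.1 hjk.2
      simp only [o3]
      rw [hD i j N (by split_ifs at hj <;> omega)]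
      simp

theorem structureEq_truncate {D : ℕ → ℕ → R} {n : ℕ} (hD : StructureEq α δ D)
    (hup : ∀ i j, j < i → D i j = 0) :
    StructureEq α δ fun i j => if i < n ∧ j < n then D i j else 0 := by
  intro i j N hN
  dsimp only
  split_ifs with h1
  · rw [hD i j N hN]
    congr 1
    refine Finset.sum_congr rfl fun l _ => ?_
    by_cases hl : l < n
    · simp [h1, hl]
    · simp [hup l j (by omega)]
  · rw [Finset.sum_eq_zero]
    · simp
    · intro l _
      split_ifs <;> first | omega | simp

/-- The parity of the blocks. -/
theorem blockDisks_parity {e : ℕ} (he : s ≤ e)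
    (hαl : ∀ i j, α (X.line i j) = sgn (Λ.deg s (.line i j)) • X.line i j)
    (hαe : ∀ e', s ≤ e' → e' < e → α (X.ev e') = sgn (Λ.deg 0 (.ev e')) • X.ev e')
    (hαm : ∀ e', s ≤ e' → e' < e → α (X.mark e' : R) = X.mark e') (i j : ℕ) :
    α (Λ.blockDisks X s e i j) = sgn (Λ.deg e (.line i j)) • Λ.blockDisks X s e i j := by
  let 𝒢 : ℤ → AddSubgroup R := fun d =>
    { carrier := {x | α x = sgn d • x}
      zero_mem' := by simp
      add_mem' := fun {a b} ha hb => by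
        simp only [Set.mem_ofPred_eq] at ha hb ⊢; rw [map_add, ha, hb, smul_add]
      neg_mem' := fun {a} ha => by
        simp only [Set.mem_ofPred_eq] at ha ⊢; rw [map_neg, ha, smul_neg] }
  refine Λ.blockDisks_mem X (𝒢 := 𝒢) ?_ ?_ he hαl hαe ?_ i j
  · change α 1 = sgn 0 • 1
    simp
  · intro a b x y hx hy
    change α (x * y) = sgn (a + b) • (x * y)
    rw [map_mul, show α x = _ from hx, show α y = _ from hy, sgn_add, smul_mul_assoc,
      mul_smul_comm, smul_smul]
  · intro a b c
    have h3 := hαm a b c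
    refine ⟨by change α _ = sgn 0 • _; simpa using h3, ?_⟩
    change α _ = sgn 0 • _
    rw [sgn_zero, one_smul]
    have h4 : Units.map α.toMonoidHom (X.mark a) = X.mark a := Units.ext h3
    have h5 : Units.map α.toMonoidHom (X.mark a)⁻¹ = (X.mark a)⁻¹ := by rw [map_inv, h4]
    exact congrArg Units.val h5

/-- The structure equation for the blocks of disks. -/
theorem structureEq_blockDisks (h : IsTwistedDer α δ) {e : ℕ} (he : s ≤ e)
    (hup : ∀ i j, j < i → X.line i j = 0)
    (hαl : ∀ i j, α (X.line i j) = sgn (Λ.deg s (.line i j)) • X.line i j)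
    (hαe : ∀ e', s ≤ e' → e' < e → α (X.ev e') = sgn (Λ.deg 0 (.ev e')) • X.ev e')
    (hαm : ∀ e', s ≤ e' → e' < e → α (X.mark e' : R) = X.mark e')
    (hδl : StructureEq α δ X.line)
    (hδe : ∀ e', s ≤ e' → e' < e →
      (∃ k, Λ.event e' = .cross k) ∨ (∃ k v, Λ.event e' = .lcusp k v) →
      δ (X.ev e') = - (sgn (Λ.deg 0 (.ev e')) • Λ.blockDiff X s (.ev e')))
    (hδm : ∀ e', s ≤ e' → e' < e → δ (X.mark e' : R) = 0) :
    StructureEq α δ (Λ.blockDisks X s e) := by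
  have hα : ∀ e', s ≤ e' → e' ≤ e → ∀ i j, α (Λ.blockDisks X s e' i j) =
      sgn (Λ.deg e' (.line i j)) • Λ.blockDisks X s e' i j := fun e' h1 h2 =>
    Λ.blockDisks_parity h1 hαl (fun a b c => hαe a b (by omega)) (fun a b c => hαm a b (by omega))
  have up : ∀ e' i j, j < i → Λ.blockDisks X s e' i j = 0 :=
    fun e' i j => Λ.blockDisks_lower X hup e'
  induction e, he using Nat.le_induction with
  | base => rw [blockDisks_of_le _ _ le_rfl]; exact hδl
  | succ e he ih =>
    have ih' := ih (fun a b c => hαe a b (by omega)) (fun a b c => hαm a b (by omega))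
      (fun a b c => hδe a b (by omega)) (fun a b c => hδm a b (by omega))
      (fun a b c => hα a b (by omega))
    rw [blockDisks_succ _ _ he]
    rcases hE : Λ.event e with k | k | ⟨k, v⟩ | b
    · have hd : Λ.deg 0 (.ev e) = (Λ.slice e).pot k - (Λ.slice e).pot (k + 1) := by
        simp [deg, hE]
      have hδC := hδe e he (by omega) (Or.inl ⟨k, hE⟩)
      have hC := hαe e he (by omega)
      simp only [blockDiff, hE] at hδC
      rw [hd] at hδC hC
      have := structureEq_cross (k := k) (p := (Λ.slice e).pot) h (up e)
        (fun i j => hα e he (by omega) i j) hC hδC ih'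
      rw [← hd] at this
      convert this using 3
      simp only [blockStep, hE]
    · have := structureEq_base (k := k) h (hαm e he (by omega)) (hδm e he (by omega)) ih'
      convert this using 3
      simp only [blockStep, hE]
    · have hd : Λ.deg 0 (.ev e) = -1 := by simp [deg, hE]
      have hδC := hδe e he (by omega) (Or.inr ⟨k, v, hE⟩)
      have hC := hαe e he (by omega)
      simp only [blockDiff, hE] at hδC
      rw [hd] at hδC hC
      simp at hC hδC
      have := structureEq_lcusp (k := k) h hC hδC ih' (up e)
      convert this using 3
      simp only [blockStep, hE]
    · have := structureEq_truncate (n := (Λ.slice e).n - 2) ih' (up e)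
      convert this using 3
      simp only [blockStep, hE]

/-- The expression for the differential of a chord is closed. -/
theorem der_blockDiff (h : IsTwistedDer α δ) (c : Chord)
    (hc : ∀ e, c = .ev e → s ≤ e)
    (hup : ∀ i j, j < i → X.line i j = 0)
    (hαl : ∀ i j, α (X.line i j) = sgn (Λ.deg s (.line i j)) • X.line i j)
    (hαe : ∀ e, c = .ev e → ∀ e', s ≤ e' → e' ≤ e →
      α (X.ev e') = sgn (Λ.deg 0 (.ev e')) • X.ev e')
    (hαm : ∀ e, c = .ev e → ∀ e', s ≤ e' → e' < e → α (X.mark e' : R) = X.mark e')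
    (hδl : StructureEq α δ X.line)
    (hδe : ∀ e, c = .ev e → ∀ e', s ≤ e' → e' ≤ e →
      (∃ k, Λ.event e' = .cross k) ∨ (∃ k v, Λ.event e' = .lcusp k v) →
      δ (X.ev e') = - (sgn (Λ.deg 0 (.ev e')) • Λ.blockDiff X s (.ev e')))
    (hδm : ∀ e, c = .ev e → ∀ e', s ≤ e' → e' < e → δ (X.mark e' : R) = 0) :
    δ (Λ.blockDiff X s c) = 0 := by
  cases c with
  | line i j =>
    simp only [blockDiff, map_neg, neg_eq_zero, map_sum, map_zsmul]
    simp only [h _ _, hαl]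
    have e1 : ∀ l ∈ Finset.range (j + 1), δ (X.line l j) =
        - ∑ r ∈ Finset.range (j + 1), X.line l r * α (X.line r j) :=
      fun l hl => hδl l j _ (by omega)
    have e2 : ∀ l ∈ Finset.range (j + 1), δ (X.line i l) =
        - ∑ r ∈ Finset.range (j + 1), X.line i r * α (X.line r l) :=
      fun l hl => hδl i l _ (by simpa using hl)
    have e3 : ∀ l ∈ Finset.range (j + 1), sgn (Λ.deg s (.line i l)) •
        (X.line i l * δ (X.line l j) + δ (X.line i l) *
          sgn (Λ.deg s (.line l j)) • X.line l j) =
        (- ∑ r ∈ Finset.range (j + 1), (sgn (Λ.deg s (.line i l)) * sgn (Λ.deg s (.line r j))) •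
          (X.line i l * X.line l r * X.line r j)) +
        ∑ r ∈ Finset.range (j + 1), (sgn (Λ.deg s (.line i r)) * sgn (Λ.deg s (.line l j))) •
          (X.line i r * X.line r l * X.line l j) := by
      intro l hl
      rw [e1 l hl, e2 l hl, smul_add]
      congr 1
      · rw [mul_neg, smul_neg, Finset.mul_sum, Finset.smul_sum]
        congr 1
        refine Finset.sum_congr rfl fun r _ => ?_
        rw [hαl, mul_smul_comm, mul_smul_comm, smul_smul, mul_assoc]
      · rw [neg_mul, smul_neg, Finset.sum_mul, Finset.smul_sum, ← Finset.sum_neg_distrib]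
        refine Finset.sum_congr rfl fun r _ => ?_
        rw [hαl, mul_smul_comm, mul_smul_comm, smul_mul_assoc, smul_smul, smul_smul, ← neg_smul]
        congr 1
        have : sgn (Λ.deg s (.line i l)) =
            - (sgn (Λ.deg s (.line i r)) * sgn (Λ.deg s (.line r l))) := by
          rw [← sgn_add, show Λ.deg s (.line i l) =
            Λ.deg s (.line i r) + Λ.deg s (.line r l) + 1 by simp only [deg]; ring, sgn_add _ 1]
          simp
        rw [this]
        linear_combination (sgn (Λ.deg s (.line i r)) * sgn (Λ.deg s (.line l j))) *
          sgn_mul_self (Λ.deg s (.line r l))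
    rw [Finset.sum_congr rfl e3, Finset.sum_add_distrib, Finset.sum_neg_distrib,
      Finset.sum_comm, neg_add_cancel]
  | ev e =>
    have hse := hc e rfl
    have hD := Λ.structureEq_blockDisks h hse hup hαl
      (fun a b c => hαe e rfl a b c.le) (hαm e rfl) hδl (fun a b c => hδe e rfl a b c.le)
      (hδm e rfl)
    have up : ∀ i j, j < i → Λ.blockDisks X s e i j = 0 :=
      fun i j => Λ.blockDisks_lower X hup e
    have hδC := hδe e rfl e hse le_rfl
    have hC := hαe e rfl e hse le_rfl
    have hα := Λ.blockDisks_parity hse hαl (fun a b c => hαe e rfl a b c.le) (hαm e rfl)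
    simp only [blockDiff] at hδC ⊢
    generalize Λ.blockDisks X s e = D at *
    rcases hE : Λ.event e with k | k | ⟨k, v⟩ | b <;> simp only
    · have hd : Λ.deg 0 (.ev e) = (Λ.slice e).pot k - (Λ.slice e).pot (k + 1) := by
        simp [deg, hE]
      have hδC' := hδC (Or.inl ⟨k, hE⟩)
      simp only [hE] at hδC'
      obtain ⟨q, hq⟩ : ∃ q, q = sgn (Λ.deg 0 (.ev e)) := ⟨_, rfl⟩
      have hqq : q = 1 ∨ q = -1 := by rw [hq]; exact sgn_eq _
      have a1 : α (D k k) = - D k k := by rw [hα, deg]; simp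
      have a2 : α (D (k + 1) (k + 1)) = - D (k + 1) (k + 1) := by rw [hα, deg]; simp
      have a3 : α (D k (k + 1)) = - (q • D k (k + 1)) := by
        rw [hα, deg, sgn_sub, hq, hd]; simp
      have s1 : ∀ j, j < k + 2 → δ (D k j) = - (D k k * α (D k j) + D k (k + 1) *
          α (D (k + 1) j)) := by
        intro j hj
        rw [hD k j (k + 2) hj, Finset.sum_range_succ, Finset.sum_range_succ, Finset.sum_eq_zero,
          zero_add]
        intro l hl
        rw [up k l (by simpa using hl), zero_mul]
      have s2 : δ (D (k + 1) (k + 1)) = - (D (k + 1) (k + 1) * α (D (k + 1) (k + 1))) := by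
        rw [hD (k + 1) (k + 1) (k + 2) (by omega), Finset.sum_range_succ, Finset.sum_eq_zero,
          zero_add]
        intro l hl
        rw [up (k + 1) l (by simpa using hl), zero_mul]
      rw [← hq] at hδC' hC ⊢
      rw [map_sub, map_add, map_zsmul, h, h, s1 (k + 1) (by omega), s1 k (by omega), s2,
        up (k + 1) k (by omega), hC, hδC', a1, a2, a3]
      rcases hqq with hq' | hq' <;> simp only [hq', one_smul, neg_smul, neg_neg, map_zero] <;>
        noncomm_ring
    · simp
    · have hd : Λ.deg 0 (.ev e) = -1 := by simp [deg, hE]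
      have hδC' := hδC (Or.inr ⟨k, v, hE⟩)
      simp only [hE] at hδC'
      rw [hd] at hδC' hC
      simp only [sgn_neg, sgn_one] at hδC' hC
      rw [h, hδC', hC]
      noncomm_ring
    · simp

end

end Front


theorem AInf.Str.splitSum_comm {O : Type u} {H : O → O → Type u} {K : Type v} [AddCommMonoid K]
    {x y x' y' : O} (s : Str H x y) (t : Str H x' y')
    (G : ∀ w w', Str H w y → Str H x w → Str H w' y' → Str H x' w' → K) :
    (s.splitSum fun w u v => t.splitSum fun w' u' v' => G w w' u v u' v') =
      t.splitSum fun w' u' v' => s.splitSum fun w u v => G w w' u v u' v' := by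
  induction s with
  | nil => simp
  | cons f s ih => simp only [Str.splitSum_cons, Str.splitSum_add, ih]

namespace AInfCat

open Str

variable {𝕜 : Type u} [CommRing 𝕜] (A : AInfCat 𝕜) {K : Type v} [Ring K]

/-! ## The coderivation and the sign automorphism on cochains -/

@[simp] theorem sgnStr_nil (x : A.Obj) : A.sgnStr (nil x) = nil x := by simp [sgnStr]

@[simp] theorem sgnStr_cons {x y z : A.Obj} (f : A.Hom y z) (s : Str A.Hom x y) :
    A.sgnStr (cons f s) = cons (- A.par _ _ f) (A.sgnStr s) := by simp [sgnStr]

theorem splitSum_sgnStr {x y : A.Obj} {K : Type*} [AddCommMonoid K] (s : Str A.Hom x y)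
    (G : ∀ w, Str A.Hom w y → Str A.Hom x w → K) :
    splitSum (A.sgnStr s) G = splitSum s fun w u v => G w (A.sgnStr u) (A.sgnStr v) :=
  splitSum_map id _ s G

/-- Evaluation of cochains after the sign operator of the shifted grading. -/
def signHom : Coch A.Hom K →+* Coch A.Hom K where
  toFun φ := ⟨fun s => φ.val (A.sgnStr s)⟩
  map_zero' := rfl
  map_add' _ _ := rfl
  map_one' := by ext x y s; cases s <;> simp
  map_mul' φ ψ := by ext x y s; simp [Coch.mul_val, splitSum_sgnStr]

@[simp] theorem signHom_val (φ : Coch A.Hom K) {x y : A.Obj} (s : Str A.Hom x y) :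
    (A.signHom φ).val s = φ.val (A.sgnStr s) := rfl

theorem sum_bHat {K : Type*} [AddCommMonoid K] {x y : A.Obj} (s : Str A.Hom x y)
    (G : Str A.Hom x y → K) : ((A.bHat s).map G).sum = splitSum s fun _ a r =>
      splitSum r fun _ q v => G ((A.sgnStr a).append (cons (A.b q) v)) := by
  have key : ∀ {α β : Type u} (l : List α) (f : α → List β) (g : β → K),
      ((l.flatMap f).map g).sum = (l.map fun a => ((f a).map g).sum).sum := by
    intro α β l f g
    induction l with
    | nil => simp
    | cons a l ih => simp [ih]
  rw [bHat, key]
  simp only [List.map_map, splitSum]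
  rfl

/-- Evaluation of cochains after the coderivation. -/
def bDer : Coch A.Hom K →+ Coch A.Hom K where
  toFun φ := ⟨fun s => ((A.bHat s).map fun r => φ.val r).sum⟩
  map_zero' := by ext x y s; simp
  map_add' φ ψ := by ext x y s; simp [List.sum_map_add]

theorem bDer_val (φ : Coch A.Hom K) {x y : A.Obj} (s : Str A.Hom x y) :
    (A.bDer φ).val s = splitSum s fun _ a r =>
      splitSum r fun _ q v => φ.val ((A.sgnStr a).append (cons (A.b q) v)) :=
  A.sum_bHat s _

theorem isTwistedDer_bDer : Front.IsTwistedDer (A.signHom (K := K)) A.bDer := by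
  intro φ ψ
  ext x y s
  rw [Coch.add_val, bDer_val]
  simp only [Coch.mul_append_cons, splitSum_add]
  simp only [splitSum_sgnStr, Coch.mul_val, bDer_val,
    signHom_val, splitSum_mul, mul_splitSum]
  rw [add_comm]
  congr 1
  · -- the right part contains `b`
    have h1 : ∀ {w : A.Obj} (a : Str A.Hom w y) (r : Str A.Hom x w),
        (splitSum r fun _ q v => splitSum v fun _ p p' =>
          φ.val p' * ψ.val ((A.sgnStr a).append (cons (A.b q) p))) =
        splitSum r fun _ m p' => splitSum m fun _ q p =>
          φ.val p' * ψ.val ((A.sgnStr a).append (cons (A.b q) p)) := fun a r =>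
      (splitSum_assoc r fun _ _ q p p' =>
        φ.val p' * ψ.val ((A.sgnStr a).append (cons (A.b q) p))).symm
    simp only [h1]
    exact (splitSum_assoc s fun _ _ a m p' => splitSum m fun _ q p =>
      φ.val p' * ψ.val ((A.sgnStr a).append (cons (A.b q) p))).symm
  · have h1 : ∀ {w : A.Obj} (a : Str A.Hom w y) (r : Str A.Hom x w),
        (splitSum r fun _ q v => splitSum a fun _ u u' =>
          φ.val ((A.sgnStr u').append (cons (A.b q) v)) * ψ.val (A.sgnStr u)) =
        splitSum a fun _ u u' => splitSum r fun _ q v =>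
          φ.val ((A.sgnStr u').append (cons (A.b q) v)) * ψ.val (A.sgnStr u) := by
      intro w a r
      exact splitSum_comm r a fun _ _ q v u u' =>
        φ.val ((A.sgnStr u').append (cons (A.b q) v)) * ψ.val (A.sgnStr u)
    simp only [h1]
    exact splitSum_assoc s fun _ _ u u' r => splitSum r fun _ q v =>
      φ.val ((A.sgnStr u').append (cons (A.b q) v)) * ψ.val (A.sgnStr u)

@[simp] theorem bDer_ofObj (a : A.Obj → K) : A.bDer (Coch.ofObj a) = 0 := by
  ext x y s
  rw [bDer_val]
  have : ∀ {w w' z : A.Obj} (u : Str A.Hom z w) (f : A.Hom w' z) (v : Str A.Hom x w'),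
      (Coch.ofObj a : Coch A.Hom K).val (u.append (cons f v)) = 0 := by
    intro w w' z u f v
    cases u <;> simp
  simp [this]

@[simp] theorem signHom_ofObj (a : A.Obj → K) : A.signHom (Coch.ofObj a) = Coch.ofObj a := by
  ext x y s
  cases s <;> simp

/-- On cochains supported on strings of length at most one, only the part with `b` applied to the
whole string contributes. -/
theorem bDer_val_of_short {φ : Coch A.Hom K}
    (hφ : ∀ {x y z w : A.Obj} (f : A.Hom z w) (g : A.Hom y z) (s : Str A.Hom x y),
      φ.val (cons f (cons g s)) = 0) {x y : A.Obj} (s : Str A.Hom x y) :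
    (A.bDer φ).val s = φ.val (single (A.b s)) := by
  have h1 : ∀ {z w a : A.Obj} (u : Str A.Hom z w) (f : A.Hom a z) (g : A.Hom y a)
      (v : Str A.Hom x y), φ.val (u.append (cons f (cons g v))) = 0 := by
    intro z w a u f g v
    cases u with
    | nil => simpa using hφ f g v
    | cons g' u => cases u <;> simp [hφ]
  have h2 : ∀ {z w a x : A.Obj} (g : A.Hom z w) (u : Str A.Hom a z) (f : A.Hom y a)
      (v : Str A.Hom x y), φ.val (cons g (u.append (cons f v))) = 0 := by
    intro z w a x g u f v
    cases u <;> simp [hφ]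
  rw [bDer_val]
  have h3 : ∀ {x y : A.Obj} (r : Str A.Hom x y),
      (splitSum r fun _ q v => φ.val (cons (A.b q) v)) = φ.val (single (A.b r)) := by
    intro x y r
    have : ∀ {x y y' : A.Obj} (r : Str A.Hom x y) (g : ∀ w, Str A.Hom w y → A.Hom w y'),
        (splitSum r fun w q v => φ.val (cons (g w q) v)) = φ.val (single (g x r)) := by
      intro x y y' r
      induction r with
      | nil => intro g; simp [single]
      | cons f r ih => intro g; simp [ih, hφ]
    exact this r fun _ q => A.b q
  cases s with
  | nil => simp [single]
  | cons f s =>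
    have h4 : ∀ {z w a x : A.Obj} (g : A.Hom z w) (u : Str A.Hom a z) (f : A.Hom y a)
      (v : Str A.Hom x y), φ.val (cons g (u.append (cons f v))) = 0 := h2
    have h5 : ∀ {z w a b x : A.Obj} (g : A.Hom z w) (u : Str A.Hom a z) (f : A.Hom b a)
      (v : Str A.Hom x b), φ.val (cons g (u.append (cons f v))) = 0 := by
      intro z w a b x g u f v
      cases u <;> simp [hφ]
    simp only [splitSum_cons, sgnStr_nil, nil_append, sgnStr_cons, cons_append, h5]
    have := h3 (cons f s)
    rw [splitSum_cons] at this
    rw [this]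
    simp

end AInfCat

namespace AInfFunctor

open Str

variable {𝕜 : Type u} [CommRing 𝕜] {A B C : AInfCat 𝕜} (F : AInfFunctor A B) {K : Type v}

/-! ## Pullback of cochains along a functor -/

@[simp] theorem blocks_nil (x : A.Obj) : F.blocks (nil x) = [nil (F.obj x)] := by
  rw [blocks]

theorem sum_blocksAux [AddCommMonoid K] {x y z : A.Obj} (acc : Str A.Hom y z) (s : Str A.Hom x y)
    (G : Str B.Hom (F.obj x) (F.obj z) → K) :
    ((F.blocksAux acc s).map G).sum = splitSum s fun _ u v =>
      ((F.blocks v).map fun r => G (cons (F.map _ _ (acc.append u)) r)).sum := by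
  induction s generalizing z with
  | nil =>
    rw [blocksAux]
    simp [single]
  | cons f s ih =>
    rw [blocksAux, List.map_append, List.sum_append, ih, splitSum_cons, append_nil, List.map_map,
      add_comm, blocks]
    congr 1
    refine splitSum_congr fun w u v => ?_
    rw [append_assoc, single, cons_append, nil_append]

theorem sum_blocks_cons [AddCommMonoid K] {x y z : A.Obj} (f : A.Hom y z) (s : Str A.Hom x y)
    (G : Str B.Hom (F.obj x) (F.obj z) → K) :
    ((F.blocks (cons f s)).map G).sum = splitSum s fun _ u v =>
      ((F.blocks v).map fun r => G (cons (F.map _ _ (cons f u)) r)).sum := by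
  rw [blocks, sum_blocksAux]
  simp [single]

variable [Ring K]

theorem sum_blocks_mul (φ : Coch B.Hom K) {x y : A.Obj} (n : ℕ) (s : Str A.Hom x y)
    (hn : s.length ≤ n) (ψ : ∀ w, Str B.Hom w (F.obj y) → K) :
    ((F.blocks s).map fun r => splitSum r fun _ u v => φ.val v * ψ _ u).sum =
      splitSum s fun _ u v => ((F.blocks v).map fun r => φ.val r).sum *
        ((F.blocks u).map fun r => ψ _ r).sum := by
  induction n generalizing y with
  | zero =>
    cases s with
    | nil => simp
    | cons f s => simp at hn
  | succ n ih =>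
    cases s with
    | nil => simp
    | cons f s =>
      simp only [length_cons, Nat.add_le_add_iff_right] at hn
      rw [sum_blocks_cons]
      simp only [splitSum_cons, List.sum_map_add, splitSum_add]
      congr 1
      · simp only [List.sum_map_mul_right, blocks_nil, List.map_cons, List.map_nil,
          List.sum_cons, List.sum_nil, add_zero]
        rw [sum_blocks_cons, splitSum_mul]
      · have len : ∀ {x y : A.Obj} {s : Str A.Hom x y} {G G' : ∀ w, Str A.Hom w y → Str A.Hom x w → K},
            (∀ w u v, v.length ≤ s.length → G w u v = G' w u v) → splitSum s G = splitSum s G' := by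
          intro x y s
          induction s with
          | nil => intro G G' h; simpa using h _ _ _ le_rfl
          | cons f s ih =>
            intro G G' h
            rw [splitSum_cons, splitSum_cons, h _ _ _ le_rfl]
            congr 1
            exact ih fun w u v h' => h _ _ _ (h'.trans (by simp))
        rw [len (G' := fun w u v => splitSum v fun _ u' v' =>
          ((F.blocks v').map fun r => φ.val r).sum *
            ((F.blocks u').map fun r => ψ _ (cons (F.map w _ (cons f u)) r)).sum)]
        · rw [← splitSum_assoc s fun _ _ u u' v' => ((F.blocks v').map fun r => φ.val r).sum *
            ((F.blocks u').map fun r => ψ _ (cons (F.map _ _ (cons f u)) r)).sum]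
          refine splitSum_congr fun w u v => ?_
          rw [← mul_splitSum, sum_blocks_cons]
        · intro w u v hv
          exact ih v (hv.trans hn) fun _ r => ψ _ (cons (F.map w _ (cons f u)) r)

/-- Pullback of cochains along a functor. -/
def pullback : Coch B.Hom K →+* Coch A.Hom K where
  toFun φ := ⟨fun s => ((F.blocks s).map fun r => φ.val r).sum⟩
  map_zero' := by ext x y s; simp
  map_add' φ ψ := by ext x y s; simp [List.sum_map_add]
  map_one' := by
    ext x y s
    cases s with
    | nil => simp
    | cons f s => simp [sum_blocks_cons]
  map_mul' φ ψ := by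
    ext x y s
    exact F.sum_blocks_mul φ s.length s le_rfl fun _ u => ψ.val u

theorem pullback_val (φ : Coch B.Hom K) {x y : A.Obj} (s : Str A.Hom x y) :
    (F.pullback φ).val s = ((F.blocks s).map fun r => φ.val r).sum := rfl

@[simp] theorem pullback_nil (φ : Coch B.Hom K) (x : A.Obj) :
    (F.pullback φ).val (nil x) = φ.val (nil (F.obj x)) := by
  simp [pullback_val]

@[simp] theorem pullback_single (φ : Coch B.Hom K) {x y : A.Obj} (f : A.Hom x y) :
    (F.pullback φ).val (single f) = φ.val (single (F.map x y (single f))) := by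
  simp [pullback_val, single, sum_blocks_cons]

@[simp] theorem pullback_ofObj (a : B.Obj → K) :
    F.pullback (Coch.ofObj a) = Coch.ofObj fun x => a (F.obj x) := by
  ext x y s
  cases s with
  | nil => simp
  | cons f s => simp [pullback_val, sum_blocks_cons]

/-- Pullback of a cochain supported on strings of length at most one. -/
theorem pullback_val_of_short {φ : Coch B.Hom K}
    (hφ : ∀ {x y z w : B.Obj} (f : B.Hom z w) (g : B.Hom y z) (s : Str B.Hom x y),
      φ.val (cons f (cons g s)) = 0) {x y z : A.Obj} (f : A.Hom y z) (s : Str A.Hom x y) :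
    (F.pullback φ).val (cons f s) = φ.val (single (F.map x z (cons f s))) := by
  rw [pullback_val, sum_blocks_cons]
  have key : ∀ {x y : A.Obj} (s : Str A.Hom x y) (g : ∀ w, Str A.Hom w y → B.Hom (F.obj w) (F.obj z)),
      (splitSum s fun w u v => ((F.blocks v).map fun r => φ.val (cons (g w u) r)).sum) =
        φ.val (single (g x s)) := by
    intro x y s
    induction s with
    | nil => intro g; simp [single]
    | cons f s ih =>
      intro g
      rw [splitSum_cons, ih (fun w u => g w (cons f u)), sum_blocks_cons]
      simp [hφ]
  exact key s fun w u => F.map w z (cons f u)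

end AInfFunctor


namespace Front

variable (Λ : Front)

section MultiCopy

variable {B : Type*} [Ring B] (g : Letter → B) (τ : ℕ → ℕ → Bˣ)

/-! ## Disks of the multicopy in terms of blocks -/

theorem sweep_append (D : ℕ → ℕ → B) (l l' : List Elem) :
    Λ.sweep g τ D (l ++ l') = Λ.sweep g τ (Λ.sweep g τ D l) l' := by
  simp [sweep]

@[simp] theorem sweep_nil (D : ℕ → ℕ → B) : Λ.sweep g τ D [] = D := rfl

@[simp] theorem sweep_cons (D : ℕ → ℕ → B) (el : Elem) (l : List Elem) :
    Λ.sweep g τ D (el :: l) = Λ.sweep g τ (Λ.slide g τ D el) l := rfl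

theorem slide_of_le (D : ℕ → ℕ → B) (el : Elem) {i j : ℕ} (h : j ≤ i) :
    Λ.slide g τ D el i j = 0 := by
  rw [slide, if_neg (by omega)]

theorem sweep_of_le {D : ℕ → ℕ → B} (hD : ∀ i j, j ≤ i → D i j = 0) (l : List Elem) :
    ∀ i j, j ≤ i → Λ.sweep g τ D l i j = 0 := by
  induction l generalizing D with
  | nil => exact hD
  | cons el l ih => exact ih fun i j h => Λ.slide_of_le g τ D el h

/-- The crossings of one understrand, in the copy `q`, with `r` consecutive overstrands. -/
def passList (e q a r : ℕ) (P : ℕ → ℕ) : List Elem :=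
  (List.range r).reverse.map fun p => Elem.cross (a + p) e (P p) q

theorem passList_succ (e q a r : ℕ) (P : ℕ → ℕ) :
    passList e q a (r + 1) P = Elem.cross (a + r) e (P r) q :: passList e q a r P := by
  simp [passList, List.range_succ]

/-- The old position of the strand at a given new position. -/
def passPos (a r x : ℕ) : ℕ := if x = a then a + r else if a < x ∧ x ≤ a + r then x - 1 else x

theorem sweep_pass {D : ℕ → ℕ → B} (hD : ∀ i j, j ≤ i → D i j = 0) (e q a r : ℕ) (P : ℕ → ℕ) :
    (∀ i, ¬ (a < i ∧ i ≤ a + r) → Λ.sweep g τ D (passList e q a r P) i a =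
      D (passPos a r i) (a + r) +
        ∑ p ∈ Finset.range r, D (passPos a r i) (a + p) * g ⟨.ev e, P p, q⟩) ∧
    (∀ i j, ¬ (a < i ∧ i ≤ a + r) → j ≠ a → Λ.sweep g τ D (passList e q a r P) i j =
      D (passPos a r i) (passPos a r j)) ∧
    (∀ p j, p < r → j ≠ a → Λ.sweep g τ D (passList e q a r P) (a + 1 + p) j =
      D (a + p) (passPos a r j) - sgn (Λ.deg 0 (.ev e)) • (g ⟨.ev e, P p, q⟩ *
        D (a + r) (passPos a r j))) := by
  induction r generalizing D with
  | zero =>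
    have : ∀ x, passPos a 0 x = x := by
      intro x; simp only [passPos]; split_ifs <;> omega
    simp [passList, this]
  | succ r ih =>
    rw [passList_succ, sweep_cons]
    obtain ⟨D1, hD1⟩ : ∃ D1, D1 = Λ.slide g τ D (.cross (a + r) e (P r) q) := ⟨_, rfl⟩
    rw [← hD1]
    have up1 : ∀ i j, j ≤ i → D1 i j = 0 := by
      rw [hD1]; exact fun i j => Λ.slide_of_le g τ D _
    obtain ⟨i1, i2, i3⟩ := ih up1
    have z1 : ∀ i, i < a + r → D1 i (a + r) = D i (a + r + 1) + D i (a + r) * g ⟨.ev e, P r, q⟩ := by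
      intro i hi
      rw [hD1, slide, if_pos hi]
      simp [tip, upper, lower, hi.ne, show i ≠ a + r + 1 by omega]
    have z2 : ∀ i j, i ≠ a + r → i ≠ a + r + 1 → j ≠ a + r → j ≠ a + r + 1 → D1 i j = D i j := by
      intro i j h1 h2 h3 h4
      by_cases hij : i < j
      · rw [hD1, slide, if_pos hij]
        simp [tip, upper, lower, h1, h2, h3, h4]
      · rw [up1 _ _ (by omega), hD _ _ (by omega)]
    have z3 : ∀ i, i ≠ a + r → i ≠ a + r + 1 → D1 i (a + r + 1) = D i (a + r) := by
      intro i h1 h2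
      by_cases hij : i < a + r + 1
      · rw [hD1, slide, if_pos hij]
        simp [tip, upper, lower, h1, h2]
      · rw [up1 _ _ (by omega), hD _ _ (by omega)]
    have z4 : ∀ j, j ≠ a + r → j ≠ a + r + 1 → D1 (a + r) j = D (a + r + 1) j := by
      intro j h1 h2
      by_cases hij : a + r < j
      · rw [hD1, slide, if_pos hij]
        simp [tip, upper, lower, h1, h2]
      · rw [up1 _ _ (by omega), hD _ _ (by omega)]
    have z5 : D1 (a + r) (a + r + 1) = 0 := by
      rw [hD1, slide, if_pos (by omega)]
      simp [tip, upper, lower, hD]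
    have z6 : ∀ j, j ≠ a + r → j ≠ a + r + 1 → D1 (a + r + 1) j = D (a + r) j -
        sgn (Λ.deg 0 (.ev e)) • (g ⟨.ev e, P r, q⟩ * D (a + r + 1) j) := by
      intro j h1 h2
      by_cases hij : a + r + 1 < j
      · rw [hD1, slide, if_pos hij]
        simp [tip, upper, lower, h1, h2, sub_eq_add_neg, mul_assoc]
      · rw [up1 _ _ (by omega), hD _ _ (by omega), hD _ _ (by omega)]; simp
    have z7 : D1 (a + r + 1) (a + r + 1) = 0 := up1 _ _ le_rfl
    clear ih hD1
    have pos1 : ∀ x, x ≠ a + r → x ≠ a + r + 1 → x ≠ a → passPos a (r + 1) x = passPos a r x := by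
      intro x h1 h2 h3
      simp only [passPos]
      split_ifs <;> omega
    have posa : ∀ r, passPos a r a = a + r := by intro r; simp [passPos]
    have posr : ∀ x, passPos a r x = a + r ↔ x = a := by
      intro x; simp only [passPos]; split_ifs <;> omega
    have posr1 : ∀ x, passPos a r x = a + r + 1 ↔ x = a + r + 1 := by
      intro x; simp only [passPos]; split_ifs <;> omega
    have pos2 : passPos a (r + 1) (a + r + 1) = a + r := by
      simp only [passPos]; split_ifs <;> omega
    have pos3 : ∀ x, a < x → x ≤ a + r → passPos a (r + 1) x = passPos a r x := by
      intro x h1 h2; simp only [passPos]; split_ifs <;> omega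
    have pos4 : ∀ x, a + r + 1 < x ∨ x < a → passPos a (r + 1) x = x ∧ passPos a r x = x := by
      intro x h1; simp only [passPos]; constructor <;> split_ifs <;> omega
    -- the new row of a strand not among the overstrands
    have rowlem : ∀ i j, ¬ (a < i ∧ i ≤ a + (r + 1)) → j ≠ a + r → j ≠ a + r + 1 →
        D1 (passPos a r i) j = D (passPos a (r + 1) i) j := by
      intro i j hi h1 h2
      by_cases hia : i = a
      · subst hia; rw [posa, posa, z4 _ h1 h2]; rfl
      · have := pos4 i (by omega)
        rw [this.1, this.2, z2 _ _ (by omega) (by omega) h1 h2]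
    have rowlem' : ∀ i, ¬ (a < i ∧ i ≤ a + (r + 1)) →
        D1 (passPos a r i) (a + r + 1) = D (passPos a (r + 1) i) (a + r) := by
      intro i hi
      by_cases hia : i = a
      · subst hia; rw [posa, posa, z5, hD _ _ (by omega)]
      · have := pos4 i (by omega)
        rw [this.1, this.2, z3 _ (by omega) (by omega)]
    -- the column of a strand other than the understrand
    have collem : ∀ j, j ≠ a → ∃ j', passPos a (r + 1) j = j' ∧
        ((j' = a + r ∧ passPos a r j = a + r + 1) ∨
          (j' = passPos a r j ∧ j' ≠ a + r ∧ j' ≠ a + r + 1)) := by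
      intro j hj
      refine ⟨_, rfl, ?_⟩
      by_cases h1 : j = a + r + 1
      · left; rw [h1, pos2, (posr1 _).2 rfl]; exact ⟨rfl, rfl⟩
      · right
        have h2 : passPos a (r + 1) j = passPos a r j := by
          simp only [passPos]; split_ifs <;> omega
        rw [h2]
        exact ⟨rfl, fun h => hj ((posr j).1 h), fun h => h1 ((posr1 j).1 h)⟩
    refine ⟨fun i hi => ?_, fun i j hi hj => ?_, fun p j hp hj => ?_⟩
    · rw [i1 i (by omega), Finset.sum_range_succ]
      have s1 : D1 (passPos a r i) (a + r) = D (passPos a (r + 1) i) (a + r + 1) +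
          D (passPos a (r + 1) i) (a + r) * g ⟨.ev e, P r, q⟩ := by
        by_cases hia : i = a
        · subst hia
          rw [posa, posa, up1 _ _ le_rfl, hD _ _ (by omega), hD _ _ (by omega)]; simp
        · have := pos4 i (by omega)
          rw [this.1, this.2]
          by_cases h2 : i < a
          · rw [z1 _ (by omega)]
          · rw [up1 _ _ (by omega), hD _ _ (by omega), hD _ _ (by omega)]; simp
      rw [s1, Finset.sum_congr rfl fun p hp => by
        rw [rowlem i (a + p) hi (by simp at hp; omega) (by simp at hp; omega)]]
      rw [← add_assoc a r 1]
      abel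
    · rw [i2 i j (by omega) hj]
      obtain ⟨j', hj', ⟨h1, h2⟩ | ⟨h1, h2, h3⟩⟩ := collem j hj
      · rw [hj', h2, h1, rowlem' i hi]
      · rw [hj', ← h1, rowlem i _ hi h2 h3]
    · obtain ⟨j', hj', hc⟩ := collem j hj
      by_cases hpr : p = r
      · subst hpr
        rw [show a + 1 + p = a + p + 1 by omega, i2 _ j (by omega) hj, (posr1 _).2 rfl, hj']
        obtain ⟨h1, h2⟩ | ⟨h1, h2, h3⟩ := hc
        · rw [h2, h1, z7, hD _ _ le_rfl, hD _ _ (by omega)]; simp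
        · rw [← h1, z6 _ h2 h3]; rfl
      · rw [i3 p j (by omega) hj, hj']
        obtain ⟨h1, h2⟩ | ⟨h1, h2, h3⟩ := hc
        · rw [h2, h1, z3 _ (by omega) (by omega), z5, hD (a + (r + 1)) _ (by omega)]
        · rw [← h1, z2 _ _ (by omega) (by omega) h2 h3, z4 _ h2 h3]; rfl

/-! ### Crossings -/

/-- The old position of a strand after the first `Q` understrands have crossed. -/
def crossPos (m a Q x : ℕ) : ℕ :=
  if a ≤ x ∧ x < a + Q then x + m else if a + Q ≤ x ∧ x < a + Q + m then x - Q else x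

theorem sweep_cross_passes {D : ℕ → ℕ → B} (hD : ∀ i j, j ≤ i → D i j = 0) (e m a Q : ℕ)
    (hQ : Q ≤ m) :
    (∀ i q, ¬ (a + Q ≤ i ∧ i < a + Q + m) → q < Q →
      Λ.sweep g τ D ((List.range Q).flatMap fun q => passList e q (a + q) m fun p => p) i (a + q) =
        D (crossPos m a Q i) (a + m + q) +
          ∑ p ∈ Finset.range m, D (crossPos m a Q i) (a + p) * g ⟨.ev e, p, q⟩) ∧
    (∀ i j, ¬ (a + Q ≤ i ∧ i < a + Q + m) → ¬ (a ≤ j ∧ j < a + Q) →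
      Λ.sweep g τ D ((List.range Q).flatMap fun q => passList e q (a + q) m fun p => p) i j =
        D (crossPos m a Q i) (crossPos m a Q j)) ∧
    (∀ p j, p < m → ¬ (a ≤ j ∧ j < a + Q) →
      Λ.sweep g τ D ((List.range Q).flatMap fun q => passList e q (a + q) m fun p => p)
          (a + Q + p) j =
        D (a + p) (crossPos m a Q j) - sgn (Λ.deg 0 (.ev e)) • ∑ q ∈ Finset.range Q,
          g ⟨.ev e, p, q⟩ * D (a + m + q) (crossPos m a Q j)) := by
  induction Q with
  | zero =>
    have : ∀ x, crossPos m a 0 x = x := by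
      intro x; simp only [crossPos]; split_ifs <;> omega
    simp [this]
  | succ Q ih =>
    obtain ⟨i1, i2, i3⟩ := ih (by omega)
    have up := Λ.sweep_of_le g τ hD ((List.range Q).flatMap fun q => passList e q (a + q) m fun p => p)
    simp only [List.range_succ, List.flatMap_append, List.flatMap_singleton, sweep_append]
    generalize Λ.sweep g τ D ((List.range Q).flatMap fun q => passList e q (a + q) m fun p => p) = D1
      at i1 i2 i3 up ⊢
    obtain ⟨p1, p2, p3⟩ := Λ.sweep_pass g τ up e Q (a + Q) m fun p => p
    have pos : ∀ x, ¬ (a + Q + 1 ≤ x ∧ x < a + Q + 1 + m) →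
        ¬ (a + Q ≤ passPos (a + Q) m x ∧ passPos (a + Q) m x < a + Q + m) ∧
        crossPos m a Q (passPos (a + Q) m x) = crossPos m a (Q + 1) x := by
      intro x hx
      simp only [passPos, crossPos]
      constructor
      · split_ifs <;> omega
      · split_ifs <;> omega
    have pos' : ∀ x, x ≠ a + Q → ¬ (a ≤ x ∧ x < a + Q) →
        ¬ (a ≤ passPos (a + Q) m x ∧ passPos (a + Q) m x < a + Q) ∧
        crossPos m a Q (passPos (a + Q) m x) = crossPos m a (Q + 1) x := by
      intro x h1 h2
      simp only [passPos, crossPos]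
      constructor
      · split_ifs <;> omega
      · split_ifs <;> omega
    have cp : ∀ p, p < m → crossPos m a Q (a + Q + p) = a + p := by
      intro p hp; simp only [crossPos]; split_ifs <;> omega
    have cp' : crossPos m a Q (a + Q + m) = a + m + Q := by
      simp only [crossPos]; split_ifs <;> omega
    refine ⟨fun i q hi hq => ?_, fun i j hi hj => ?_, fun p j hp hj => ?_⟩
    · have hp := pos i (by omega)
      by_cases hqQ : q = Q
      · subst hqQ
        rw [p1 i (by omega), i2 _ _ hp.1 (by omega), hp.2, cp']
        congr 1
        refine Finset.sum_congr rfl fun p hp' => ?_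
        rw [i2 _ _ hp.1 (by omega), hp.2, cp p (by simpa using hp')]
      · rw [p2 i (a + q) (by omega) (by omega)]
        have : passPos (a + Q) m (a + q) = a + q := by simp only [passPos]; split_ifs <;> omega
        rw [this, i1 _ q hp.1 (by omega), hp.2]
    · have hp := pos i (by omega)
      have hp' := pos' j (by omega) (by omega)
      rw [p2 i j (by omega) (by omega), i2 _ _ hp.1 hp'.1, hp.2, hp'.2]
    · have hp' := pos' j (by omega) (by omega)
      rw [show a + (Q + 1) + p = a + Q + 1 + p by omega, p3 p j hp (by omega), i3 p _ hp hp'.1,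
        hp'.2, i2 _ _ (by omega) hp'.1, hp'.2, cp', Finset.sum_range_succ, smul_add]
      abel

end MultiCopy

end Front


namespace Front

variable (Λ : Front)

section MultiCopy

variable {B : Type*} [Ring B] (g : Letter → B) (τ : ℕ → ℕ → Bˣ)

theorem sweep_cross_penultimate {D : ℕ → ℕ → B} (hD : ∀ i j, j ≤ i → D i j = 0) (e m a : ℕ) :
    Λ.sweep g τ (Λ.sweep g τ D ((List.range m).flatMap fun q => passList e q (a + q) (m + 1)
        fun p => p)) (passList e m (a + m + 1) m fun p => p + 1) (a + m) (a + m + 1) =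
      D a (a + (m + 1) + m) + ∑ p ∈ Finset.range (m + 1), D a (a + p) * g ⟨.ev e, p, m⟩ -
        sgn (Λ.deg 0 (.ev e)) • ∑ q ∈ Finset.range (m + 1),
          g ⟨.ev e, 0, q⟩ * D (a + (m + 1) + q) (a + (m + 1) + m) := by
  obtain ⟨i1, i2, i3⟩ := Λ.sweep_cross_passes g τ hD e (m + 1) a m (by omega)
  have up := Λ.sweep_of_le g τ hD
    ((List.range m).flatMap fun q => passList e q (a + q) (m + 1) fun p => p)
  rw [(Λ.sweep_pass g τ up e m (a + m + 1) m fun p => p + 1).1 (a + m) (by omega)]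
  have h1 : passPos (a + m + 1) m (a + m) = a + m + 0 := by
    simp only [passPos]; split_ifs <;> omega
  have h2 : crossPos (m + 1) a m (a + m + 1 + m) = a + (m + 1) + m := by
    simp only [crossPos]; split_ifs <;> omega
  have h3 : ∀ p ∈ Finset.range m, crossPos (m + 1) a m (a + m + 1 + p) = a + (p + 1) := by
    intro p hp; simp at hp; simp only [crossPos]; split_ifs <;> omega
  have i3' := fun j hj => i3 0 j (by omega) hj
  simp only [Nat.add_zero] at i3'
  have h4 : ∀ p ∈ Finset.range m, Λ.sweep g τ D ((List.range m).flatMap fun q =>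
      passList e q (a + q) (m + 1) fun p => p) (a + m) (a + m + 1 + p) *
        g ⟨.ev e, p + 1, m⟩ = D a (a + (p + 1)) * g ⟨.ev e, p + 1, m⟩ := by
    intro p hp
    rw [i3' _ (by omega), h3 p hp, Finset.sum_eq_zero]
    · simp
    · intro q _
      simp at hp
      rw [hD _ _ (by omega), mul_zero]
  rw [h1]
  simp only [Nat.add_zero]
  rw [Finset.sum_congr rfl h4, i3' _ (by omega), h2,
    Finset.sum_range_succ (fun q => g ⟨.ev e, 0, q⟩ * _),
    Finset.sum_range_succ' (fun p => D a (a + p) * _), hD (a + (m + 1) + m) _ le_rfl, mul_zero]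
  simp only [hD a a le_rfl, zero_mul, add_zero]
  abel

/-! ### Left cusps -/

theorem sweep_lcusps {D : ℕ → ℕ → B} (hD : ∀ i j, j ≤ i → D i j = 0) (a r : ℕ) (i j : ℕ) :
    Λ.sweep g τ D ((List.range r).map fun p => Elem.lcusp (a + 2 * p)) i j =
      if (a ≤ i ∧ i < a + 2 * r) ∨ (a ≤ j ∧ j < a + 2 * r) then
        if a ≤ i ∧ i < a + 2 * r ∧ j = i + 1 ∧ (i - a) % 2 = 0 then 1 else 0
      else D (if i < a then i else i - 2 * r) (if j < a then j else j - 2 * r) := by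
  induction r generalizing i j with
  | zero =>
    rw [if_neg (by omega)]
    simp
  | succ r ih =>
    have up := Λ.sweep_of_le g τ hD ((List.range r).map fun p => Elem.lcusp (a + 2 * p))
    simp only [List.range_succ, List.map_append, List.map_cons, List.map_nil, sweep_append]
    generalize Λ.sweep g τ D ((List.range r).map fun p => Elem.lcusp (a + 2 * p)) = D1 at ih up ⊢
    simp only [sweep_cons, sweep_nil]
    by_cases hij : i < j
    · rw [slide, if_pos hij]
      by_cases h1 : i = a + 2 * r ∧ j = a + 2 * r + 1
      · rw [if_pos (by omega), if_pos (by omega)]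
        obtain ⟨rfl, rfl⟩ := h1
        simp [tip, upper]
      · by_cases h2 : i = a + 2 * r ∨ i = a + 2 * r + 1 ∨ j = a + 2 * r ∨ j = a + 2 * r + 1
        · rw [if_pos (by omega), if_neg (by omega)]
          simp only [tip, h1, if_false, zero_add, upper, lower]
          split_ifs <;> first | omega | simp
        · have : ∀ x y, Λ.sweep g τ D1 [] x y = D1 x y := fun _ _ => rfl
          simp only [tip, h1, if_false, zero_add, upper, lower]
          split_ifs <;> (try omega) <;> simp only [List.map_cons, List.map_nil, List.sum_cons,
            List.sum_nil, one_mul, mul_one, add_zero] <;> rw [ih] <;> split_ifs <;>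
            first | omega | rfl | (congr 1 <;> omega)
    · rw [Λ.slide_of_le g τ _ _ (by omega)]
      split_ifs <;> first | omega | rfl | (rw [hD _ _ (by omega)])

/-- The disks between the strands close to a left cusp after the first `Q` steps, with the crossings
`y`. -/
def cuspMatrix (y : ℕ → ℕ → B) (Q u v : ℕ) : B :=
  if u < Q ∧ v < Q then y u v
  else if u < Q ∧ Q ≤ v ∧ v < 2 * Q then if v = u + Q then 1 else 0
  else if Q ≤ u ∧ u < 2 * Q ∧ Q ≤ v ∧ v < 2 * Q then y (u - Q) (v - Q)
  else if 2 * Q ≤ u ∧ v = u + 1 ∧ u % 2 = 0 then 1 else 0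

theorem cuspMatrix_succ (y : ℕ → ℕ → B) (Q u v : ℕ) (hu : ¬ (Q < u ∧ u ≤ 2 * Q)) (hv : v ≠ Q)
    (hy : ∀ p q, q ≤ p → y p q = 0) :
    cuspMatrix y Q (if u = Q then 2 * Q else u) (if Q < v ∧ v ≤ 2 * Q then v - 1 else v) =
      cuspMatrix y (Q + 1) u v := by
  by_cases h1 : u = Q
  · subst h1
    rw [if_pos rfl]
    by_cases h2 : u < v ∧ v ≤ 2 * u
    · rw [if_pos h2]
      simp only [cuspMatrix]
      split_ifs <;> first | omega | rfl
    · rw [if_neg h2]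
      simp only [cuspMatrix]
      split_ifs <;> first | omega | rfl | (rw [hy _ _ (by omega)])
  · rw [if_neg h1]
    by_cases h2 : Q < v ∧ v ≤ 2 * Q
    · rw [if_pos h2]
      simp only [cuspMatrix]
      split_ifs <;> first | omega | rfl | (rw [hy _ _ (by omega)])
    · rw [if_neg h2]
      simp only [cuspMatrix]
      split_ifs <;> first | omega | rfl | (rw [hy _ _ (by omega)])

theorem sweep_lcusp_passes {D : ℕ → ℕ → B} (hD : ∀ i j, j ≤ i → D i j = 0) (e m a Q : ℕ)
    (hQ : Q ≤ m) (hs : Λ.deg 0 (.ev e) = -1) (hy : ∀ p q, q ≤ p → g ⟨.ev e, p, q⟩ = 0) (i j : ℕ) :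
    Λ.sweep g τ D (((List.range m).map fun p => Elem.lcusp (a + 2 * p)) ++
        (List.range Q).flatMap fun q => passList e q (a + q) q fun p => p) i j =
      if a ≤ i ∧ i < a + 2 * m ∧ a ≤ j ∧ j < a + 2 * m then
        cuspMatrix (fun p q => g ⟨.ev e, p, q⟩) Q (i - a) (j - a)
      else if (a ≤ i ∧ i < a + 2 * m) ∨ (a ≤ j ∧ j < a + 2 * m) then 0
      else D (if i < a then i else i - 2 * m) (if j < a then j else j - 2 * m) := by
  induction Q generalizing i j with
  | zero =>
    simp only [List.range_zero, List.flatMap_nil, List.append_nil, Λ.sweep_lcusps g τ hD,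
      cuspMatrix]
    split_ifs <;> first | omega | rfl
  | succ Q ih =>
    have ih' := ih (by omega)
    have up := Λ.sweep_of_le g τ hD (((List.range m).map fun p => Elem.lcusp (a + 2 * p)) ++
        (List.range Q).flatMap fun q => passList e q (a + q) q fun p => p)
    rw [List.range_succ, List.flatMap_append, List.flatMap_singleton, ← List.append_assoc,
      sweep_append]
    generalize Λ.sweep g τ D (((List.range m).map fun p => Elem.lcusp (a + 2 * p)) ++
        (List.range Q).flatMap fun q => passList e q (a + q) q fun p => p) = D1 at ih' up ⊢
    clear ih
    obtain ⟨p1, p2, p3⟩ := Λ.sweep_pass g τ up e Q (a + Q) Q fun p => p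
    generalize hyg : (fun p q => g ⟨.ev e, p, q⟩) = y at *
    have hyz : ∀ p q, q ≤ p → y p q = 0 := by rw [← hyg]; exact hy
    have hy' : ∀ p q, g ⟨.ev e, p, q⟩ = y p q := by rw [← hyg]; exact fun _ _ => rfl
    simp only [hy', hs, sgn_neg, sgn_one, neg_smul, one_smul, sub_neg_eq_add] at p1 p2 p3
    have up' := up
    clear hyg hy up hs hy'
    have pos : ∀ x, ¬ (a + Q < x ∧ x ≤ a + Q + Q) → (x < a ∧ passPos (a + Q) Q x = x) ∨
        (∃ u, u < Q ∧ x = a + u ∧ passPos (a + Q) Q x = a + u) ∨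
        (x = a + Q ∧ passPos (a + Q) Q x = a + 2 * Q) ∨
        (∃ u, 2 * Q + 1 ≤ u ∧ u < 2 * m ∧ x = a + u ∧ passPos (a + Q) Q x = a + u) ∨
        (a + 2 * m ≤ x ∧ passPos (a + Q) Q x = x) := by
      intro x hx
      rcases lt_or_ge x a with h | h
      · left; refine ⟨h, ?_⟩; simp only [passPos]; split_ifs <;> omega
      obtain ⟨u, rfl⟩ := Nat.exists_eq_add_of_le h
      right
      rcases lt_trichotomy u Q with h | h | h
      · left; refine ⟨u, h, rfl, ?_⟩; simp only [passPos]; split_ifs <;> omega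
      · right; left; refine ⟨by omega, ?_⟩; simp only [passPos]; split_ifs <;> omega
      · right; right
        have : passPos (a + Q) Q (a + u) = a + u := by simp only [passPos]; split_ifs <;> omega
        by_cases h' : u < 2 * m
        · left; exact ⟨u, by omega, h', rfl, this⟩
        · right; exact ⟨by omega, this⟩
    have pos' : ∀ p, p < Q → passPos (a + Q) Q (a + Q + 1 + p) = a + (Q + p) := by
      intro p hp; simp only [passPos]; split_ifs <;> omega
    have inn : ∀ u v, u < 2 * m → v < 2 * m → D1 (a + u) (a + v) = cuspMatrix y Q u v := by
      intro u v hu hv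
      rw [ih', if_pos (by omega), Nat.add_sub_cancel_left, Nat.add_sub_cancel_left]
    have out : ∀ i j, ¬ (a ≤ i ∧ i < a + 2 * m) ∨ ¬ (a ≤ j ∧ j < a + 2 * m) →
        ((a ≤ i ∧ i < a + 2 * m) ∨ (a ≤ j ∧ j < a + 2 * m)) → D1 i j = 0 := by
      intro i j h h'
      rw [ih', if_neg (by omega), if_pos h']
    by_cases hi : a + Q < i ∧ i ≤ a + Q + Q
    · obtain ⟨p, rfl⟩ : ∃ p, i = a + Q + 1 + p := ⟨i - (a + Q + 1), by omega⟩
      have hp : p < Q := by omega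
      have e1 : a + Q + 1 + p - a = Q + 1 + p := by omega
      have e2 : a + Q + Q = a + 2 * Q := by omega
      have e3 : a + Q + p = a + (Q + p) := by omega
      by_cases hj : j = a + Q
      · subst hj
        rw [Λ.sweep_of_le g τ up' _ _ _ (by omega), if_pos (by omega), cuspMatrix]
        split_ifs <;> first | omega | rfl
      · rw [p3 p j hp hj, e2, e3]
        by_cases hj2 : a + Q < j ∧ j ≤ a + Q + Q
        · obtain ⟨p', rfl⟩ : ∃ p, j = a + Q + 1 + p := ⟨j - (a + Q + 1), by omega⟩
          rw [pos' p' (by omega), inn _ _ (by omega) (by omega), inn _ _ (by omega) (by omega),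
            if_pos (by omega), e1, show a + Q + 1 + p' - a = Q + 1 + p' by omega]
          have c1 : cuspMatrix y Q (Q + p) (Q + p') = y p p' := by
            simp only [cuspMatrix]; split_ifs <;> first | omega | skip
            congr 1 <;> omega
          have c2 : cuspMatrix y Q (2 * Q) (Q + p') = 0 := by
            simp only [cuspMatrix]; split_ifs <;> first | omega | rfl
          have c3 : cuspMatrix y (Q + 1) (Q + 1 + p) (Q + 1 + p') = y p p' := by
            simp only [cuspMatrix]; split_ifs <;> first | omega | skip
            congr 1 <;> omega
          rw [c1, c2, c3]; simp
        · rcases pos j hj2 with ⟨h1, h2⟩ | ⟨v, h1, rfl, h2⟩ | ⟨h1, h2⟩ | ⟨v, h1, h3, rfl, h2⟩ | ⟨h1, h2⟩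
          · rw [h2, out _ _ (by omega) (by omega), out _ _ (by omega) (by omega), if_neg (by omega),
              if_pos (by omega)]; simp
          · rw [h2, inn _ _ (by omega) (by omega), inn _ _ (by omega) (by omega), if_pos (by omega),
              e1, Nat.add_sub_cancel_left]
            have c1 : cuspMatrix y Q (Q + p) v = 0 := by
              simp only [cuspMatrix]; split_ifs <;> first | omega | rfl
            have c2 : cuspMatrix y Q (2 * Q) v = 0 := by
              simp only [cuspMatrix]; split_ifs <;> first | omega | rfl
            have c3 : cuspMatrix y (Q + 1) (Q + 1 + p) v = 0 := by
              simp only [cuspMatrix]; split_ifs <;> first | omega | rfl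
            rw [c1, c2, c3]; simp
          · exact absurd h1 hj
          · rw [h2, inn _ _ (by omega) (by omega), inn _ _ (by omega) (by omega), if_pos (by omega),
              e1, Nat.add_sub_cancel_left]
            have c1 : cuspMatrix y Q (Q + p) v = 0 := by
              simp only [cuspMatrix]; split_ifs <;> first | omega | rfl
            have c2 : cuspMatrix y Q (2 * Q) v = if v = 2 * Q + 1 then 1 else 0 := by
              simp only [cuspMatrix]; split_ifs <;> first | omega | rfl
            have c3 : cuspMatrix y (Q + 1) (Q + 1 + p) v = if v = 2 * Q + 1 then y p Q else 0 := by
              simp only [cuspMatrix]; split_ifs <;> first | omega | rfl | skip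
              congr 1 <;> omega
            rw [c1, c2, c3]; split_ifs <;> simp
          · rw [h2, out _ _ (by omega) (by omega), out _ _ (by omega) (by omega), if_neg (by omega),
              if_pos (by omega)]; simp
    · by_cases hj : j = a + Q
      · subst hj
        have e2 : a + Q + Q = a + 2 * Q := by omega
        have e3 : ∀ p, a + Q + p = a + (Q + p) := by intro p; omega
        rw [p1 i hi, e2]
        simp only [e3]
        rcases pos i hi with ⟨h1, h2⟩ | ⟨u, h1, rfl, h2⟩ | ⟨h1, h2⟩ | ⟨u, h1, h3, rfl, h2⟩ | ⟨h1, h2⟩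
        · rw [h2, out _ _ (by omega) (by omega), if_neg (by omega), if_pos (by omega), zero_add]
          refine Finset.sum_eq_zero fun p hp => ?_
          simp at hp
          rw [out _ _ (by omega) (by omega), zero_mul]
        · rw [h2, inn _ _ (by omega) (by omega), if_pos (by omega), Nat.add_sub_cancel_left,
            Nat.add_sub_cancel_left, Finset.sum_eq_single u]
          · rw [inn _ _ (by omega) (by omega)]
            have c1 : cuspMatrix y Q u (2 * Q) = 0 := by
              simp only [cuspMatrix]; split_ifs <;> first | omega | rfl
            have c2 : cuspMatrix y Q u (Q + u) = 1 := by
              simp only [cuspMatrix]; split_ifs <;> first | omega | rfl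
            have c3 : cuspMatrix y (Q + 1) u Q = y u Q := by
              simp only [cuspMatrix]; split_ifs <;> first | omega | rfl
            rw [c1, c2, c3]; simp
          · intro p hp hpu
            simp at hp
            rw [inn _ _ (by omega) (by omega)]
            have c2 : cuspMatrix y Q u (Q + p) = 0 := by
              simp only [cuspMatrix]; split_ifs <;> first | omega | rfl
            rw [c2, zero_mul]
          · intro h; simp at h; omega
        · rw [h2, inn _ _ (by omega) (by omega), if_pos (by omega), Finset.sum_eq_zero]
          · have c1 : cuspMatrix y Q (2 * Q) (2 * Q) = 0 := by
              simp only [cuspMatrix]; split_ifs <;> first | omega | rfl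
            have c3 : cuspMatrix y (Q + 1) (i - a) (a + Q - a) = 0 := by
              simp only [cuspMatrix]; split_ifs <;> first | omega | rfl | (rw [hyz _ _ (by omega)])
            rw [c1, c3, add_zero]
          · intro p hp
            simp at hp
            rw [inn _ _ (by omega) (by omega)]
            have c2 : cuspMatrix y Q (2 * Q) (Q + p) = 0 := by
              simp only [cuspMatrix]; split_ifs <;> first | omega | rfl
            rw [c2, zero_mul]
        · rw [h2, inn _ _ (by omega) (by omega), if_pos (by omega), Nat.add_sub_cancel_left,
            Nat.add_sub_cancel_left, Finset.sum_eq_zero]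
          · have c1 : cuspMatrix y Q u (2 * Q) = 0 := by
              simp only [cuspMatrix]; split_ifs <;> first | omega | rfl
            have c3 : cuspMatrix y (Q + 1) u Q = 0 := by
              simp only [cuspMatrix]; split_ifs <;> first | omega | rfl
            rw [c1, c3, add_zero]
          · intro p hp
            simp at hp
            rw [inn _ _ (by omega) (by omega)]
            have c2 : cuspMatrix y Q u (Q + p) = 0 := by
              simp only [cuspMatrix]; split_ifs <;> first | omega | rfl
            rw [c2, zero_mul]
        · rw [h2, out _ _ (by omega) (by omega), if_neg (by omega), if_pos (by omega), zero_add]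
          refine Finset.sum_eq_zero fun p hp => ?_
          simp at hp
          rw [out _ _ (by omega) (by omega), zero_mul]
      · rw [p2 i j hi hj]
        by_cases hio : a ≤ i ∧ i < a + 2 * m
        · by_cases hjo : a ≤ j ∧ j < a + 2 * m
          · obtain ⟨u, rfl⟩ := Nat.exists_eq_add_of_le hio.1
            obtain ⟨v, rfl⟩ := Nat.exists_eq_add_of_le hjo.1
            have e1 : passPos (a + Q) Q (a + u) = a + if u = Q then 2 * Q else u := by
              simp only [passPos]; split_ifs <;> omega
            have e2 : passPos (a + Q) Q (a + v) = a + if Q < v ∧ v ≤ 2 * Q then v - 1 else v := by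
              simp only [passPos]; split_ifs <;> omega
            rw [e1, e2, inn _ _ (by clear e1 e2; split_ifs <;> omega) (by clear e1 e2; split_ifs <;> omega),
              if_pos (show a ≤ a + u ∧ a + u < a + 2 * m ∧ a ≤ a + v ∧ a + v < a + 2 * m from
                ⟨hio.1, hio.2, hjo⟩), Nat.add_sub_cancel_left, Nat.add_sub_cancel_left]
            exact cuspMatrix_succ y Q u v (by omega) (by omega) hyz
          · have hpi : a ≤ passPos (a + Q) Q i ∧ passPos (a + Q) Q i < a + 2 * m := by
              simp only [passPos]; split_ifs <;> omega
            have hpj : passPos (a + Q) Q j = j := by simp only [passPos]; split_ifs <;> omega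
            rw [hpj, out _ _ (Or.inr hjo) (Or.inl hpi), if_neg (by omega), if_pos (by omega)]
        · have hpi : passPos (a + Q) Q i = i := by simp only [passPos]; split_ifs <;> omega
          by_cases hjo : a ≤ j ∧ j < a + 2 * m
          · have hpj : a ≤ passPos (a + Q) Q j ∧ passPos (a + Q) Q j < a + 2 * m := by
              simp only [passPos]; split_ifs <;> omega
            rw [hpi, out _ _ (Or.inl hio) (Or.inr hpj), if_neg (by omega), if_pos (by omega)]
          · have hpj : passPos (a + Q) Q j = j := by simp only [passPos]; split_ifs <;> omega
            have c1 : ¬ (a ≤ i ∧ i < a + 2 * m ∧ a ≤ j ∧ j < a + 2 * m) := fun h => hio ⟨h.1, h.2.1⟩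
            have c2 : ¬ ((a ≤ i ∧ i < a + 2 * m) ∨ (a ≤ j ∧ j < a + 2 * m)) := by tauto
            rw [hpi, hpj, ih']
            simp only [c1, c2, if_false]

end MultiCopy

end Front


namespace Front

variable (Λ : Front)

section MultiCopy

variable {B : Type*} [Ring B] (g : Letter → B) (τ : ℕ → ℕ → Bˣ)

/-! ### The blocks of the multicopy -/

/-- A family of units as an invertible diagonal matrix. -/
def diagUnit (m : ℕ) (u : ℕ → Bˣ) : (Matrix (Fin m) (Fin m) B)ˣ where
  val := Matrix.diagonal fun p => (u p : B)
  inv := Matrix.diagonal fun p => ((u p)⁻¹ : Bˣ)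
  val_inv := by simp [Matrix.diagonal_mul_diagonal]
  inv_val := by simp [Matrix.diagonal_mul_diagonal]

@[simp] theorem coe_diagUnit (m : ℕ) (u : ℕ → Bˣ) :
    (diagUnit m u : Matrix (Fin m) (Fin m) B) =
      Matrix.diagonal fun p : Fin m => (u p : B) := rfl

@[simp] theorem coe_diagUnit_inv (m : ℕ) (u : ℕ → Bˣ) :
    (((diagUnit m u)⁻¹ : (Matrix (Fin m) (Fin m) B)ˣ) : Matrix (Fin m) (Fin m) B) =
      Matrix.diagonal fun p : Fin m => (((u p)⁻¹ : Bˣ) : B) := rfl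

/-- The values of the letters of the `m`-copy as matrices indexed by pairs of copies. -/
def multiData (m : ℕ) : SweepData (Matrix (Fin m) (Fin m) B) where
  line i j := Matrix.of fun p q => g ⟨.line i j, p, q⟩
  ev e := Matrix.of fun p q => g ⟨.ev e, p, q⟩
  mark e := diagUnit m fun p => Λ.markFactor τ e p

/-- `D` is the matrix with the blocks `M`. -/
def IsBlocks {m : ℕ} (D : ℕ → ℕ → B) (M : ℕ → ℕ → Matrix (Fin m) (Fin m) B) : Prop :=
  ∀ i j (p q : Fin m), D (m * i + p) (m * j + q) = M i j p q

theorem mul_add_le_of_lt {m i k : ℕ} (h : i < k) : m * i + m ≤ m * k := by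
  rw [← Nat.mul_succ]
  exact Nat.mul_le_mul_left m h

theorem le_of_block_lt {m i j p q : ℕ} (hp : q < m) (h : j < i) : m * j + q ≤ m * i + p := by
  have := mul_add_le_of_lt (m := m) h
  omega

theorem isBlocks_cross {m k e : ℕ} (hev : Λ.event e = .cross k) {D : ℕ → ℕ → B}
    (hD : ∀ i j, j ≤ i → D i j = 0) {M : ℕ → ℕ → Matrix (Fin m) (Fin m) B} (hM : IsBlocks D M) :
    IsBlocks (Λ.sweep g τ D (Λ.block m e)) (Λ.blockStep (Λ.multiData g τ m) e M) := by
  have hb : Λ.block m e = (List.range m).flatMap fun q => passList e q (m * k + q) m fun p => p := by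
    simp only [block, hev, passList]
  intro i j p q
  have hp := p.2
  have hq := q.2
  simp only [blockStep, hev]
  by_cases hji : j < i
  · rw [if_pos hji, Λ.sweep_of_le g τ hD _ _ _ (le_of_block_lt hq hji)]
    rfl
  rw [if_neg hji, hb]
  obtain ⟨c1, c2, c3⟩ := Λ.sweep_cross_passes g τ hD e m (m * k) m le_rfl
  have hk1 : m * (k + 1) = m * k + m := Nat.mul_succ m k
  have cp : ∀ i p, p < m → crossPos m (m * k) m (m * i + p) = m * (Equiv.swap k (k + 1) i) + p := by
    intro i p hp
    rcases lt_trichotomy i k with h | h | h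
    · have := mul_add_le_of_lt (m := m) h
      rw [Equiv.swap_apply_of_ne_of_ne (by omega) (by omega)]
      simp only [crossPos]; split_ifs <;> omega
    · subst h
      rw [Equiv.swap_apply_left, hk1]
      simp only [crossPos]; split_ifs <;> omega
    · have := mul_add_le_of_lt (m := m) h
      by_cases h' : i = k + 1
      · subst h'
        rw [Equiv.swap_apply_right, hk1]
        simp only [crossPos]; split_ifs <;> omega
      · have := mul_add_le_of_lt (m := m) (show k + 1 < i by omega)
        rw [Equiv.swap_apply_of_ne_of_ne (by omega) (by omega)]
        simp only [crossPos]; split_ifs <;> omega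
  have blk : ∀ i k p, p < m → (m * k ≤ m * i + p ∧ m * i + p < m * k + m ↔ i = k) := by
    intro i k p hp
    constructor
    · intro h
      rcases lt_trichotomy i k with h' | h' | h'
      · have := mul_add_le_of_lt (m := m) h'; omega
      · exact h'
      · have := mul_add_le_of_lt (m := m) h'; omega
    · rintro rfl; omega
  have hi' : ¬ i = k + 1 → ¬ (m * k + m ≤ m * i + p ∧ m * i + p < m * k + m + m) := by
    intro h; rw [← hk1, blk i (k + 1) p hp]; exact h
  have hj' : ¬ j = k → ¬ (m * k ≤ m * j + q ∧ m * j + q < m * k + m) := by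
    intro h; rw [blk j k q hq]; exact h
  have key : ∀ i j (p q : Fin m), D (m * i + p) (m * j + q) = M i j p q := hM
  have keyk : ∀ (x : ℕ) (q : Fin m), ∑ p ∈ Finset.range m, D x (m * k + p) * g ⟨.ev e, p, q⟩ =
      ∑ p : Fin m, D x (m * k + p) * g ⟨.ev e, p, q⟩ := fun x q => Finset.sum_range _
  have keyr : ∀ (y : ℕ) (p : Fin m), ∑ q ∈ Finset.range m, g ⟨.ev e, p, q⟩ * D (m * k + m + q) y =
      ∑ q : Fin m, g ⟨.ev e, p, q⟩ * D (m * k + m + q) y := fun x q => Finset.sum_range _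
  rw [rowOp, colOp, colOp, colOp]
  by_cases hjk : j = k
  · subst hjk
    simp only [if_true]
    rw [c1 _ q (hi' (by omega)) hq, cp i p hp, keyk, ← hk1]
    simp only [key]
    by_cases hik : i = j
    · subst hik
      simp [Matrix.mul_apply, multiData]
    · rw [Equiv.swap_apply_of_ne_of_ne hik (by omega), if_neg hik, if_neg (by omega)]
      simp [Matrix.mul_apply, multiData]
  · have col : ∀ i (p : Fin m), D (m * i + p) (m * (Equiv.swap k (k + 1) j) + q) =
        (if j = k + 1 then M i k else M i j) p q := by
      intro i p
      split_ifs with h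
      · subst h; rw [Equiv.swap_apply_right, key]
      · rw [Equiv.swap_apply_of_ne_of_ne hjk h, key]
    simp only [hjk, if_false]
    by_cases hik : i = k + 1
    · subst hik
      rw [hk1, c3 p _ hp (hj' hjk), cp j q hq, keyr, ← hk1]
      simp only [col, if_true, if_neg (show k + 1 ≠ k by omega)]
      split_ifs <;> rw [Matrix.sub_apply, smul_mul_assoc, Matrix.smul_apply, Matrix.mul_apply] <;> rfl
    · rw [c2 _ _ (hi' hik) (hj' hjk), cp i p hp, cp j q hq, col, if_neg hik]
      by_cases hik' : i = k
      · subst hik'; simp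
      · rw [Equiv.swap_apply_of_ne_of_ne hik' hik, if_neg hik']

theorem sweep_bases {D : ℕ → ℕ → B} (hD : ∀ i j, j ≤ i → D i j = 0) (e a P : ℕ) (i j : ℕ) :
    Λ.sweep g τ D ((List.range P).map fun p => Elem.base (a + p) e p) i j =
      (if a ≤ i ∧ i < a + P then Λ.markFactor τ e (i - a) else 1 : Bˣ) * D i j *
        ((if a ≤ j ∧ j < a + P then Λ.markFactor τ e (j - a) else 1 : Bˣ)⁻¹ : Bˣ) := by
  induction P generalizing i j with
  | zero =>
    rw [if_neg (by omega), if_neg (by omega)]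
    simp
  | succ P ih =>
    rw [List.range_succ, List.map_append, sweep_append, List.map_singleton, sweep_cons, sweep_nil]
    by_cases hij : i < j
    · have e1 : ∀ x, (if a ≤ x ∧ x < a + (P + 1) then Λ.markFactor τ e (x - a) else 1 : Bˣ) =
          (if x = a + P then Λ.markFactor τ e P else 1) *
            (if a ≤ x ∧ x < a + P then Λ.markFactor τ e (x - a) else 1) := by
        intro x
        split_ifs <;> first | omega | skip
        · subst_vars; simp
        · simp
        · simp
      rw [slide, if_pos hij, e1 i, e1 j]
      simp only [tip, upper, lower]
      by_cases h1 : i = a + P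
      · have h2 : j ≠ a + P := by omega
        simp [ih, h1, h2, mul_assoc]
      · by_cases h2 : j = a + P
        · simp [ih, h1, h2, mul_assoc]
        · simp [ih, h1, h2, mul_assoc]
    · rw [Λ.slide_of_le g τ _ _ (by omega), hD _ _ (by omega)]
      simp

theorem isBlocks_base {m k e : ℕ} (hev : Λ.event e = .base k) {D : ℕ → ℕ → B}
    (hD : ∀ i j, j ≤ i → D i j = 0) {M : ℕ → ℕ → Matrix (Fin m) (Fin m) B} (hM : IsBlocks D M) :
    IsBlocks (Λ.sweep g τ D (Λ.block m e)) (Λ.blockStep (Λ.multiData g τ m) e M) := by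
  have hb : Λ.block m e = (List.range m).map fun p => Elem.base (m * k + p) e p := by
    simp only [block, hev]
  intro i j p q
  have key : ∀ i (p : Fin m), (if m * k ≤ m * i + p ∧ m * i + p < m * k + m then
      Λ.markFactor τ e (m * i + p - m * k) else 1) = if i = k then Λ.markFactor τ e p else 1 := by
    intro i p
    have hp := p.2
    rcases lt_trichotomy i k with h' | h' | h'
    · have := mul_add_le_of_lt (m := m) h'
      rw [if_neg (by omega), if_neg (by omega)]
    · subst h'
      rw [if_pos (by omega), if_pos rfl, Nat.add_sub_cancel_left]
    · have := mul_add_le_of_lt (m := m) h'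
      rw [if_neg (by omega), if_neg (by omega)]
  have key2 : ∀ i, ((if i = k then (Λ.multiData g τ m).mark e else 1 :
      (Matrix (Fin m) (Fin m) B)ˣ)) = diagUnit m fun p => if i = k then Λ.markFactor τ e p else 1 := by
    intro i
    split_ifs
    · rfl
    · ext : 1; simp
  rw [hb, Λ.sweep_bases g τ hD]
  simp only [blockStep, hev, key2, coe_diagUnit, coe_diagUnit_inv]
  rw [key i p, key j q, hM i j p q, Matrix.mul_diagonal, Matrix.diagonal_mul]

theorem filter_range_reverse {m q : ℕ} (hq : q ≤ m) :
    ((List.range m).reverse.filter fun p => p < q) = (List.range q).reverse := by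
  rw [List.filter_reverse]
  congr 1
  obtain ⟨d, rfl⟩ := Nat.exists_eq_add_of_le hq
  rw [List.range_add, List.filter_append, List.filter_eq_self.2, List.filter_eq_nil_iff.2]
  · simp
  · intro x hx; simp at hx ⊢; omega
  · intro x hx; simp at hx ⊢; exact hx

theorem block_lcusp {m k e : ℕ} {v : ℤ} (hev : Λ.event e = .lcusp k v) : Λ.block m e =
    ((List.range m).map fun p => Elem.lcusp (m * k + 2 * p)) ++
      (List.range m).flatMap fun q => passList e q (m * k + q) q fun p => p := by
  simp only [block, hev, passList]
  congr 1
  rw [List.flatMap_def, List.flatMap_def]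
  congr 1
  apply List.map_congr_left
  intro q hq
  rw [filter_range_reverse (by simpa using (List.mem_range.1 hq).le)]

theorem isBlocks_lcusp {m k e : ℕ} {v : ℤ} (hev : Λ.event e = .lcusp k v) {D : ℕ → ℕ → B}
    (hD : ∀ i j, j ≤ i → D i j = 0) {M : ℕ → ℕ → Matrix (Fin m) (Fin m) B} (hM : IsBlocks D M)
    (hy : ∀ p q, q ≤ p → g ⟨.ev e, p, q⟩ = 0) :
    IsBlocks (Λ.sweep g τ D (Λ.block m e)) (Λ.blockStep (Λ.multiData g τ m) e M) := by
  intro i j p q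
  have hp := p.2
  have hq := q.2
  have hs : Λ.deg 0 (.ev e) = -1 := by simp [deg, hev]
  rw [Λ.block_lcusp hev, Λ.sweep_lcusp_passes g τ hD e m (m * k) m le_rfl hs hy]
  simp only [blockStep, hev]
  have pos : ∀ i p, p < m → (i < k ∧ m * i + p < m * k) ∨ (i = k) ∨ (i = k + 1) ∨
      (k + 2 ≤ i ∧ m * k + 2 * m ≤ m * i + p ∧ m * i + p - 2 * m = m * (i - 2) + p) := by
    intro i p hp
    rcases Nat.lt_or_ge i k with h | h
    · left; have := mul_add_le_of_lt (m := m) h; exact ⟨h, by omega⟩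
    · right
      rcases Nat.lt_or_ge i (k + 2) with h' | h'
      · omega
      · right; right
        obtain ⟨d, rfl⟩ := Nat.exists_eq_add_of_le h'
        have h1 : m * (k + 2 + d) = m * k + 2 * m + m * d := by ring
        have h2 : m * (k + 2 + d - 2) = m * k + m * d := by
          rw [show k + 2 + d - 2 = k + d by omega]; ring
        refine ⟨h', ?_, ?_⟩ <;> omega
  have hk1 : m * (k + 1) = m * k + m := Nat.mul_succ m k
  have key : ∀ i j (p q : Fin m), D (m * i + p) (m * j + q) = M i j p q := hM
  have hz : ∀ (p q : Fin m), (0 : Matrix (Fin m) (Fin m) B) p q = 0 := fun _ _ => rfl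
  rcases pos i p hp with ⟨h1, h2⟩ | h1 | h1 | ⟨h1, h2, h3⟩
  · rcases pos j q hq with ⟨h4, h5⟩ | h4 | h4 | ⟨h4, h5, h6⟩
    · rw [if_neg (by omega), if_neg (by omega), if_pos h2, if_pos h5, if_neg (by omega),
        if_neg (by omega), if_neg (by omega), if_pos h1, if_pos h4, key]
    · subst h4
      rw [if_neg (by omega), if_pos (by omega), if_neg (by omega), if_neg (by omega),
        if_pos (by omega), hz]
    · subst h4
      rw [if_neg (by omega), if_pos (by omega), if_neg (by omega), if_neg (by omega),
        if_pos (by omega), hz]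
    · rw [if_neg (by omega), if_neg (by omega), if_pos h2, if_neg (by omega), h6, if_neg (by omega),
        if_neg (by omega), if_neg (by omega), if_pos h1, if_neg (by omega), key]
  · subst h1
    rcases pos j q hq with ⟨h4, h5⟩ | h4 | h4 | ⟨h4, h5, h6⟩
    · rw [if_neg (by omega), if_pos (by omega), if_neg (by omega), if_neg (by omega),
        if_pos (by omega), hz]
    · subst h4
      rw [if_pos (by omega), if_neg (by omega), if_pos (by omega), Nat.add_sub_cancel_left,
        Nat.add_sub_cancel_left, cuspMatrix, if_pos ⟨hp, hq⟩]
      rfl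
    · subst h4
      rw [if_pos (by omega), if_pos (by omega), Nat.add_sub_cancel_left, hk1,
        show m * i + m + q - m * i = m + q by omega, cuspMatrix, if_neg (by omega),
        if_pos (by omega), Matrix.one_apply]
      simp only [Fin.ext_iff]
      split_ifs <;> first | omega | rfl
    · rw [if_neg (by omega), if_pos (by omega), if_neg (by omega), if_neg (by omega),
        if_pos (by omega), hz]
  · subst h1
    rcases pos j q hq with ⟨h4, h5⟩ | h4 | h4 | ⟨h4, h5, h6⟩
    · rw [if_neg (by omega), if_pos (by omega), if_neg (by omega), if_neg (by omega),
        if_pos (by omega), hz]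
    · subst h4
      rw [if_pos (by omega), if_neg (by omega), if_neg (by omega), if_pos (by omega),
        Nat.add_sub_cancel_left, hk1, cuspMatrix, if_neg (by omega), if_neg (by omega),
        if_neg (by omega), if_neg (by omega), hz]
    · subst h4
      rw [if_pos (by omega), if_neg (by omega), if_pos (by omega), hk1,
        show ∀ x, m * k + m + x - m * k = m + x by omega,
        show ∀ x, m * k + m + x - m * k = m + x by omega, cuspMatrix, if_neg (by omega),
        if_neg (by omega), if_pos (by omega), Nat.add_sub_cancel_left, Nat.add_sub_cancel_left]
      rfl
    · rw [if_neg (by omega), if_pos (by omega), if_neg (by omega), if_neg (by omega),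
        if_pos (by omega), hz]
  · rcases pos j q hq with ⟨h4, h5⟩ | h4 | h4 | ⟨h4, h5, h6⟩
    · rw [if_neg (by omega), if_neg (by omega), if_neg (by omega), if_pos h5, h3, if_neg (by omega),
        if_neg (by omega), if_neg (by omega), if_neg (by omega), if_pos h4, key]
    · subst h4
      rw [if_neg (by omega), if_pos (by omega), if_neg (by omega), if_neg (by omega),
        if_pos (by omega), hz]
    · subst h4
      rw [if_neg (by omega), if_pos (by omega), if_neg (by omega), if_neg (by omega),
        if_pos (by omega), hz]
    · rw [if_neg (by omega), if_neg (by omega), if_neg (by omega), if_neg (by omega), h3, h6,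
        if_neg (by omega), if_neg (by omega), if_neg (by omega), if_neg (by omega),
        if_neg (by omega), key]

theorem sweep_eq_of_strand_ge {a : ℕ} (l : List Elem)
    (hl : ∀ el ∈ l, a ≤ el.strand ∧ ∀ k, el ≠ .lcusp k) (D : ℕ → ℕ → B)
    (hD : ∀ i j, j ≤ i → D i j = 0) {i j : ℕ}
    (hi : i < a) (hj : j < a) : Λ.sweep g τ D l i j = D i j := by
  induction l generalizing D with
  | nil => rfl
  | cons el l ih =>
    rw [sweep_cons, ih (fun el' h => hl el' (by simp [h])) _ fun i j h => Λ.slide_of_le g τ _ _ h]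
    obtain ⟨h1, h2⟩ := hl el (by simp)
    by_cases hij : i < j
    · rw [slide, if_pos hij]
      cases el with
      | cross k e p q =>
        simp only [Elem.strand] at h1
        simp [tip, upper, lower, show i ≠ k by omega, show i ≠ k + 1 by omega,
          show j ≠ k by omega, show j ≠ k + 1 by omega]
      | base k e p =>
        simp only [Elem.strand] at h1
        simp [tip, upper, lower, show i ≠ k by omega, show j ≠ k by omega]
      | lcusp k => exact absurd rfl (h2 k)
      | rcusp k e p =>
        simp only [Elem.strand] at h1
        simp [tip, upper, lower, show i < k by omega, show j < k by omega]
    · rw [Λ.slide_of_le g τ _ _ (by omega), hD _ _ (by omega)]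

theorem isBlocks_rcusp {m e : ℕ} (hm : 0 < m) {b : Bool} (hev : Λ.event e = .rcusp b)
    {D : ℕ → ℕ → B} (hD : ∀ i j, j ≤ i → D i j = 0) {M : ℕ → ℕ → Matrix (Fin m) (Fin m) B}
    (hM : IsBlocks D M) :
    IsBlocks (Λ.sweep g τ D (Λ.block m e)) (Λ.blockStep (Λ.multiData g τ m) e M) := by
  intro i j p q
  have hp := p.2
  have hq := q.2
  simp only [blockStep, hev]
  set N := (Λ.slice e).n - 2 with hN
  have lt : ∀ i p, p < m → (m * i + p < m * N ↔ i < N) := by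
    intro i p hp
    constructor
    · intro h
      by_contra h'
      have := Nat.mul_le_mul_left m (not_lt.1 h')
      omega
    · intro h
      have := mul_add_le_of_lt (m := m) h
      omega
  obtain ⟨r, rfl⟩ : ∃ r, m = r + 1 := ⟨m - 1, by omega⟩
  obtain ⟨l, hl, hb⟩ : ∃ l : List Elem, (∀ el ∈ l, (r + 1) * N ≤ el.strand ∧ ∀ k, el ≠ .lcusp k) ∧
      Λ.block (r + 1) e = l ++ [.rcusp ((r + 1) * N) e 0] := by
    refine ⟨((List.range (r + 1)).flatMap fun q =>
        ((List.range (r + 1)).reverse.filter fun p => q < p).map fun p =>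
          Elem.cross ((r + 1) * N + q + p) e p q) ++
        (List.map Nat.succ (List.range r)).reverse.map fun p =>
          Elem.rcusp ((r + 1) * N + 2 * p) e p, And.symm ⟨?_, ?_⟩⟩
    · have hr : (List.range (r + 1)).reverse = (List.map Nat.succ (List.range r)).reverse ++ [0] := by
        rw [List.range_succ_eq_map, List.reverse_cons]
      simp only [block, hev]
      rw [List.append_assoc]
      congr 1
      rw [hr, List.map_append]
      rfl
    · intro el hel
      simp only [List.mem_append, List.mem_flatMap, List.mem_map] at hel
      rcases hel with ⟨x, _, y, _, rfl⟩ | ⟨x, _, rfl⟩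
      · simp only [Elem.strand]; exact ⟨by omega, by simp⟩
      · simp only [Elem.strand]; exact ⟨by omega, by simp⟩
  rw [hb, sweep_append, sweep_cons, sweep_nil]
  have hup := Λ.sweep_of_le g τ hD l
  have hlow := fun i j hi hj => Λ.sweep_eq_of_strand_ge g τ l hl D hD (i := i) (j := j) hi hj
  generalize Λ.sweep g τ D l = D1 at hup hlow ⊢
  by_cases hij : (r + 1) * i + p < (r + 1) * j + q
  · rw [slide, if_pos hij]
    simp only [tip, upper, lower, lt i p hp, lt j q hq]
    by_cases h : i < N ∧ j < N
    · rw [if_pos h.1, if_pos h.2, if_pos h]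
      simp only [List.map_cons, List.map_nil, List.sum_cons, List.sum_nil, one_mul, mul_one,
        add_zero, zero_add]
      rw [hlow _ _ ((lt i p hp).2 h.1) ((lt j q hq).2 h.2), hM]
    · rw [if_neg h]
      split_ifs <;> first | exact absurd ⟨‹_›, ‹_›⟩ h | simp
  · rw [Λ.slide_of_le g τ _ _ (by omega)]
    split_ifs with h
    · rw [← hM, hD _ _ (by omega)]
    · rfl

theorem isBlocks_border {m : ℕ}  :
    IsBlocks (border g m) (Λ.multiData g τ m).line := by
  intro i j p q
  have hm : 0 < m := p.pos
  simp [border, multiData, Nat.mul_add_div hm, Nat.div_eq_of_lt, Nat.mod_eq_of_lt]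

variable {g} in
theorem border_of_le {m : ℕ} (hline : ∀ i j p q, j < i ∨ (i = j ∧ q ≤ p) → g ⟨.line i j, p, q⟩ = 0)
    {i j : ℕ} (h : j ≤ i) : border g m i j = 0 := by
  apply hline
  rcases (Nat.div_le_div_right (c := m) h).lt_or_eq with h' | h'
  · exact Or.inl h'
  · right
    refine ⟨h'.symm, ?_⟩
    have h1 := Nat.div_add_mod i m
    have h2 := Nat.div_add_mod j m
    rw [h'] at h2
    omega

/-- The disks of the multicopy, in terms of blocks. -/
theorem isBlocks_sweep {m s e : ℕ} (hm : 0 < m) (he : s ≤ e)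
    (hline : ∀ i j p q, j < i ∨ (i = j ∧ q ≤ p) → g ⟨.line i j, p, q⟩ = 0)
    (hcusp : ∀ e k v, Λ.event e = .lcusp k v → ∀ p q, q ≤ p → g ⟨.ev e, p, q⟩ = 0) :
    IsBlocks (Λ.sweep g τ (border g m) (Λ.elems m s e))
      (Λ.blockDisks (Λ.multiData g τ m) s e) := by
  have hb := fun i j h => border_of_le (g := g) (m := m) hline (i := i) (j := j) h
  induction e, he using Nat.le_induction with
  | base =>
    rw [Λ.blockDisks_of_le _ le_rfl]
    simpa [elems] using Λ.isBlocks_border g τ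
  | succ e he ih =>
    rw [Λ.blockDisks_succ _ he, Λ.sweep_succ _ _ _ he]
    have hup := Λ.sweep_of_le g τ hb (Λ.elems m s e)
    rcases hE : Λ.event e with k | k | ⟨k, v⟩ | b
    · exact Λ.isBlocks_cross g τ hE hup ih
    · exact Λ.isBlocks_base g τ hE hup ih
    · exact Λ.isBlocks_lcusp g τ hE hup ih (hcusp e k v hE)
    · exact Λ.isBlocks_rcusp g τ hm hE hup ih

end MultiCopy

end Front


namespace Front

variable (Λ : Front)

section MultiCopy

variable {B : Type*} [Ring B] (g : Letter → B) (τ : ℕ → ℕ → Bˣ)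

/-! ### The differential in terms of blocks -/

theorem chordDisks_eq {s m e p q : ℕ} {l : List Elem} {k : ℕ}
    (hb : Λ.block m e = l ++ [.cross k e p q]) (hl : ∀ el ∈ l, el.Names e p q = false) :
    Λ.chordDisks g τ s m e p q = Λ.sweep g τ (Λ.sweep g τ (border g m) (Λ.elems m s e)) l
      k (k + 1) := by
  have h1 : (Λ.block m e).find? (fun el => el.Names e p q) = some (.cross k e p q) := by
    rw [hb, List.find?_append, List.find?_eq_none.2 (by simpa using hl)]
    simp [Elem.Names]
  have h2 : (Λ.block m e).takeWhile (fun el => !el.Names e p q) = l := by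
    rw [hb, List.takeWhile_append_of_pos (by simpa using hl)]
    simp [Elem.Names]
  rw [chordDisks, h1]
  simp only [h2, sweep_append, Elem.strand, add_zero]

theorem names_cross (k e p q p' q' : ℕ) :
    (Elem.cross k e p q).Names e p' q' = false ↔ ¬ (p = p' ∧ q = q') := by
  simp [Elem.Names]

theorem passList_last (e q a r : ℕ) (P : ℕ → ℕ) : passList e q a (r + 1) P =
    passList e q (a + 1) r (fun p => P (p + 1)) ++ [.cross a e (P 0) q] := by
  rw [passList, List.range_succ_eq_map, List.reverse_cons, List.map_append, List.map_reverse,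
    List.map_map, passList, List.map_reverse]
  congr 2
  apply List.map_congr_left
  intro p _
  simp only [Function.comp_apply, Nat.succ_eq_add_one]
  congr 1
  omega

theorem mem_passList {e q a r : ℕ} {P : ℕ → ℕ} {el : Elem} :
    el ∈ passList e q a r P ↔ ∃ p < r, el = .cross (a + p) e (P p) q := by
  simp only [passList, List.mem_map, List.mem_reverse, List.mem_range]
  constructor
  · rintro ⟨p, hp, rfl⟩; exact ⟨p, hp, rfl⟩
  · rintro ⟨p, hp, rfl⟩; exact ⟨p, hp, rfl⟩

theorem chordDisks_multi_cross {s e k L : ℕ} (he : s ≤ e) (hev : Λ.event e = .cross k)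
    (hline : ∀ i j p q, j < i ∨ (i = j ∧ q ≤ p) → g ⟨.line i j, p, q⟩ = 0)
    (hcusp : ∀ e k v, Λ.event e = .lcusp k v → ∀ p q, q ≤ p → g ⟨.ev e, p, q⟩ = 0) :
    Λ.chordDisks g τ s (L + 1) e 0 L =
      Λ.blockDiff (Λ.multiData g τ (L + 1)) s (.ev e) 0 (Fin.last L) := by
  have hM := Λ.isBlocks_sweep g τ (m := L + 1) (by omega) he hline hcusp
  have hb := fun i j h => border_of_le (g := g) (m := L + 1) hline (i := i) (j := j) h
  have hup := Λ.sweep_of_le g τ hb (Λ.elems (L + 1) s e)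
  have hbl : Λ.block (L + 1) e = (((List.range L).flatMap fun q =>
      passList e q ((L + 1) * k + q) (L + 1) fun p => p) ++
      passList e L ((L + 1) * k + L + 1) L fun p => p + 1) ++ [.cross ((L + 1) * k + L) e 0 L] := by
    rw [List.append_assoc, ← passList_last e L ((L + 1) * k + L) L fun p => p]
    simp only [block, hev, List.range_succ (n := L), List.flatMap_append, List.flatMap_singleton,
      passList]
  rw [Λ.chordDisks_eq g τ hbl, sweep_append, Λ.sweep_cross_penultimate g τ hup]
  · simp only [blockDiff, hev]
    have key : ∀ i j (p q : Fin (L + 1)), Λ.sweep g τ (border g (L + 1)) (Λ.elems (L + 1) s e)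
      ((L + 1) * i + p) ((L + 1) * j + q) = _ := hM
    have k1 : (L + 1) * k + (L + 1) = (L + 1) * (k + 1) := (Nat.mul_succ _ k).symm
    have key1 : ∀ j (q : Fin (L + 1)), Λ.sweep g τ (border g (L + 1)) (Λ.elems (L + 1) s e)
        ((L + 1) * k) ((L + 1) * j + q) = Λ.blockDisks (Λ.multiData g τ (L + 1)) s e k j 0 q :=
      fun j q => key k j 0 q
    have key2 : ∀ i (p : Fin (L + 1)), Λ.sweep g τ (border g (L + 1)) (Λ.elems (L + 1) s e)
        ((L + 1) * i + p) ((L + 1) * (k + 1) + L) =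
          Λ.blockDisks (Λ.multiData g τ (L + 1)) s e i (k + 1) p (Fin.last L) :=
      fun i p => key i (k + 1) p (Fin.last L)
    rw [Finset.sum_range, Finset.sum_range, k1]
    simp only [key1, key2]
    rw [Matrix.sub_apply, Matrix.add_apply, Matrix.smul_apply, Matrix.mul_apply, Matrix.mul_apply]
    congr 2
    exact key1 (k + 1) (Fin.last L)
  · intro el hel
    simp only [List.mem_append, List.mem_flatMap, mem_passList, List.mem_range] at hel
    rcases hel with ⟨q, hq, p, hp, rfl⟩ | ⟨p, hp, rfl⟩
    · rw [names_cross]; omega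
    · rw [names_cross]; omega

theorem chordDisks_multi_lcusp {s e k L : ℕ} {v : ℤ} (he : s ≤ e) (hL : 0 < L)
    (hev : Λ.event e = .lcusp k v)
    (hline : ∀ i j p q, j < i ∨ (i = j ∧ q ≤ p) → g ⟨.line i j, p, q⟩ = 0)
    (hcusp : ∀ p q, q ≤ p → g ⟨.ev e, p, q⟩ = 0) :
    Λ.chordDisks g τ s (L + 1) e 0 L =
      Λ.blockDiff (Λ.multiData g τ (L + 1)) s (.ev e) 0 (Fin.last L) := by
  have hb := fun i j h => border_of_le (g := g) (m := L + 1) hline (i := i) (j := j) h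
  have hup := Λ.sweep_of_le g τ hb (Λ.elems (L + 1) s e)
  obtain ⟨r, rfl⟩ : ∃ r, L = r + 1 := ⟨L - 1, by omega⟩
  have hs : Λ.deg 0 (.ev e) = -1 := by simp [deg, hev]
  set a := (r + 1 + 1) * k with ha
  have hbl : Λ.block (r + 1 + 1) e = (((List.range (r + 1 + 1)).map fun p => Elem.lcusp (a + 2 * p)) ++
      ((List.range (r + 1)).flatMap fun q => passList e q (a + q) q fun p => p) ++
      passList e (r + 1) (a + (r + 1) + 1) r fun p => p + 1) ++ [.cross (a + (r + 1)) e 0 (r + 1)] := by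
    rw [List.append_assoc _ (passList _ _ _ _ _),
      ← passList_last e (r + 1) (a + (r + 1)) r fun p => p, Λ.block_lcusp hev, ← ha,
      List.append_assoc, List.range_succ (n := r + 1), List.flatMap_append, List.flatMap_singleton]
  rw [Λ.chordDisks_eq g τ hbl, sweep_append]
  · have h1 := Λ.sweep_lcusp_passes g τ hup e (r + 1 + 1) a (r + 1) (by omega) hs hcusp
    have up1 := Λ.sweep_of_le g τ hup (((List.range (r + 1 + 1)).map fun p => Elem.lcusp (a + 2 * p)) ++
      (List.range (r + 1)).flatMap fun q => passList e q (a + q) q fun p => p)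
    generalize Λ.sweep g τ (Λ.sweep g τ (border g (r + 1 + 1)) (Λ.elems (r + 1 + 1) s e)) _ = D1
      at h1 up1 ⊢
    rw [(Λ.sweep_pass g τ up1 e (r + 1) (a + (r + 1) + 1) r fun p => p + 1).1 _ (by omega)]
    have p1 : passPos (a + (r + 1) + 1) r (a + (r + 1)) = a + (r + 1) := by
      simp only [passPos]; split_ifs <;> omega
    have e1 : D1 (a + (r + 1)) (a + (r + 1) + 1 + r) = 0 := by
      rw [h1, if_pos (by omega), cuspMatrix]
      split_ifs <;> first | omega | rfl
    have e2 : ∀ p ∈ Finset.range r, D1 (a + (r + 1)) (a + (r + 1) + 1 + p) *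
        g ⟨.ev e, p + 1, r + 1⟩ = g ⟨.ev e, 0, p + 1⟩ * g ⟨.ev e, p + 1, r + 1⟩ := by
      intro p hp
      simp at hp
      rw [h1, if_pos (by omega), cuspMatrix, if_neg (by omega), if_neg (by omega), if_pos (by omega)]
      congr 3 <;> omega
    rw [p1, e1, zero_add, Finset.sum_congr rfl e2]
    simp only [blockDiff, hev]
    rw [Matrix.mul_apply]
    have e3 : ∀ q : Fin (r + 1 + 1), (Λ.multiData g τ (r + 1 + 1)).ev e 0 q *
        (Λ.multiData g τ (r + 1 + 1)).ev e q (Fin.last (r + 1)) =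
        g ⟨.ev e, 0, q⟩ * g ⟨.ev e, q, r + 1⟩ := fun _ => rfl
    simp only [e3]
    rw [← Finset.sum_range fun q => g ⟨.ev e, 0, q⟩ * g ⟨.ev e, q, r + 1⟩, Finset.sum_range_succ,
      Finset.sum_range_succ', hcusp 0 0 le_rfl, hcusp (r + 1) (r + 1) le_rfl]
    simp
  · intro el hel
    simp only [List.mem_append, List.mem_flatMap, mem_passList, List.mem_range, List.mem_map] at hel
    rcases hel with (⟨p, _, rfl⟩ | ⟨q, hq, p, hp, rfl⟩) | ⟨p, hp, rfl⟩
    · rfl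
    · rw [names_cross]; omega
    · rw [names_cross]; omega

end MultiCopy

theorem sum_range_mul {B : Type*} [AddCommMonoid B] (m n : ℕ) (f : ℕ → B) :
    ∑ c ∈ Finset.range (m * n), f c =
      ∑ l ∈ Finset.range n, ∑ r ∈ Finset.range m, f (m * l + r) := by
  induction n with
  | zero => simp
  | succ n ih => rw [Nat.mul_succ, Finset.sum_range_add, ih, Finset.sum_range_succ]

variable {Λ} {s t m : ℕ}

theorem gen_line_eq_zero {i j p q : ℕ} (h : j < i ∨ (i = j ∧ q ≤ p)) :
    Λ.gen s t m ⟨.line i j, p, q⟩ = 0 := by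
  apply Λ.gen_eq_zero
  simp only [IsReeb]
  omega

theorem gen_lcusp_eq_zero {e k : ℕ} {v : ℤ} (hev : Λ.event e = .lcusp k v) {p q : ℕ} (h : q ≤ p) :
    Λ.gen s t m ⟨.ev e, p, q⟩ = 0 := by
  apply Λ.gen_eq_zero
  simp only [IsReeb, hev]
  omega

variable (Λ)

/-- The differential of a chord from the first to the last copy, in terms of blocks. -/
theorem dgen_eq_blockDiff {c : Chord} {L : ℕ} (hc : Λ.IsReeb s t 2 ⟨c, 0, 1⟩) (hL : 0 < L) :
    Λ.dgen s t (L + 1) ⟨c, 0, L⟩ =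
      Λ.blockDiff (Λ.multiData (Λ.gen s t (L + 1)) (Λ.tgen s t (L + 1)) (L + 1)) s c 0
        (Fin.last L) := by
  cases c with
  | ev e =>
    simp only [dgen]
    have hc' := hc
    simp only [IsReeb] at hc'
    rcases hE : Λ.event e with k | k | ⟨k, v⟩ | b
    · exact Λ.chordDisks_multi_cross _ _ hc'.2.2.1 hE (fun _ _ _ _ h => gen_line_eq_zero h)
        fun _ _ _ h _ _ h' => gen_lcusp_eq_zero h h'
    · simp [hE] at hc'
    · exact Λ.chordDisks_multi_lcusp _ _ hc'.2.2.1 hL hE (fun _ _ _ _ h => gen_line_eq_zero h)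
        fun _ _ h' => gen_lcusp_eq_zero hE h'
    · simp [hE] at hc'
  | line i j =>
    have hm : 0 < L + 1 := by omega
    simp only [dgen, blockDiff, Nat.add_zero]
    rw [Finset.sum_subset (s₂ := Finset.range ((L + 1) * (j + 1)))]
    · rw [sum_range_mul, Matrix.neg_apply, Matrix.sum_apply, ← Finset.sum_neg_distrib]
      refine Finset.sum_congr rfl fun l _ => ?_
      rw [Matrix.smul_apply, Matrix.mul_apply, Finset.smul_sum, ← Finset.sum_neg_distrib,
        Finset.sum_range]
      refine Finset.sum_congr rfl fun r _ => ?_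
      rw [Nat.mul_add_div hm, Nat.div_eq_of_lt r.2, Nat.mul_add_mod, Nat.mod_eq_of_lt r.2, sgn_add,
        sgn_one, mul_neg_one, neg_smul]
      simp only [Nat.add_zero]
      rfl
    · intro c hc
      simp only [Finset.mem_Ioo, Finset.mem_range, Nat.mul_succ] at hc ⊢
      omega
    · intro c hc hc'
      simp only [Finset.mem_Ioo, Finset.mem_range, not_and, not_lt] at hc hc'
      have h1 := Nat.div_add_mod c (L + 1)
      have h2 := Nat.mod_lt c hm
      by_cases h : (L + 1) * i < c
      · have h3 := hc' h
        have h4 : c / (L + 1) ≤ j := by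
          rw [← Nat.lt_succ_iff, Nat.div_lt_iff_lt_mul hm, Nat.mul_comm]; exact hc
        have h5 : j ≤ c / (L + 1) := by
          rw [Nat.le_div_iff_mul_le hm, Nat.mul_comm]; omega
        have h6 : c / (L + 1) = j := le_antisymm h4 h5
        rw [h6] at h1 ⊢
        rw [gen_line_eq_zero (i := j) (j := j) (Or.inr ⟨rfl, by omega⟩), mul_zero, smul_zero]
      · have h4 : c / (L + 1) ≤ i := by
          rw [← Nat.lt_succ_iff, Nat.div_lt_iff_lt_mul hm, Nat.mul_comm, Nat.mul_succ]; omega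
        rcases h4.lt_or_eq with h5 | h5
        · rw [gen_line_eq_zero (i := i) (Or.inl h5), zero_mul, smul_zero]
        · rw [h5] at h1 ⊢
          rw [gen_line_eq_zero (i := i) (j := i) (Or.inr ⟨rfl, by omega⟩), zero_mul, smul_zero]

end Front


namespace AInf

/-! ## Evaluation of cochains on consecutive substrings -/

namespace Str

variable {O : Type u} {H : O → O → Type u} {K : Type v}

/-- The value on the string with the first `p` morphisms removed. -/
def dropVal : {x y : O} → (s : Str H x y) → (∀ w, Str H w y → K) → ℕ → K
  | x, _, nil _, ψ, _ => ψ x (nil x)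
  | _, _, cons f s, ψ, p =>
      if p ≤ length s then dropVal s (fun w u => ψ w (cons f u)) p else ψ _ (nil _)

/-- The value of a cochain on the substring from the object `p` to the object `q`. -/
def subVal : {x y : O} → (s : Str H x y) → Coch H K → ℕ → ℕ → K
  | x, _, nil _, φ, _, _ => φ.val (nil x)
  | _, _, cons f s, φ, p, q =>
      if q ≤ length s then subVal s φ p q else dropVal (cons f s) (fun _ u => φ.val u) p

variable {x y z w : O}

@[simp] theorem dropVal_nil (ψ : ∀ w, Str H w x → K) (p : ℕ) : dropVal (nil x) ψ p = ψ x (nil x) := by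
  rw [dropVal]

theorem dropVal_cons (f : H y z) (s : Str H x y) (ψ : ∀ w, Str H w z → K) (p : ℕ) :
    dropVal (cons f s) ψ p =
      if p ≤ length s then dropVal s (fun w u => ψ w (cons f u)) p else ψ _ (nil _) := by
  rw [dropVal]

@[simp] theorem subVal_nil (φ : Coch H K) (p q : ℕ) : subVal (nil x) φ p q = φ.val (nil x) := by
  rw [subVal]

theorem subVal_cons (f : H y z) (s : Str H x y) (φ : Coch H K) (p q : ℕ) :
    subVal (cons f s) φ p q =
      if q ≤ length s then subVal s φ p q else dropVal (cons f s) (fun _ u => φ.val u) p := by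
  rw [subVal]

theorem dropVal_zero (s : Str H x y) (ψ : ∀ w, Str H w y → K) : dropVal s ψ 0 = ψ x s := by
  induction s with
  | nil => simp
  | cons f s ih => rw [dropVal_cons, if_pos (by omega), ih]

theorem dropVal_length (s : Str H x y) (ψ : ∀ w, Str H w y → K) {p : ℕ} (hp : s.length ≤ p) :
    dropVal s ψ p = ψ y (nil y) := by
  cases s with
  | nil => simp
  | cons f s => rw [dropVal_cons, if_neg (by simp at hp; omega)]

theorem subVal_length (s : Str H x y) (φ : Coch H K) (p : ℕ) :
    subVal s φ p s.length = dropVal s (fun _ u => φ.val u) p := by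
  cases s with
  | nil => simp
  | cons f s => rw [subVal_cons, if_neg (by simp)]

theorem dropVal_add [AddCommMonoid K] (s : Str H x y) (ψ χ : ∀ w, Str H w y → K) (p : ℕ) :
    dropVal s (fun w u => ψ w u + χ w u) p = dropVal s ψ p + dropVal s χ p := by
  induction s with
  | nil => simp
  | cons f s ih =>
    simp only [dropVal_cons]
    split_ifs
    · exact ih _ _
    · rfl

theorem dropVal_mul_right [Mul K] (s : Str H x y) (ψ : ∀ w, Str H w y → K) (a : K) (p : ℕ) :
    dropVal s (fun w u => ψ w u * a) p = dropVal s ψ p * a := by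
  induction s with
  | nil => simp
  | cons f s ih =>
    simp only [dropVal_cons]
    split_ifs
    · exact ih _
    · rfl

theorem dropVal_eq_zero [Zero K] (s : Str H x y) (n : ℕ) (ψ : ∀ w, Str H w y → K)
    (hψ : ∀ w (u : Str H w y), n ≤ u.length → ψ w u = 0) {p : ℕ} (hp : p + n ≤ s.length) :
    dropVal s ψ p = 0 := by
  induction s generalizing n with
  | nil => rw [dropVal_nil]; exact hψ _ _ (by simp at hp ⊢; omega)
  | cons f s ih =>
    rw [dropVal_cons]
    simp only [length_cons] at hp
    split_ifs with h
    · refine ih (n - 1) _ (fun w u hu => hψ _ _ ?_) ?_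
      · simp only [length_cons]; omega
      · omega
    · exact hψ _ _ (by simp; omega)

theorem dropVal_mul [Ring K] (s : Str H x y) (φ : Coch H K) (ψ : ∀ w, Str H w y → K) {p : ℕ}
    (hp : p ≤ s.length) :
    dropVal s (fun _ r => splitSum r fun w u v => φ.val v * ψ w u) p =
      ∑ r ∈ Finset.Icc p s.length, subVal s φ p r * dropVal s ψ r := by
  induction s with
  | nil =>
    simp only [length_nil, Nat.le_zero] at hp
    subst hp
    simp
  | cons f s ih =>
    simp only [length_cons] at hp ⊢
    rw [← Finset.insert_Icc_right_eq_Icc_add_one hp, Finset.sum_insert (by simp),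
      dropVal_cons, subVal_cons, if_neg (show ¬ s.length + 1 ≤ s.length by omega), dropVal_cons,
      dropVal_length (cons f s) ψ (by simp)]
    split_ifs with h
    · simp only [splitSum_cons]
      rw [dropVal_add, dropVal_mul_right, ih _ h]
      congr 1
      refine Finset.sum_congr rfl fun r hr => ?_
      simp only [Finset.mem_Icc] at hr
      rw [subVal_cons, if_pos hr.2, dropVal_cons, if_pos hr.2]
    · rw [Finset.Icc_eq_empty (by omega)]
      simp

theorem subVal_mul [Ring K] (s : Str H x y) (φ ψ : Coch H K) {p q : ℕ} (hpq : p ≤ q)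
    (hq : q ≤ s.length) :
    subVal s (φ * ψ) p q = ∑ r ∈ Finset.Icc p q, subVal s φ p r * subVal s ψ r q := by
  induction s with
  | nil =>
    simp only [length_nil, Nat.le_zero] at hq
    subst hq
    simp only [Nat.le_zero] at hpq
    subst hpq
    simp
  | cons f s ih =>
    rw [subVal_cons]
    split_ifs with h
    · rw [ih h]
      refine Finset.sum_congr rfl fun r hr => ?_
      simp only [Finset.mem_Icc] at hr
      rw [subVal_cons, if_pos (hr.2.trans h), subVal_cons, if_pos h]
    · have hq' : q = (cons f s).length := by simp only [length_cons] at hq ⊢; omega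
      subst hq'
      simp only [Coch.mul_val]
      rw [dropVal_mul _ _ _ hpq]
      refine Finset.sum_congr rfl fun r hr => ?_
      rw [subVal_length]

theorem subVal_one [Ring K] (s : Str H x y) {p q : ℕ} (hpq : p ≤ q) (hq : q ≤ s.length) :
    subVal s (1 : Coch H K) p q = if p = q then 1 else 0 := by
  induction s with
  | nil =>
    simp only [length_nil, Nat.le_zero] at hq
    subst hq
    simp only [Nat.le_zero] at hpq
    simp [hpq]
  | cons f s ih =>
    rw [subVal_cons]
    split_ifs with h h' h'
    · rw [ih h, if_pos h']
    · rw [ih h, if_neg h']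
    · rw [dropVal_length _ _ (by simp; omega)]; rfl
    · simp only [length_cons] at hq
      refine dropVal_eq_zero _ 1 _ (fun w u hu => ?_) (by simp; omega)
      cases u with
      | nil => simp at hu
      | cons g u => rfl

theorem subVal_add [Ring K] (s : Str H x y) (φ ψ : Coch H K) (p q : ℕ) :
    subVal s (φ + ψ) p q = subVal s φ p q + subVal s ψ p q := by
  induction s with
  | nil => simp
  | cons f s ih =>
    simp only [subVal_cons]
    split_ifs
    · exact ih
    · simp only [Coch.add_val]; exact dropVal_add _ _ _ _

theorem subVal_self (s : Str H x y) (φ : Coch H K) (p : ℕ) :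
    subVal s φ p p = φ.val (nil (s.objAt p)) := by
  induction s with
  | nil => rw [subVal_nil, objAt]
  | cons f s ih =>
    rw [subVal_cons, objAt]
    by_cases h : p ≤ s.length
    · rw [if_pos h, if_pos h]; exact ih
    · rw [if_neg h, if_neg h, dropVal_cons, if_neg h]

theorem subVal_zero_length (s : Str H x y) (φ : Coch H K) : subVal s φ 0 s.length = φ.val s := by
  rw [subVal_length, dropVal_zero]

theorem subVal_eq_zero [Ring K] (s : Str H x y) (n : ℕ) {φ : Coch H K}
    (hφ : ∀ {x y : O} (u : Str H x y), n ≤ u.length → φ.val u = 0) {p q : ℕ} (hpq : p + n ≤ q)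
    (hq : q ≤ s.length) : subVal s φ p q = 0 := by
  induction s with
  | nil => rw [subVal_nil]; exact hφ _ (by simp at hq ⊢; omega)
  | cons f s ih =>
    rw [subVal_cons]
    split_ifs with h
    · exact ih h
    · exact dropVal_eq_zero _ n _ (fun w u hu => hφ u hu) (by omega)

theorem length_vals {V : Type u} {x y : O} (s : Str (fun _ _ : O => V) x y) :
    s.vals.length = s.length := by
  induction s with
  | nil => rw [vals]; simp
  | cons f s ih => rw [vals]; simp [ih]

theorem subVal_succ {V : Type u} (d : V) {x y : O} (s : Str (fun _ _ : O => V) x y)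
    {φ : Coch (fun _ _ : O => V) K} {a : V → K} (hφ : ∀ x y (f : V), φ.val (single (x := x) (y := y) f) = a f)
    {p : ℕ} (hp : p < s.length) : subVal s φ p (p + 1) = a (s.vals.getD p d) := by
  induction s with
  | nil => simp at hp
  | cons f s ih =>
    rw [subVal_cons, vals]
    split_ifs with h
    · rw [ih h, List.getD_append _ _ _ _ (by rw [length_vals]; exact h)]
    · have : p = s.length := by simp only [length_cons] at hp; omega
      subst this
      rw [dropVal_cons, if_pos le_rfl, dropVal_length _ _ le_rfl,
        List.getD_append_right _ _ _ _ (by rw [length_vals]), length_vals, Nat.sub_self]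
      exact hφ _ _ f

end Str

namespace Coch

open Str

variable {O : Type u} {H : O → O → Type u} {K : Type v} [CommRing K] {x y : O}

/-- The placement of a scalar at an entry on or above the diagonal: on the diagonal, it becomes a scalar
matrix. -/
def place (m : ℕ) (p q : Fin m) (a : K) : Matrix (Fin m) (Fin m) K :=
  if p = q then Matrix.scalar _ a else if p < q then Matrix.single p q a else 0

theorem place_add (m : ℕ) (p q : Fin m) (a b : K) :
    place m p q (a + b) = place m p q a + place m p q b := by
  unfold place
  split_ifs
  · simp
  · simp [Matrix.single_add]
  · simp

theorem place_zero (m : ℕ) (p q : Fin m) : place m p q (0 : K) = 0 := by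
  simpa using place_add m p q (0 : K) 0

theorem place_mul {m : ℕ} {p r q : Fin m} (h : p ≤ r) (h' : r ≤ q) (a b : K) :
    place m p r a * place m r q b = place m p q (a * b) := by
  unfold place
  rcases h.lt_or_eq with h1 | h1
  · rcases h'.lt_or_eq with h2 | h2
    · rw [if_neg h1.ne, if_pos h1, if_neg h2.ne, if_pos h2, if_neg (h1.trans h2).ne,
        if_pos (h1.trans h2), Matrix.single_mul_single_same]
    · subst h2
      rw [if_neg h1.ne, if_pos h1, if_pos rfl, if_neg h1.ne, if_pos h1, ← (Matrix.scalar_commute b (Commute.all b) _).eq]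
      simp [Matrix.scalar_apply, ← Matrix.smul_eq_diagonal_mul, Matrix.smul_single, mul_comm]
  · subst h1
    rcases h'.lt_or_eq with h2 | h2
    · rw [if_pos rfl, if_neg h2.ne, if_pos h2, if_neg h2.ne, if_pos h2]
      simp [Matrix.scalar_apply, ← Matrix.smul_eq_diagonal_mul, Matrix.smul_single]
    · subst h2
      simp

theorem place_of_lt {m : ℕ} {p q : Fin m} (h : q < p) (a : K) : place m p q a = 0 := by
  rw [place, if_neg h.ne', if_neg h.not_gt]

/-- The matrix of the values of a cochain on all consecutive substrings of a string. -/
def subHom (s : Str H x y) : Coch H K →+*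
    Matrix (Fin (s.length + 1)) (Fin (s.length + 1)) (Matrix (Fin (s.length + 1)) (Fin (s.length + 1)) K) where
  toFun φ := Matrix.of fun p q => place _ p q (s.subVal φ p q)
  map_zero' := by
    ext p q : 2
    have h : s.subVal (0 : Coch H K) p q = 0 := by
      have := s.subVal_add (0 : Coch H K) 0 p q
      simpa using this
    rw [Matrix.of_apply, h, place_zero]; rfl
  map_one' := by
    ext p q : 2
    rw [Matrix.of_apply]
    rcases lt_trichotomy p q with h | h | h
    · rw [s.subVal_one (Fin.le_def.1 h.le) (by omega), if_neg (by have := Fin.lt_def.1 h; omega),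
        place_zero, Matrix.one_apply_ne h.ne]
    · subst h
      rw [s.subVal_one le_rfl (by omega), if_pos rfl, place, if_pos rfl, Matrix.one_apply_eq, map_one]
    · rw [place_of_lt h, Matrix.one_apply_ne h.ne']
  map_add' φ ψ := by
    ext p q : 2
    simp only [Matrix.of_apply, Matrix.add_apply, s.subVal_add, place_add]
  map_mul' φ ψ := by
    ext p q : 2
    rw [Matrix.mul_apply]
    simp only [Matrix.of_apply]
    by_cases h : q < p
    · rw [place_of_lt h]
      rw [Finset.sum_eq_zero]
      intro r _
      rcases lt_or_ge r p with h1 | h1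
      · rw [place_of_lt h1, zero_mul]
      · rw [place_of_lt (h.trans_le h1), mul_zero]
    · rw [not_lt] at h
      rw [s.subVal_mul _ _ (Fin.le_def.1 h) (by omega), ← Finset.sum_subset (Finset.subset_univ (Finset.Icc p q))]
      · have hs : ∀ F : ℕ → K, place (s.length + 1) p q (∑ r ∈ Finset.Icc (p : ℕ) q, F r) =
            ∑ r ∈ Finset.Icc (p : ℕ) q, place (s.length + 1) p q (F r) := fun F =>
          map_sum (⟨⟨place (s.length + 1) p q, place_zero _ _ _⟩, place_add _ _ _⟩ :
            K →+ Matrix (Fin (s.length + 1)) (Fin (s.length + 1)) K) F (Finset.Icc (p : ℕ) q)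
        rw [hs, ← Fin.map_valEmbedding_Icc, Finset.sum_map]
        refine congrFun (congrFun (Finset.sum_congr rfl fun r hr => ?_) _) _
        rw [Finset.mem_Icc] at hr
        exact (place_mul hr.1 hr.2 _ _).symm
      · intro r _ hr
        rw [Finset.mem_Icc, not_and_or, not_le, not_le] at hr
        rcases hr with h1 | h1
        · rw [place_of_lt h1, zero_mul]
        · rw [place_of_lt h1, mul_zero]

theorem subHom_apply (s : Str H x y) (φ : Coch H K) (p q : Fin (s.length + 1)) :
    subHom s φ p q = place _ p q (s.subVal φ p q) := rfl

theorem subHom_corner (s : Str H x y) (hs : 0 < s.length) (φ : Coch H K) :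
    subHom s φ 0 (Fin.last _) 0 (Fin.last _) = φ.val s := by
  have h : (0 : Fin (s.length + 1)) < Fin.last _ := by rw [Fin.lt_def]; simpa using hs
  rw [subHom_apply, place, if_neg h.ne, if_pos h]
  simp [s.subVal_zero_length]

end Coch

end AInf


namespace Front

variable (Λ : Front)

/-! ## The sign of the reversal of a word -/

/-- `(-1)^{d (d - 1) / 2}`, as an integer. -/
def sig (d : ℤ) : ℤ := sgn (d * (d - 1) / 2)

theorem sig_mul_self (d : ℤ) : sig d * sig d = 1 := sgn_mul_self _

@[simp] theorem sig_zero : sig 0 = 1 := by simp [sig]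

@[simp] theorem sig_neg_one : sig (-1) = -1 := by
  rw [sig, show (-1 : ℤ) * (-1 - 1) / 2 = 1 from rfl, sgn_one]

theorem sig_add (a b : ℤ) : sig (a + b) = sig a * sig b * sgn (a * b) := by
  rw [sig, sig, sig, ← sgn_add, ← sgn_add]
  congr 1
  have h : ∀ d : ℤ, 2 ∣ d * (d - 1) := fun d => (Int.even_mul_pred_self d).two_dvd
  obtain ⟨x, hx⟩ := h a
  obtain ⟨y, hy⟩ := h b
  have : (a + b) * (a + b - 1) = 2 * (x + y + a * b) := by linear_combination hx + hy
  rw [hx, hy, this, Int.mul_ediv_cancel_left _ (by norm_num), Int.mul_ediv_cancel_left _ (by norm_num),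
    Int.mul_ediv_cancel_left _ (by norm_num)]

theorem sig_sub_one (d : ℤ) : sig (d - 1) = - (sig d * sgn d) := by
  rw [sub_eq_add_neg, sig_add, sig_neg_one, mul_neg_one d, sgn_neg]
  ring

section

variable (𝕜 : Type u) [CommRing 𝕜]

/-- The ring obtained by adjoining a square root of `-1`. -/
abbrev SqrtNegOne : Type u := QuadraticAlgebra 𝕜 (-1) 0

variable {𝕜}

/-- The power `d` of the square root of `-1`. -/
def rootPow (d : ℤ) : SqrtNegOne 𝕜 := if Even d then ⟨(sig d : 𝕜), 0⟩ else ⟨0, (sig d : 𝕜)⟩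

theorem rootPow_zero : (rootPow 0 : SqrtNegOne 𝕜) = 1 := by
  simp [rootPow]; rfl

theorem rootPow_add (a b : ℤ) : (rootPow (a + b) : SqrtNegOne 𝕜) = rootPow a * rootPow b := by
  have h : ∀ a b : ℤ, sgn (a * b) = if Even a ∨ Even b then 1 else -1 := by
    intro a b
    by_cases h : Even (a * b)
    · rw [if_pos (Int.even_mul.1 h)]; simp [sgn, Int.negOnePow_even _ h]
    · rw [if_neg (mt Int.even_mul.2 h)]
      simp [sgn, Int.negOnePow_odd _ (Int.not_even_iff_odd.1 h)]
  unfold rootPow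
  rw [sig_add, h]
  by_cases ha : Even a <;> by_cases hb : Even b <;>
    simp [ha, hb, Int.even_add, QuadraticAlgebra.mk_mul_mk]

/-- The sum of the two coordinates. -/
def coordSum : SqrtNegOne 𝕜 →+ 𝕜 where
  toFun z := z.re + z.im
  map_zero' := by simp
  map_add' z w := by simp; ring

theorem coordSum_rootPow_mul (d : ℤ) (a : 𝕜) :
    coordSum (rootPow d * algebraMap 𝕜 _ a) = (sig d : 𝕜) * a := by
  unfold rootPow coordSum
  split_ifs <;> simp [QuadraticAlgebra.algebraMap_eq, QuadraticAlgebra.mk_mul_mk]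

/-! ## The cochains of the chords -/

variable (s t : ℕ)

/-- Strings of morphisms between augmentations. -/
abbrev AugHom (𝕜 : Type u) [CommRing 𝕜] (s t : ℕ) : Λ.AugObj 𝕜 s t → Λ.AugObj 𝕜 s t → Type u :=
  fun _ _ => Λ.Plus s t → 𝕜

/-- The cochain with the values of augmentations at a chord on objects, and the coordinate at this
chord, up to sign, on morphisms. -/
def augCoch (𝕜 : Type u) [CommRing 𝕜] (s t : ℕ) (c : Chord) : Coch (Λ.AugHom 𝕜 s t) 𝕜 :=
  ⟨fun {x _} r => match r with
    | .nil _ => x.1 (Λ.gen s t 1 ⟨c, 0, 0⟩)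
    | .cons f (.nil _) => sig (Λ.deg s c) * Λ.coord s t f c
    | .cons _ (.cons _ _) => 0⟩

variable {s t} {x y z w : Λ.AugObj 𝕜 s t}

@[simp] theorem augCoch_nil (c : Chord) (x : Λ.AugObj 𝕜 s t) :
    (Λ.augCoch 𝕜 s t c).val (.nil x) = x.1 (Λ.gen s t 1 ⟨c, 0, 0⟩) := rfl

theorem augCoch_of_long (c : Chord) (r : Str (Λ.AugHom 𝕜 s t) x y) (hr : 2 ≤ r.length) :
    (Λ.augCoch 𝕜 s t c).val r = 0 := by
  cases r with
  | nil => simp at hr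
  | cons f r => cases r with
    | nil => simp at hr
    | cons g r => rfl

variable (𝕜 s t) in
/-- The values of all chords and base points. -/
def augData : SweepData (Coch (Λ.AugHom 𝕜 s t) 𝕜) where
  line i j := Λ.augCoch 𝕜 s t (.line i j)
  ev e := Λ.augCoch 𝕜 s t (.ev e)
  mark e := Coch.unitOfObj fun x =>
    Λ.markFactor (fun e p => Units.map x.1.toMonoidHom (Λ.tgen s t 1 e p)) e 0

/-- Change of coefficients for cochains. -/
def _root_.AInf.Coch.mapCoeff {O : Type u} {H : O → O → Type u} {K K' : Type*} [Ring K] [Ring K']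
    (h : K →+* K') : Coch H K →+* Coch H K' where
  toFun φ := ⟨fun s => h (φ.val s)⟩
  map_zero' := by ext x y s; simp
  map_add' φ ψ := by ext x y s; simp
  map_one' := by ext x y s; cases s <;> simp
  map_mul' φ ψ := by
    ext x y s
    simp only [Coch.mul_val, ← map_mul]
    exact Str.map_splitSum h.toAddMonoidHom s _

variable (𝕜 s t) in
/-- The cochain of a chord, multiplied by a power of the square root of `-1`. -/
def twistedCoch (c : Chord) : Coch (Λ.AugHom 𝕜 s t) (SqrtNegOne 𝕜) where
  val r := rootPow (Λ.deg s c) * algebraMap 𝕜 _ ((Λ.augCoch 𝕜 s t c).val r)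

variable (𝕜 s t) in
def twistedData : SweepData (Coch (Λ.AugHom 𝕜 s t) (SqrtNegOne 𝕜)) where
  line i j := Λ.twistedCoch 𝕜 s t (.line i j)
  ev e := Λ.twistedCoch 𝕜 s t (.ev e)
  mark e := Units.map (Coch.mapCoeff (algebraMap 𝕜 (SqrtNegOne 𝕜))).toMonoidHom
    ((Λ.augData 𝕜 s t).mark e)

/-- The pairs of a cochain and its multiple by the power `d` of the square root of `-1`. -/
def rootGraded {O : Type u} (H : O → O → Type u) (𝕜 : Type u) [CommRing 𝕜] (d : ℤ) :
    AddSubgroup (Coch H 𝕜 × Coch H (SqrtNegOne 𝕜)) where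
  carrier := {φ | ∀ {x y : O} (r : Str H x y), φ.2.val r = rootPow d * algebraMap 𝕜 _ (φ.1.val r)}
  zero_mem' := fun _ => by simp
  add_mem' := fun h h' _ _ r => by
    rw [Prod.snd_add, Coch.add_val, h r, h' r, Prod.fst_add, Coch.add_val, map_add, mul_add]
  neg_mem' := fun h _ _ r => by
    rw [Prod.snd_neg, Coch.neg_val, h r, Prod.fst_neg, Coch.neg_val, map_neg, mul_neg]

theorem mem_rootGraded {O : Type u} {H : O → O → Type u} {d : ℤ}
    {φ : Coch H 𝕜 × Coch H (SqrtNegOne 𝕜)} : φ ∈ rootGraded H 𝕜 d ↔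
      ∀ {x y : O} (r : Str H x y), φ.2.val r = rootPow d * algebraMap 𝕜 _ (φ.1.val r) := Iff.rfl

theorem rootGraded_mul {O : Type u} {H : O → O → Type u} {a b : ℤ}
    {φ ψ : Coch H 𝕜 × Coch H (SqrtNegOne 𝕜)} (h : φ ∈ rootGraded H 𝕜 a)
    (h' : ψ ∈ rootGraded H 𝕜 b) : φ * ψ ∈ rootGraded H 𝕜 (a + b) := by
  intro x y r
  have e : algebraMap 𝕜 (SqrtNegOne 𝕜) ((φ * ψ).1.val r) =
      Str.splitSum r fun _ u v => algebraMap 𝕜 (SqrtNegOne 𝕜) (φ.1.val v * ψ.1.val u) :=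
    Str.map_splitSum (algebraMap 𝕜 (SqrtNegOne 𝕜)).toAddMonoidHom r fun _ u v => φ.1.val v * ψ.1.val u
  rw [e, Str.mul_splitSum, Prod.snd_mul, Coch.mul_val]
  refine Str.splitSum_congr fun w u v => ?_
  rw [h v, h' u, rootPow_add, map_mul]
  ring

theorem rootGraded_one {O : Type u} {H : O → O → Type u} : 1 ∈ rootGraded H 𝕜 0 := by
  intro x y r
  cases r <;> simp [rootPow_zero]

theorem rootGraded_mapCoeff {O : Type u} {H : O → O → Type u} (φ : Coch H 𝕜) :
    (φ, Coch.mapCoeff (algebraMap 𝕜 (SqrtNegOne 𝕜)) φ) ∈ rootGraded H 𝕜 0 := by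
  intro x y r
  rw [rootPow_zero, one_mul]
  rfl

/-- The pairs of the values of the chords and their multiples. -/
def pairData (𝕜 : Type u) [CommRing 𝕜] (s t : ℕ) :
    SweepData (Coch (Λ.AugHom 𝕜 s t) 𝕜 × Coch (Λ.AugHom 𝕜 s t) (SqrtNegOne 𝕜)) where
  line i j := (Λ.augCoch 𝕜 s t (.line i j), Λ.twistedCoch 𝕜 s t (.line i j))
  ev e := (Λ.augCoch 𝕜 s t (.ev e), Λ.twistedCoch 𝕜 s t (.ev e))
  mark e := MulEquiv.prodUnits.symm ((Λ.augData 𝕜 s t).mark e, (Λ.twistedData 𝕜 s t).mark e)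

theorem pairData_map_fst : (Λ.pairData 𝕜 s t).map (RingHom.fst _ _) = Λ.augData 𝕜 s t := rfl

theorem pairData_map_snd : (Λ.pairData 𝕜 s t).map (RingHom.snd _ _) = Λ.twistedData 𝕜 s t := rfl

theorem pairData_mark_mem (e : ℕ) :
    (((Λ.pairData 𝕜 s t).mark e : _ˣ) : _ × _) ∈ rootGraded (Λ.AugHom 𝕜 s t) 𝕜 0 ∧
      ((((Λ.pairData 𝕜 s t).mark e)⁻¹ : _ˣ) : _ × _) ∈ rootGraded (Λ.AugHom 𝕜 s t) 𝕜 0 :=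
  ⟨rootGraded_mapCoeff _, rootGraded_mapCoeff _⟩

theorem twisted_blockDisks {e : ℕ} (he : s ≤ e) (i j : ℕ) (r : Str (Λ.AugHom 𝕜 s t) x y) :
    (Λ.blockDisks (Λ.twistedData 𝕜 s t) s e i j).val r =
      rootPow (Λ.deg e (.line i j)) *
        algebraMap 𝕜 _ ((Λ.blockDisks (Λ.augData 𝕜 s t) s e i j).val r) := by
  have h := mem_rootGraded.1 (Λ.blockDisks_mem (Λ.pairData 𝕜 s t) (𝒢 := rootGraded (Λ.AugHom 𝕜 s t) 𝕜)
    rootGraded_one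
    rootGraded_mul he (fun _ _ _ _ _ => rfl) (fun _ _ _ _ _ _ => rfl)
    (fun _ _ _ => Λ.pairData_mark_mem _) i j) r
  have h1 := Λ.map_blockDisks (s := s) (Λ.pairData 𝕜 s t) (RingHom.fst _ _) e i j
  have h2 := Λ.map_blockDisks (s := s) (Λ.pairData 𝕜 s t) (RingHom.snd _ _) e i j
  rw [pairData_map_fst] at h1
  rw [pairData_map_snd] at h2
  rw [h1, h2]
  exact h

theorem twisted_blockDiff {c : Chord} (hc : ∀ e, c = .ev e → s ≤ e) (r : Str (Λ.AugHom 𝕜 s t) x y) :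
    (Λ.blockDiff (Λ.twistedData 𝕜 s t) s c).val r =
      rootPow (Λ.deg s c - 1) *
        algebraMap 𝕜 _ ((Λ.blockDiff (Λ.augData 𝕜 s t) s c).val r) := by
  have h := mem_rootGraded.1 (Λ.blockDiff_mem (Λ.pairData 𝕜 s t) (𝒢 := rootGraded (Λ.AugHom 𝕜 s t) 𝕜)
    rootGraded_one
    rootGraded_mul c (fun _ _ _ _ _ => rfl) (fun _ _ _ _ _ _ _ _ _ => rfl)
    (fun _ _ _ _ _ _ => Λ.pairData_mark_mem _) hc) r
  have h1 := Λ.map_blockDiff (s := s) (Λ.pairData 𝕜 s t) (RingHom.fst _ _) c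
  have h2 := Λ.map_blockDiff (s := s) (Λ.pairData 𝕜 s t) (RingHom.snd _ _) c
  rw [pairData_map_fst] at h1
  rw [pairData_map_snd] at h2
  rw [h1, h2]
  exact h

/-! ## Evaluation on words -/

/-- The matrix of a letter for a list of morphisms. -/
def letterMatrix (s t : ℕ) {L : ℕ} (F : ℕ → Λ.Plus s t → 𝕜) (l : Letter) :
    Matrix (Fin (L + 1)) (Fin (L + 1)) (SqrtNegOne 𝕜) :=
  Matrix.of fun p q => if l.row = p ∧ l.col = q ∧ l.col = l.row + 1 then
    rootPow (Λ.deg s l.chord) * algebraMap 𝕜 _ (sig (Λ.deg s l.chord) * Λ.coord s t (F l.row) l.chord)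
    else 0

theorem prod_letterMatrix {L : ℕ} (fs : List (Λ.Plus s t → 𝕜)) (hfs : fs.length = L)
    (ls : List Letter) (i : Fin (L + 1)) :
    (ls.map (Λ.letterMatrix s t fun p => fs.getD p 0)).prod i (Fin.last L) =
      rootPow (ls.map fun l => Λ.deg s l.chord).sum * algebraMap 𝕜 _
        (sig (ls.map fun l => Λ.deg s l.chord).sum * Λ.pairing s t i (fs.drop i) ls) := by
  induction ls generalizing i with
  | nil =>
    rcases eq_or_ne i (Fin.last L) with h | h
    · subst h
      rw [List.drop_eq_nil_of_le (by simp [hfs])]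
      simp [pairing, rootPow_zero]
    · have hi : (i : ℕ) < fs.length := by
        rw [hfs]; exact Fin.val_lt_last h
      rw [List.drop_eq_getElem_cons hi]
      simp [pairing, Matrix.one_apply_ne h]
  | cons l ls ih =>
    rw [List.map_cons, List.prod_cons, Matrix.mul_apply]
    rcases eq_or_ne i (Fin.last L) with h | h
    · subst h
      rw [List.drop_eq_nil_of_le (by simp [hfs]), Finset.sum_eq_zero]
      · simp [pairing]
      · intro j _
        rw [letterMatrix, Matrix.of_apply, if_neg, zero_mul]
        rintro ⟨h1, h2, h3⟩
        have := j.2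
        simp only [Fin.val_last] at h1
        omega
    · have hi : (i : ℕ) < fs.length := by
        rw [hfs]; exact Fin.val_lt_last h
      rw [List.drop_eq_getElem_cons hi, pairing]
      have hi' : (i : ℕ) + 1 < L + 1 := by omega
      rw [Finset.sum_eq_single (⟨i + 1, hi'⟩ : Fin (L + 1))]
      · rw [ih]
        simp only [letterMatrix, Matrix.of_apply]
        by_cases hl : l.row = i ∧ l.col = i + 1
        · rw [if_pos ⟨hl.1, hl.2, by omega⟩, if_pos hl, hl.1, List.getD_eq_getElem _ _ hi,
            List.map_cons, List.sum_cons, rootPow_add, sig_add]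
          simp only [map_mul]
          push_cast
          have : (algebraMap 𝕜 (SqrtNegOne 𝕜)) (sgn (Λ.deg s l.chord * (ls.map fun l => Λ.deg s l.chord).sum) : 𝕜) *
              (algebraMap 𝕜 (SqrtNegOne 𝕜)) (sgn (Λ.deg s l.chord * (ls.map fun l => Λ.deg s l.chord).sum) : 𝕜) = 1 := by
            rw [← map_mul, ← Int.cast_mul, sgn_mul_self]; simp
          simp only [map_intCast] at this ⊢
          linear_combination (-(rootPow (Λ.deg s l.chord) : SqrtNegOne 𝕜) * (sig (Λ.deg s l.chord)) *
            algebraMap 𝕜 _ (Λ.coord s t fs[i] l.chord) * rootPow (ls.map fun l => Λ.deg s l.chord).sum *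
            (sig (ls.map fun l => Λ.deg s l.chord).sum) *
            algebraMap 𝕜 _ (Λ.pairing s t (i + 1) (fs.drop (i + 1)) ls)) * this
        · rw [if_neg hl, if_neg (fun h => hl ⟨h.1, by omega⟩)]
          simp
      · intro j _ hj
        rw [letterMatrix, Matrix.of_apply, if_neg, zero_mul]
        rintro ⟨h1, h2, h3⟩
        apply hj
        ext
        exact h2.symm.trans (h3.trans (by rw [h1]))
      · simp

end

end Front


namespace Front

variable (Λ : Front) {𝕜 : Type u} [CommRing 𝕜] {s t : ℕ} {x y z w : Λ.AugObj 𝕜 s t}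

/-! ## The structure maps in terms of cochains -/

theorem markFactor_congr {B : Type*} [Ring B] {τ τ' : ℕ → ℕ → Bˣ} {e p p' : ℕ}
    (h : τ e p = τ' e p') : Λ.markFactor τ e p = Λ.markFactor τ' e p' := by
  simp only [markFactor, h]

/-- Evaluation of words by the matrices of their letters. -/
def wordHom {L : ℕ} (F : ℕ → Λ.Plus s t → 𝕜) :
    MonoidAlgebra 𝕜 (FreeMonoid (Λ.Reeb s t (L + 1))) →ₐ[𝕜]
      Matrix (Fin (L + 1)) (Fin (L + 1)) (SqrtNegOne 𝕜) :=
  MonoidAlgebra.lift 𝕜 _ _ (FreeMonoid.lift fun r => Λ.letterMatrix s t F r.1)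

/-- The ring homomorphism defined by a string of morphisms. -/
def strHom (f : Str (Λ.AugHom 𝕜 s t) x y) : Λ.Alg s t (f.length + 1) →+*
    Matrix (Fin (f.length + 1)) (Fin (f.length + 1)) (SqrtNegOne 𝕜) :=
  (Λ.wordHom fun p => f.vals.getD p 0).toRingHom.comp
    (Λ.twist s t (f.length + 1) fun p => (f.objAt p).1)

theorem strEval_eq (f : Str (Λ.AugHom 𝕜 s t) x y) (a : Λ.Alg s t (f.length + 1)) :
    Λ.strEval 𝕜 f a = coordSum (Λ.strHom f a 0 (Fin.last _)) := by
  rw [strEval, strHom, RingHom.comp_apply]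
  generalize Λ.twist s t (f.length + 1) (fun p => (f.objAt p).1) a = z
  induction z using MonoidAlgebra.induction_linear with
  | zero => simp
  | add z z' h h' =>
    rw [MonoidAlgebra.coeff_add, Finsupp.sum_add_index' (by simp) (by intros; ring), h, h', map_add,
      Matrix.add_apply, map_add]
  | single w c =>
    rw [MonoidAlgebra.coeff_single, Finsupp.sum_single_index (by simp)]
    have h1 : (Λ.wordHom (L := f.length) fun p => f.vals.getD p 0).toRingHom (MonoidAlgebra.single w c) =
        c • ((FreeMonoid.toList w).map Subtype.val |>.map
          (Λ.letterMatrix s t fun p => f.vals.getD p 0)).prod := by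
      change Λ.wordHom _ _ = _
      rw [wordHom, MonoidAlgebra.lift_single, FreeMonoid.lift_apply, List.map_map]
      rfl
    rw [h1, Matrix.smul_apply, Λ.prod_letterMatrix _ f.length_vals, Algebra.smul_def, mul_left_comm,
      ← map_mul, coordSum_rootPow_mul]
    have h2 := sig_mul_self (((FreeMonoid.toList w).map Subtype.val).map fun l => Λ.deg s l.chord).sum
    have h3 : (sig (((FreeMonoid.toList w).map Subtype.val).map fun l => Λ.deg s l.chord).sum : 𝕜) *
      sig (((FreeMonoid.toList w).map Subtype.val).map fun l => Λ.deg s l.chord).sum = 1 := by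
      exact_mod_cast congrArg (Int.cast : ℤ → 𝕜) h2
    simp only [Fin.val_zero, List.drop_zero]
    linear_combination (-(c * Λ.pairing s t 0 f.vals ((FreeMonoid.toList w).map Subtype.val))) * h3

theorem strHom_gen (f : Str (Λ.AugHom 𝕜 s t) x y) (c : Chord) (p q : Fin (f.length + 1)) :
    Λ.strHom f (Λ.gen s t _ ⟨c, p, q⟩) = Coch.subHom f (Λ.twistedCoch 𝕜 s t c) p q := by
  have hword : ∀ r : Λ.Reeb s t (f.length + 1),
      Λ.strHom f (Λ.gen s t _ r.1) = Λ.letterMatrix s t (fun p => f.vals.getD p 0) r.1 +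
        if r.1.row = r.1.col then algebraMap 𝕜 _ ((f.objAt r.1.row).1 (Λ.gen s t 1 ⟨r.1.chord, 0, 0⟩))
        else 0 := by
    intro r
    rw [strHom, RingHom.comp_apply, twist, Λ.lift_gen, map_add]
    congr 1
    · change Λ.wordHom _ _ = _
      rw [wordHom, MonoidAlgebra.of_apply, MonoidAlgebra.lift_single, one_smul,
        FreeMonoid.lift_eval_of]
    · split_ifs
      · exact (Λ.wordHom _).commutes _
      · exact map_zero _
  have letter0 : p.val + 1 ≠ q → Λ.letterMatrix s t (L := f.length) (fun p => f.vals.getD p 0) ⟨c, p, q⟩ = 0 := by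
    intro h
    refine Matrix.ext fun i j => ?_
    rw [letterMatrix, Matrix.of_apply, if_neg]
    · rfl
    · rintro ⟨_, _, h3⟩; exact h h3.symm
  rw [Coch.subHom_apply]
  rcases lt_trichotomy p q with hpq | hpq | hpq
  · have hpq' : p.val < q := hpq
    by_cases h : p.val + 1 = q
    · have hc : Λ.IsReeb s t (f.length + 1) ⟨c, p, q⟩ ↔ Λ.IsReeb s t 2 ⟨c, 0, 1⟩ := by
        simp only [IsReeb]
        cases c with
        | line i j => simp only; omega
        | ev e => rcases hE : Λ.event e <;> simp [hE] <;> omega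
      have h2 := f.subVal_succ (0 : Λ.Plus s t → 𝕜) (φ := Λ.twistedCoch 𝕜 s t c)
        (a := fun f => rootPow (Λ.deg s c) * algebraMap 𝕜 _ (sig (Λ.deg s c) * Λ.coord s t f c))
        (fun _ _ _ => rfl) (p := p) (by omega)
      rw [h] at h2
      rw [h2, Coch.place, if_neg hpq.ne, if_pos hpq]
      by_cases hr : Λ.IsReeb s t (f.length + 1) ⟨c, p, q⟩
      · rw [hword ⟨_, hr⟩, if_neg (show ¬ p.val = q by omega), add_zero]
        refine Matrix.ext fun i j => ?_
        simp only [letterMatrix, Matrix.of_apply, Matrix.single_apply, Fin.ext_iff]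
        by_cases hij : p.val = i ∧ q.val = j
        · rw [if_pos ⟨hij.1, hij.2, h.symm⟩, if_pos hij]
        · rw [if_neg (fun h' => hij ⟨h'.1, h'.2.1⟩), if_neg hij]
      · rw [Λ.gen_eq_zero hr, map_zero]
        have : ∀ f, Λ.coord s t (𝕜 := 𝕜) f c = 0 := by
          intro f
          rw [coord, dif_neg (fun h => hr (hc.2 h))]
        simp [this]
    · rw [f.subVal_eq_zero 2 (fun u hu => ?_) (by omega) (by omega), Coch.place_zero]
      · by_cases hr : Λ.IsReeb s t (f.length + 1) ⟨c, p, q⟩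
        · rw [hword ⟨_, hr⟩, if_neg (show ¬ p.val = q by omega), letter0 h, add_zero]
        · rw [Λ.gen_eq_zero hr, map_zero]
      · simp only [twistedCoch]
        rw [Λ.augCoch_of_long _ _ hu, map_zero, mul_zero]
  · subst hpq
    have hc : Λ.IsReeb s t (f.length + 1) ⟨c, p, p⟩ ↔ Λ.IsReeb s t 1 ⟨c, 0, 0⟩ := by
      simp only [IsReeb]
      cases c with
      | line i j => simp only; omega
      | ev e => rcases hE : Λ.event e <;> simp [hE] <;> omega
    rw [f.subVal_self, Coch.place, if_pos rfl]
    have h1 : (Λ.twistedCoch 𝕜 s t c).val (.nil (f.objAt p)) =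
        algebraMap 𝕜 _ ((f.objAt p).1 (Λ.gen s t 1 ⟨c, 0, 0⟩)) := by
      simp only [twistedCoch, augCoch_nil]
      by_cases hd : Λ.deg s c = 0
      · rw [hd, rootPow_zero, one_mul]
      · rw [Λ.aug_gen (f.objAt p).2 ⟨c, 0, 0⟩ hd]; simp
    rw [h1]
    by_cases hr : Λ.IsReeb s t (f.length + 1) ⟨c, p, p⟩
    · rw [hword ⟨_, hr⟩, if_pos rfl, letter0 (by omega), zero_add]
      rfl
    · rw [Λ.gen_eq_zero hr, Λ.gen_eq_zero (fun h => hr (hc.2 h))]; simp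
  · have hpq' : q.val < p := hpq
    rw [Coch.place_of_lt hpq]
    by_cases hr : Λ.IsReeb s t (f.length + 1) ⟨c, p, q⟩
    · rw [hword ⟨_, hr⟩, if_neg (show ¬ p.val = q by omega), letter0 (by omega), add_zero]
    · rw [Λ.gen_eq_zero hr, map_zero]

theorem strHom_tgen (f : Str (Λ.AugHom 𝕜 s t) x y) (e : ℕ) (p : Fin (f.length + 1)) :
    Units.map (Λ.strHom f).toMonoidHom (Λ.tgen s t _ e p) =
      Units.map (algebraMap 𝕜 (Matrix (Fin (f.length + 1)) (Fin (f.length + 1)) (SqrtNegOne 𝕜))).toMonoidHom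
        (Units.map (f.objAt p).1.toMonoidHom (Λ.tgen s t 1 e 0)) := by
  by_cases h : Λ.IsMark s t (f.length + 1) (e, p)
  · have key : Λ.strHom f (Λ.tgen s t (f.length + 1) e p : Λ.Alg s t (f.length + 1)) = algebraMap 𝕜 _
        ((f.objAt p).1 (Λ.tgen s t 1 e 0 : Λ.Alg s t 1)) := by
      rw [strHom, RingHom.comp_apply, twist, Λ.lift_tgen _ _ ⟨_, h⟩]
      exact (Λ.wordHom (s := s) (t := t) (L := f.length) fun p => f.vals.getD p 0).commutes
        ((f.objAt p).1 (Λ.tgen s t 1 e 0 : Λ.Alg s t 1))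
    exact Units.ext key
  · have h' : ¬ Λ.IsMark s t 1 (e, 0) := fun h'' => h ⟨p.2, h''.2⟩
    simp [tgen, h, h']

theorem strHom_mapMatrix (f : Str (Λ.AugHom 𝕜 s t) x y) :
    (Λ.multiData (Λ.gen s t _) (Λ.tgen s t _) (f.length + 1)).map
      (Λ.strHom f).mapMatrix = (Λ.twistedData 𝕜 s t).map (Coch.subHom f) := by
  rw [SweepData.map, SweepData.map]
  congr 1
  · funext i j
    ext p q : 2
    exact congrFun (congrFun (Λ.strHom_gen f (.line i j) p q) _) _
  · funext e
    ext p q : 2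
    exact congrFun (congrFun (Λ.strHom_gen f (.ev e) p q) _) _
  · funext e
    ext p q : 3
    refine congrFun (congrFun ?_ _) _
    change Λ.strHom f (Matrix.diagonal (fun p : Fin (f.length + 1) =>
      (Λ.markFactor (Λ.tgen s t (f.length + 1)) e p : Λ.Alg s t (f.length + 1))) p q) = Coch.subHom f
        (Coch.mapCoeff (algebraMap 𝕜 (SqrtNegOne 𝕜)) ((Λ.augData 𝕜 s t).mark e : Coch (Λ.AugHom 𝕜 s t) 𝕜)) p q
    rw [Coch.subHom_apply]
    have hφ : ∀ {x y : Λ.AugObj 𝕜 s t} (u : Str (Λ.AugHom 𝕜 s t) x y), 1 ≤ u.length →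
        (Coch.mapCoeff (algebraMap 𝕜 (SqrtNegOne 𝕜)) ((Λ.augData 𝕜 s t).mark e : Coch (Λ.AugHom 𝕜 s t) 𝕜)).val u = 0 := by
      intro x y u hu
      cases u with
      | nil => simp at hu
      | cons g u => exact map_zero _
    rcases lt_trichotomy p q with h | h | h
    · rw [f.subVal_eq_zero 1 hφ (Fin.lt_def.1 h) (by omega), Coch.place_zero,
        Matrix.diagonal_apply_ne _ h.ne, map_zero]
    · subst h
      rw [f.subVal_self, Coch.place, if_pos rfl, Matrix.diagonal_apply_eq]
      rw [← (Λ.map_markFactor (Λ.strHom f) (Λ.tgen s t (f.length + 1)) e p).1]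
      rw [Λ.markFactor_congr (τ' := fun e' p' => Units.map (algebraMap 𝕜
        (Matrix (Fin (f.length + 1)) (Fin (f.length + 1)) (SqrtNegOne 𝕜))).toMonoidHom
        (Units.map (f.objAt p).1.toMonoidHom (Λ.tgen s t 1 e' p'))) (p' := 0) (Λ.strHom_tgen f e p)]
      rw [(Λ.map_markFactor (algebraMap 𝕜 (Matrix (Fin (f.length + 1)) (Fin (f.length + 1)) (SqrtNegOne 𝕜))) _ e 0).1]
      rfl
    · rw [Coch.place_of_lt h, Matrix.diagonal_apply_ne _ h.ne', map_zero]

/-- The components of the differential, in terms of cochains. -/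
theorem strEval_diff {c : Chord} (hc : Λ.IsReeb s t 2 ⟨c, 0, 1⟩) (f : Str (Λ.AugHom 𝕜 s t) x y)
    (hf : 0 < f.length) :
    Λ.strEval 𝕜 f (Λ.diff s t _ (Λ.gen s t _ ⟨c, 0, f.length⟩)) =
      sig (Λ.deg s c - 1) * (Λ.blockDiff (Λ.augData 𝕜 s t) s c).val f := by
  have hr : Λ.IsReeb s t (f.length + 1) ⟨c, 0, f.length⟩ := by
    simp only [IsReeb] at hc ⊢
    cases c with
    | line i j => simp only at hc ⊢; omega
    | ev e => rcases hE : Λ.event e <;> simp [hE] at hc ⊢ <;> omega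
  rw [Λ.diff_gen ⟨_, hr⟩, Λ.dgen_eq_blockDiff hc hf, strEval_eq]
  have h1 := Λ.map_blockDiff (s := s) (Λ.multiData (Λ.gen s t _) (Λ.tgen s t _) (f.length + 1))
    (Λ.strHom f).mapMatrix c
  rw [Λ.strHom_mapMatrix, Λ.map_blockDiff] at h1
  have h2 := congrFun (congrFun h1 0) (Fin.last _)
  rw [RingHom.mapMatrix_apply, Matrix.map_apply] at h2
  rw [← h2, Coch.subHom_corner f hf, Λ.twisted_blockDiff, coordSum_rootPow_mul]
  rintro e rfl
  exact hc.2.2.1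

/-- The components of the corestriction, in terms of cochains. -/
theorem strEval_sweep (f : Str (Λ.AugHom 𝕜 s t) x y) (hf : 0 < f.length) {e : ℕ} (he : s ≤ e)
    (i j : ℕ) :
    Λ.strEval 𝕜 f (Λ.sweep (Λ.gen s t _) (Λ.tgen s t _) (border (Λ.gen s t _) (f.length + 1))
      (Λ.elems (f.length + 1) s e) ((f.length + 1) * i + 0) ((f.length + 1) * j + f.length)) =
      sig (Λ.deg e (.line i j)) * (Λ.blockDisks (Λ.augData 𝕜 s t) s e i j).val f := by
  have h0 := Λ.isBlocks_sweep (Λ.gen s t (f.length + 1)) (Λ.tgen s t (f.length + 1)) (m := f.length + 1) (by omega) he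
    (fun _ _ _ _ h => gen_line_eq_zero h) (fun _ _ _ h _ _ h' => gen_lcusp_eq_zero h h') i j 0
    (Fin.last _)
  rw [Fin.val_zero, Fin.val_last] at h0
  rw [h0, strEval_eq]
  have h1 := Λ.map_blockDisks (s := s) (Λ.multiData (Λ.gen s t _) (Λ.tgen s t _) (f.length + 1))
    (Λ.strHom f).mapMatrix e i j
  rw [Λ.strHom_mapMatrix, Λ.map_blockDisks] at h1
  have h2 := congrFun (congrFun h1 0) (Fin.last _)
  rw [RingHom.mapMatrix_apply, Matrix.map_apply] at h2
  rw [← h2, Coch.subHom_corner f hf, Λ.twisted_blockDisks he, coordSum_rootPow_mul]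

theorem strEval_gen (f : Str (Λ.AugHom 𝕜 s t) x y) (hf : 0 < f.length) (c : Chord) :
    Λ.strEval 𝕜 f (Λ.gen s t _ ⟨c, 0, f.length⟩) =
      sig (Λ.deg s c) * (Λ.augCoch 𝕜 s t c).val f := by
  have h := Λ.strHom_gen f c 0 (Fin.last _)
  rw [Fin.val_zero, Fin.val_last] at h
  rw [strEval_eq, h, Coch.subHom_corner f hf]
  exact coordSum_rootPow_mul _ _

end Front


/-! ## Cochains on strings containing units, and homogeneous cochains -/

namespace AInf.Str

variable {O : Type u} {H : O → O → Type u} {K : Type v} [AddCommMonoid K] {x y : O}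

theorem splitSum_right_nil (s : Str H x y) (G : ∀ w, Str H w y → K) :
    (splitSum s fun w u v => if v.length = 0 then G w u else 0) = G x s := by
  induction s with
  | nil => simp
  | cons f s ih => simp [ih]

theorem splitSum_left_nil (s : Str H x y) (G : ∀ w, Str H x w → K) :
    (splitSum s fun w u v => if u.length = 0 then G w v else 0) = G y s := by
  cases s with
  | nil => simp
  | cons f s => simp

end AInf.Str

namespace AInfCat

open Str

variable {𝕜 : Type u} [CommRing 𝕜] (A : AInfCat 𝕜)

/-- The cochains which take the value `a` on units, and vanish on longer strings containing a unit. -/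
def AtUnit (a : 𝕜) (φ : Coch A.Hom 𝕜) : Prop :=
  ∀ ⦃x y z : A.Obj⦄ (u : Str A.Hom y z) (v : Str A.Hom x y),
    φ.val (u.append (cons (A.one y) v)) = if u.length + v.length = 0 then a else 0

variable {A}

theorem AtUnit.mul_val {a b : 𝕜} {φ ψ : Coch A.Hom 𝕜} (h : A.AtUnit a φ) (h' : A.AtUnit b ψ)
    {x y z : A.Obj} (u : Str A.Hom y z) (v : Str A.Hom x y) :
    (φ * ψ).val (u.append (cons (A.one y) v)) =
      (if v.length = 0 then a * ψ.val u else 0) + if u.length = 0 then φ.val v * b else 0 := by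
  rw [Coch.mul_append_cons]
  congr 1
  · split_ifs with hv
    · rw [← splitSum_right_nil u fun _ p => a * ψ.val p]
      refine splitSum_congr fun w p q => ?_
      rw [h q v, hv, Nat.add_zero, ite_mul, zero_mul]
    · rw [← splitSum_zero u]
      refine splitSum_congr fun w p q => ?_
      rw [h q v, if_neg (by omega), zero_mul]
  · split_ifs with hu
    · rw [← splitSum_left_nil v fun _ q => φ.val q * b]
      refine splitSum_congr fun w p q => ?_
      rw [h' u p, hu, Nat.zero_add, mul_ite, mul_zero]
    · rw [← splitSum_zero v]
      refine splitSum_congr fun w p q => ?_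
      rw [h' u p, if_neg (by omega), mul_zero]

theorem AtUnit.add {a b : 𝕜} {φ ψ : Coch A.Hom 𝕜} (h : A.AtUnit a φ) (h' : A.AtUnit b ψ) :
    A.AtUnit (a + b) (φ + ψ) := by
  intro x y z u v
  rw [Coch.add_val, h u v, h' u v]
  split_ifs <;> simp

theorem AtUnit.sub {a b : 𝕜} {φ ψ : Coch A.Hom 𝕜} (h : A.AtUnit a φ) (h' : A.AtUnit b ψ) :
    A.AtUnit (a - b) (φ - ψ) := by
  intro x y z u v
  rw [Coch.sub_val, h u v, h' u v]
  split_ifs <;> simp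

theorem AtUnit.zsmul {φ : Coch A.Hom 𝕜} (h : A.AtUnit 0 φ) (n : ℤ) : A.AtUnit 0 (n • φ) := by
  intro x y z u v
  rw [Coch.zsmul_val, h u v]
  split_ifs <;> simp

theorem AtUnit.zero : A.AtUnit 0 (0 : Coch A.Hom 𝕜) := by
  intro x y z u v
  simp

theorem AtUnit.mul {φ ψ : Coch A.Hom 𝕜} (h : A.AtUnit 0 φ) (h' : A.AtUnit 0 ψ) :
    A.AtUnit 0 (φ * ψ) := by
  intro x y z u v
  rw [h.mul_val h']
  simp

theorem atUnit_ofObj (a : A.Obj → 𝕜) : A.AtUnit 0 (Coch.ofObj a : Coch A.Hom 𝕜) := by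
  intro x y z u v
  rw [Coch.val_append_ne_nil]
  simp

/-- Conjugation by a family of units. -/
theorem AtUnit.conj {a : 𝕜} {φ : Coch A.Hom 𝕜} (h : A.AtUnit a φ) (p q : A.Obj → 𝕜)
    (hpq : a ≠ 0 → ∀ x, p x * q x = 1) : A.AtUnit a (Coch.ofObj p * φ * Coch.ofObj q) := by
  intro x y z u v
  rw [Coch.mul_ofObj_val, Coch.ofObj_mul_val, h u v]
  split_ifs with h1
  · cases u with
    | nil => cases v with
      | nil =>
        by_cases ha : a = 0
        · simp [ha]
        · rw [mul_right_comm, hpq ha, one_mul]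
      | cons f v => simp at h1
    | cons f u => simp at h1
  · simp

theorem splitSum_eq_zero_of_hasDeg {K : Type*} [AddCommMonoid K] {x y : A.Obj} {s : Str A.Hom x y}
    {d : ℤ} (hs : A.HasDeg s d) {G : ∀ w, Str A.Hom w y → Str A.Hom x w → K}
    (hG : ∀ w u v d₁ d₂, A.HasDeg u d₁ → A.HasDeg v d₂ → d = d₁ + d₂ → G w u v = 0) :
    splitSum s G = 0 := by
  induction s generalizing d with
  | nil => 
    rw [HasDeg] at hs
    rw [splitSum_nil]
    exact hG _ _ _ 0 0 (by rw [HasDeg]) (by rw [HasDeg]) (by simp [hs])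
  | cons f s ih =>
    have hs' := hs
    rw [HasDeg] at hs
    obtain ⟨d₁, d₂, h1, h2, rfl⟩ := hs
    rw [splitSum_cons, hG _ _ _ 0 _ (by rw [HasDeg]) hs' (by simp), zero_add]
    refine ih h2 fun w u v e₁ e₂ h3 h4 h5 => hG _ _ _ (d₁ + e₁) e₂ ?_ h4 (by omega)
    rw [HasDeg]
    exact ⟨d₁, e₁, h1, h3, rfl⟩

variable (A) in
/-- The cochains which vanish on homogeneous strings of degree different from `e`. -/
def homogeneous (e : ℤ) : AddSubgroup (Coch A.Hom 𝕜) where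
  carrier := {φ | ∀ {x y : A.Obj} (s : Str A.Hom x y) (d : ℤ), A.HasDeg s d → d ≠ e → φ.val s = 0}
  zero_mem' := fun _ _ _ _ => rfl
  add_mem' := fun h h' _ _ s d hs hd => by rw [Coch.add_val, h s d hs hd, h' s d hs hd, add_zero]
  neg_mem' := fun h _ _ s d hs hd => by rw [Coch.neg_val, h s d hs hd, neg_zero]

theorem homogeneous_mul {a b : ℤ} {φ ψ : Coch A.Hom 𝕜} (h : φ ∈ A.homogeneous a)
    (h' : ψ ∈ A.homogeneous b) : φ * ψ ∈ A.homogeneous (a + b) := by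
  intro x y s d hs hd
  rw [Coch.mul_val]
  refine splitSum_eq_zero_of_hasDeg hs fun w u v d₁ d₂ h1 h2 h3 => ?_
  by_cases h4 : d₂ = a
  · rw [h' u d₁ h1 (by omega), mul_zero]
  · rw [h v d₂ h2 h4, zero_mul]

theorem ofObj_mem_homogeneous (a : A.Obj → 𝕜) : Coch.ofObj a ∈ A.homogeneous 0 := by
  intro x y s d hs hd
  cases s with
  | nil => rw [HasDeg] at hs; exact absurd hs hd
  | cons f s => rfl

end AInfCat

namespace AInf.Coch

/-- Evaluation at the empty string of an object. -/
def nilHom {O : Type u} (H : O → O → Type u) {K : Type v} [Ring K] (x : O) : Coch H K →+* K where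
  toFun φ := φ.val (.nil x)
  map_zero' := rfl
  map_one' := rfl
  map_add' _ _ := rfl
  map_mul' φ ψ := mul_nil φ ψ x

end AInf.Coch

namespace Front

open Str

variable (Λ : Front) {𝕜 : Type u} [CommRing 𝕜] {s t : ℕ}

/-! ## The structure maps of the augmentation category -/

variable (𝕜 s t) in
/-- The values of the chords, as cochains on the augmentation category. -/
def catData : SweepData (Coch (Λ.augCat 𝕜 s t).Hom 𝕜) := Λ.augData 𝕜 s t

variable (𝕜 s t) in
/-- The value of one chord. -/
def catCoch (c : Chord) : Coch (Λ.augCat 𝕜 s t).Hom 𝕜 := Λ.augCoch 𝕜 s t c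

theorem catData_line (i j : ℕ) : (Λ.catData 𝕜 s t).line i j = Λ.catCoch 𝕜 s t (.line i j) := rfl

theorem catData_ev (e : ℕ) : (Λ.catData 𝕜 s t).ev e = Λ.catCoch 𝕜 s t (.ev e) := rfl

/-- The value of an augmentation at the base point of an event. -/
def objMark (x : Λ.AugObj 𝕜 s t) (e : ℕ) : 𝕜ˣ :=
  Λ.markFactor (fun e p => Units.map x.1.toMonoidHom (Λ.tgen s t 1 e p)) e 0

theorem catCoch_nil_of_deg {c : Chord} (hc : Λ.deg s c ≠ 0) (x : (Λ.augCat 𝕜 s t).Obj) :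
    (Λ.catCoch 𝕜 s t c).val (nil x) = 0 :=
  Λ.aug_gen (Subtype.property (p := Λ.IsAug) x) ⟨c, 0, 0⟩ hc

theorem catCoch_single (c : Chord) {x y : (Λ.augCat 𝕜 s t).Obj} (f : (Λ.augCat 𝕜 s t).Hom x y) :
    (Λ.catCoch 𝕜 s t c).val (single f) = sig (Λ.deg s c) * Λ.coord s t f c := rfl

theorem catCoch_cons_nil (c : Chord) {x y : (Λ.augCat 𝕜 s t).Obj} (f : (Λ.augCat 𝕜 s t).Hom x y) :
    (Λ.catCoch 𝕜 s t c).val (cons f (nil x)) = sig (Λ.deg s c) * Λ.coord s t f c := rfl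

@[simp] theorem catCoch_cons_cons (c : Chord) {x y z w : (Λ.augCat 𝕜 s t).Obj}
    (f : (Λ.augCat 𝕜 s t).Hom z w) (g : (Λ.augCat 𝕜 s t).Hom y z) (r : Str (Λ.augCat 𝕜 s t).Hom x y) :
    (Λ.catCoch 𝕜 s t c).val (cons f (cons g r)) = 0 := rfl

theorem catCoch_of_long (c : Chord) {x y : (Λ.augCat 𝕜 s t).Obj} (r : Str (Λ.augCat 𝕜 s t).Hom x y)
    (hr : 2 ≤ r.length) : (Λ.catCoch 𝕜 s t c).val r = 0 := Λ.augCoch_of_long c r hr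

theorem coord_of_mem (f : Λ.Plus s t → 𝕜) (c : Λ.Plus s t) : Λ.coord s t f c.1 = f c := by
  rw [coord, dif_pos c.2]

theorem coord_of_not_mem (f : Λ.Plus s t → 𝕜) {c : Chord} (hc : ¬ Λ.IsReeb s t 2 ⟨c, 0, 1⟩) :
    Λ.coord s t f c = 0 := by
  rw [coord, dif_neg hc]

theorem coord_add_smul (f g : Λ.Plus s t → 𝕜) (a : 𝕜) (c : Chord) :
    Λ.coord s t (f + a • g) c = Λ.coord s t f c + a * Λ.coord s t g c := by
  unfold coord
  split_ifs <;> simp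

/-- A cochain vanishes if its chord does not exist. -/
theorem catCoch_eq_zero {c : Chord} (hc : ¬ Λ.IsReeb s t 2 ⟨c, 0, 1⟩)
    (hc' : Λ.IsReeb s t 1 ⟨c, 0, 0⟩ → Λ.deg s c ≠ 0) : Λ.catCoch 𝕜 s t c = 0 := by
  ext x y r
  cases r with
  | nil =>
    by_cases h : Λ.IsReeb s t 1 ⟨c, 0, 0⟩
    · exact Λ.catCoch_nil_of_deg (hc' h) _
    · have h1 : (Subtype.val (p := Λ.IsAug) x) (Λ.gen s t 1 ⟨c, 0, 0⟩) = 0 := by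
        rw [Λ.gen_eq_zero h, map_zero]
      exact h1
  | cons f r => cases r with
    | nil =>
      have h1 : Λ.coord s t f c = 0 := Λ.coord_of_not_mem f hc
      rw [catCoch_cons_nil, h1, mul_zero]; rfl
    | cons g r => rfl

theorem catCoch_line_eq_zero {i j : ℕ} (h : ¬ (i ≤ j ∧ j < (Λ.slice s).n)) :
    Λ.catCoch 𝕜 s t (.line i j) = 0 := by
  apply catCoch_eq_zero
  · simp only [IsReeb]; omega
  · simp only [IsReeb]; omega

theorem catCoch_ev_eq_zero {e : ℕ} (h : (∃ k, Λ.event e = .base k) ∨ ∃ b, Λ.event e = .rcusp b) :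
    Λ.catCoch 𝕜 s t (.ev e) = 0 := by
  apply catCoch_eq_zero
  · simp only [IsReeb]
    rcases h with ⟨k, h⟩ | ⟨b, h⟩ <;> simp [h]
  · rcases h with ⟨k, h⟩ | ⟨b, h⟩
    · simp [IsReeb, h]
    · simp [deg, h]

theorem catCoch_parity (c : Chord) : (Λ.augCat 𝕜 s t).signHom (Λ.catCoch 𝕜 s t c) =
    sgn (Λ.deg s c) • Λ.catCoch 𝕜 s t c := by
  ext x y r
  rw [AInfCat.signHom_val, Coch.zsmul_val]
  cases r with
  | nil =>
    rw [AInfCat.sgnStr_nil]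
    by_cases h : Λ.deg s c = 0
    · simp [h]
    · rw [Λ.catCoch_nil_of_deg h, smul_zero]
  | cons f r => cases r with
    | nil =>
      rw [AInfCat.sgnStr_cons, AInfCat.sgnStr_nil, catCoch_cons_nil, catCoch_cons_nil]
      have h : Λ.coord s t (-(Λ.augCat 𝕜 s t).par _ _ f) c = sgn (Λ.deg s c) * Λ.coord s t f c := by
        unfold coord
        split_ifs with h
        · change - ((sgn (Λ.deg s c + 1) : 𝕜) * f ⟨c, h⟩) = _
          rw [sgn_add]; simp
        · simp
      rw [h, zsmul_eq_mul]
      ring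
    | cons g r => simp

theorem catCoch_mem_multilinear (c : Chord) :
    Λ.catCoch 𝕜 s t c ∈ Coch.multilinear (Λ.augCat 𝕜 s t).Hom 𝕜 := by
  intro x y z w u f g a v
  cases u with
  | nil => cases v with
    | nil =>
      simp only [nil_append, catCoch_cons_nil]
      have h1 : Λ.coord s t (f + a • g) c = Λ.coord s t f c + a * Λ.coord s t g c :=
        Λ.coord_add_smul f g a c
      rw [h1]; ring
    | cons h v => simp
  | cons h u =>
    have : ∀ f : (Λ.augCat 𝕜 s t).Hom y z,
        (Λ.catCoch 𝕜 s t c).val ((cons h u).append (cons f v)) = 0 := fun f =>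
      Λ.catCoch_of_long _ _ (by simp; omega)
    rw [this, this, this]; simp

theorem catCoch_mem_homogeneous (c : Chord) :
    Λ.catCoch 𝕜 s t c ∈ (Λ.augCat 𝕜 s t).homogeneous (Λ.deg s c) := by
  intro x y r d hr hd
  cases r with
  | nil =>
    rw [AInfCat.HasDeg] at hr
    exact Λ.catCoch_nil_of_deg (by omega) _
  | cons f r => cases r with
    | nil =>
      rw [AInfCat.HasDeg] at hr
      obtain ⟨d₁, d₂, h1, h2, rfl⟩ := hr
      rw [AInfCat.HasDeg] at h2
      rw [catCoch_cons_nil]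
      have : Λ.coord s t f c = 0 := by
        unfold coord
        split_ifs with h
        · exact h1 ⟨c, h⟩ (by simp only; omega)
        · rfl
      rw [this, mul_zero]
    | cons g r => rfl

/-- The values of an augmentation. -/
def objData (x : Λ.AugObj 𝕜 s t) : SweepData 𝕜 where
  line i j := x.1 (Λ.gen s t 1 ⟨.line i j, 0, 0⟩)
  ev e := x.1 (Λ.gen s t 1 ⟨.ev e, 0, 0⟩)
  mark e := Λ.objMark x e

/-- The matrix of disks, evaluated by an augmentation. -/
theorem blockDisks_objData {e : ℕ} (he : s ≤ e) (i j : ℕ) (x : Λ.AugObj 𝕜 s t) :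
    Λ.blockDisks (Λ.objData x) s e i j = Λ.evalDisks x.1 e i j := by
  have h1 : Λ.multiData (fun l => x.1 (Λ.gen s t 1 l))
      (fun e p => Units.map x.1.toMonoidHom (Λ.tgen s t 1 e p)) 1 =
      (Λ.objData x).map (Matrix.scalar (Fin 1)) := by
    rw [SweepData.map, multiData]
    congr 1
    · funext i j; ext p q; fin_cases p; fin_cases q; simp; rfl
    · funext e; ext p q; fin_cases p; fin_cases q; simp; rfl
    · funext e; ext p q; fin_cases p; fin_cases q; simp; rfl
  have h2 := Λ.isBlocks_sweep (fun l => x.1 (Λ.gen s t 1 l))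
    (fun e p => Units.map x.1.toMonoidHom (Λ.tgen s t 1 e p)) (m := 1) (by omega) he
    (fun _ _ _ _ h => by rw [gen_line_eq_zero h, map_zero])
    (fun _ _ _ h _ _ h' => by rw [gen_lcusp_eq_zero h h', map_zero]) i j 0 0
  rw [h1, map_blockDisks] at h2
  simp only [one_mul, Fin.val_zero, Nat.add_zero] at h2
  rw [evalDisks, h2]
  simp

theorem blockDiff_objData (ht : t ≤ Λ.size) {c : Chord} (hc : Λ.IsReeb s t 2 ⟨c, 0, 1⟩)
    (x : Λ.AugObj 𝕜 s t) : Λ.blockDiff (Λ.objData x) s c = 0 := by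
  have hinv := fun e h1 h2 => Λ.evalDisks_inv ht x.2 (e := e) h1 h2
  cases c with
  | line i j =>
    simp only [blockDiff, objData]
    rw [neg_eq_zero]
    by_cases hij : i < j
    · have hr : Λ.IsReeb s t 1 ⟨.line i j, 0, 0⟩ := by
        simp only [IsReeb] at hc ⊢; omega
      have h2 := Λ.aug_dgen x.2 hr
      simp only [dgen, map_sum, one_mul, Nat.add_zero, Nat.div_one, Nat.mod_one] at h2
      rw [← neg_eq_zero, ← h2, ← Finset.sum_neg_distrib]
      symm
      refine Finset.sum_subset_zero_on_sdiff (fun l hl => ?_) (fun l hl => ?_) fun l _ => ?_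
      · simp at hl ⊢; omega
      · simp only [Finset.mem_sdiff, Finset.mem_Ioo] at hl
        rcases Nat.lt_or_ge i l with h3 | h3
        · rw [gen_line_eq_zero (i := l) (j := j) (by omega), map_zero, mul_zero, smul_zero, neg_zero]
        · rw [gen_line_eq_zero (i := i) (j := l) (by omega), map_zero, zero_mul, smul_zero, neg_zero]
      · rw [sgn_add]; simp
    · refine Finset.sum_eq_zero fun l _ => ?_
      rcases Nat.lt_or_ge i l with h3 | h3
      · rw [gen_line_eq_zero (i := l) (j := j) (by omega), map_zero, mul_zero, smul_zero]
      · rw [gen_line_eq_zero (i := i) (j := l) (by omega), map_zero, zero_mul, smul_zero]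
  | ev e =>
    obtain ⟨-, -, h1, h2, h3⟩ := hc
    rcases hE : Λ.event e with k | k | ⟨k, v⟩ | b
    · simp only [blockDiff, hE]
      have hr : Λ.IsReeb s t 1 ⟨.ev e, 0, 0⟩ := by simp [IsReeb, hE]; omega
      have h4 := Λ.aug_dgen x.2 hr
      simp only [dgen] at h4
      rw [← Λ.map_chordDisks, Λ.chordDisks_cross _ _ hE] at h4
      have h4' : Λ.evalDisks x.1 e k (k + 1) = 0 := h4
      have hz : ∀ i, Λ.evalDisks x.1 e i i = 0 := by
        intro i
        by_contra h
        have := (hinv e h1 h2.le).supp i i h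
        omega
      simp only [Λ.blockDisks_objData h1, hz, h4']
      simp
    · simp only [blockDiff, hE]
    · simp only [blockDiff, hE, objData]
      rw [gen_lcusp_eq_zero hE le_rfl, map_zero, zero_mul]
    · simp only [blockDiff, hE]

theorem blockDiff_nil (ht : t ≤ Λ.size) {c : Chord} (hc : Λ.IsReeb s t 2 ⟨c, 0, 1⟩)
    (x : (Λ.augCat 𝕜 s t).Obj) : (Λ.blockDiff (Λ.catData 𝕜 s t) s c).val (nil x) = 0 :=
  (Λ.map_blockDiff (Λ.catData 𝕜 s t) (Coch.nilHom _ x) c).symm.trans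
    (Λ.blockDiff_objData ht hc x)

theorem blockDisks_nil {e : ℕ} (he : s ≤ e) (i j : ℕ) (x : (Λ.augCat 𝕜 s t).Obj) :
    (Λ.blockDisks (Λ.catData 𝕜 s t) s e i j).val (nil x) = Λ.evalDisks (Subtype.val (p := Λ.IsAug) x) e i j :=
  (Λ.map_blockDisks (Λ.catData 𝕜 s t) (Coch.nilHom _ x) e i j).symm.trans
    (Λ.blockDisks_objData he i j x)

/-- The structure maps in terms of cochains. -/
theorem augCat_b (ht : t ≤ Λ.size) {x y : (Λ.augCat 𝕜 s t).Obj} (f : Str (Λ.augCat 𝕜 s t).Hom x y)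
    (c : Λ.Plus s t) : (Λ.augCat 𝕜 s t).b f c =
      sig (Λ.deg s c.1 - 1) * (Λ.blockDiff (Λ.catData 𝕜 s t) s c.1).val f := by
  change (if f.length = 0 then 0 else Λ.strEval 𝕜 f (Λ.diff s t _ (Λ.gen s t _ ⟨c.1, 0, f.length⟩))) = _
  split_ifs with hf
  · cases f with
    | nil => rw [Λ.blockDiff_nil ht c.2, mul_zero]
    | cons g f => simp at hf
  · exact Λ.strEval_diff c.2 f (Nat.pos_of_ne_zero hf)

end Front


namespace AInf.Coch

open Str

variable {O : Type u} {H : O → O → Type u} [∀ x y, AddCommGroup (H x y)] {K : Type v} [CommRing K]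
  [∀ x y, Module K (H x y)] {φ : Coch H K}

theorem multilinear_val_add (h : φ ∈ multilinear H K) {x y z w : O} (u : Str H z w) (f g : H y z)
    (v : Str H x y) : φ.val (u.append (cons (f + g) v)) =
      φ.val (u.append (cons f v)) + φ.val (u.append (cons g v)) := by
  have := mem_multilinear.1 h u f g 1 v
  rwa [one_smul, one_mul] at this

theorem multilinear_val_smul (h : φ ∈ multilinear H K) {x y z w : O} (u : Str H z w) (a : K)
    (f : H y z) (v : Str H x y) : φ.val (u.append (cons (a • f) v)) =
      a * φ.val (u.append (cons f v)) := by
  have h0 := multilinear_val_add h u 0 0 v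
  rw [add_zero, left_eq_add] at h0
  have := mem_multilinear.1 h u 0 f a v
  rwa [zero_add, h0, zero_add] at this

end AInf.Coch

namespace Front

open Str

variable (Λ : Front) {𝕜 : Type u} [CommRing 𝕜] {s t : ℕ}

/-! ## The augmentation category is a strictly unital A-infinity category -/

instance finite_plus : Finite (Λ.Plus s t) := by
  let F : (Fin (Λ.slice s).n × Fin (Λ.slice s).n) ⊕ Fin t → Chord
    | .inl x => .line x.1 x.2
    | .inr e => .ev e
  have h : {c | Λ.IsReeb s t 2 ⟨c, 0, 1⟩} ⊆ Set.range F := by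
    rintro (⟨i, j⟩ | e) hc
    · exact ⟨.inl (⟨i, hc.2.2.1⟩, ⟨j, hc.2.2.2.1⟩), rfl⟩
    · exact ⟨.inr ⟨e, hc.2.2.2.1⟩, rfl⟩
  exact ((Set.finite_range F).subset h).to_subtype

theorem isInternal_support {ι : Type*} [Finite ι] (d : ι → ℤ) (G : ℤ → Submodule 𝕜 (ι → 𝕜))
    (hG : ∀ m f, f ∈ G m ↔ ∀ c, d c ≠ m → f c = 0) : DirectSum.IsInternal G := by
  classical
  have := Fintype.ofFinite ι
  refine DirectSum.isInternal_submodule_of_iSupIndep_of_iSup_eq_top ?_ ?_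
  · intro m
    let S : Submodule 𝕜 (ι → 𝕜) :=
      { carrier := {f | ∀ c, d c = m → f c = 0}
        add_mem' := fun hf hg c hc => by simp [hf c hc, hg c hc]
        zero_mem' := fun _ _ => rfl
        smul_mem' := fun a f hf c hc => by simp [hf c hc] }
    have h : ⨆ j, ⨆ _ : j ≠ m, G j ≤ S := iSup₂_le fun j hj f hf c hc =>
      (hG j f).1 hf c (by omega)
    rw [Submodule.disjoint_def]
    intro f hf hf'
    funext c
    by_cases hc : d c = m
    · exact h hf' c hc
    · exact (hG m f).1 hf c hc
  · rw [eq_top_iff]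
    intro f _
    rw [← Finset.univ_sum_single f]
    refine sum_mem fun c _ => Submodule.mem_iSup_of_mem (d c) ((hG _ _).2 fun c' hc' => ?_)
    rw [Pi.single_eq_of_ne]
    rintro rfl
    exact hc' rfl

theorem catData_line_lower {i j : ℕ} (h : j < i) : (Λ.catData 𝕜 s t).line i j = 0 :=
  Λ.catCoch_line_eq_zero (by omega)

theorem signHom_catData_mark (e : ℕ) : (Λ.augCat 𝕜 s t).signHom
    ((Λ.catData 𝕜 s t).mark e : Coch (Λ.augCat 𝕜 s t).Hom 𝕜) = (Λ.catData 𝕜 s t).mark e := by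
  exact AInfCat.signHom_ofObj _ _

theorem bDer_catData_mark (e : ℕ) : (Λ.augCat 𝕜 s t).bDer
    ((Λ.catData 𝕜 s t).mark e : Coch (Λ.augCat 𝕜 s t).Hom 𝕜) = 0 := by
  exact AInfCat.bDer_ofObj _ _

theorem bDer_catCoch (ht : t ≤ Λ.size) {c : Chord} (hc : Λ.IsReeb s t 2 ⟨c, 0, 1⟩) :
    (Λ.augCat 𝕜 s t).bDer (Λ.catCoch 𝕜 s t c) =
      - (sgn (Λ.deg s c) • Λ.blockDiff (Λ.catData 𝕜 s t) s c) := by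
  ext x y r
  rw [AInfCat.bDer_val_of_short _ (fun f g r => rfl), catCoch_single]
  have h : Λ.coord s t ((Λ.augCat 𝕜 s t).b r) c =
      sig (Λ.deg s c - 1) * (Λ.blockDiff (Λ.catData 𝕜 s t) s c).val r :=
    (Λ.coord_of_mem _ ⟨c, hc⟩).trans (Λ.augCat_b ht r ⟨c, hc⟩)
  rw [h, Coch.neg_val, Coch.zsmul_val, zsmul_eq_mul, sig_sub_one]
  have h2 := congrArg (Int.cast (R := 𝕜)) (sig_mul_self (Λ.deg s c))
  push_cast at h2 ⊢
  linear_combination (-(sgn (Λ.deg s c) : 𝕜) * (Λ.blockDiff (Λ.catData 𝕜 s t) s c).val r) * h2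

theorem isReeb_line {i j : ℕ} : Λ.IsReeb s t 2 ⟨.line i j, 0, 1⟩ ↔ i ≤ j ∧ j < (Λ.slice s).n := by
  simp only [IsReeb]
  omega

theorem isReeb_ev {e : ℕ} (h : (∃ k, Λ.event e = .cross k) ∨ ∃ k v, Λ.event e = .lcusp k v)
    (h1 : s ≤ e) (h2 : e < t) : Λ.IsReeb s t 2 ⟨.ev e, 0, 1⟩ := by
  refine ⟨by simp, by simp, h1, h2, ?_⟩
  rcases h with ⟨k, h⟩ | ⟨k, v, h⟩ <;> simp [h]

theorem structureEq_catData (ht : t ≤ Λ.size) : StructureEq (Λ.augCat 𝕜 s t).signHom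
    (Λ.augCat 𝕜 s t).bDer (Λ.catData 𝕜 s t).line := by
  intro i j N hj
  have hterm : ∀ l, (Λ.catData 𝕜 s t).line i l * (Λ.augCat 𝕜 s t).signHom
      ((Λ.catData 𝕜 s t).line l j) = sgn (Λ.deg s (.line l j)) •
        ((Λ.catData 𝕜 s t).line i l * (Λ.catData 𝕜 s t).line l j) := by
    intro l
    rw [catData_line _ l j, catCoch_parity, mul_smul_comm]
  simp only [hterm]
  by_cases hij : i ≤ j ∧ j < (Λ.slice s).n
  · rw [catData_line, Λ.bDer_catCoch ht (Λ.isReeb_line.2 hij), blockDiff, smul_neg, neg_neg,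
      ← sum_range_eq_of_lt (j := j) (N := j + 1) (N' := N) ?_ (by omega) hj, Finset.smul_sum,
      ← Finset.sum_neg_distrib]
    · refine Finset.sum_congr rfl fun l _ => ?_
      rw [smul_smul, ← neg_smul]
      congr 1
      have : Λ.deg s (.line i j) = Λ.deg s (.line i l) + Λ.deg s (.line l j) + 1 := by
        simp only [deg_line]; ring
      rw [this, sgn_add, sgn_add]
      have h1 : sgn 1 = -1 := by simp [sgn]
      rw [h1]
      linear_combination (- sgn (Λ.deg s (.line l j))) * sgn_mul_self (Λ.deg s (.line i l))
    · intro l hl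
      rw [Λ.catData_line_lower hl, mul_zero, smul_zero]
  · rw [catData_line, Λ.catCoch_line_eq_zero hij, map_zero, eq_comm, neg_eq_zero]
    refine Finset.sum_eq_zero fun l _ => ?_
    rcases Nat.lt_or_ge l i with h | h
    · rw [Λ.catData_line_lower h, zero_mul, smul_zero]
    · rw [catData_line _ l j, Λ.catCoch_line_eq_zero (by omega), mul_zero, smul_zero]

theorem bDer_blockDiff (ht : t ≤ Λ.size) {c : Chord} (hc : Λ.IsReeb s t 2 ⟨c, 0, 1⟩) :
    (Λ.augCat 𝕜 s t).bDer (Λ.blockDiff (Λ.catData 𝕜 s t) s c) = 0 := by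
  refine Λ.der_blockDiff (X := Λ.catData 𝕜 s t) (AInfCat.isTwistedDer_bDer _) c ?_
    (fun i j h => Λ.catData_line_lower h) (fun i j => Λ.catCoch_parity _)
    (fun _ _ e _ _ => Λ.catCoch_parity (.ev e)) (fun _ _ e _ _ => Λ.signHom_catData_mark e)
    (Λ.structureEq_catData ht) ?_ (fun _ _ e _ _ => Λ.bDer_catData_mark e)
  · rintro e rfl
    exact hc.2.2.1
  · rintro e rfl e' h1 h2 h3
    exact Λ.bDer_catCoch ht (Λ.isReeb_ev h3 h1 (h2.trans_lt hc.2.2.2.1))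

theorem blockDiff_mem_multilinear {c : Chord} (hc : Λ.IsReeb s t 2 ⟨c, 0, 1⟩) :
    Λ.blockDiff (Λ.catData 𝕜 s t) s c ∈ Coch.multilinear (Λ.augCat 𝕜 s t).Hom 𝕜 := by
  refine Λ.blockDiff_mem (Λ.catData 𝕜 s t) (𝒢 := fun _ => Coch.multilinear (Λ.augCat 𝕜 s t).Hom 𝕜)
    ?_ (fun h h' => Coch.multilinear_mul h h') c (fun i j => Λ.catCoch_mem_multilinear _)
    (fun _ _ _ e _ _ => Λ.catCoch_mem_multilinear _)
    (fun _ _ _ e _ _ => ⟨Coch.ofObj_mem_multilinear _, Coch.ofObj_mem_multilinear _⟩) ?_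
  · rw [Coch.one_eq_ofObj]; exact Coch.ofObj_mem_multilinear _
  · rintro e rfl
    exact hc.2.2.1

theorem blockDiff_mem_homogeneous {c : Chord} (hc : Λ.IsReeb s t 2 ⟨c, 0, 1⟩) :
    Λ.blockDiff (Λ.catData 𝕜 s t) s c ∈ (Λ.augCat 𝕜 s t).homogeneous (Λ.deg s c - 1) := by
  refine Λ.blockDiff_mem (Λ.catData 𝕜 s t) (𝒢 := (Λ.augCat 𝕜 s t).homogeneous)
    ?_ (fun h h' => AInfCat.homogeneous_mul h h') c (fun i j => Λ.catCoch_mem_homogeneous _)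
    (fun _ _ _ e _ _ => Λ.catCoch_mem_homogeneous (.ev e))
    (fun _ _ _ e _ _ => ⟨AInfCat.ofObj_mem_homogeneous _, AInfCat.ofObj_mem_homogeneous _⟩) ?_
  · rw [Coch.one_eq_ofObj]; exact AInfCat.ofObj_mem_homogeneous _
  · rintro e rfl
    exact hc.2.2.1

variable (𝕜) in
/-- The entries of the identity matrix of size `n`. -/
def unitAt (n i j : ℕ) : 𝕜 := if i = j ∧ j < n then 1 else 0

theorem unitAt_congr {n i j n' i' j' : ℕ} (h : (i = j ∧ j < n) ↔ (i' = j' ∧ j' < n')) :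
    unitAt 𝕜 n i j = unitAt 𝕜 n' i' j' := by
  simp only [unitAt, h]

theorem unitAt_zero {n i j : ℕ} (h : ¬ (i = j ∧ j < n)) : unitAt 𝕜 n i j = 0 := if_neg h

theorem unitAt_one {n i j : ℕ} (h : i = j ∧ j < n) : unitAt 𝕜 n i j = 1 := if_pos h

variable (𝕜 s t) in
/-- The coordinate of the units at a chord, up to sign. -/
def unitCoord : Chord → 𝕜
  | .line i j => unitAt 𝕜 (Λ.slice s).n i j
  | .ev e => match Λ.event e with
    | .lcusp _ _ => if s ≤ e ∧ e < t then 1 else 0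
    | _ => 0

theorem coord_one (x : (Λ.augCat 𝕜 s t).Obj) (c : Chord) :
    sig (Λ.deg s c) * Λ.coord s t ((Λ.augCat 𝕜 s t).one x) c = Λ.unitCoord 𝕜 s t c := by
  unfold coord
  split_ifs with h
  · cases c with
    | line i j =>
      have h1 : (Λ.augCat 𝕜 s t).one x ⟨.line i j, h⟩ = if i = j then -1 else 0 := rfl
      have hj := (Λ.isReeb_line.1 h).2
      rw [h1, unitCoord, unitAt]
      by_cases hij : i = j
      · subst hij
        simp [hj, deg_line]
      · simp [hij]
    | ev e =>
      have h1 : (Λ.augCat 𝕜 s t).one x ⟨.ev e, h⟩ = match Λ.event e with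
        | .lcusp _ _ => -1
        | _ => 0 := rfl
      have h2 := h.2.2.1
      have h3 := h.2.2.2.1
      rw [h1]
      rcases hE : Λ.event e with k | k | ⟨k, v⟩ | b
      · simp [unitCoord, hE]
      · simp [unitCoord, hE]
      · simp [unitCoord, hE, deg, h2, h3]
      · simp [unitCoord, hE]
  · rw [mul_zero]
    cases c with
    | line i j =>
      rw [isReeb_line] at h
      rw [unitCoord, unitAt_zero (by omega)]
    | ev e =>
      rcases hE : Λ.event e with k | k | ⟨k, v⟩ | b
      · simp [unitCoord, hE]
      · simp [unitCoord, hE]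
      · simp only [unitCoord, hE]
        rw [if_neg]
        rintro ⟨h1, h2⟩
        exact h (Λ.isReeb_ev (.inr ⟨k, v, hE⟩) h1 h2)
      · simp [unitCoord, hE]

theorem catCoch_atUnit (c : Chord) :
    (Λ.augCat 𝕜 s t).AtUnit (Λ.unitCoord 𝕜 s t c) (Λ.catCoch 𝕜 s t c) := by
  intro x y z u v
  split_ifs with h
  · cases u with
    | nil => cases v with
      | nil =>
        rw [nil_append, catCoch_cons_nil, coord_one]
      | cons f v => simp at h
    | cons f u => simp at h
  · exact Λ.catCoch_of_long _ _ (by simp; omega)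

theorem atUnit_congr {A : AInfCat 𝕜} {a b : 𝕜} {φ : Coch A.Hom 𝕜} (h : A.AtUnit a φ)
    (hab : a = b) : A.AtUnit b φ := hab ▸ h

theorem blockDisks_catData_lower (e : ℕ) {i j : ℕ} (h : j < i) :
    Λ.blockDisks (Λ.catData 𝕜 s t) s e i j = 0 :=
  Λ.blockDisks_lower _ (fun _ _ h => Λ.catData_line_lower h) e h

theorem blockDisks_atUnit {e : ℕ} (he : s ≤ e) (het : e ≤ t) (ht : t ≤ Λ.size) (i j : ℕ) :
    (Λ.augCat 𝕜 s t).AtUnit (unitAt 𝕜 (Λ.slice e).n i j)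
      (Λ.blockDisks (Λ.catData 𝕜 s t) s e i j) := by
  induction e, he using Nat.le_induction generalizing i j with
  | base =>
    rw [blockDisks_of_le _ _ le_rfl]
    exact Λ.catCoch_atUnit (.line i j)
  | succ e he ih =>
    have ih' := ih (by omega)
    have hl := Λ.legal e (by omega)
    have low := fun i j => Λ.blockDisks_catData_lower (𝕜 := 𝕜) (s := s) (t := t) e (i := i) (j := j)
    rw [blockDisks_succ _ _ he, slice_succ]
    set D := Λ.blockDisks (Λ.catData 𝕜 s t) s e
    have hD : ∀ {a b : ℕ}, a ≠ b → (Λ.augCat 𝕜 s t).AtUnit 0 (D a b) := fun h =>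
      atUnit_congr (ih' _ _) (unitAt_zero (by tauto))
    rcases hE : Λ.event e with k | k | ⟨k, v⟩ | b
    · have hk : k + 1 < (Λ.slice e).n := by rw [hE] at hl; exact hl
      have hC : (Λ.augCat 𝕜 s t).AtUnit 0 ((Λ.catData 𝕜 s t).ev e) :=
        atUnit_congr (Λ.catCoch_atUnit (.ev e)) (by simp [unitCoord, hE])
      have hC' := hC.zsmul (sgn (Λ.deg 0 (.ev e)))
      simp only [blockStep, hE]
      change (Λ.augCat 𝕜 s t).AtUnit (unitAt 𝕜 (Λ.slice e).n i j) _
      by_cases h1 : j < i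
      · rw [if_pos h1, unitAt_zero (by omega)]
        exact AInfCat.AtUnit.zero
      rw [if_neg h1]
      simp only [rowOp, colOp]
      by_cases hi : i = k
      · subst hi
        simp only [if_true]
        by_cases hj : j = i
        · subst hj
          simp only [if_true]
          rw [low (j + 1) j (by omega), zero_mul, add_zero]
          exact atUnit_congr (ih' _ _) (unitAt_congr (by omega))
        · rw [if_neg hj, unitAt_zero (by omega)]
          split_ifs
          · exact hD (by omega)
          · exact hD (by omega)
      rw [if_neg hi]
      by_cases hi' : i = k + 1
      · subst hi'
        rw [if_pos rfl]
        by_cases hj : j = k + 1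
        · subst hj
          simp only [if_neg hi, if_true]
          rw [low (k + 1) k (by omega), mul_zero, sub_zero]
          exact atUnit_congr (ih' _ _) (unitAt_congr (by omega))
        · simp only [if_neg hj]
          rw [if_neg (by omega), if_neg (by omega), unitAt_zero (by omega)]
          exact atUnit_congr ((hD (by omega)).sub (hC'.mul (hD (by omega)))) (by simp)
      rw [if_neg hi']
      by_cases hj : j = k
      · subst hj
        rw [if_pos rfl, unitAt_zero (by omega)]
        exact atUnit_congr ((hD (by omega)).add ((hD hi).mul hC)) (by simp)
      rw [if_neg hj]
      by_cases hj' : j = k + 1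
      · subst hj'
        rw [if_pos rfl, unitAt_zero (by omega)]
        exact hD (by omega)
      rw [if_neg hj']
      exact ih' i j
    · simp only [blockStep, hE]
      change (Λ.augCat 𝕜 s t).AtUnit (unitAt 𝕜 (Λ.slice e).n i j) _
      have h1 : ∀ i, ((if i = k then (Λ.catData 𝕜 s t).mark e else 1 : (Coch (Λ.augCat 𝕜 s t).Hom 𝕜)ˣ) :
          Coch (Λ.augCat 𝕜 s t).Hom 𝕜) = Coch.ofObj fun x => if i = k then (Λ.objMark x e : 𝕜) else 1 := by
        intro i
        split_ifs
        · rfl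
        · exact Coch.one_eq_ofObj
      have h2 : ∀ i, (((if i = k then (Λ.catData 𝕜 s t).mark e else 1)⁻¹ : (Coch (Λ.augCat 𝕜 s t).Hom 𝕜)ˣ) :
          Coch (Λ.augCat 𝕜 s t).Hom 𝕜) =
            Coch.ofObj fun x => if i = k then (((Λ.objMark x e)⁻¹ : 𝕜ˣ) : 𝕜) else 1 := by
        intro i
        split_ifs
        · rfl
        · rw [inv_one]; exact Coch.one_eq_ofObj
      rw [h1, h2]
      refine (ih' i j).conj _ _ fun h x => ?_
      obtain rfl : i = j := by
        by_contra h'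
        exact h (unitAt_zero (by tauto))
      split_ifs <;> simp
    · have hC : (Λ.augCat 𝕜 s t).AtUnit 1 ((Λ.catData 𝕜 s t).ev e) :=
        atUnit_congr (Λ.catCoch_atUnit (.ev e)) (by simp [unitCoord, hE]; omega)
      have hk : k ≤ (Λ.slice e).n := by rw [hE] at hl; exact hl
      simp only [blockStep, hE]
      change (Λ.augCat 𝕜 s t).AtUnit (unitAt 𝕜 ((Λ.slice e).n + 2) i j) _
      by_cases h1 : i = k ∧ j = k + 1
      · rw [if_pos h1, unitAt_zero (by omega), Coch.one_eq_ofObj]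
        exact AInfCat.atUnit_ofObj _
      rw [if_neg h1]
      by_cases h2 : (i = k ∧ j = k) ∨ (i = k + 1 ∧ j = k + 1)
      · rw [if_pos h2, unitAt_one (by omega)]
        exact hC
      rw [if_neg h2]
      by_cases h3 : i = k ∨ i = k + 1 ∨ j = k ∨ j = k + 1
      · rw [if_pos h3, unitAt_zero (by omega)]
        exact AInfCat.AtUnit.zero
      rw [if_neg h3]
      refine atUnit_congr (ih' _ _) (unitAt_congr ?_)
      split_ifs <;> omega
    · simp only [blockStep, hE]
      change (Λ.augCat 𝕜 s t).AtUnit (unitAt 𝕜 ((Λ.slice e).n - 2) i j) _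
      split_ifs with h1
      · exact atUnit_congr (ih' _ _) (unitAt_congr (by omega))
      · rw [unitAt_zero (by omega)]
        exact AInfCat.AtUnit.zero

theorem blockDiff_at_unit (ht : t ≤ Λ.size) {c : Chord} (hc : Λ.IsReeb s t 2 ⟨c, 0, 1⟩)
    {x y z : (Λ.augCat 𝕜 s t).Obj} (u : Str (Λ.augCat 𝕜 s t).Hom y z)
    (v : Str (Λ.augCat 𝕜 s t).Hom x y) :
    (Λ.blockDiff (Λ.catData 𝕜 s t) s c).val (u.append (cons ((Λ.augCat 𝕜 s t).one y) v)) =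
      (if v.length = 0 then (Λ.catCoch 𝕜 s t c).val u else 0) -
        sgn (Λ.deg s c) * if u.length = 0 then (Λ.catCoch 𝕜 s t c).val v else 0 := by
  cases c with
  | line i j =>
    have hij := Λ.isReeb_line.1 hc
    rw [blockDiff, Coch.neg_val, Coch.sum_val]
    have h : ∀ l, (sgn (Λ.deg s (.line i l)) • ((Λ.catData 𝕜 s t).line i l *
        (Λ.catData 𝕜 s t).line l j)).val (u.append (cons ((Λ.augCat 𝕜 s t).one y) v)) =
        (if i = l then - (if v.length = 0 then (Λ.catCoch 𝕜 s t (.line i j)).val u else 0) else 0) +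
        if l = j then sgn (Λ.deg s (.line i j)) *
          (if u.length = 0 then (Λ.catCoch 𝕜 s t (.line i j)).val v else 0) else 0 := by
      intro l
      rw [Coch.zsmul_val, catData_line, catData_line, (Λ.catCoch_atUnit (.line i l)).mul_val (Λ.catCoch_atUnit (.line l j)),
        smul_add, zsmul_eq_mul, zsmul_eq_mul]
      simp only [unitCoord]
      congr 1
      · by_cases h1 : i = l
        · subst h1
          rw [if_pos rfl, unitAt_one (by omega)]
          split_ifs <;> simp [deg_line]
        · rw [unitAt_zero (by omega), if_neg h1]
          simp
      · by_cases h1 : l = j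
        · subst h1
          rw [if_pos rfl, unitAt_one (by omega)]
          simp
        · rw [unitAt_zero (by omega), if_neg h1]
          simp
    simp only [h, Finset.sum_add_distrib, Finset.sum_ite_eq, Finset.sum_ite_eq']
    have hi : i ∈ Finset.range (j + 1) := by simp; omega
    have hj : j ∈ Finset.range (j + 1) := by simp
    rw [if_pos hi, if_pos hj]
    ring
  | ev e =>
    have h1 := hc.2.2.1
    have h2 := hc.2.2.2.1
    have h3 := hc.2.2.2.2
    rcases hE : Λ.event e with k | k | ⟨k, v⟩ | b
    · have hl := Λ.legal e (by omega)
      have hk : k + 1 < (Λ.slice e).n := by rw [hE] at hl; exact hl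
      have hC : (Λ.augCat 𝕜 s t).AtUnit 0 ((Λ.catData 𝕜 s t).ev e) :=
        atUnit_congr (Λ.catCoch_atUnit (.ev e)) (by simp [unitCoord, hE])
      have hD := Λ.blockDisks_atUnit (𝕜 := 𝕜) h1 h2.le ht
      simp only [blockDiff, hE]
      rw [Coch.sub_val, Coch.add_val, Coch.zsmul_val, hD k (k + 1) u v, (hD k k).mul_val hC,
        hC.mul_val (hD (k + 1) (k + 1)), unitAt_zero (by omega),
        unitAt_one (by omega), unitAt_one (by omega), zsmul_eq_mul]
      simp [catData_ev, deg]
    · simp [hE] at h3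
    · have hC : (Λ.augCat 𝕜 s t).AtUnit 1 ((Λ.catData 𝕜 s t).ev e) :=
        atUnit_congr (Λ.catCoch_atUnit (.ev e)) (by simp [unitCoord, hE]; omega)
      simp only [blockDiff, hE]
      rw [hC.mul_val hC]
      have h4 : sgn (Λ.deg s (.ev e)) = -1 := by simp [deg, hE, sgn]
      rw [h4, catData_ev]
      push_cast
      split_ifs <;> ring
    · simp [hE] at h3

theorem augCat_b_at_unit (ht : t ≤ Λ.size) (c : Λ.Plus s t)
    {x y z : (Λ.augCat 𝕜 s t).Obj} (u : Str (Λ.augCat 𝕜 s t).Hom y z)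
    (v : Str (Λ.augCat 𝕜 s t).Hom x y) :
    (Λ.augCat 𝕜 s t).b (u.append (cons ((Λ.augCat 𝕜 s t).one y) v)) c =
      sig (Λ.deg s c.1 - 1) * ((if v.length = 0 then (Λ.catCoch 𝕜 s t c.1).val u else 0) -
        sgn (Λ.deg s c.1) * if u.length = 0 then (Λ.catCoch 𝕜 s t c.1).val v else 0) :=
  (Λ.augCat_b ht _ c).trans (congrArg _ (Λ.blockDiff_at_unit ht c.2 u v))

/-- Evaluation of morphisms at a chord. -/
def evalHom (c : Λ.Plus s t) (x y : (Λ.augCat 𝕜 s t).Obj) : (Λ.augCat 𝕜 s t).Hom x y →+ 𝕜 where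
  toFun f := f c
  map_zero' := rfl
  map_add' _ _ := rfl

theorem sig_mul_sig_sub_one (d : ℤ) : (sig (d - 1) : 𝕜) * sig d = - sgn d := by
  have h := congrArg (Int.cast (R := 𝕜)) (sig_mul_self d)
  rw [sig_sub_one]
  push_cast at h ⊢
  linear_combination (- (sgn d : 𝕜)) * h

theorem isAInf_augCat (ht : t ≤ Λ.size) : (Λ.augCat 𝕜 s t).IsAInf where
  graded x y := isInternal_support (fun c : Λ.Plus s t => Λ.deg s c.1 + 1) _ fun _ _ => Iff.rfl
  par_eq x y d f hf := by
    funext c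
    change (sgn (Λ.deg s c.1 + 1) : 𝕜) * f c = (sgn d • f) c
    by_cases h : Λ.deg s c.1 + 1 = d
    · rw [h]
      exact (zsmul_eq_mul _ _).symm
    · have h1 : f c = 0 := hf c h
      rw [h1, mul_zero]
      change 0 = sgn d • f c
      rw [h1, smul_zero]
  par_add x y f g := by
    funext c
    exact mul_add _ _ _
  b_add u f g v := by
    funext c
    refine (Λ.augCat_b ht _ c).trans ?_
    rw [Coch.multilinear_val_add (Λ.blockDiff_mem_multilinear c.2), mul_add]
    exact (congrArg₂ (· + ·) (Λ.augCat_b ht _ c) (Λ.augCat_b ht _ c)).symm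
  b_smul u a f v := by
    funext c
    refine (Λ.augCat_b ht _ c).trans ?_
    rw [Coch.multilinear_val_smul (Λ.blockDiff_mem_multilinear c.2), mul_left_comm]
    exact (congrArg (a * ·) (Λ.augCat_b ht _ c)).symm
  b_nil x := by
    funext c
    exact if_pos (length_nil x)
  b_deg f d hf c hc := by
    refine (Λ.augCat_b ht f c).trans ?_
    rw [Λ.blockDiff_mem_homogeneous c.2 f d hf (by omega), mul_zero]
  b_b {x y} f := by
    funext c
    change Λ.evalHom c x y (((Λ.augCat 𝕜 s t).bHat f).map (Λ.augCat 𝕜 s t).b).sum = 0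
    rw [map_list_sum, List.map_map]
    have h : (Λ.evalHom c x y : (Λ.augCat 𝕜 s t).Hom x y → 𝕜) ∘ (Λ.augCat 𝕜 s t).b =
        fun r => (sig (Λ.deg s c.1 - 1) : 𝕜) * (Λ.blockDiff (Λ.catData 𝕜 s t) s c.1).val r :=
      funext fun r => Λ.augCat_b ht r c
    rw [h, List.sum_map_mul_left]
    have h1 : ((Λ.augCat 𝕜 s t).bDer (Λ.blockDiff (Λ.catData 𝕜 s t) s c.1)).val f = 0 := by
      rw [Λ.bDer_blockDiff ht c.2]; rfl
    exact (congrArg _ h1).trans (mul_zero _)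
  one_deg x c hc := by
    obtain ⟨c, h⟩ := c
    cases c with
    | line i j => exact if_neg fun h => hc (by simp [deg_line, h])
    | ev e =>
      change (match Λ.event e with
        | .lcusp _ _ => -1
        | _ => 0) = (0 : 𝕜)
      rcases hE : Λ.event e with k | k | ⟨k, v⟩ | b
      · rfl
      · rfl
      · exact absurd (by simp [deg, hE]) hc
      · rfl
  b_one x := by
    funext c
    have h0 := Λ.augCat_b_at_unit ht c (nil x) (nil x)
    rw [nil_append] at h0
    refine h0.trans ?_
    simp only [length_nil, if_true]
    change _ = (0 : 𝕜)
    by_cases h : Λ.deg s c.1 = 0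
    · rw [h]; simp
    · rw [Λ.catCoch_nil_of_deg h]; simp
  one_left {x y} f := by
    funext c
    have h0 := Λ.augCat_b_at_unit ht c (nil y) (single f)
    rw [nil_append] at h0
    refine h0.trans ?_
    rw [if_neg (by simp [single]), if_pos (by simp), catCoch_single]
    have h := Λ.coord_of_mem f c
    have h1 := sig_mul_sig_sub_one (𝕜 := 𝕜) (Λ.deg s c.1)
    have h2 := congrArg (Int.cast (R := 𝕜)) (sgn_mul_self (Λ.deg s c.1))
    push_cast at h2
    linear_combination h - (sgn (Λ.deg s c.1) * Λ.coord s t f c) * h1 + Λ.coord s t f c * h2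
  one_right {x y} f := by
    funext c
    have h0 := Λ.augCat_b_at_unit ht c (single f) (nil x)
    rw [single, cons_append, nil_append] at h0
    refine h0.trans ?_
    rw [if_pos (by simp), if_neg (by simp), catCoch_cons_nil]
    have h := Λ.coord_of_mem f c
    have h1 := sig_mul_sig_sub_one (𝕜 := 𝕜) (Λ.deg s c.1)
    change _ = (sgn (Λ.deg s c.1 + 1) : 𝕜) * f c
    have h2 : (sgn (Λ.deg s c.1 + 1) : 𝕜) = - sgn (Λ.deg s c.1) := by
      rw [sgn_add]; simp [sgn]
    linear_combination Λ.coord s t f c * h1 - (sgn (Λ.deg s c.1) : 𝕜) * h - f c * h2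
  one_long u v h := by
    funext c
    refine (Λ.augCat_b_at_unit ht c u v).trans ?_
    have h1 : (if v.length = 0 then (Λ.catCoch 𝕜 s t c.1).val u else 0) = 0 := by
      split_ifs
      · exact Λ.catCoch_of_long _ _ (by omega)
      · rfl
    have h2 : (if u.length = 0 then (Λ.catCoch 𝕜 s t c.1).val v else 0) = 0 := by
      split_ifs
      · exact Λ.catCoch_of_long _ _ (by omega)
      · rfl
    rw [h1, h2, mul_zero, sub_zero, mul_zero]
    rfl

end Front


namespace Front

open Str

variable (Λ : Front) {𝕜 : Type u} [CommRing 𝕜] {s t s' t' : ℕ}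

/-! ## Restrictions in terms of cochains -/

section

variable {R : Type*} [Ring R] {X Y : SweepData R}

theorem blockDisks_right {s e : ℕ} (he : s ≤ e) (hes : e ≤ Λ.size)
    (h : ∀ i j, (Λ.slice s).n ≤ j → X.line i j = 0) {i j : ℕ} (hj : (Λ.slice e).n ≤ j) :
    Λ.blockDisks X s e i j = 0 := by
  induction e, he using Nat.le_induction generalizing i j with
  | base => rw [blockDisks_of_le _ _ le_rfl, h _ _ hj]
  | succ e he ih =>
    have ih' := fun i j => ih (by omega) (i := i) (j := j)
    have hl := Λ.legal e (by omega)
    rw [blockDisks_succ _ _ he, blockStep]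
    rw [slice_succ] at hj
    rcases hE : Λ.event e with k | k | ⟨k, v⟩ | b
    · have hk : k + 1 < (Λ.slice e).n := by rw [hE] at hl; exact hl
      have hj' : (Λ.slice e).n ≤ j := by rw [hE] at hj; exact hj
      have : ∀ i, colOp k (X.ev e) (Λ.blockDisks X s e) i j = 0 := by
        intro i
        rw [colOp, if_neg (by omega), if_neg (by omega), ih' _ _ hj']
      simp only [rowOp, this]
      split_ifs <;> simp
    · have hj' : (Λ.slice e).n ≤ j := by rw [hE] at hj; exact hj
      simp [ih' _ _ hj']
    · have hk : k ≤ (Λ.slice e).n := by rw [hE] at hl; exact hl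
      have hj' : (Λ.slice e).n + 2 ≤ j := by rw [hE] at hj; exact hj
      simp only
      rw [if_neg (by omega), if_neg (by omega)]
      split_ifs
      all_goals first | rfl | exact ih' _ _ (by omega)
    · have hj' : (Λ.slice e).n - 2 ≤ j := by rw [hE] at hj; exact hj
      simp only
      rw [if_neg (by omega)]

theorem blockDiff_congr {s : ℕ} {c : Chord} (h : X.line = Y.line)
    (h1 : ∀ e, c = .ev e → ∀ e', s ≤ e' → e' ≤ e → X.ev e' = Y.ev e')
    (h2 : ∀ e, c = .ev e → ∀ e', s ≤ e' → e' < e → X.mark e' = Y.mark e')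
    (hc : ∀ e, c = .ev e → s ≤ e) :
    Λ.blockDiff X s c = Λ.blockDiff Y s c := by
  cases c with
  | line i j => simp only [blockDiff, h]
  | ev e =>
    have h3 := Λ.blockDisks_congr (s := s) h (fun e' a b => h1 e rfl e' a b.le) (h2 e rfl)
    simp only [blockDiff, h3, h1 e rfl e (hc e rfl) le_rfl]

end

variable (𝕜 s t s') in
/-- The cochains of a part of the front starting with the event `s'`, as cochains of a larger
part. -/
def resData : SweepData (Coch (Λ.augCat 𝕜 s t).Hom 𝕜) :=
  ⟨Λ.blockDisks (Λ.catData 𝕜 s t) s s', (Λ.catData 𝕜 s t).ev, (Λ.catData 𝕜 s t).mark⟩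

variable (𝕜 s t s') in
/-- The cochain giving the value of a chord on the restriction to a part of the front starting with
the event `s'`. -/
def resCoch : Chord → Coch (Λ.augCat 𝕜 s t).Hom 𝕜
  | .line i j => (Λ.resData 𝕜 s t s').line i j
  | .ev e => (Λ.resData 𝕜 s t s').ev e

theorem blockDisks_resData (h : s ≤ s') {e : ℕ} (he : s' ≤ e) :
    Λ.blockDisks (Λ.resData 𝕜 s t s') s' e = Λ.blockDisks (Λ.catData 𝕜 s t) s e :=
  (Λ.blockDisks_append _ h he).symm

/-- The chords which make sense for the part of the front with the events `e`, `s ≤ e < t`. -/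
def Lies (s t : ℕ) (c : Chord) : Prop := ∀ e, c = .ev e → s ≤ e ∧ e < t

theorem IsReeb.lies {c : Chord} {m p q : ℕ} (hc : Λ.IsReeb s t m ⟨c, p, q⟩) : Lies s t c := by
  rintro e rfl
  exact ⟨hc.2.2.1, hc.2.2.2.1⟩

theorem corestrict_line {m i j p q : ℕ} (hr : Λ.IsReeb s' t' m ⟨.line i j, p, q⟩) :
    Λ.corestrict s t s' t' m (Λ.gen s' t' m ⟨.line i j, p, q⟩) =
      Λ.sweep (Λ.gen s t m) (Λ.tgen s t m) (border (Λ.gen s t m) m)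
          (Λ.elems m s s') (m * i + p) (m * j + q) := by
  rw [corestrict, Λ.lift_gen _ _ ⟨_, hr⟩]

theorem corestrict_ev {m e p q : ℕ} (hr : Λ.IsReeb s' t' m ⟨.ev e, p, q⟩) :
    Λ.corestrict s t s' t' m (Λ.gen s' t' m ⟨.ev e, p, q⟩) = Λ.gen s t m ⟨.ev e, p, q⟩ := by
  rw [corestrict, Λ.lift_gen _ _ ⟨_, hr⟩]

theorem isReeb_multi {c : Chord} (hc : Λ.IsReeb s t 2 ⟨c, 0, 1⟩) {L : ℕ} (hL : 0 < L) :
    Λ.IsReeb s t (L + 1) ⟨c, 0, L⟩ := by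
  simp only [IsReeb] at hc ⊢
  cases c with
  | line i j => simp only at hc ⊢; omega
  | ev e =>
    refine ⟨by omega, by omega, hc.2.2.1, hc.2.2.2.1, ?_⟩
    have := hc.2.2.2.2
    rcases hE : Λ.event e with k | k | ⟨k, v⟩ | b <;> simp_all

theorem augRes_map (h : s ≤ s') (hst : s' ≤ t') (h' : t' ≤ t) (ht : t ≤ Λ.size)
    {x y : (Λ.augCat 𝕜 s t).Obj} (f : Str (Λ.augCat 𝕜 s t).Hom x y)
    (hf : 0 < f.length) (c : Λ.Plus s' t') :
    (Λ.augRes 𝕜 h hst h' ht).map x y f c =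
      sig (Λ.deg s' c.1) * (Λ.resCoch 𝕜 s t s' c.1).val f := by
  have h1 : (Λ.augRes 𝕜 h hst h' ht).map x y f c = Λ.strEval 𝕜 f
      (Λ.corestrict s t s' t' _ (Λ.gen s' t' _ ⟨c.1, 0, f.length⟩)) := if_neg (by omega)
  rw [h1]
  have hr := Λ.isReeb_multi c.2 hf
  obtain ⟨c, hc⟩ := c
  cases c with
  | line i j =>
    exact (congrArg (Λ.strEval 𝕜 f) (Λ.corestrict_line hr)).trans (Λ.strEval_sweep f hf h i j)
  | ev e =>
    exact (congrArg (Λ.strEval 𝕜 f) (Λ.corestrict_ev hr)).trans (Λ.strEval_gen f hf (.ev e))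

theorem augRes_map_nil (h : s ≤ s') (hst : s' ≤ t') (h' : t' ≤ t) (ht : t ≤ Λ.size)
    (x : (Λ.augCat 𝕜 s t).Obj) :
    (Λ.augRes 𝕜 h hst h' ht).map x x (nil x) = 0 := by
  funext c
  exact if_pos (length_nil x)

theorem augRes_gen_line (h : s ≤ s') (hst : s' ≤ t') (h' : t' ≤ t) (ht : t ≤ Λ.size)
    (x : Λ.AugObj 𝕜 s t) (i j : ℕ) :
    (x.1.comp (Λ.corestrict s t s' t' 1)) (Λ.gen s' t' 1 ⟨.line i j, 0, 0⟩) =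
      Λ.evalDisks x.1 s' i j := by
  have hinv := Λ.evalDisks_inv ht x.2 h (hst.trans h')
  by_cases hr : Λ.IsReeb s' t' 1 ⟨.line i j, 0, 0⟩
  · rw [RingHom.comp_apply, Λ.corestrict_line hr, evalDisks_eq]
    simp
  · rw [Λ.gen_eq_zero hr, map_zero]
    by_contra hne
    have := hinv.supp i j (Ne.symm hne)
    apply hr
    simp [IsReeb]
    omega

theorem augRes_gen_ev (x : Λ.AugObj 𝕜 s t) {e : ℕ} (h2 : s' ≤ e) (h3 : e < t') (p q : ℕ) :
    (x.1.comp (Λ.corestrict s t s' t' 1)) (Λ.gen s' t' 1 ⟨.ev e, p, q⟩) =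
      x.1 (Λ.gen s t 1 ⟨.ev e, p, q⟩) := by
  by_cases hr : Λ.IsReeb s' t' 1 ⟨.ev e, p, q⟩
  · rw [RingHom.comp_apply, Λ.corestrict_ev hr]
  · have hr' : ¬ Λ.IsReeb s t 1 ⟨.ev e, p, q⟩ := fun h4 =>
      hr ⟨h4.1, h4.2.1, h2, h3, h4.2.2.2.2⟩
    rw [Λ.gen_eq_zero hr, Λ.gen_eq_zero hr', map_zero, map_zero]

theorem augRes_tgen (x : Λ.AugObj 𝕜 s t) {e : ℕ} (h2 : s' ≤ e) (h3 : e < t') (p : ℕ) :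
    Units.map (x.1.comp (Λ.corestrict s t s' t' 1)).toMonoidHom (Λ.tgen s' t' 1 e p) =
      Units.map x.1.toMonoidHom (Λ.tgen s t 1 e p) := by
  by_cases hr : Λ.IsMark s' t' 1 (e, p)
  · apply Units.ext
    have : Λ.corestrict s t s' t' 1 (Λ.tgen s' t' 1 e p : Λ.Alg s' t' 1) = Λ.tgen s t 1 e p := by
      rw [corestrict, Λ.lift_tgen _ _ ⟨_, hr⟩]
    exact congrArg x.1 this
  · have hr' : ¬ Λ.IsMark s t 1 (e, p) := fun h5 => hr ⟨h5.1, h2, h3, h5.2.2.2⟩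
    simp [tgen, hr, hr']

theorem catCoch_mem_line (i j : ℕ) (hj : (Λ.slice s).n ≤ j) : (Λ.catData 𝕜 s t).line i j = 0 :=
  Λ.catCoch_line_eq_zero (by omega)

theorem pullback_catCoch (h : s ≤ s') (hst : s' ≤ t') (h' : t' ≤ t) (ht : t ≤ Λ.size)
    {c : Chord} (hc : Lies s' t' c) :
    (Λ.augRes 𝕜 h hst h' ht).pullback (Λ.catCoch 𝕜 s' t' c) = Λ.resCoch 𝕜 s t s' c := by
  ext x y f
  cases f with
  | nil =>
    rw [AInfFunctor.pullback_nil]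
    cases c with
    | line i j =>
      exact (Λ.augRes_gen_line h hst h' ht x i j).trans (Λ.blockDisks_nil h i j x).symm
    | ev e =>
      obtain ⟨h1, h2⟩ := hc e rfl
      exact Λ.augRes_gen_ev x h1 h2 0 0
  | cons f r =>
    rw [AInfFunctor.pullback_val_of_short _ fun f g r => rfl, catCoch_single]
    by_cases hr : Λ.IsReeb s' t' 2 ⟨c, 0, 1⟩
    · have h1 := (Λ.coord_of_mem ((Λ.augRes 𝕜 h hst h' ht).map _ _ (cons f r)) ⟨c, hr⟩).trans
        (Λ.augRes_map h hst h' ht (cons f r) (by simp) ⟨c, hr⟩)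
      have h2 := congrArg (Int.cast (R := 𝕜)) (sig_mul_self (Λ.deg s' c))
      push_cast at h2
      refine (congrArg _ h1).trans ?_
      linear_combination (Λ.resCoch 𝕜 s t s' c).val (cons f r) * h2
    · have h1 := Λ.coord_of_not_mem ((Λ.augRes 𝕜 h hst h' ht).map _ _ (cons f r)) hr
      refine (congrArg _ h1).trans ?_
      have h2 : Λ.resCoch 𝕜 s t s' c = 0 := by
        cases c with
        | line i j =>
          rw [isReeb_line] at hr
          rcases Nat.lt_or_ge j i with h3 | h3
          · exact Λ.blockDisks_catData_lower s' h3
          · exact Λ.blockDisks_right h (by omega) (fun i j => Λ.catCoch_mem_line i j) (by omega)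
        | ev e =>
          obtain ⟨h3, h4⟩ := hc e rfl
          refine Λ.catCoch_ev_eq_zero ?_
          by_contra h5
          refine hr (Λ.isReeb_ev ?_ h3 h4)
          rcases hE : Λ.event e with k | k | ⟨k, v⟩ | b <;> simp_all
      rw [h2, mul_zero]
      rfl

theorem objMark_augRes (h : s ≤ s') (hst : s' ≤ t') (h' : t' ≤ t) (ht : t ≤ Λ.size)
    (x : (Λ.augCat 𝕜 s t).Obj) {e : ℕ} (h1 : s' ≤ e) (h2 : e < t') :
    Λ.objMark ((Λ.augRes 𝕜 h hst h' ht).obj x) e = Λ.objMark x e :=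
  Λ.markFactor_congr (Λ.augRes_tgen x h1 h2 0)

theorem pullback_mark (h : s ≤ s') (hst : s' ≤ t') (h' : t' ≤ t) (ht : t ≤ Λ.size)
    {e : ℕ} (h1 : s' ≤ e) (h2 : e < t') :
    ((Λ.catData 𝕜 s' t').map (Λ.augRes 𝕜 h hst h' ht).pullback).mark e =
      (Λ.catData 𝕜 s t).mark e := by
  apply Units.ext
  refine ((Λ.augRes 𝕜 h hst h' ht).pullback_ofObj (K := 𝕜) _).trans ?_
  refine congrArg Coch.ofObj (funext fun x => ?_)
  exact congrArg Units.val (Λ.objMark_augRes h hst h' ht x h1 h2)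

theorem pullback_blockDisks (h : s ≤ s') (hst : s' ≤ t') (h' : t' ≤ t) (ht : t ≤ Λ.size)
    {e : ℕ} (h1 : s' ≤ e) (h2 : e ≤ t') (i j : ℕ) :
    (Λ.augRes 𝕜 h hst h' ht).pullback (Λ.blockDisks (Λ.catData 𝕜 s' t') s' e i j) =
      Λ.blockDisks (Λ.catData 𝕜 s t) s e i j := by
  rw [← Λ.map_blockDisks, ← Λ.blockDisks_resData h h1]
  refine congrFun (congrFun (Λ.blockDisks_congr ?_ (fun e' h3 h4 => ?_) fun e' h3 h4 => ?_) i) j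
  · funext i j
    exact Λ.pullback_catCoch h hst h' ht (c := .line i j) nofun
  · refine Λ.pullback_catCoch h hst h' ht (c := .ev e') ?_
    rintro _ ⟨⟩
    omega
  · exact Λ.pullback_mark h hst h' ht h3 (by omega)

theorem pullback_blockDiff (h : s ≤ s') (hst : s' ≤ t') (h' : t' ≤ t) (ht : t ≤ Λ.size)
    {c : Chord} (hc : Lies s' t' c) :
    (Λ.augRes 𝕜 h hst h' ht).pullback (Λ.blockDiff (Λ.catData 𝕜 s' t') s' c) =
      Λ.blockDiff (Λ.resData 𝕜 s t s') s' c := by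
  rw [← Λ.map_blockDiff]
  refine Λ.blockDiff_congr ?_ (fun e h1 e' h3 h4 => ?_) (fun e h1 e' h3 h4 => ?_) fun e h1 => (hc e h1).1
  · funext i j
    exact Λ.pullback_catCoch h hst h' ht (c := .line i j) nofun
  · refine Λ.pullback_catCoch h hst h' ht (c := .ev e') ?_
    have := hc e h1
    rintro _ ⟨⟩
    omega
  · have := hc e h1
    exact Λ.pullback_mark h hst h' ht h3 (by omega)

theorem structureEq_resData (h : s ≤ s') (ht : t ≤ Λ.size)
    (hs' : s' ≤ t) : StructureEq (Λ.augCat 𝕜 s t).signHom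
    (Λ.augCat 𝕜 s t).bDer (Λ.resData 𝕜 s t s').line :=
  Λ.structureEq_blockDisks (X := Λ.catData 𝕜 s t) (AInfCat.isTwistedDer_bDer _) h
    (fun i j h => Λ.catData_line_lower h) (fun i j => Λ.catCoch_parity _)
    (fun e _ _ => Λ.catCoch_parity (.ev e)) (fun e _ _ => Λ.signHom_catData_mark e)
    (Λ.structureEq_catData ht) (fun e h1 h2 h3 => Λ.bDer_catCoch ht (Λ.isReeb_ev h3 h1 (by omega)))
    (fun e _ _ => Λ.bDer_catData_mark e)

theorem bDer_resCoch (h : s ≤ s') (hst : s' ≤ t') (h' : t' ≤ t) (ht : t ≤ Λ.size)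
    {c : Chord} (hc : Λ.IsReeb s' t' 2 ⟨c, 0, 1⟩) :
    (Λ.augCat 𝕜 s t).bDer (Λ.resCoch 𝕜 s t s' c) =
      - (sgn (Λ.deg s' c) • Λ.blockDiff (Λ.resData 𝕜 s t s') s' c) := by
  cases c with
  | line i j =>
    have hpar := Λ.blockDisks_parity (X := Λ.catData 𝕜 s t) (α := (Λ.augCat 𝕜 s t).signHom) h
      (fun i j => Λ.catCoch_parity _)
      (fun e _ _ => Λ.catCoch_parity (.ev e)) (fun e _ _ => Λ.signHom_catData_mark e)
    refine (Λ.structureEq_resData h ht (by omega) i j (j + 1) (by omega)).trans ?_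
    rw [blockDiff, smul_neg, neg_neg, Finset.smul_sum, ← Finset.sum_neg_distrib]
    refine Finset.sum_congr rfl fun l _ => ?_
    have h0 : (Λ.augCat 𝕜 s t).signHom ((Λ.resData 𝕜 s t s').line l j) =
      sgn (Λ.deg s' (.line l j)) • (Λ.resData 𝕜 s t s').line l j := hpar l j
    rw [h0, mul_smul_comm, smul_smul, ← neg_smul]
    congr 1
    have : Λ.deg s' (.line i j) = Λ.deg s' (.line i l) + Λ.deg s' (.line l j) + 1 := by
      simp only [deg_line]; ring
    rw [this, sgn_add, sgn_add]
    have h1 : sgn 1 = -1 := by simp [sgn]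
    rw [h1]
    linear_combination (sgn (Λ.deg s' (.line l j))) * sgn_mul_self (Λ.deg s' (.line i l))
  | ev e =>
    have h1 := hc.2.2.1
    have h2 := hc.2.2.2.1
    have h3 := hc.2.2.2.2
    have h4 : (∃ k, Λ.event e = .cross k) ∨ ∃ k v, Λ.event e = .lcusp k v := by
      rcases hE : Λ.event e with k | k | ⟨k, v⟩ | b <;> simp_all
    refine (Λ.bDer_catCoch ht (Λ.isReeb_ev h4 (h.trans h1) (h2.trans_le h'))).trans ?_
    have h5 : Λ.blockDiff (Λ.resData 𝕜 s t s') s' (.ev e) = Λ.blockDiff (Λ.catData 𝕜 s t) s (.ev e) := by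
      simp only [blockDiff, Λ.blockDisks_resData h h1]
      rfl
    rw [h5]
    rfl

theorem resCoch_mem_multilinear (h : s ≤ s')
    (c : Chord) :
    Λ.resCoch 𝕜 s t s' c ∈ Coch.multilinear (Λ.augCat 𝕜 s t).Hom 𝕜 := by
  cases c with
  | line i j =>
    refine Λ.blockDisks_mem (Λ.catData 𝕜 s t) (𝒢 := fun _ => Coch.multilinear (Λ.augCat 𝕜 s t).Hom 𝕜)
      ?_ (fun h h' => Coch.multilinear_mul h h') h (fun i j => Λ.catCoch_mem_multilinear _)
      (fun e _ _ => Λ.catCoch_mem_multilinear _)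
      (fun e _ _ => ⟨Coch.ofObj_mem_multilinear _, Coch.ofObj_mem_multilinear _⟩) i j
    rw [Coch.one_eq_ofObj]; exact Coch.ofObj_mem_multilinear _
  | ev e => exact Λ.catCoch_mem_multilinear _

theorem resCoch_mem_homogeneous (h : s ≤ s')
    (c : Chord) :
    Λ.resCoch 𝕜 s t s' c ∈ (Λ.augCat 𝕜 s t).homogeneous (Λ.deg s' c) := by
  cases c with
  | line i j =>
    refine Λ.blockDisks_mem (Λ.catData 𝕜 s t) (𝒢 := (Λ.augCat 𝕜 s t).homogeneous)
      ?_ (fun h h' => AInfCat.homogeneous_mul h h') h (fun i j => Λ.catCoch_mem_homogeneous _)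
      (fun e _ _ => Λ.catCoch_mem_homogeneous (.ev e))
      (fun e _ _ => ⟨AInfCat.ofObj_mem_homogeneous _, AInfCat.ofObj_mem_homogeneous _⟩) i j
    rw [Coch.one_eq_ofObj]; exact AInfCat.ofObj_mem_homogeneous _
  | ev e => exact Λ.catCoch_mem_homogeneous (.ev e)

theorem resCoch_atUnit (h : s ≤ s') (h' : t' ≤ t) (ht : t ≤ Λ.size)
    (hs' : s' ≤ t) {c : Chord} (hc : Lies s' t' c) :
    (Λ.augCat 𝕜 s t).AtUnit (Λ.unitCoord 𝕜 s' t' c) (Λ.resCoch 𝕜 s t s' c) := by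
  cases c with
  | line i j => exact Λ.blockDisks_atUnit h hs' ht i j
  | ev e =>
    refine atUnit_congr (Λ.catCoch_atUnit (.ev e)) ?_
    obtain ⟨h1, h2⟩ := hc e rfl
    simp only [unitCoord]
    split
    · rw [if_pos (by omega), if_pos (by omega)]
    · rfl

end Front


namespace Front

open Str

variable (Λ : Front) {𝕜 : Type u} [CommRing 𝕜] {s t s' t' : ℕ}

/-! ## Restrictions are strictly unital A-infinity functors -/

theorem augRes_map_append_cons (h : s ≤ s') (hst : s' ≤ t') (h' : t' ≤ t) (ht : t ≤ Λ.size)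
    {x y z w : (Λ.augCat 𝕜 s t).Obj} (u : Str (Λ.augCat 𝕜 s t).Hom z w)
    (f : (Λ.augCat 𝕜 s t).Hom y z) (r : Str (Λ.augCat 𝕜 s t).Hom x y) (c : Λ.Plus s' t') :
    (Λ.augRes 𝕜 h hst h' ht).map _ _ (u.append (cons f r)) c =
      sig (Λ.deg s' c.1) * (Λ.resCoch 𝕜 s t s' c.1).val (u.append (cons f r)) :=
  Λ.augRes_map h hst h' ht _ (by simp) c

theorem sum_apply (c : Λ.Plus s t) {x y : (Λ.augCat 𝕜 s t).Obj} (l : List ((Λ.augCat 𝕜 s t).Hom x y)) :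
    l.sum c = (l.map fun f => Λ.evalHom c x y f).sum :=
  map_list_sum (Λ.evalHom c x y) l

theorem isFunctor_augRes (h : s ≤ s') (hst : s' ≤ t') (h' : t' ≤ t) (ht : t ≤ Λ.size) :
    (Λ.augRes 𝕜 h hst h' ht).IsFunctor where
  map_add u f g v := by
    funext c
    refine (Λ.augRes_map_append_cons h hst h' ht u _ v c).trans ?_
    rw [Coch.multilinear_val_add (Λ.resCoch_mem_multilinear h c.1), mul_add]
    exact (congrArg₂ (· + ·) (Λ.augRes_map_append_cons h hst h' ht u f v c)
      (Λ.augRes_map_append_cons h hst h' ht u g v c)).symm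
  map_smul u a f v := by
    funext c
    refine (Λ.augRes_map_append_cons h hst h' ht u _ v c).trans ?_
    rw [Coch.multilinear_val_smul (Λ.resCoch_mem_multilinear h c.1), mul_left_comm]
    exact (congrArg (a * ·) (Λ.augRes_map_append_cons h hst h' ht u f v c)).symm
  map_nil x := Λ.augRes_map_nil h hst h' ht x
  map_deg f d hf c hc := by
    cases f with
    | nil => exact congrFun (Λ.augRes_map_nil h hst h' ht _) c
    | cons f r =>
      refine (Λ.augRes_map h hst h' ht _ (by simp) c).trans ?_
      rw [Λ.resCoch_mem_homogeneous h c.1 _ d hf (by omega), mul_zero]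
  map_b {x y} f := by
    funext c
    refine ((Λ.sum_apply c _).trans ?_).trans (Λ.sum_apply c _).symm
    rw [List.map_map, List.map_map, AInfCat.sum_bHat]
    have h1 : ∀ {w w' : (Λ.augCat 𝕜 s t).Obj} (u : Str (Λ.augCat 𝕜 s t).Hom w y)
        (g : (Λ.augCat 𝕜 s t).Hom w' w) (v : Str (Λ.augCat 𝕜 s t).Hom x w'),
        ((fun f => Λ.evalHom c _ _ f) ∘ (Λ.augRes 𝕜 h hst h' ht).map x y) (u.append (cons g v)) =
        sig (Λ.deg s' c.1) * (Λ.resCoch 𝕜 s t s' c.1).val (u.append (cons g v)) :=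
      fun u g v => Λ.augRes_map_append_cons h hst h' ht u g v c
    simp only [h1]
    simp only [← mul_splitSum]
    rw [← AInfCat.bDer_val, Λ.bDer_resCoch h hst h' ht c.2, Coch.neg_val, Coch.zsmul_val]
    have h2 : ((fun f => Λ.evalHom c _ _ f) ∘ (Λ.augCat 𝕜 s' t').b :
        Str (Λ.augCat 𝕜 s' t').Hom ((Λ.augRes 𝕜 h hst h' ht).obj x)
          ((Λ.augRes 𝕜 h hst h' ht).obj y) → 𝕜) = fun r =>
        (sig (Λ.deg s' c.1 - 1) : 𝕜) * (Λ.blockDiff (Λ.catData 𝕜 s' t') s' c.1).val r :=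
      funext fun r => Λ.augCat_b (h'.trans ht) r c
    rw [h2, List.sum_map_mul_left, ← AInfFunctor.pullback_val,
      Λ.pullback_blockDiff h hst h' ht (IsReeb.lies Λ c.2), sig_sub_one, zsmul_eq_mul]
    push_cast
    ring
  map_one x := by
    funext c
    have h1 := Λ.augRes_map_append_cons h hst h' ht (nil x) ((Λ.augCat 𝕜 s t).one x) (nil x) c
    rw [Λ.resCoch_atUnit h h' ht (hst.trans h') (IsReeb.lies Λ c.2)] at h1
    rw [nil_append] at h1
    refine h1.trans ?_
    rw [if_pos (by simp), ← Λ.coord_one ((Λ.augRes 𝕜 h hst h' ht).obj x)]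
    have h2 := congrArg (Int.cast (R := 𝕜)) (sig_mul_self (Λ.deg s' c))
    have h3 := Λ.coord_of_mem ((Λ.augCat 𝕜 s' t').one ((Λ.augRes 𝕜 h hst h' ht).obj x)) c
    push_cast at h2
    refine Eq.trans ?_ h3
    linear_combination Λ.coord s' t' ((Λ.augCat 𝕜 s' t').one ((Λ.augRes 𝕜 h hst h' ht).obj x)) c * h2
  map_one_long u v huv := by
    funext c
    refine (Λ.augRes_map_append_cons h hst h' ht u _ v c).trans ?_
    rw [Λ.resCoch_atUnit h h' ht (hst.trans h') (IsReeb.lies Λ c.2) u v, if_neg (by omega), mul_zero]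
    rfl

/-! ## Restrictions compose strictly -/

theorem augObj_ext {x y : Λ.AugObj 𝕜 s t}
    (h : ∀ c, Lies s t c → x.1 (Λ.gen s t 1 ⟨c, 0, 0⟩) = y.1 (Λ.gen s t 1 ⟨c, 0, 0⟩))
    (h' : ∀ e, s ≤ e → e < t → Λ.objMark x e = Λ.objMark y e) : x = y := by
  apply Subtype.ext
  apply Λ.alg_hom_ext
  · rintro ⟨⟨c, p, q⟩, hr⟩
    have hp : p = 0 := by have := hr.1; simp at this; exact this
    have hq : q = 0 := by have := hr.2.1; simp at this; exact this
    subst hp hq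
    exact h c (IsReeb.lies Λ hr)
  · rintro ⟨⟨e, p⟩, hr⟩
    have hp : p = 0 := by have := hr.1; simp at this; exact this
    subst hp
    have h1 := h' e hr.2.1 hr.2.2.1
    have h2 : Units.map x.1.toMonoidHom (Λ.tgen s t 1 e 0) =
        Units.map y.1.toMonoidHom (Λ.tgen s t 1 e 0) := by
      have h3 := hr.2.2.2
      simp only [objMark, markFactor] at h1
      rcases hE : Λ.event e with k | k | ⟨k, v⟩ | b
      · simp [hE] at h3
      · simp only [hE] at h1
        split_ifs at h1
        · exact inv_injective h1
        · exact h1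
      · simp [hE] at h3
      · simp only [hE] at h1
        split_ifs at h1
        · exact h1
        · exact inv_injective h1
    exact congrArg Units.val h2

theorem functor_ext {A : AInfCat 𝕜} {F G : AInfFunctor A (Λ.augCat 𝕜 s t)}
    (h : ∀ x, F.obj x = G.obj x)
    (h' : ∀ x y (f : Str A.Hom x y) (c : Λ.Plus s t),
      Λ.evalHom c _ _ (F.map x y f) = Λ.evalHom c _ _ (G.map x y f)) : F = G := by
  obtain ⟨o, m⟩ := F
  obtain ⟨o', m'⟩ := G
  obtain rfl : o = o' := funext h
  congr 1
  funext x y f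
  exact funext fun c => h' x y f c

theorem augRes_refl (h : s ≤ s) (hst : s ≤ t) (h' : t ≤ t) (ht : t ≤ Λ.size) :
    Λ.augRes 𝕜 h hst h' ht = AInfFunctor.id (Λ.augCat 𝕜 s t) := by
  have h0 : ∀ c, Λ.resCoch 𝕜 s t s c = Λ.catCoch 𝕜 s t c := by
    rintro (⟨i, j⟩ | e)
    · exact congrFun (congrFun (Λ.blockDisks_of_le (Λ.catData 𝕜 s t) le_rfl) i) j
    · rfl
  refine Λ.functor_ext (fun x => ?_) fun x y f c => ?_
  · refine Λ.augObj_ext (fun c hc => ?_) fun e h1 h2 => Λ.objMark_augRes h hst h' ht x h1 h2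
    have h1 := Λ.pullback_catCoch (𝕜 := 𝕜) h hst h' ht hc
    rw [h0] at h1
    have h2 := congrArg (fun φ => φ.val (nil x)) h1
    simp only [AInfFunctor.pullback_nil] at h2
    exact h2
  · cases f with
    | nil => exact congrFun (Λ.augRes_map_nil h hst h' ht _) c
    | cons f r =>
      refine (Λ.augRes_map h hst h' ht _ (by simp) c).trans ?_
      rw [h0]
      cases r with
      | nil =>
        have h1 := Λ.coord_of_mem f c
        have h2 := congrArg (Int.cast (R := 𝕜)) (sig_mul_self (Λ.deg s c.1))
        push_cast at h2
        refine Eq.trans ?_ h1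
        rw [catCoch_cons_nil]
        linear_combination Λ.coord s t f c * h2
      | cons g r =>
        rw [catCoch_cons_cons, mul_zero]
        rfl

theorem augRes_trans {s₁ t₁ s₂ t₂ : ℕ} (h : s ≤ s₁) (hst : s₁ ≤ t₁) (h' : t₁ ≤ t) (ht : t ≤ Λ.size)
    (h₁ : s₁ ≤ s₂) (hst₁ : s₂ ≤ t₂) (h₁' : t₂ ≤ t₁) :
    Λ.augRes 𝕜 (h.trans h₁) hst₁ (h₁'.trans h') ht =
      (Λ.augRes 𝕜 h hst h' ht).comp (Λ.augRes 𝕜 h₁ hst₁ h₁' (h'.trans ht)) := by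
  have h0 : ∀ {c}, Lies s₂ t₂ c → (Λ.augRes 𝕜 h hst h' ht).pullback (Λ.resCoch 𝕜 s₁ t₁ s₂ c) =
      Λ.resCoch 𝕜 s t s₂ c := by
    rintro (⟨i, j⟩ | e) hc
    · exact Λ.pullback_blockDisks h hst h' ht h₁ (hst₁.trans h₁') i j
    · refine Λ.pullback_catCoch h hst h' ht (c := .ev e) ?_
      have := hc e rfl
      rintro _ ⟨⟩
      omega
  refine Λ.functor_ext (fun x => ?_) fun x y f c => ?_
  · refine Λ.augObj_ext (fun c hc => ?_) fun e h1 h2 => ?_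
    · have h1 := Λ.pullback_catCoch (𝕜 := 𝕜) (h.trans h₁) hst₁ (h₁'.trans h') ht hc
      have h2 := congrArg (Λ.augRes 𝕜 h hst h' ht).pullback
        (Λ.pullback_catCoch (𝕜 := 𝕜) h₁ hst₁ h₁' (h'.trans ht) hc)
      rw [h0 hc, ← h1] at h2
      have h3 := congrArg (fun φ => φ.val (nil x)) h2
      simp only [AInfFunctor.pullback_nil] at h3
      exact h3.symm
    · exact (Λ.objMark_augRes (h.trans h₁) hst₁ (h₁'.trans h') ht x h1 h2).trans
        ((Λ.objMark_augRes h₁ hst₁ h₁' (h'.trans ht) _ h1 h2).trans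
          (Λ.objMark_augRes h hst h' ht x (h₁.trans h1) (by omega))).symm
  · cases f with
    | nil =>
      refine (congrFun (Λ.augRes_map_nil (h.trans h₁) hst₁ (h₁'.trans h') ht x) c).trans ?_
      change _ = Λ.evalHom c _ _ (((Λ.augRes 𝕜 h hst h' ht).blocks (nil x)).map
        ((Λ.augRes 𝕜 h₁ hst₁ h₁' (h'.trans ht)).map _ _)).sum
      rw [AInfFunctor.blocks_nil, List.map_singleton, List.sum_singleton]
      exact (congrFun (Λ.augRes_map_nil h₁ hst₁ h₁' (h'.trans ht) _) c).symm
    | cons f r =>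
      refine (Λ.augRes_map (h.trans h₁) hst₁ (h₁'.trans h') ht (cons f r) (by simp) c).trans ?_
      refine Eq.trans ?_ (Λ.sum_apply c _).symm
      rw [List.map_map, AInfFunctor.sum_blocks_cons]
      have h1 : ∀ {a b d : (Λ.augCat 𝕜 s₁ t₁).Obj} (g : (Λ.augCat 𝕜 s₁ t₁).Hom b d)
          (v : Str (Λ.augCat 𝕜 s₁ t₁).Hom a b),
          ((fun f => Λ.evalHom c _ _ f) ∘ (Λ.augRes 𝕜 h₁ hst₁ h₁' (h'.trans ht)).map a d) (cons g v) =
          sig (Λ.deg s₂ c.1) * (Λ.resCoch 𝕜 s₁ t₁ s₂ c.1).val (cons g v) :=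
        fun g v => Λ.augRes_map h₁ hst₁ h₁' (h'.trans ht) (cons g v) (by simp) c
      simp only [h1, List.sum_map_mul_left]
      rw [← mul_splitSum, ← AInfFunctor.sum_blocks_cons, ← h0 (IsReeb.lies Λ c.2)]
      rfl

theorem isPresheaf_augPresheaf : (Λ.augPresheaf 𝕜).IsPresheaf where
  isAInf U := Λ.isAInf_augCat (Λ.hi_le U)
  isFunctor {U V} h := Λ.isFunctor_augRes (Λ.lo_mono h) (Λ.lo_le_hi V) (Λ.hi_mono h) (Λ.hi_le U)
  res_refl U := Λ.augRes_refl le_rfl (Λ.lo_le_hi U) le_rfl (Λ.hi_le U)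
  res_trans {U V W} h h' := Λ.augRes_trans (Λ.lo_mono h) (Λ.lo_le_hi V) (Λ.hi_mono h) (Λ.hi_le U)
    (Λ.lo_mono h') (Λ.lo_le_hi W) (Λ.hi_mono h')

end Front


namespace AInfCat

open Str

variable {𝕜 : Type u} [CommRing 𝕜] {A : AInfCat 𝕜}

/-! ## Low order relations -/

namespace IsAInf

theorem b_zero_mid (hA : A.IsAInf) {x y z w : A.Obj} (u : Str A.Hom z w) (v : Str A.Hom x y) :
    A.b (u.append (cons (0 : A.Hom y z) v)) = 0 := by
  have := hA.b_smul u 0 0 v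
  rwa [zero_smul, zero_smul] at this

theorem b_zero_left (hA : A.IsAInf) {x y z : A.Obj} (v : Str A.Hom x y) :
    A.b (cons (0 : A.Hom y z) v) = 0 := by
  have := hA.b_zero_mid (nil z) v
  rwa [nil_append] at this

theorem b_zero_right (hA : A.IsAInf) {x y z : A.Obj} (f : A.Hom y z) :
    A.b (cons f (single (0 : A.Hom x y))) = 0 := by
  have := hA.b_zero_mid (cons f (nil y)) (nil x)
  rwa [cons_append, nil_append] at this

theorem b_zero (hA : A.IsAInf) {x y : A.Obj} : A.b (single (0 : A.Hom x y)) = 0 :=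
  hA.b_zero_left (nil x)

theorem b_sub_left (hA : A.IsAInf) {x y z : A.Obj} (f g : A.Hom y z) (v : Str A.Hom x y) :
    A.b (cons (f - g) v) = A.b (cons f v) - A.b (cons g v) := by
  have h1 := hA.b_add (nil z) (f - g) g v
  rw [nil_append, nil_append, nil_append, sub_add_cancel] at h1
  rw [h1, add_sub_cancel_right]

theorem b_neg_left (hA : A.IsAInf) {x y z : A.Obj} (f : A.Hom y z) (v : Str A.Hom x y) :
    A.b (cons (-f) v) = - A.b (cons f v) := by
  have := hA.b_sub_left 0 f v
  rwa [zero_sub, hA.b_zero_left, zero_sub] at this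

theorem b_sub_right (hA : A.IsAInf) {x y z : A.Obj} (e : A.Hom y z) (f g : A.Hom x y) :
    A.b (cons e (single (f - g))) = A.b (cons e (single f)) - A.b (cons e (single g)) := by
  have h1 := hA.b_add (cons e (nil y)) (f - g) g (nil x)
  simp only [cons_append, nil_append, sub_add_cancel] at h1
  simp only [single, h1, add_sub_cancel_right]

theorem b_neg_mid (hA : A.IsAInf) {x y z w : A.Obj} (f : A.Hom z w) (g : A.Hom y z) (v : Str A.Hom x y) :
    A.b (cons f (cons (-g) v)) = - A.b (cons f (cons g v)) := by
  have h := hA.b_smul (cons f (nil z)) (-1) g v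
  simpa only [cons_append, nil_append, neg_smul, one_smul] using h

theorem par_zero (hA : A.IsAInf) {x y : A.Obj} {f : A.Hom x y} (hf : f ∈ A.gr x y 0) : A.par x y f = f := by
  rw [hA.par_eq x y 0 f hf]; simp

theorem par_neg_one (hA : A.IsAInf) {x y : A.Obj} {f : A.Hom x y} (hf : f ∈ A.gr x y (-1)) :
    A.par x y f = - f := by
  rw [hA.par_eq x y (-1) f hf]; simp

theorem rel_two (hA : A.IsAInf) {x y z : A.Obj} (g : A.Hom y z) (f : A.Hom x y) :
    A.b (cons (A.b (single g)) (single f)) + A.b (single (A.b (cons g (single f)))) +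
      A.b (cons (- A.par y z g) (single (A.b (single f)))) = 0 := by
  have h := hA.b_b (cons g (single f))
  rw [sum_bHat] at h
  simp only [single, splitSum_cons, splitSum_nil, sgnStr_cons, sgnStr_nil, cons_append, nil_append,
    hA.b_nil, hA.b_zero_left, zero_add] at h
  have h1 := hA.b_zero_right (- A.par y z g) (x := y)
  have h2 := hA.b_zero_mid (cons (- A.par y z g) (nil y)) (cons f (nil x))
  have h3 := hA.b_zero_mid (cons (- A.par y z g) (cons (- A.par x y f) (nil x))) (nil x)
  simp only [cons_append, nil_append] at h2 h3
  rw [h2, h3] at h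
  simp only [single]
  simpa only [add_zero, zero_add] using h

theorem rel_three (hA : A.IsAInf) {x y z w : A.Obj} (h : A.Hom z w) (g : A.Hom y z) (f : A.Hom x y)
    (hh : Closed h) (hg : Closed g) (hf : Closed f) :
    A.b (cons (A.b (cons h (single g))) (single f)) +
      A.b (single (A.b (cons h (cons g (single f))))) +
      A.b (cons (- A.par z w h) (single (A.b (cons g (single f))))) = 0 := by
  have e := hA.b_b (cons h (cons g (single f)))
  rw [sum_bHat] at e
  simp only [Closed, single] at hh hg hf
  simp only [single, splitSum_cons, splitSum_nil, sgnStr_cons, sgnStr_nil, cons_append, nil_append,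
    hA.b_nil, hA.b_zero_left, zero_add, hh, hg, hf] at e
  have h1 := hA.b_zero_mid (cons (- A.par z w h) (nil z)) (cons g (cons f (nil x)))
  have h2 := hA.b_zero_mid (cons (- A.par z w h) (nil z)) (cons f (nil x))
  have h3 := hA.b_zero_mid (cons (- A.par z w h) (cons (- A.par y z g) (nil y))) (cons f (nil x))
  have h4 := hA.b_zero_mid (cons (- A.par z w h) (cons (- A.par y z g) (nil y))) (nil x)
  have h5 := hA.b_zero_mid (cons (- A.par z w h) (cons (- A.par y z g) (cons (- A.par x y f) (nil x)))) (nil x)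
  simp only [cons_append, nil_append] at h1 h2 h3 h4 h5
  rw [h1, h2, h3, h4, h5] at e
  simp only [single]
  simpa only [add_zero, zero_add] using e

end IsAInf

/-! ## Inverses up to homotopy -/

theorem hasDeg_pair {x y z : A.Obj} {g : A.Hom y z} {f : A.Hom x y} {d e : ℤ} (hg : g ∈ A.gr y z d)
    (hf : f ∈ A.gr x y e) : A.HasDeg (cons g (single f)) (d + e - 2) := by
  simp only [single, HasDeg]
  exact ⟨d - 1, e - 1, by simpa using hg, ⟨e - 1, 0, by simpa using hf, rfl, by ring⟩, by ring⟩

theorem IsAInf.b_pair_deg (hA : A.IsAInf) {x y z : A.Obj} {g : A.Hom y z} {f : A.Hom x y} {d e : ℤ}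
    (hg : g ∈ A.gr y z d) (hf : f ∈ A.gr x y e) : A.b (cons g (single f)) ∈ A.gr x z (d + e) := by
  have := hA.b_deg _ _ (hasDeg_pair hg hf)
  rwa [sub_add_cancel] at this

theorem IsAInf.b_triple_deg (hA : A.IsAInf) {x y z w : A.Obj} {h : A.Hom z w} {g : A.Hom y z}
    {f : A.Hom x y} (hh : h ∈ A.gr z w 0) (hg : g ∈ A.gr y z 0) (hf : f ∈ A.gr x y 0) :
    A.b (cons h (cons g (single f))) ∈ A.gr x w (-1) := by
  have h1 : A.HasDeg (cons h (cons g (single f))) (-3) := by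
    rw [HasDeg]
    exact ⟨-1, 0 + 0 - 2, hh, hasDeg_pair hg hf, by norm_num⟩
  exact hA.b_deg _ _ h1

/-- Composition with `ψ` from the right is injective, and surjective in all degrees. -/
structure RightBij {x y : A.Obj} (ψ : A.Hom x y) : Prop where
  inj : ∀ {z} {f g : A.Hom y z}, A.b (cons f (single ψ)) = A.b (cons g (single ψ)) → f = g
  surj : ∀ {z} {d : ℤ} {g : A.Hom x z}, g ∈ A.gr x z d → ∃ f ∈ A.gr y z d, A.b (cons f (single ψ)) = g

/-- Composition with `ψ` from the left is injective, and surjective in all degrees. -/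
structure LeftBij {x y : A.Obj} (ψ : A.Hom x y) : Prop where
  inj : ∀ {z} {f g : A.Hom z x}, A.b (cons ψ (single f)) = A.b (cons ψ (single g)) → f = g
  surj : ∀ {z} {d : ℤ} {g : A.Hom z y}, g ∈ A.gr z y d → ∃ f ∈ A.gr z x d, A.b (cons ψ (single f)) = g

theorem RightBij.exists_inverse (hA : A.IsAInf) {x y : A.Obj} {ψ : A.Hom x y} (hψ : RightBij ψ)
    (h0 : ψ ∈ A.gr x y 0) (hc : Closed ψ) : ∃ (ψ' : A.Hom y x) (k : A.Hom y y),
      ψ' ∈ A.gr y x 0 ∧ Closed ψ' ∧ k ∈ A.gr y y (-1) ∧ A.b (cons ψ' (single ψ)) = A.one x ∧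
      A.b (cons k (single ψ)) = A.b (cons ψ (cons ψ' (single ψ))) ∧
      A.b (single k) = A.b (cons ψ (single ψ')) - A.one y := by
  obtain ⟨ψ', h1, h2⟩ := hψ.surj (hA.one_deg x)
  have hc' : Closed ψ' := by
    have h3 := hA.rel_two ψ' ψ
    rw [h2, hA.b_one, hc, hA.b_zero_right, add_zero, add_zero] at h3
    exact hψ.inj (h3.trans (hA.b_zero_left _).symm)
  obtain ⟨k, hk, h3⟩ := hψ.surj (hA.b_triple_deg h0 h1 h0)
  refine ⟨ψ', k, h1, hc', hk, h2, h3, hψ.inj ?_⟩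
  have h4 := hA.rel_two k ψ
  have h5 := hA.rel_three ψ ψ' ψ hc hc' hc
  rw [hc, hA.b_zero_right, add_zero, h3] at h4
  rw [h2, hA.b_neg_left, hA.one_right, hA.par_zero h0, hA.par_zero h0] at h5
  rw [hA.b_sub_left, hA.one_left, eq_neg_of_add_eq_zero_left h4, eq_comm, sub_eq_iff_eq_add, 
    ← sub_eq_zero]
  rw [← h5]; abel

theorem LeftBij.exists_inverse (hA : A.IsAInf) {x y : A.Obj} {ψ : A.Hom x y} (hψ : LeftBij ψ)
    (h0 : ψ ∈ A.gr x y 0) (hc : Closed ψ) : ∃ (ψ' : A.Hom y x) (k : A.Hom x x),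
      ψ' ∈ A.gr y x 0 ∧ Closed ψ' ∧ k ∈ A.gr x x (-1) ∧ A.b (cons ψ (single ψ')) = A.one y ∧
      A.b (cons ψ (single k)) = A.b (cons ψ (cons ψ' (single ψ))) ∧
      A.b (single k) = A.b (cons ψ' (single ψ)) - A.one x := by
  obtain ⟨ψ', h1, h2⟩ := hψ.surj (hA.one_deg y)
  have hc' : Closed ψ' := by
    have h3 := hA.rel_two ψ ψ'
    rw [h2, hA.b_one, hc, hA.b_zero_left, zero_add, zero_add, hA.b_neg_left, hA.par_zero h0,
      neg_eq_zero] at h3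
    exact hψ.inj (h3.trans (hA.b_zero_right _).symm)
  obtain ⟨k, hk, h3⟩ := hψ.surj (hA.b_triple_deg h0 h1 h0)
  refine ⟨ψ', k, h1, hc', hk, h2, h3, hψ.inj ?_⟩
  have h4 := hA.rel_two ψ k
  have h5 := hA.rel_three ψ ψ' ψ hc hc' hc
  rw [hc, hA.b_zero_left, zero_add, h3, hA.b_neg_left, hA.par_zero h0] at h4
  rw [h2, hA.b_neg_left, hA.one_left, hA.par_zero h0] at h5
  rw [hA.b_sub_right, hA.one_right, hA.par_zero h0, ← sub_eq_zero]
  rw [add_neg_eq_zero] at h4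
  rw [← h4, ← h5]; abel

end AInfCat


namespace AInf

open Str

variable {𝕜 : Type u} [CommRing 𝕜] {A B C : AInfCat 𝕜} {P : AInfFunctor A C} {Q : AInfFunctor B C}

/-! ## Morphisms in the fibre product -/

theorem fibB_single {X Y : FibObj P Q} (Φ : FibHom P Q X Y) :
    fibB P Q (single Φ) = - (C.b (cons Y.iso (single (P.map _ _ (single Φ.1)))) +
      C.b (single Φ.2.2) +
      C.b (cons (Q.map _ _ (single (- B.par _ _ Φ.2.1))) (single X.iso))) := by
  simp [fibB, fibTerm, splits, single, fstStr, sndStr, AInfCat.sgnStr, AInfFunctor.blocks,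
    AInfFunctor.blocksAux]

theorem fibB_pair (hC : C.IsAInf) {X Y Z : FibObj P Q} (f' : A.Hom Y.fst Z.fst)
    (g' : B.Hom Y.snd Z.snd) (f : A.Hom X.fst Y.fst) (g : B.Hom X.snd Y.snd) :
    fibB P Q (cons ((f', g', 0) : FibHom P Q Y Z) (single ((f, g, 0) : FibHom P Q X Y))) =
      - (C.b (cons Z.iso (single (P.map _ _ (cons f' (single f))))) +
      C.b (cons Z.iso (cons (P.map _ _ (single f')) (single (P.map _ _ (single f))))) +
      C.b (cons (Q.map _ _ (single (- B.par _ _ g')))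
        (cons Y.iso (single (P.map _ _ (single f))))) +
      C.b (cons (Q.map _ _ (cons (- B.par _ _ g') (single (- B.par _ _ g)))) (single X.iso)) +
      C.b (cons (Q.map _ _ (single (- B.par _ _ g')))
        (cons (Q.map _ _ (single (- B.par _ _ g))) (single X.iso)))) := by
  have h1 : ∀ {x y z : C.Obj} (w : C.Hom y z), C.b (cons w (cons (0 : C.Hom x y) (nil x))) = 0 :=
    fun w => hC.b_zero_right w
  simp [fibB, fibTerm, splits, single, fstStr, sndStr, AInfCat.sgnStr, AInfFunctor.blocks,
    AInfFunctor.blocksAux, hC.b_zero_left, h1]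
  abel

end AInf

namespace AInfFunctor

open Str

variable {𝕜 : Type u} [CommRing 𝕜] {A B : AInfCat 𝕜}

/-- All higher components vanish. -/
def IsStrict (F : AInfFunctor A B) : Prop :=
  ∀ {x y : A.Obj} (s : Str A.Hom x y), 2 ≤ s.length → F.map _ _ s = 0

variable {F : AInfFunctor A B}

theorem IsFunctor.map_neg (hF : F.IsFunctor) {x y : A.Obj} (f : A.Hom x y) :
    F.map _ _ (single (-f)) = - F.map _ _ (single f) := by
  have := hF.map_smul (nil y) (-1) f (nil x)
  rwa [nil_append, nil_append, neg_smul, one_smul, neg_smul, one_smul] at this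

theorem IsFunctor.map_sub (hF : F.IsFunctor) {x y : A.Obj} (f g : A.Hom x y) :
    F.map _ _ (single (f - g)) = F.map _ _ (single f) - F.map _ _ (single g) := by
  have := hF.map_add (nil y) (f - g) g (nil x)
  simp only [nil_append, sub_add_cancel] at this
  exact eq_sub_of_add_eq this.symm

theorem IsFunctor.map_zero (hF : F.IsFunctor) {x y : A.Obj} :
    F.map _ _ (single (0 : A.Hom x y)) = 0 := by
  have := hF.map_sub (0 : A.Hom x y) 0
  rwa [sub_self, sub_self] at this

theorem IsFunctor.map_gr (hF : F.IsFunctor) {x y : A.Obj} {f : A.Hom x y} {d : ℤ}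
    (hf : f ∈ A.gr x y d) : F.map _ _ (single f) ∈ B.gr _ _ d := by
  have h : A.HasDeg (single f) (d - 1) := by
    rw [single, AInfCat.HasDeg]
    exact ⟨d - 1, 0, by simpa using hf, by rw [AInfCat.HasDeg], by ring⟩
  have := hF.map_deg (single f) (d - 1) h
  rwa [sub_add_cancel] at this

theorem IsFunctor.map_b_single (hA : A.IsAInf) (hF : F.IsFunctor) {x y : A.Obj} (f : A.Hom x y) :
    F.map _ _ (single (A.b (single f))) = B.b (single (F.map _ _ (single f))) := by
  have h := hF.map_b (single f)
  have h0 := hF.map_zero (x := y) (y := y)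
  have h1 : ∀ r : Str A.Hom x y, r = cons f (single (0 : A.Hom x x)) ∨
    r = cons (-A.par _ _ f) (single (0 : A.Hom x x)) ∨ r = cons (0 : A.Hom y y) (single f) → F.map _ _ r = 0 := by
    have h2 : ∀ g : A.Hom x y, F.map _ _ (cons g (single (0 : A.Hom x x))) = 0 := by
      intro g
      have := hF.map_smul (single g) 0 (0 : A.Hom x x) (nil x)
      simpa only [single, cons_append, nil_append, zero_smul] using this
    rintro r (rfl | rfl | rfl)
    · exact h2 f
    · exact h2 _
    · have := hF.map_smul (nil y) 0 (0 : A.Hom y y) (single f)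
      simpa only [nil_append, zero_smul] using this
  rw [AInfCat.sum_bHat] at h
  simp only [single, splitSum_cons, splitSum_nil, AInfCat.sgnStr_cons, AInfCat.sgnStr_nil, cons_append,
    nil_append, hA.b_nil] at h
  simp only [single] at h1
  rw [h1 _ (.inr (.inl rfl)), h1 _ (.inr (.inr rfl))] at h
  simpa [blocks, blocksAux, single] using h

theorem IsStrict.map_cons_cons (hs : F.IsStrict) {x y z w : A.Obj} (g : A.Hom z w) (f : A.Hom y z)
    (r : Str A.Hom x y) : F.map _ _ (cons g (cons f r)) = 0 := hs _ (by simp)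

theorem IsStrict.map_cons_single (hs : F.IsStrict) {x y z : A.Obj} (g : A.Hom y z) (f : A.Hom x y) :
    F.map _ _ (cons g (single f)) = 0 := hs.map_cons_cons g f (nil x)

theorem IsStrict.map_b_pair (hA : A.IsAInf) (hB : B.IsAInf) (hF : F.IsFunctor) (hs : F.IsStrict)
    {x y z : A.Obj} (g : A.Hom y z) (f : A.Hom x y) :
    F.map _ _ (single (A.b (cons g (single f)))) =
      B.b (cons (F.map _ _ (single g)) (single (F.map _ _ (single f)))) := by
  have h := hF.map_b (cons g (single f))
  rw [AInfCat.sum_bHat] at h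
  simpa [single, splitSum_cons, splitSum_nil, AInfCat.sgnStr_cons, AInfCat.sgnStr_nil, cons_append,
    nil_append, hA.b_nil, hs.map_cons_cons, blocks, blocksAux, hB.b_zero_left] using h

theorem IsStrict.map_b_triple (hA : A.IsAInf) (hB : B.IsAInf) (hF : F.IsFunctor) (hs : F.IsStrict)
    {x y z w : A.Obj} (h : A.Hom z w) (g : A.Hom y z) (f : A.Hom x y) :
    F.map _ _ (single (A.b (cons h (cons g (single f))))) =
      B.b (cons (F.map _ _ (single h)) (cons (F.map _ _ (single g)) (single (F.map _ _ (single f))))) := by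
  have e := hF.map_b (cons h (cons g (single f)))
  rw [AInfCat.sum_bHat] at e
  have h1 : ∀ {x y z : B.Obj} (w : B.Hom y z), B.b (cons w (cons (0 : B.Hom x y) (nil x))) = 0 :=
    fun w => hB.b_zero_right w
  simpa [single, splitSum_cons, splitSum_nil, AInfCat.sgnStr_cons, AInfCat.sgnStr_nil, cons_append,
    nil_append, hA.b_nil, hs.map_cons_cons, blocks, blocksAux, hB.b_zero_left, h1] using e

end AInfFunctor


namespace AInfCat

open Str

variable {𝕜 : Type u} [CommRing 𝕜] {A B C : AInfCat 𝕜} {P : AInfFunctor A C} {Q : AInfFunctor B C}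

/-! ## Composition with the identification of equal objects -/

theorem b_transOne_long (hC : C.IsAInf) {p q x y : C.Obj} (e : p = q) (u : Str C.Hom q y)
    (v : Str C.Hom x p) (h : 2 ≤ u.length + v.length) : C.b (u.append (cons (C.transOne e) v)) = 0 := by
  subst e
  exact hC.one_long u v h

variable {p q r : C.Obj}

/-- Precomposition with the identification of equal objects. -/
theorem comp_transOne (hC : C.IsAInf) (e : p = q) {u : C.Hom q r} (hu : u ∈ C.gr q r 0) {φ : C.Hom p r}
    (hφ : C.b (cons u (single (C.transOne e))) = φ) {w : C.Hom r q} (hw : C.b (cons w (single u)) = C.one q) :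
    C.b (cons w (single φ)) = C.transOne e := by
  subst e hφ
  rw [transOne, hC.one_right, hC.par_zero hu, hw]

theorem comp_transOne_triple (hC : C.IsAInf) (e : p = q) {u : C.Hom q r} (hu : u ∈ C.gr q r 0)
    {φ : C.Hom p r} (hφ : C.b (cons u (single (C.transOne e))) = φ) {w : C.Hom r q} {k : C.Hom r r}
    (hk : C.b (cons k (single u)) = C.b (cons u (cons w (single u)))) :
    C.b (cons k (single φ)) = C.b (cons u (cons w (single φ))) := by
  subst e hφ
  rw [transOne, hC.one_right, hC.par_zero hu, hk]

theorem transOne_comp (hC : C.IsAInf) (e : q = r) {u : C.Hom p q} {φ : C.Hom p r}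
    (hφ : C.b (cons (C.transOne e) (single u)) = φ) {w : C.Hom q p} (hw : C.b (cons u (single w)) = C.one q) :
    C.b (cons φ (single w)) = C.transOne e := by
  subst e hφ
  rw [transOne, hC.one_left, hw]

theorem transOne_comp_triple (hC : C.IsAInf) (e : q = r) {u : C.Hom p q} {φ : C.Hom p r}
    (hφ : C.b (cons (C.transOne e) (single u)) = φ) {w : C.Hom q p} {k : C.Hom p p}
    (hk : C.b (cons u (single k)) = C.b (cons u (cons w (single u)))) :
    C.b (cons φ (single k)) = C.b (cons φ (cons w (single u))) := by
  subst e hφ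
  rw [transOne, hC.one_left, hk]

/-! ## Isomorphisms in the fibre product -/

theorem fibre_b_single {X Y : FibObj P Q} (Φ : FibHom P Q X Y) :
    (fibre P Q).b (single (H := (fibre P Q).Hom) (x := X) (y := Y) Φ) =
      (A.b (single Φ.1), B.b (single Φ.2.1), fibB P Q (single Φ)) := by
  simp [fibre, fstStr, sndStr, single]

theorem fibre_b_pair {X Y Z : FibObj P Q} (Φ' : FibHom P Q Y Z) (Φ : FibHom P Q X Y) :
    (fibre P Q).b (cons (H := (fibre P Q).Hom) Φ' (single (H := (fibre P Q).Hom) Φ)) =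
      (A.b (cons Φ'.1 (single Φ.1)), B.b (cons Φ'.2.1 (single Φ.2.1)),
        fibB P Q (cons Φ' (single Φ))) := by
  simp [fibre, fstStr, sndStr, single]

theorem fibre_homotopy {X Y : (fibre P Q).Obj} {f' : A.Hom Y.fst X.fst} {g' : B.Hom Y.snd X.snd}
    {f : A.Hom X.fst Y.fst} {g : B.Hom X.snd Y.snd} {k : A.Hom X.fst X.fst} {l : B.Hom X.snd X.snd}
    (h1 : A.b (single k) = A.b (cons f' (single f)) - A.one X.fst)
    (h2 : B.b (single l) = B.b (cons g' (single g)) - B.one X.snd)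
    (h3 : fibB P Q (single ((k, l, 0) : FibHom P Q X X)) =
      fibB P Q (cons ((f', g', 0) : FibHom P Q Y X) (single ((f, g, 0) : FibHom P Q X Y)))) :
    Exact ((fibre P Q).b (cons (show (fibre P Q).Hom Y X from (f', g', 0))
      (single (show (fibre P Q).Hom X Y from (f, g, 0)))) - (fibre P Q).one X) := by
  refine ⟨(k, l, 0), (fibre_b_single _).trans ?_⟩
  refine Eq.trans ?_ (congrArg (· - (fibre P Q).one X) (fibre_b_pair (f', g', 0) (f, g, 0)).symm)
  exact Prod.ext h1 (Prod.ext h2 (h3.trans (sub_zero _).symm))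

theorem fibre_isIso_of_right (hA : A.IsAInf) (hB : B.IsAInf) (hC : C.IsAInf) (hP : P.IsFunctor)
    (hQ : Q.IsFunctor) (hs : Q.IsStrict) (T : FibObj P Q) {y : B.Obj} (e : P.obj T.fst = Q.obj y)
    (he : IsIso (C.transOne e)) {ψ : B.Hom y T.snd} (h0 : ψ ∈ B.gr y T.snd 0) (hc : Closed ψ)
    (hψ : RightBij ψ) (hT : C.b (cons (Q.map _ _ (single ψ)) (single (C.transOne e))) = T.iso) :
    ∃ Φ : (fibre P Q).Hom ⟨T.fst, y, C.transOne e, he⟩ T, IsIso Φ := by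
  obtain ⟨ψ', k, h0', hc', hk, h1, h2, h3⟩ := hψ.exists_inverse hB h0 hc
  have m1 := hs.map_b_pair hB hC hQ ψ' ψ
  have m2 := hs.map_b_pair hB hC hQ k ψ
  have m3 := hs.map_b_triple hB hC hQ ψ ψ' ψ
  rw [h1, hQ.map_one] at m1
  rw [h2, m3] at m2
  have c1 := comp_transOne hC e (hQ.map_gr h0) hT m1.symm
  have c2 := comp_transOne_triple hC e (hQ.map_gr h0) hT m2.symm
  have hPl : P.map _ _ (cons (A.one T.fst) (single (A.one T.fst))) = 0 := by
    have := hP.map_one_long (nil T.fst) (single (A.one T.fst)) (by simp [single])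
    rwa [nil_append] at this
  have pψ : B.par _ _ ψ = ψ := hB.par_zero h0
  have pψ' : B.par _ _ ψ' = ψ' := hB.par_zero h0'
  have pk : B.par _ _ k = - k := hB.par_neg_one hk
  have l1 : ∀ {a b : C.Obj} (u : C.Hom a b) {d : C.Obj} (v : C.Hom d a),
      C.b (cons u (cons v (single (C.one d)))) = 0 := fun u _ v => by
    have := hC.one_long (cons u (single v)) (nil _) (by simp [single])
    simpa [single, cons_append] using this
  have l2 : ∀ {a b : C.Obj} (u : C.Hom (Q.obj y) a) (v : C.Hom a b),
      C.b (cons v (cons u (single (C.transOne e)))) = 0 := fun u v => by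
    have := b_transOne_long hC e (cons v (single u)) (nil _) (by simp [single])
    simpa [single, cons_append] using this
  have l3 : ∀ {a b : C.Obj} (u : C.Hom (Q.obj y) a) (v : C.Hom b (P.obj T.fst)),
      C.b (cons u (cons (C.transOne e) (single v))) = 0 := fun u v => by
    have := b_transOne_long hC e (single u) (single v) (by simp [single])
    simpa [single, cons_append] using this
  have pp : ∀ {a b : C.Obj} (v : C.Hom a b) , C.b (cons v (single (C.one a))) = C.par _ _ v :=
    fun v => hC.one_right v
  have pe : C.par _ _ (C.transOne e) = C.transOne e := hC.par_zero he.1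
  have pT : C.par _ _ T.iso = T.iso := hC.par_zero T.isIso.1
  have eA : A.b (cons (A.one T.fst) (single (A.one T.fst))) = A.one T.fst := hA.one_left _
  refine ⟨(A.one T.fst, ψ, 0), ⟨hA.one_deg _, h0, zero_mem _⟩, ?_, (A.one T.fst, ψ', 0),
    ⟨hA.one_deg _, h0', zero_mem _⟩, ?_, fibre_homotopy (k := 0) (l := 0) ?_ ?_ ?_,
    fibre_homotopy (k := 0) (l := k) ?_ ?_ ?_⟩
  · refine (fibre_b_single _).trans ?_
    rw [hA.b_one, hc, fibB_single]
    simp only [hP.map_one, pp, pT, hC.b_zero, pψ, hQ.map_neg, hC.b_neg_left, hT]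
    simp
    rfl
  · refine (fibre_b_single _).trans ?_
    rw [hA.b_one, hc', fibB_single]
    simp only [hP.map_one, pp, pe, hC.b_zero, pψ', hQ.map_neg, hC.b_neg_left, c1]
    simp
    rfl
  · rw [hA.b_zero, eA, sub_self]
  · rw [hB.b_zero, h1, sub_self]
  · rw [fibB_pair hC, fibB_single]
    simp only [hPl, hP.map_one, l1, l2, hs.map_cons_single, hC.b_zero_left, hC.b_zero_right, hP.map_zero,
      pψ, pψ', hQ.map_neg, hQ.map_zero, hC.b_neg_left, hC.b_zero, hB.par_zero (zero_mem _)]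
    simp
  · rw [hA.b_zero, eA, sub_self]
  · rw [h3]
  · rw [fibB_pair hC, fibB_single]
    simp only [hPl, hP.map_one, l1, hs.map_cons_single, hC.b_zero_left, hC.b_zero_right, hP.map_zero,
      pψ, pψ', pk, neg_neg, hQ.map_neg, hC.b_neg_left, hC.b_neg_mid, hC.b_zero, c2]
    simp

theorem fibre_isIso_of_left (hA : A.IsAInf) (hB : B.IsAInf) (hC : C.IsAInf) (hP : P.IsFunctor)
    (hQ : Q.IsFunctor) (hs : P.IsStrict) (T : FibObj P Q) {x : A.Obj} (e : P.obj x = Q.obj T.snd)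
    (he : IsIso (C.transOne e)) {ψ : A.Hom T.fst x} (h0 : ψ ∈ A.gr T.fst x 0) (hc : Closed ψ)
    (hψ : LeftBij ψ) (hT : C.b (cons (C.transOne e) (single (P.map _ _ (single ψ)))) = T.iso) :
    ∃ Φ : (fibre P Q).Hom ⟨x, T.snd, C.transOne e, he⟩ T, IsIso Φ := by
  obtain ⟨ψ', k, h0', hc', hk, h1, h2, h3⟩ := hψ.exists_inverse hA h0 hc
  have m1 := hs.map_b_pair hA hC hP ψ ψ'
  have m2 := hs.map_b_pair hA hC hP ψ k
  have m3 := hs.map_b_triple hA hC hP ψ ψ' ψ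
  rw [h1, hP.map_one] at m1
  rw [h2, m3] at m2
  have c1 := transOne_comp hC e hT m1.symm
  have c2 := transOne_comp_triple hC e hT m2.symm
  have hQl : Q.map _ _ (cons (B.one T.snd) (single (B.one T.snd))) = 0 := by
    have := hQ.map_one_long (nil T.snd) (single (B.one T.snd)) (by simp [single])
    rwa [nil_append] at this
  have p1 : B.par _ _ (B.one T.snd) = B.one T.snd := hB.par_zero (hB.one_deg _)
  have hQl' : Q.map _ _ (cons (-B.one T.snd) (single (-B.one T.snd))) = 0 := by
    have e1 := hQ.map_smul (nil _) (-1) (B.one T.snd) (single (-B.one T.snd))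
    have e2 := hQ.map_smul (single (B.one T.snd)) (-1) (B.one T.snd) (nil _)
    simp only [nil_append, single, cons_append, neg_smul, one_smul] at e1 e2 hQl
    simp only [single]
    rw [e1, e2, hQl, neg_zero, neg_zero]
  have l1 : ∀ {a b d : C.Obj} (v : C.Hom a b) (u : C.Hom d a),
      C.b (cons (C.one b) (cons v (single u))) = 0 := fun v u => by
    have := hC.one_long (nil _) (cons v (single u)) (by simp [single])
    rwa [nil_append] at this
  have l2 : ∀ {a d : C.Obj} (v : C.Hom a (P.obj x)) (u : C.Hom d a),
      C.b (cons (C.transOne e) (cons v (single u))) = 0 := fun v u => by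
    have := b_transOne_long hC e (nil _) (cons v (single u)) (by simp [single])
    rwa [nil_append] at this
  have eB : B.b (cons (B.one T.snd) (single (B.one T.snd))) = B.one T.snd := hB.one_left _
  refine ⟨(ψ', B.one T.snd, 0), ⟨h0', hB.one_deg _, zero_mem _⟩, ?_, (ψ, B.one T.snd, 0),
    ⟨h0, hB.one_deg _, zero_mem _⟩, ?_, 
    fibre_homotopy (k := 0) (l := 0) ?_ ?_ ?_, fibre_homotopy (k := k) (l := 0) ?_ ?_ ?_⟩
  · refine (fibre_b_single _).trans ?_
    rw [hB.b_one, hc', fibB_single]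
    simp only [hQ.map_one, p1, hC.b_zero, hQ.map_neg, hC.b_neg_left, c1, hC.one_left]
    simp
    rfl
  · refine (fibre_b_single _).trans ?_
    rw [hB.b_one, hc, fibB_single]
    simp only [hQ.map_one, p1, hC.b_zero, hQ.map_neg, hC.b_neg_left, hT, hC.one_left]
    simp
    rfl
  · rw [hA.b_zero, h1, sub_self]
  · rw [hB.b_zero, eB, sub_self]
  · rw [fibB_pair hC, fibB_single]
    simp only [hQl', hQ.map_one, l1, l2, hs.map_cons_single, hC.b_zero_left, hC.b_zero_right, hP.map_zero,
      p1, hQ.map_neg, hQ.map_zero, hC.b_neg_left, hC.b_zero, hB.par_zero (zero_mem _)]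
    simp
  · rw [h3]
  · rw [hB.b_zero, eB, sub_self]
  · rw [fibB_pair hC, fibB_single]
    simp only [hQl', hQ.map_one, l1, hs.map_cons_single, hC.b_zero_left, hC.b_zero_right, 
      p1, hQ.map_neg, hQ.map_zero, hC.b_neg_left, hC.b_zero, hB.par_zero (zero_mem _), c2]
    simp

end AInfCat


/-! ## Triangular systems -/

/-- The `c`-th component of `T f` is a unit times `f c`, plus terms depending on the
components of `f` of lower order. -/
def IsTriangular {ι R : Type*} [CommRing R] (ord : ι → ℕ) (T : (ι → R) → ι → R) : Prop :=
  ∀ c, ∃ u : Rˣ, ∀ f f' : ι → R, (∀ c', ord c' < ord c → f c' = f' c') →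
    T f c - T f' c = u * (f c - f' c)

theorem IsTriangular.injective {ι R : Type*} [CommRing R] {ord : ι → ℕ} {T : (ι → R) → ι → R}
    (h : IsTriangular ord T) : Function.Injective T := by
  intro f f' hf
  have key : ∀ n c, ord c = n → f c = f' c := by
    intro n
    induction n using Nat.strong_induction_on with
    | _ n ih =>
      rintro c rfl
      obtain ⟨u, hu⟩ := h c
      have h1 := hu f f' fun c' hc' => ih _ hc' c' rfl
      rw [hf, sub_self, eq_comm, Units.mul_right_eq_zero] at h1
      exact sub_eq_zero.1 h1
  funext c
  exact key _ c rfl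

theorem IsTriangular.exists_eq {ι R : Type*} [CommRing R] [Finite ι] {ord : ι → ℕ}
    {T : (ι → R) → ι → R} (h : IsTriangular ord T) (bad : Set ι)
    (hT : ∀ f, (∀ c ∈ bad, f c = 0) → ∀ c ∈ bad, T f c = 0) (g : ι → R) (hg : ∀ c ∈ bad, g c = 0) :
    ∃ f, (∀ c ∈ bad, f c = 0) ∧ T f = g := by
  classical
  have key : ∀ n, ∃ f, (∀ c ∈ bad, f c = 0) ∧ ∀ c, ord c < n → T f c = g c := by
    intro n
    induction n with
    | zero => exact ⟨0, fun _ _ => rfl, fun c hc => absurd hc (by omega)⟩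
    | succ n ih =>
      obtain ⟨f, h1, h2⟩ := ih
      choose u hu using h
      refine ⟨fun c => if ord c < n then f c else f c + ((u c)⁻¹ : Rˣ) * (g c - T f c), ?_, ?_⟩
      · intro c hc
        simp [h1 c hc, hg c hc, hT f h1 c hc]
      · intro c hc
        have h3 := hu c (fun c => if ord c < n then f c else f c + ((u c)⁻¹ : Rˣ) * (g c - T f c)) f
          fun c' hc' => if_pos (by omega)
        by_cases hn : ord c < n
        · rw [if_pos hn, sub_self, mul_zero] at h3
          rw [sub_eq_zero.1 h3, h2 c hn]
        · rw [if_neg hn, add_sub_cancel_left, Units.mul_inv_cancel_left] at h3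
          exact sub_left_injective h3
  obtain ⟨N, hN⟩ : ∃ N, ∀ c, ord c < N := by
    cases nonempty_fintype ι
    refine ⟨Finset.univ.sup ord + 1, fun c => ?_⟩
    have := Finset.le_sup (f := ord) (Finset.mem_univ c)
    omega
  obtain ⟨f, h1, h2⟩ := key N
  exact ⟨f, h1, funext fun c => h2 c (hN c)⟩

namespace Front

open Str AInfCat

variable (Λ : Front) {𝕜 : Type u} [CommRing 𝕜] {s t : ℕ}

/-! ## Morphisms which are invertible on the diagonal -/

/-- The chords between two copies of the same strand, and the crossings next to left cusps. -/
def IsDiag : Chord → Prop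
  | .line i j => i = j
  | .ev e => ∃ k v, Λ.event e = .lcusp k v

/-- All diagonal components are units. -/
def UnitDiag (f : Λ.Plus s t → 𝕜) : Prop := ∀ c, Λ.IsDiag c.1 → IsUnit (f c)

variable {Λ}

theorem isUnit_sig_mul {a : 𝕜} (d : ℤ) (h : IsUnit a) : IsUnit ((sig d : 𝕜) * a) := by
  refine IsUnit.mul ?_ h
  refine IsUnit.of_mul_eq_one (sig d : 𝕜) ?_
  exact_mod_cast congrArg (Int.cast (R := 𝕜)) (sig_mul_self d)

theorem UnitDiag.catCoch {x y : (Λ.augCat 𝕜 s t).Obj} {ψ : (Λ.augCat 𝕜 s t).Hom x y}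
    (h : Λ.UnitDiag (𝕜 := 𝕜) ψ) {c : Chord} (hc : Λ.IsReeb s t 2 ⟨c, 0, 1⟩) (hd : Λ.IsDiag c) :
    IsUnit ((Λ.catCoch 𝕜 s t c).val (single ψ)) := by
  rw [catCoch_single]
  refine isUnit_sig_mul _ ?_
  rw [coord_of_mem (Λ := Λ) ψ ⟨c, hc⟩]
  exact h ⟨c, hc⟩ hd

theorem catData_mark_ite_val (e : ℕ) (p q : Prop) [Decidable p] [Decidable q]
    (φ : Coch (Λ.augCat 𝕜 s t).Hom 𝕜) {x y : (Λ.augCat 𝕜 s t).Obj}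
    (r : Str (Λ.augCat 𝕜 s t).Hom x y) :
    (((if p then (Λ.catData 𝕜 s t).mark e else 1 : (Coch (Λ.augCat 𝕜 s t).Hom 𝕜)ˣ) :
      Coch (Λ.augCat 𝕜 s t).Hom 𝕜) * φ *
      (((if q then (Λ.catData 𝕜 s t).mark e else 1)⁻¹ : (Coch (Λ.augCat 𝕜 s t).Hom 𝕜)ˣ) :
      Coch (Λ.augCat 𝕜 s t).Hom 𝕜)).val r =
    (if p then (Λ.objMark x e) else 1 : 𝕜ˣ) * φ.val r *
      ((if q then Λ.objMark y e else 1)⁻¹ : 𝕜ˣ) := by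
  have h1 : ((if p then (Λ.catData 𝕜 s t).mark e else 1 : (Coch (Λ.augCat 𝕜 s t).Hom 𝕜)ˣ) :
      Coch (Λ.augCat 𝕜 s t).Hom 𝕜) =
      Coch.ofObj fun x : (Λ.augCat 𝕜 s t).Obj => ((if p then Λ.objMark x e else 1 : 𝕜ˣ) : 𝕜) := by
    split_ifs
    · rfl
    · exact Coch.one_eq_ofObj
  have h2 : (((if q then (Λ.catData 𝕜 s t).mark e else 1)⁻¹ : (Coch (Λ.augCat 𝕜 s t).Hom 𝕜)ˣ) :
      Coch (Λ.augCat 𝕜 s t).Hom 𝕜) =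
      Coch.ofObj fun x : (Λ.augCat 𝕜 s t).Obj => (((if q then Λ.objMark x e else 1)⁻¹ : 𝕜ˣ) : 𝕜) := by
    split_ifs
    · rfl
    · rw [inv_one, inv_one]; exact Coch.one_eq_ofObj
  rw [h1, h2]
  exact (Coch.mul_ofObj_val _ _ _).trans (congrArg (· * _) (Coch.ofObj_mul_val _ _ _))

theorem UnitDiag.blockDisks {x y : (Λ.augCat 𝕜 s t).Obj} {ψ : (Λ.augCat 𝕜 s t).Hom x y}
    (h : Λ.UnitDiag (𝕜 := 𝕜) ψ) (ht : t ≤ Λ.size) {e : ℕ} (he : s ≤ e) (het : e ≤ t) {i : ℕ}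
    (hi : i < (Λ.slice e).n) :
    IsUnit ((Λ.blockDisks (Λ.catData 𝕜 s t) s e i i).val (single ψ)) := by
  induction e, he using Nat.le_induction generalizing i with
  | base =>
    rw [blockDisks_of_le _ _ le_rfl]
    exact h.catCoch (Λ.isReeb_line.2 ⟨le_rfl, hi⟩) rfl
  | succ e he ih =>
    have ih' := fun i hi => ih (by omega) (i := i) hi
    have hl := Λ.legal e (by omega)
    have low := fun i j => Λ.blockDisks_catData_lower (𝕜 := 𝕜) (s := s) (t := t) e (i := i) (j := j)
    rw [blockDisks_succ _ _ he, blockStep]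
    rw [slice_succ] at hi
    set D := Λ.blockDisks (Λ.catData 𝕜 s t) s e
    rcases hE : Λ.event e with k | k | ⟨k, v⟩ | b
    · have hk : k + 1 < (Λ.slice e).n := by rw [hE] at hl; exact hl
      rw [hE] at hi
      change i < (Λ.slice e).n at hi
      simp only [lt_irrefl, if_false, rowOp, colOp]
      by_cases h1 : i = k
      · subst h1
        simp only [if_true]
        rw [low (i + 1) i (by omega), zero_mul, add_zero]
        exact ih' _ hk
      · simp only [if_neg h1]
        by_cases h2 : i = k + 1
        · subst h2
          simp only [if_true]
          rw [low (k + 1) k (by omega), mul_zero, sub_zero]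
          exact ih' _ (by omega)
        · simp only [if_neg h2]
          exact ih' _ hi
    · rw [hE] at hi
      change i < (Λ.slice e).n at hi
      simp only
      rw [catData_mark_ite_val]
      exact ((Units.isUnit _).mul (ih' _ hi)).mul (Units.isUnit _)
    · have hk : k ≤ (Λ.slice e).n := by rw [hE] at hl; exact hl
      rw [hE] at hi
      change i < (Λ.slice e).n + 2 at hi
      simp only
      rw [if_neg (by omega)]
      by_cases h1 : i = k ∨ i = k + 1
      · rw [if_pos (by tauto)]
        exact h.catCoch (Λ.isReeb_ev (.inr ⟨k, v, hE⟩) he (by omega)) ⟨k, v, hE⟩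
      · rw [if_neg (by tauto), if_neg (by tauto)]
        exact ih' _ (by split_ifs <;> omega)
    · rw [hE] at hi
      change i < (Λ.slice e).n - 2 at hi
      simp only
      rw [if_pos ⟨hi, hi⟩]
      exact ih' _ (by omega)

/-! ## Composition with such a morphism -/

variable (Λ) in
/-- The order in which the values on chords are determined. -/
def rank (s : ℕ) : Chord → ℕ
  | .line i j => j - i
  | .ev e => (Λ.slice s).n + 1 + e

theorem catCoch_single_congr {x y : (Λ.augCat 𝕜 s t).Obj} {f f' : (Λ.augCat 𝕜 s t).Hom x y} {c : Chord}
    (h : ∀ hc : Λ.IsReeb s t 2 ⟨c, 0, 1⟩, evalHom Λ ⟨c, hc⟩ x y f = evalHom Λ ⟨c, hc⟩ x y f') :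
    (Λ.catCoch 𝕜 s t c).val (single f) = (Λ.catCoch 𝕜 s t c).val (single f') := by
  rw [catCoch_single, catCoch_single]
  congr 1
  unfold coord
  split_ifs with hc
  · exact h hc
  · rfl

theorem catCoch_pair (c : Chord) {x y z : (Λ.augCat 𝕜 s t).Obj} (g : (Λ.augCat 𝕜 s t).Hom y z)
    (f : (Λ.augCat 𝕜 s t).Hom x y) : (Λ.catCoch 𝕜 s t c).val (cons g (single f)) = 0 :=
  catCoch_of_long Λ c _ (by simp [single])

theorem blockDisks_right_congr {x y z : (Λ.augCat 𝕜 s t).Obj} (ψ : (Λ.augCat 𝕜 s t).Hom x y)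
    {f f' : (Λ.augCat 𝕜 s t).Hom y z} {e : ℕ} (he : s ≤ e)
    (h : ∀ c : Λ.Plus s t, (∀ e', c.1 = .ev e' → e' < e) → f c = f' c) (i j : ℕ) :
    (Λ.blockDisks (Λ.catData 𝕜 s t) s e i j).val (single f) =
      (Λ.blockDisks (Λ.catData 𝕜 s t) s e i j).val (single f') ∧
    (Λ.blockDisks (Λ.catData 𝕜 s t) s e i j).val (cons f (single ψ)) =
      (Λ.blockDisks (Λ.catData 𝕜 s t) s e i j).val (cons f' (single ψ)) := by
  let G : AddSubgroup (Coch (Λ.augCat 𝕜 s t).Hom 𝕜) :=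
    { carrier := {φ | φ.val (single f) = φ.val (single f') ∧
        φ.val (cons f (single ψ)) = φ.val (cons f' (single ψ))}
      zero_mem' := ⟨rfl, rfl⟩
      add_mem' := fun {a b} ha hb => ⟨congrArg₂ (· + ·) ha.1 hb.1, congrArg₂ (· + ·) ha.2 hb.2⟩
      neg_mem' := fun {a} ha => ⟨congrArg Neg.neg ha.1, congrArg Neg.neg ha.2⟩ }
  have hG : ∀ c : Chord, (∀ e', c = .ev e' → e' < e) → Λ.catCoch 𝕜 s t c ∈ G := fun c hc =>
    ⟨catCoch_single_congr fun hc' => h ⟨c, hc'⟩ hc, by rw [catCoch_pair, catCoch_pair]⟩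
  refine Λ.blockDisks_mem _ (𝒢 := fun _ => G) ⟨rfl, rfl⟩ ?_ he (fun i j => hG _ (by simp))
    (fun e' h1 h2 => hG _ (by simpa using h2)) (fun e' h1 h2 => ⟨⟨rfl, rfl⟩, ⟨rfl, rfl⟩⟩) i j
  rintro a b φ φ' ⟨h1, h2⟩ ⟨h3, h4⟩
  refine ⟨?_, ?_⟩
  · rw [Coch.mul_single, Coch.mul_single, h1, h3]
  · rw [Coch.mul_pair, Coch.mul_pair, h2, h3, h4]

theorem blockDisks_left_congr {x y z : (Λ.augCat 𝕜 s t).Obj} (ψ : (Λ.augCat 𝕜 s t).Hom y z)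
    {f f' : (Λ.augCat 𝕜 s t).Hom x y} {e : ℕ} (he : s ≤ e)
    (h : ∀ c : Λ.Plus s t, (∀ e', c.1 = .ev e' → e' < e) → f c = f' c) (i j : ℕ) :
    (Λ.blockDisks (Λ.catData 𝕜 s t) s e i j).val (single f) =
      (Λ.blockDisks (Λ.catData 𝕜 s t) s e i j).val (single f') ∧
    (Λ.blockDisks (Λ.catData 𝕜 s t) s e i j).val (cons ψ (single f)) =
      (Λ.blockDisks (Λ.catData 𝕜 s t) s e i j).val (cons ψ (single f')) := by
  let G : AddSubgroup (Coch (Λ.augCat 𝕜 s t).Hom 𝕜) :=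
    { carrier := {φ | φ.val (single f) = φ.val (single f') ∧
        φ.val (cons ψ (single f)) = φ.val (cons ψ (single f'))}
      zero_mem' := ⟨rfl, rfl⟩
      add_mem' := fun {a b} ha hb => ⟨congrArg₂ (· + ·) ha.1 hb.1, congrArg₂ (· + ·) ha.2 hb.2⟩
      neg_mem' := fun {a} ha => ⟨congrArg Neg.neg ha.1, congrArg Neg.neg ha.2⟩ }
  have hG : ∀ c : Chord, (∀ e', c = .ev e' → e' < e) → Λ.catCoch 𝕜 s t c ∈ G := fun c hc =>
    ⟨catCoch_single_congr fun hc' => h ⟨c, hc'⟩ hc, by rw [catCoch_pair, catCoch_pair]⟩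
  refine Λ.blockDisks_mem _ (𝒢 := fun _ => G) ⟨rfl, rfl⟩ ?_ he (fun i j => hG _ (by simp))
    (fun e' h1 h2 => hG _ (by simpa using h2)) (fun e' h1 h2 => ⟨⟨rfl, rfl⟩, ⟨rfl, rfl⟩⟩) i j
  rintro a b φ φ' ⟨h1, h2⟩ ⟨h3, h4⟩
  refine ⟨?_, ?_⟩
  · rw [Coch.mul_single, Coch.mul_single, h1, h3]
  · rw [Coch.mul_pair, Coch.mul_pair, h2, h1, h4]

end Front


namespace Front

open Str AInfCat

variable {Λ : Front} {𝕜 : Type u} [CommRing 𝕜] {s t : ℕ}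

theorem catCoch_single_sub (c : Λ.Plus s t) {x y : (Λ.augCat 𝕜 s t).Obj}
    (f f' : (Λ.augCat 𝕜 s t).Hom x y) :
    (Λ.catCoch 𝕜 s t c.1).val (single f) - (Λ.catCoch 𝕜 s t c.1).val (single f') =
      sig (Λ.deg s c.1) * (evalHom Λ c x y f - evalHom Λ c x y f') := by
  rw [catCoch_single, catCoch_single, ← mul_sub]
  exact congrArg _ (congrArg₂ (· - ·) (coord_of_mem (Λ := Λ) f c) (coord_of_mem (Λ := Λ) f' c))

theorem deg_diag (s i : ℕ) : Λ.deg s (.line i i) = -1 := by simp [deg]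

theorem isUnit_sgn (d : ℤ) : IsUnit ((sgn d : ℤ) : 𝕜) := by
  refine IsUnit.of_mul_eq_one ((sgn d : ℤ) : 𝕜) ?_
  exact_mod_cast congrArg (Int.cast (R := 𝕜)) (sgn_mul_self d)

theorem isUnit_sig (d : ℤ) : IsUnit ((sig d : ℤ) : 𝕜) := by
  simpa using isUnit_sig_mul (𝕜 := 𝕜) d isUnit_one

theorem UnitDiag.right_aux (ht : t ≤ Λ.size) {x y z : (Λ.augCat 𝕜 s t).Obj}
    {ψ : (Λ.augCat 𝕜 s t).Hom x y} (h : Λ.UnitDiag (𝕜 := 𝕜) ψ) (c : Λ.Plus s t) :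
    ∃ a : 𝕜, IsUnit a ∧ ∀ f f' : (Λ.augCat 𝕜 s t).Hom y z,
      (∀ c' : Λ.Plus s t, Λ.rank s c'.1 < Λ.rank s c.1 → evalHom Λ c' y z f = evalHom Λ c' y z f') →
      (Λ.blockDiff (Λ.catData 𝕜 s t) s c.1).val (cons f (single ψ)) -
        (Λ.blockDiff (Λ.catData 𝕜 s t) s c.1).val (cons f' (single ψ)) =
      a * (evalHom Λ c y z f - evalHom Λ c y z f') := by
  obtain ⟨c, hc⟩ := c
  cases c with
  | line i j =>
    have hij := Λ.isReeb_line.1 hc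
    refine ⟨(Λ.catCoch 𝕜 s t (.line i i)).val (single ψ) * sig (Λ.deg s (.line i j)),
      (h.catCoch (Λ.isReeb_line.2 ⟨le_rfl, by omega⟩) rfl).mul (isUnit_sig _), fun f f' hf => ?_⟩
    have h0 : ∀ f : (Λ.augCat 𝕜 s t).Hom y z,
        (Λ.blockDiff (Λ.catData 𝕜 s t) s (.line i j)).val (cons f (single ψ)) =
        - ∑ l ∈ Finset.range (j + 1), sgn (Λ.deg s (.line i l)) *
          ((Λ.catCoch 𝕜 s t (.line i l)).val (single ψ) *
            (Λ.catCoch 𝕜 s t (.line l j)).val (single f)) := by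
      intro f
      rw [blockDiff, Coch.neg_val, Coch.sum_val]
      congr 1
      refine Finset.sum_congr rfl fun l _ => ?_
      rw [Coch.zsmul_val, Coch.mul_pair]
      rw [catData_line, catData_line, catCoch_pair, catCoch_pair, zero_mul, zero_add, mul_zero, add_zero]
      simp
    rw [h0, h0, neg_sub_neg, ← Finset.sum_sub_distrib]
    rw [Finset.sum_eq_single_of_mem i (by simp; omega)]
    · have := catCoch_single_sub ⟨_, hc⟩ f f'
      rw [deg_diag, show sgn (-1) = -1 by simp [sgn], ← mul_sub, ← mul_sub, ← neg_sub, this]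
      push_cast
      ring
    · intro l hl hli
      have hl' : l ≤ j := by simp at hl; omega
      rcases lt_or_gt_of_ne hli with h1 | h1
      · rw [Λ.catCoch_line_eq_zero (by omega)]
        simp
      · rw [catCoch_single_congr (f := f) (f' := f'), sub_self]
        intro hc'
        exact hf ⟨_, hc'⟩ (by simp only [rank]; omega)
  | ev e =>
    have hl := IsReeb.lies Λ hc e rfl
    have hrank : ∀ c' : Λ.Plus s t, (∀ e', c'.1 = .ev e' → e' < e) → Λ.rank s c'.1 < Λ.rank s (.ev e) := by
      rintro ⟨c', h'⟩ h1
      cases c' with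
      | line i j =>
        have := Λ.isReeb_line.1 h'
        simp only [rank]
        omega
      | ev e' =>
        have := h1 e' rfl
        simp only [rank]
        omega
    have he := hc.2.2.2.2
    rcases hE : Λ.event e with k | k | ⟨k, v⟩ | b
    · have hleg := Λ.legal e (by omega)
      rw [hE] at hleg
      have hk : k + 1 < (Λ.slice e).n := hleg
      refine ⟨(Λ.blockDisks (Λ.catData 𝕜 s t) s e k k).val (single ψ) * sig (Λ.deg s (.ev e)),
        (h.blockDisks ht hl.1 (by omega) (by omega)).mul (isUnit_sig _), fun f f' hf => ?_⟩
      have h1 := blockDisks_right_congr ψ (f := f) (f' := f') hl.1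
        fun c' hc' => hf c' (hrank c' hc')
      have := catCoch_single_sub ⟨_, hc⟩ f f'
      simp only [blockDiff, hE, Coch.sub_val, Coch.add_val, Coch.zsmul_val, Coch.mul_pair,
        catData_ev, catCoch_pair, h1]
      simp only [mul_zero, zero_mul, add_zero, zero_add]
      linear_combination (Λ.blockDisks (Λ.catData 𝕜 s t) s e k k).val (single ψ) * this
    · simp [hE] at he
    · refine ⟨(Λ.catCoch 𝕜 s t (.ev e)).val (single ψ) * sig (Λ.deg s (.ev e)),
        (h.catCoch hc ⟨k, v, hE⟩).mul (isUnit_sig _), fun f f' hf => ?_⟩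
      have := catCoch_single_sub ⟨_, hc⟩ f f'
      simp only [blockDiff, hE, Coch.mul_pair, catData_ev, catCoch_pair]
      simp only [mul_zero, zero_mul, add_zero, zero_add]
      linear_combination (Λ.catCoch 𝕜 s t (.ev e)).val (single ψ) * this
    · simp [hE] at he

theorem UnitDiag.left_aux (ht : t ≤ Λ.size) {x y z : (Λ.augCat 𝕜 s t).Obj}
    {ψ : (Λ.augCat 𝕜 s t).Hom y z} (h : Λ.UnitDiag (𝕜 := 𝕜) ψ) (c : Λ.Plus s t) :
    ∃ a : 𝕜, IsUnit a ∧ ∀ f f' : (Λ.augCat 𝕜 s t).Hom x y,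
      (∀ c' : Λ.Plus s t, Λ.rank s c'.1 < Λ.rank s c.1 → evalHom Λ c' x y f = evalHom Λ c' x y f') →
      (Λ.blockDiff (Λ.catData 𝕜 s t) s c.1).val (cons ψ (single f)) -
        (Λ.blockDiff (Λ.catData 𝕜 s t) s c.1).val (cons ψ (single f')) =
      a * (evalHom Λ c x y f - evalHom Λ c x y f') := by
  obtain ⟨c, hc⟩ := c
  cases c with
  | line i j =>
    have hij := Λ.isReeb_line.1 hc
    refine ⟨- (sgn (Λ.deg s (.line i j)) * (Λ.catCoch 𝕜 s t (.line j j)).val (single ψ) *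
      sig (Λ.deg s (.line i j))),
      (((isUnit_sgn _).mul (h.catCoch (Λ.isReeb_line.2 ⟨le_rfl, by omega⟩) rfl)).mul (isUnit_sig _)).neg,
      fun f f' hf => ?_⟩
    have h0 : ∀ f : (Λ.augCat 𝕜 s t).Hom x y,
        (Λ.blockDiff (Λ.catData 𝕜 s t) s (.line i j)).val (cons ψ (single f)) =
        - ∑ l ∈ Finset.range (j + 1), sgn (Λ.deg s (.line i l)) *
          ((Λ.catCoch 𝕜 s t (.line i l)).val (single f) *
            (Λ.catCoch 𝕜 s t (.line l j)).val (single ψ)) := by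
      intro f
      rw [blockDiff, Coch.neg_val, Coch.sum_val]
      congr 1
      refine Finset.sum_congr rfl fun l _ => ?_
      rw [Coch.zsmul_val, Coch.mul_pair]
      rw [catData_line, catData_line, catCoch_pair, catCoch_pair, zero_mul, zero_add, mul_zero, add_zero]
      simp
    rw [h0, h0, neg_sub_neg, ← Finset.sum_sub_distrib]
    rw [Finset.sum_eq_single_of_mem j (by simp)]
    · have := catCoch_single_sub ⟨_, hc⟩ f f'
      linear_combination - (sgn (Λ.deg s (.line i j)) * (Λ.catCoch 𝕜 s t (.line j j)).val (single ψ)) * this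
    · intro l hl hli
      have hl' : l ≤ j := by simp at hl; omega
      rcases Nat.lt_or_ge l i with h1 | h1
      · rw [Λ.catCoch_line_eq_zero (by omega)]
        simp
      · rw [catCoch_single_congr (f := f) (f' := f'), sub_self]
        intro hc'
        exact hf ⟨_, hc'⟩ (by simp only [rank]; omega)
  | ev e =>
    have hl := IsReeb.lies Λ hc e rfl
    have hrank : ∀ c' : Λ.Plus s t, (∀ e', c'.1 = .ev e' → e' < e) → Λ.rank s c'.1 < Λ.rank s (.ev e) := by
      rintro ⟨c', h'⟩ h1
      cases c' with
      | line i j =>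
        have := Λ.isReeb_line.1 h'
        simp only [rank]
        omega
      | ev e' =>
        have := h1 e' rfl
        simp only [rank]
        omega
    have he := hc.2.2.2.2
    rcases hE : Λ.event e with k | k | ⟨k, v⟩ | b
    · have hleg := Λ.legal e (by omega)
      rw [hE] at hleg
      have hk : k + 1 < (Λ.slice e).n := hleg
      refine ⟨- (sgn (Λ.deg 0 (.ev e)) *
        (Λ.blockDisks (Λ.catData 𝕜 s t) s e (k + 1) (k + 1)).val (single ψ) * sig (Λ.deg s (.ev e))),
        (((isUnit_sgn _).mul (h.blockDisks ht hl.1 (by omega) (by omega))).mul (isUnit_sig _)).neg, fun f f' hf => ?_⟩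
      have h1 := blockDisks_left_congr ψ (f := f) (f' := f') hl.1
        fun c' hc' => hf c' (hrank c' hc')
      have := catCoch_single_sub ⟨_, hc⟩ f f'
      simp only [blockDiff, hE, Coch.sub_val, Coch.add_val, Coch.zsmul_val, Coch.mul_pair,
        catData_ev, catCoch_pair, h1]
      simp only [mul_zero, zero_mul, add_zero, zero_add]
      linear_combination - (sgn (Λ.deg 0 (.ev e)) *
        (Λ.blockDisks (Λ.catData 𝕜 s t) s e (k + 1) (k + 1)).val (single ψ)) * this
    · simp [hE] at he
    · refine ⟨(Λ.catCoch 𝕜 s t (.ev e)).val (single ψ) * sig (Λ.deg s (.ev e)),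
        (h.catCoch hc ⟨k, v, hE⟩).mul (isUnit_sig _), fun f f' hf => ?_⟩
      have := catCoch_single_sub ⟨_, hc⟩ f f'
      simp only [blockDiff, hE, Coch.mul_pair, catData_ev, catCoch_pair]
      simp only [mul_zero, zero_mul, add_zero, zero_add]
      linear_combination (Λ.catCoch 𝕜 s t (.ev e)).val (single ψ) * this
    · simp [hE] at he

theorem UnitDiag.rightBij (ht : t ≤ Λ.size) {x y : (Λ.augCat 𝕜 s t).Obj}
    {ψ : (Λ.augCat 𝕜 s t).Hom x y} (h : Λ.UnitDiag (𝕜 := 𝕜) ψ) (h0 : ψ ∈ (Λ.augCat 𝕜 s t).gr x y 0) :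
    RightBij ψ := by
  have tri : ∀ z : (Λ.augCat 𝕜 s t).Obj, IsTriangular (fun c : Λ.Plus s t => Λ.rank s c.1)
      fun f : Λ.Plus s t → 𝕜 => (Λ.augCat 𝕜 s t).b
        (cons (show (Λ.augCat 𝕜 s t).Hom y z from f) (single ψ)) := by
    intro z c
    obtain ⟨a, ha, h1⟩ := h.right_aux ht (z := z) c
    refine ⟨((isUnit_sig (Λ.deg s c.1 - 1)).mul ha).unit, fun f f' hf => ?_⟩
    have h2 := h1 f f' hf
    simp only [augCat_b Λ ht, IsUnit.unit_spec, ← mul_sub, mul_assoc]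
    exact congrArg _ h2
  have hA := Λ.isAInf_augCat (𝕜 := 𝕜) (s := s) ht
  refine ⟨fun {z f g} hfg => (tri z).injective hfg, fun {z d g} hg => ?_⟩
  obtain ⟨f, h1, h2⟩ := (tri z).exists_eq {c | Λ.deg s c.1 + 1 ≠ d} (fun f hf => by
    have h3 : (show (Λ.augCat 𝕜 s t).Hom y z from f) ∈ (Λ.augCat 𝕜 s t).gr y z d := hf
    have h4 := hA.b_pair_deg h3 h0
    rw [add_zero] at h4
    exact h4) g hg
  exact ⟨f, h1, h2⟩

theorem UnitDiag.leftBij (ht : t ≤ Λ.size) {x y : (Λ.augCat 𝕜 s t).Obj}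
    {ψ : (Λ.augCat 𝕜 s t).Hom x y} (h : Λ.UnitDiag (𝕜 := 𝕜) ψ) (h0 : ψ ∈ (Λ.augCat 𝕜 s t).gr x y 0) :
    LeftBij ψ := by
  have tri : ∀ z : (Λ.augCat 𝕜 s t).Obj, IsTriangular (fun c : Λ.Plus s t => Λ.rank s c.1)
      fun f : Λ.Plus s t → 𝕜 => (Λ.augCat 𝕜 s t).b
        (cons ψ (single (show (Λ.augCat 𝕜 s t).Hom z x from f))) := by
    intro z c
    obtain ⟨a, ha, h1⟩ := h.left_aux ht (x := z) c
    refine ⟨((isUnit_sig (Λ.deg s c.1 - 1)).mul ha).unit, fun f f' hf => ?_⟩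
    have h2 := h1 f f' hf
    simp only [augCat_b Λ ht, IsUnit.unit_spec, ← mul_sub, mul_assoc]
    exact congrArg _ h2
  have hA := Λ.isAInf_augCat (𝕜 := 𝕜) (s := s) ht
  refine ⟨fun {z f g} hfg => (tri z).injective hfg, fun {z d g} hg => ?_⟩
  obtain ⟨f, h1, h2⟩ := (tri z).exists_eq {c | Λ.deg s c.1 + 1 ≠ d} (fun f hf => by
    have h3 : (show (Λ.augCat 𝕜 s t).Hom z x from f) ∈ (Λ.augCat 𝕜 s t).gr z x d := hf
    have h4 := hA.b_pair_deg h0 h3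
    rw [zero_add] at h4
    exact h4) g hg
  exact ⟨f, h1, h2⟩

end Front


namespace Front

open Str AInfCat

variable {Λ : Front} {𝕜 : Type u} [CommRing 𝕜] {s t : ℕ}

/-! ## Isomorphisms are invertible on the diagonal -/

theorem IsDiag.deg {c : Chord} (hd : Λ.IsDiag c) : Λ.deg s c = -1 := by
  cases c with
  | line i j => obtain rfl : i = j := hd; exact deg_diag s i
  | ev e => obtain ⟨k, v, hE⟩ := hd; simp [Front.deg, hE]

theorem IsDiag.blockDiff {c : Chord} (hd : Λ.IsDiag c) :
    Λ.blockDiff (Λ.catData 𝕜 s t) s c = Λ.catCoch 𝕜 s t c * Λ.catCoch 𝕜 s t c := by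
  cases c with
  | line i j =>
    obtain rfl : i = j := hd
    rw [Front.blockDiff, Finset.sum_eq_single_of_mem i (by simp), deg_diag, sgn, Int.negOnePow_neg,
      Int.negOnePow_one]
    · simp [catData_line]
    · intro l hl hli
      have hl' : l < i := by simp at hl; omega
      rw [catData_line, Λ.catCoch_line_eq_zero (by omega), zero_mul, smul_zero]
  | ev e => obtain ⟨k, v, hE⟩ := hd; simp [Front.blockDiff, hE, catData_ev]

theorem IsDiag.catCoch_nil {c : Chord} (hd : Λ.IsDiag c) (x : (Λ.augCat 𝕜 s t).Obj) :
    (Λ.catCoch 𝕜 s t c).val (nil x) = 0 :=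
  Λ.catCoch_nil_of_deg (by rw [hd.deg]; decide) x

theorem IsDiag.b_single (ht : t ≤ Λ.size) {c : Λ.Plus s t} (hd : Λ.IsDiag c.1)
    {x y : (Λ.augCat 𝕜 s t).Obj} (f : (Λ.augCat 𝕜 s t).Hom x y) :
    evalHom Λ c x y ((Λ.augCat 𝕜 s t).b (single f)) = 0 := by
  refine (augCat_b Λ ht (single f) c).trans ?_
  rw [hd.blockDiff, Coch.mul_single, hd.catCoch_nil, hd.catCoch_nil]
  simp

theorem IsDiag.b_pair (ht : t ≤ Λ.size) {c : Λ.Plus s t} (hd : Λ.IsDiag c.1)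
    {x y z : (Λ.augCat 𝕜 s t).Obj} (g : (Λ.augCat 𝕜 s t).Hom y z) (f : (Λ.augCat 𝕜 s t).Hom x y) :
    evalHom Λ c x z ((Λ.augCat 𝕜 s t).b (cons g (single f))) =
      - (evalHom Λ c x y f * evalHom Λ c y z g) := by
  refine (augCat_b Λ ht (cons g (single f)) c).trans ?_
  have h1 : ∀ {x y : (Λ.augCat 𝕜 s t).Obj} (f : (Λ.augCat 𝕜 s t).Hom x y),
      (Λ.catCoch 𝕜 s t c.1).val (single f) = - evalHom Λ c x y f := by
    intro x y f
    rw [catCoch_single, hd.deg, sig_neg_one]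
    exact (congrArg _ (coord_of_mem (Λ := Λ) f c)).trans (by simp; rfl)
  rw [hd.blockDiff, Coch.mul_pair, hd.catCoch_nil, hd.catCoch_nil, h1, h1, hd.deg,
    show sig (-1 - 1) = -1 by decide]
  push_cast
  ring

theorem IsDiag.one {c : Λ.Plus s t} (hd : Λ.IsDiag c.1) (x : (Λ.augCat 𝕜 s t).Obj) :
    evalHom Λ c x x ((Λ.augCat 𝕜 s t).one x) = -1 := by
  have h1 := coord_one Λ (t := t) x c.1
  have h2 : coord Λ s t ((Λ.augCat 𝕜 s t).one x) c.1 = evalHom Λ c x x ((Λ.augCat 𝕜 s t).one x) :=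
    coord_of_mem (Λ := Λ) _ c
  rw [h2, hd.deg, sig_neg_one] at h1
  have h3 : Λ.unitCoord 𝕜 s t c.1 = 1 := by
    obtain ⟨c, hc⟩ := c
    cases c with
    | line i j =>
      obtain rfl : i = j := hd
      exact unitAt_one ⟨rfl, (Λ.isReeb_line.1 hc).2⟩
    | ev e =>
      obtain ⟨k, v, hE⟩ := hd
      simp only [unitCoord, hE]
      exact if_pos (IsReeb.lies Λ hc e rfl)
  rw [h3] at h1
  push_cast at h1
  linear_combination - h1

theorem unitDiag_of_isIso (ht : t ≤ Λ.size) {x y : (Λ.augCat 𝕜 s t).Obj}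
    {φ : (Λ.augCat 𝕜 s t).Hom x y} (h : IsIso φ) : Λ.UnitDiag (𝕜 := 𝕜) φ := by
  obtain ⟨_, _, g, _, _, ⟨k, hk⟩, _⟩ := h
  intro c hd
  have h1 := congrArg (evalHom Λ c x x) hk
  rw [map_sub, hd.b_single ht, hd.b_pair ht, hd.one] at h1
  refine IsUnit.of_mul_eq_one (evalHom Λ c y x g) ?_
  change evalHom Λ c x y φ * _ = 1
  linear_combination h1

end Front


namespace Front

open Str AInfCat

variable (Λ : Front) {𝕜 : Type u} [CommRing 𝕜] {s t : ℕ}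

/-! ## Extension of augmentations over one more event -/

/-- The homomorphism with prescribed values at the last event. -/
def extend (x : Λ.Alg s t 1 →+* 𝕜) (v : 𝕜) (w : 𝕜ˣ) : Λ.Alg s (t + 1) 1 →+* 𝕜 :=
  lift
    (fun r => match r.1.chord with
      | .line i j => x (Λ.gen s t 1 ⟨.line i j, 0, 0⟩)
      | .ev e => if e = t then v else x (Λ.gen s t 1 ⟨.ev e, 0, 0⟩))
    (fun m => if m.1.1 = t then w else Units.map x.toMonoidHom (Λ.tgen s t 1 m.1.1 0))

variable {Λ} {x : Λ.Alg s t 1 →+* 𝕜} {v : 𝕜} {w : 𝕜ˣ}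

theorem reeb_one {l : Letter} (h : Λ.IsReeb s t 1 l) : l = ⟨l.chord, 0, 0⟩ := by
  obtain ⟨c, p, q⟩ := l
  have h1 := h.1
  have h2 := h.2.1
  simp only [Nat.lt_one_iff] at h1 h2
  rw [h1, h2]

theorem extend_line (i j p q : ℕ) : Λ.extend x v w (Λ.gen s (t + 1) 1 ⟨.line i j, p, q⟩) =
    x (Λ.gen s t 1 ⟨.line i j, p, q⟩) := by
  by_cases h : Λ.IsReeb s (t + 1) 1 ⟨.line i j, p, q⟩
  · refine (lift_gen Λ _ _ ⟨_, h⟩).trans ?_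
    have := reeb_one h
    simp only [Letter.mk.injEq, true_and] at this
    simp [this]
  · rw [gen_eq_zero Λ h, gen_eq_zero Λ (s := s) (t := t) (l := ⟨.line i j, p, q⟩) h, map_zero, map_zero]

theorem extend_ev {e : ℕ} (he : e < t) (p q : ℕ) : Λ.extend x v w (Λ.gen s (t + 1) 1 ⟨.ev e, p, q⟩) =
    x (Λ.gen s t 1 ⟨.ev e, p, q⟩) := by
  by_cases h : Λ.IsReeb s (t + 1) 1 ⟨.ev e, p, q⟩
  · refine (lift_gen Λ _ _ ⟨_, h⟩).trans ?_
    have := reeb_one h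
    simp only [Letter.mk.injEq, true_and] at this
    simp [this, he.ne]
  · rw [gen_eq_zero Λ h, gen_eq_zero Λ (s := s) (t := t), map_zero, map_zero]
    intro h'
    exact h ⟨h'.1, h'.2.1, h'.2.2.1, by omega, h'.2.2.2.2⟩

theorem extend_last (h : Λ.IsReeb s (t + 1) 1 ⟨.ev t, 0, 0⟩) :
    Λ.extend x v w (Λ.gen s (t + 1) 1 ⟨.ev t, 0, 0⟩) = v := by
  refine (lift_gen Λ _ _ ⟨_, h⟩).trans ?_
  simp

theorem extend_tgen {e : ℕ} (he : e < t) (p : ℕ) :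
    Units.map (Λ.extend x v w).toMonoidHom (Λ.tgen s (t + 1) 1 e p) =
      Units.map x.toMonoidHom (Λ.tgen s t 1 e p) := by
  by_cases h : Λ.IsMark s (t + 1) 1 (e, p)
  · have hp : p = 0 := by have := h.1; simpa using this
    subst hp
    apply Units.ext
    refine (lift_tgen Λ _ _ ⟨_, h⟩).trans ?_
    simp [he.ne]
  · have h' : ¬ Λ.IsMark s t 1 (e, p) := fun h' => h ⟨h'.1, h'.2.1, by have := h'.2.2.1; simp at this ⊢; omega, h'.2.2.2⟩
    simp [tgen, h, h']

theorem extend_tgen_last (h : Λ.IsMark s (t + 1) 1 (t, 0)) :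
    Units.map (Λ.extend x v w).toMonoidHom (Λ.tgen s (t + 1) 1 t 0) = w := by
  apply Units.ext
  refine (lift_tgen Λ _ _ ⟨_, h⟩).trans ?_
  simp

theorem evalDisks_congr {t' : ℕ} {x : Λ.Alg s t 1 →+* 𝕜} {y : Λ.Alg s t' 1 →+* 𝕜} {e : ℕ} (he : s ≤ e)
    (h1 : ∀ i j p q, x (Λ.gen s t 1 ⟨.line i j, p, q⟩) = y (Λ.gen s t' 1 ⟨.line i j, p, q⟩))
    (h2 : ∀ e', s ≤ e' → e' < e → ∀ p q, x (Λ.gen s t 1 ⟨.ev e', p, q⟩) = y (Λ.gen s t' 1 ⟨.ev e', p, q⟩))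
    (h3 : ∀ e', s ≤ e' → e' < e → ∀ p, Units.map x.toMonoidHom (Λ.tgen s t 1 e' p) =
      Units.map y.toMonoidHom (Λ.tgen s t' 1 e' p)) :
    Λ.evalDisks x e = Λ.evalDisks y e := by
  induction e, he using Nat.le_induction with
  | base =>
    funext i j
    simp [evalDisks, elems, sweep, border, Nat.mod_one, h1]
  | succ e he ih =>
    have ih' := ih (fun e' h h' => h2 e' h (by omega)) (fun e' h h' => h3 e' h (by omega))
    rw [evalDisks, evalDisks, Λ.sweep_succ _ _ _ he, Λ.sweep_succ _ _ _ he]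
    change Λ.sweep _ _ (Λ.evalDisks x e) _ = Λ.sweep _ _ (Λ.evalDisks y e) _
    rw [ih']
    exact Λ.sweep_congr (h2 e he (by omega)) (h3 e he (by omega)) (fun _ h => h) _

theorem evalDisks_extend {e : ℕ} (he : s ≤ e) (het : e ≤ t) :
    Λ.evalDisks (Λ.extend x v w) e = Λ.evalDisks x e :=
  evalDisks_congr he extend_line (fun e' _ h => extend_ev (by omega)) fun e' _ h => extend_tgen (by omega)

theorem isAug_extend (hx : Λ.IsAug x) (hst : s ≤ t)
    (h1 : ∀ k, Λ.event t = .cross k → (Λ.deg 0 (.ev t) ≠ 0 → v = 0) ∧ Λ.evalDisks x t k (k + 1) = 0)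
    (h2 : ∀ b, Λ.event t = .rcusp b → v = 0 ∧ b = true ∧
      Λ.evalDisks x t ((Λ.slice t).n - 2) ((Λ.slice t).n - 2 + 1) +
        (Λ.markFactor (fun _ _ => w) t 0 : 𝕜ˣ) = 0) :
    Λ.IsAug (Λ.extend x v w) := by
  apply Λ.isAug_of_gen
  · rintro ⟨l, hr⟩ hd
    have hl := reeb_one hr
    obtain ⟨c, p, q⟩ := l
    simp only [Letter.mk.injEq, true_and] at hl
    obtain ⟨rfl, rfl⟩ := hl
    cases c with
    | line i j => exact (extend_line i j 0 0).trans (Λ.aug_gen hx _ hd)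
    | ev e =>
      have h3 := hr.2.2
      rcases Nat.lt_or_ge e t with he | he
      · exact (extend_ev he 0 0).trans (Λ.aug_gen hx _ hd)
      · obtain rfl : e = t := by omega
        rw [extend_last hr]
        have h4 := hr.2.2.2.2
        rcases hE : Λ.event e with k | k | ⟨k, v⟩ | b
        · exact (h1 k hE).1 hd
        · simp [hE] at h4
        · simp [hE] at h4
        · exact (h2 b hE).1
  · rintro ⟨l, hr⟩
    have hl := reeb_one hr
    obtain ⟨c, p, q⟩ := l
    simp only [Letter.mk.injEq, true_and] at hl
    obtain ⟨rfl, rfl⟩ := hl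
    cases c with
    | line i j =>
      have h3 := Λ.aug_dgen hx (l := ⟨.line i j, 0, 0⟩) hr
      simp only [dgen, map_sum, map_zsmul, map_mul, extend_line] at h3 ⊢
      exact h3
    | ev e =>
      have h4 := hr.2.2
      have h5 : e < t → Λ.evalDisks x e = Λ.evalDisks x e := fun _ => rfl
      rcases Nat.lt_or_ge e t with he | he
      · have hr' : Λ.IsReeb s t 1 ⟨.ev e, 0, 0⟩ := ⟨hr.1, hr.2.1, hr.2.2.1, he, hr.2.2.2.2⟩
        have h3 := Λ.aug_dgen hx hr'
        simp only [dgen] at h3 ⊢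
        rw [← Λ.map_chordDisks] at h3 ⊢
        rcases hE : Λ.event e with k | k | ⟨k, v⟩ | b
        · rw [Λ.chordDisks_cross _ _ hE] at h3 ⊢
          rw [← h3]
          exact congrFun (congrFun (evalDisks_extend hr.2.2.1 he.le) k) (k + 1)
        · simp [hE] at h4
        · simp [hE] at h4
        · rw [Λ.chordDisks_rcusp _ _ hE] at h3 ⊢
          rw [← h3]
          congr 1
          · exact congrFun (congrFun (evalDisks_extend hr.2.2.1 he.le) _) _
          · exact congrArg Units.val (Λ.markFactor_congr (extend_tgen he 0))
      · obtain rfl : e = t := by omega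
        simp only [dgen]
        rw [← Λ.map_chordDisks]
        rcases hE : Λ.event e with k | k | ⟨k, v⟩ | b
        · rw [Λ.chordDisks_cross _ _ hE]
          exact (congrFun (congrFun (evalDisks_extend hr.2.2.1 le_rfl) k) (k + 1)).trans (h1 k hE).2
        · simp [hE] at h4
        · simp [hE] at h4
        · obtain ⟨_, rfl, h6⟩ := h2 b hE
          rw [Λ.chordDisks_rcusp _ _ hE, ← h6]
          congr 1
          · exact congrFun (congrFun (evalDisks_extend hr.2.2.1 le_rfl) _) _
          · exact congrArg Units.val (Λ.markFactor_congr (extend_tgen_last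
              ⟨by simp, hst, by simp, by simp [hE]⟩))

end Front


namespace Front

open Str AInfCat

variable {Λ : Front} {𝕜 : Type u} [CommRing 𝕜] {s t : ℕ}

theorem markFactor_markFactor (M : 𝕜ˣ) (e p : ℕ)
    (h : (∃ k, Λ.event e = .base k) ∨ ∃ b, Λ.event e = .rcusp b) :
    Λ.markFactor (fun _ _ => Λ.markFactor (fun _ _ => M) e p) e p = M := by
  rcases h with ⟨k, hE⟩ | ⟨b, hE⟩ <;> simp only [markFactor, hE] <;> split_ifs <;> simp

theorem exists_extension (x : (Λ.augCat 𝕜 s t).Obj) (hst : s ≤ t) (ht : t + 1 ≤ Λ.size) (v : 𝕜) (M : 𝕜ˣ)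
    (h1 : ∀ k, Λ.event t = .cross k → (Λ.deg 0 (.ev t) ≠ 0 → v = 0) ∧
      Λ.evalDisks (Subtype.val (p := Λ.IsAug) x) t k (k + 1) = 0)
    (h2 : ∀ b, Λ.event t = .rcusp b → b = true ∧
      Λ.evalDisks (Subtype.val (p := Λ.IsAug) x) t ((Λ.slice t).n - 2) ((Λ.slice t).n - 2 + 1) + M = 0) :
    ∃ y : (Λ.augCat 𝕜 s (t + 1)).Obj, (Λ.augRes 𝕜 le_rfl hst t.le_succ ht).obj y = x ∧
      (∀ k, Λ.event t = .cross k → (Subtype.val (p := Λ.IsAug) y) (Λ.gen s (t + 1) 1 ⟨.ev t, 0, 0⟩) = v) ∧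
      ((∃ k, Λ.event t = .base k) ∨ (∃ b, Λ.event t = .rcusp b) → Λ.objMark y t = M) := by
  classical
  set w := Λ.markFactor (fun _ _ => M) t 0 with hw
  have haug : Λ.IsAug (Λ.extend (Subtype.val (p := Λ.IsAug) x) (if ∃ k, Λ.event t = .cross k then v else 0) w) := by
    refine isAug_extend (Subtype.property (p := Λ.IsAug) x) hst ?_ ?_
    · intro k hk
      rw [if_pos ⟨k, hk⟩]
      exact h1 k hk
    · intro b hb
      rw [if_neg (by simp [hb]), hw, markFactor_markFactor M t 0 (.inr ⟨b, hb⟩)]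
      exact ⟨rfl, h2 b hb⟩
  refine ⟨⟨_, haug⟩, ?_, ?_, ?_⟩
  · apply Λ.augObj_ext
    · intro c hc
      cases c with
      | line i j =>
        refine (Λ.augRes_gen_line le_rfl hst t.le_succ ht _ i j).trans ?_
        refine (congrFun (congrFun (evalDisks_extend le_rfl hst) i) j).trans ?_
        simp [evalDisks, elems, sweep, border, Nat.mod_one]
      | ev e =>
        refine (Λ.augRes_gen_ev _ (hc e rfl).1 (hc e rfl).2 0 0).trans ?_
        exact extend_ev (hc e rfl).2 0 0
    · intro e he het
      refine (Λ.objMark_augRes le_rfl hst t.le_succ ht _ he het).trans ?_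
      exact Λ.markFactor_congr (extend_tgen het 0)
  · intro k hk
    refine (extend_last ⟨by simp, by simp, hst, by simp, by simp [hk]⟩).trans ?_
    rw [if_pos ⟨k, hk⟩]
  · intro h
    by_cases hm : Λ.IsMark s (t + 1) 1 (t, 0)
    · refine (Λ.markFactor_congr (τ' := fun _ _ => w) (p' := 0) (extend_tgen_last hm)).trans ?_
      exact markFactor_markFactor M t 0 h
    · exfalso
      apply hm
      refine ⟨by simp, hst, by simp, ?_⟩
      rcases h with ⟨k, hE⟩ | ⟨b, hE⟩
      · simp [hE]
      · simp [hE, (h2 b hE).1]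

end Front


namespace Front

open Str AInfCat

variable {Λ : Front} {𝕜 : Type u} [CommRing 𝕜] {s t t' : ℕ}

/-! ## Restriction to a part of the front with the same left end -/

/-- The values of a morphism on the chords of a smaller part of the front. -/
def cut (t : ℕ) (f : Λ.Plus s t' → 𝕜) : Λ.Plus s t → 𝕜 := fun c => Λ.coord s t' f c.1

theorem resCoch_self (c : Chord) : Λ.resCoch 𝕜 s t s c = Λ.catCoch 𝕜 s t c := by
  cases c with
  | line i j => exact congrFun (congrFun (Λ.blockDisks_of_le _ le_rfl) i) j
  | ev e => rfl

theorem augRes_map_single (hst : s ≤ t) (h' : t ≤ t') (ht : t' ≤ Λ.size)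
    {x y : (Λ.augCat 𝕜 s t').Obj} (f : (Λ.augCat 𝕜 s t').Hom x y) :
    (Λ.augRes 𝕜 le_rfl hst h' ht).map x y (single f) = cut (𝕜 := 𝕜) t f := by
  funext c
  refine (Λ.augRes_map le_rfl hst h' ht (single f) (by simp [single]) c).trans ?_
  rw [resCoch_self, catCoch_single, ← mul_assoc]
  have := congrArg (Int.cast (R := 𝕜)) (sig_mul_self (Λ.deg s c.1))
  push_cast at this
  rw [this, one_mul]
  rfl

theorem isStrict_augRes (hst : s ≤ t) (h' : t ≤ t') (ht : t' ≤ Λ.size) :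
    (Λ.augRes 𝕜 le_rfl hst h' ht).IsStrict := by
  intro x y r hr
  funext c
  refine (Λ.augRes_map le_rfl hst h' ht r (by omega) c).trans ?_
  rw [resCoch_self, catCoch_of_long Λ _ _ hr, mul_zero]
  rfl

/-! ## Isomorphisms, as functions on chords -/

/-- A function on the chords is a closed morphism of degree zero, invertible on the diagonal. -/
structure DiagIso (x y : (Λ.augCat 𝕜 s t).Obj) (f : Λ.Plus s t → 𝕜) : Prop where
  deg : (show (Λ.augCat 𝕜 s t).Hom x y from f) ∈ (Λ.augCat 𝕜 s t).gr x y 0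
  closed : Closed (show (Λ.augCat 𝕜 s t).Hom x y from f)
  unit : Λ.UnitDiag f

/-- The disks, evaluated at a morphism. -/
def diskAt (x y : (Λ.augCat 𝕜 s t).Obj) (f : Λ.Plus s t → 𝕜) (e i j : ℕ) : 𝕜 :=
  (Λ.blockDisks (Λ.catData 𝕜 s t) s e i j).val (single (show (Λ.augCat 𝕜 s t).Hom x y from f))

/-- The disks, evaluated at an object. -/
def diskOf (x : (Λ.augCat 𝕜 s t).Obj) (e i j : ℕ) : 𝕜 :=
  Λ.evalDisks (Subtype.val (p := Λ.IsAug) x) e i j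

theorem diskOf_inv (ht : t ≤ Λ.size) (x : (Λ.augCat 𝕜 s t).Obj) {e : ℕ} (he : s ≤ e) (het : e ≤ t) :
    Inv (Λ.slice e) (diskOf x e) := Λ.evalDisks_inv ht (Subtype.property (p := Λ.IsAug) x) he het

theorem diskOf_eq_zero (ht : t ≤ Λ.size) (x : (Λ.augCat 𝕜 s t).Obj) {e : ℕ} (he : s ≤ e) (het : e ≤ t)
    {i j : ℕ} (h : j ≤ i) : diskOf x e i j = 0 := by
  by_contra h'
  have := ((diskOf_inv ht x he het).supp i j h').1
  omega

theorem blockDisks_val_nil (x : (Λ.augCat 𝕜 s t).Obj) {e : ℕ} (he : s ≤ e) (i j : ℕ) :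
    (Λ.blockDisks (Λ.catData 𝕜 s t) s e i j).val (nil x) = diskOf x e i j := Λ.blockDisks_nil he i j x

variable {x y : (Λ.augCat 𝕜 s t).Obj} {f : Λ.Plus s t → 𝕜}

theorem hasDeg_single {A : AInfCat 𝕜} {x y : A.Obj} {f : A.Hom x y} {d : ℤ} (hf : f ∈ A.gr x y d) :
    A.HasDeg (single f) (d - 1) := by
  rw [single, HasDeg]
  exact ⟨d - 1, 0, by simpa using hf, by rw [HasDeg], by ring⟩

theorem DiagIso.diskAt_eq_zero (h : DiagIso x y f) {e : ℕ} (he : s ≤ e) {i j : ℕ}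
    (hd : (Λ.slice e).pot i ≠ (Λ.slice e).pot j) : diskAt x y f e i j = 0 := by
  have h1 : Λ.resCoch 𝕜 s t e (.line i j) ∈ (Λ.augCat 𝕜 s t).homogeneous (Λ.deg e (.line i j)) :=
    Λ.resCoch_mem_homogeneous he (.line i j)
  refine h1 _ (0 - 1) (hasDeg_single h.deg) ?_
  · simp only [Front.deg]
    omega

theorem DiagIso.isUnit_diskAt (h : DiagIso x y f) (ht : t ≤ Λ.size) {e : ℕ} (he : s ≤ e) (het : e ≤ t)
    {i : ℕ} (hi : i < (Λ.slice e).n) : IsUnit (diskAt x y f e i i) :=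
  UnitDiag.blockDisks (ψ := (show (Λ.augCat 𝕜 s t).Hom x y from f)) h.unit ht he het hi

theorem intertwine_of_closed {φ : (Λ.augCat 𝕜 s t).Hom x y} (h0 : φ ∈ (Λ.augCat 𝕜 s t).gr x y 0)
    (hc : (Λ.augCat 𝕜 s t).b (single φ) = 0) (ht : t ≤ Λ.size) {e : ℕ} (he : s ≤ e) (het : e ≤ t) (k : ℕ) :
    (Λ.blockDisks (Λ.catData 𝕜 s t) s e k k).val (single φ) * diskOf y e k (k + 1) =
      diskOf x e k (k + 1) * (Λ.blockDisks (Λ.catData 𝕜 s t) s e (k + 1) (k + 1)).val (single φ) := by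
  have hA := Λ.isAInf_augCat (𝕜 := 𝕜) (s := s) ht
  have h1 := Λ.structureEq_resData (𝕜 := 𝕜) he ht het k (k + 1) (k + 2) (by omega)
  have h2 := congrArg (fun χ => Coch.val χ (single φ)) h1
  have hml : Λ.resCoch 𝕜 s t e (.line k (k + 1)) ∈ Coch.multilinear (Λ.augCat 𝕜 s t).Hom 𝕜 :=
    Λ.resCoch_mem_multilinear he (.line k (k + 1))
  have hz : ∀ {a b c d : (Λ.augCat 𝕜 s t).Obj} (u : Str (Λ.augCat 𝕜 s t).Hom c d)
      (v : Str (Λ.augCat 𝕜 s t).Hom a b), (Λ.resCoch 𝕜 s t e (.line k (k + 1))).val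
        (u.append (cons 0 v)) = 0 := by
    intro a b c d u v
    have := Coch.multilinear_val_smul hml u (0 : 𝕜) 0 v
    rwa [zero_smul, zero_mul] at this
  have hl : ((Λ.augCat 𝕜 s t).bDer ((Λ.resData 𝕜 s t e).line k (k + 1))).val
      (single φ) = 0 := by
    rw [bDer_val]
    simp only [single] at hc ⊢
    simp only [splitSum_cons, splitSum_nil, hA.b_nil, hc]
    have e1 := hz (nil y) (nil x)
    have e2 := hz (nil y) (cons φ (nil x))
    have e3 := hz ((Λ.augCat 𝕜 s t).sgnStr (cons φ (nil x))) (nil x)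
    simp only [resCoch] at e1 e2 e3
    rw [nil_append] at e1 e2
    simp only [sgnStr_nil, nil_append, e1, e2, e3, add_zero]
  have hs : ∀ i j, ((Λ.augCat 𝕜 s t).signHom ((Λ.resData 𝕜 s t e).line i j)).val
      (single φ) = - (Λ.blockDisks (Λ.catData 𝕜 s t) s e i j).val (single φ) := by
    intro i j
    rw [signHom_val, single, sgnStr_cons, sgnStr_nil, hA.par_zero h0]
    have hml : Λ.resCoch 𝕜 s t e (.line i j) ∈ Coch.multilinear (Λ.augCat 𝕜 s t).Hom 𝕜 :=
      Λ.resCoch_mem_multilinear he (.line i j)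
    have := Coch.multilinear_val_smul hml (nil y) (-1 : 𝕜) φ (nil x)
    rw [nil_append, nil_append, neg_one_smul, neg_one_mul] at this
    exact this
  have hn : ∀ i j, ((Λ.augCat 𝕜 s t).signHom ((Λ.resData 𝕜 s t e).line i j)).val (nil y) = diskOf y e i j := by
    intro i j
    rw [signHom_val, sgnStr_nil]
    exact blockDisks_val_nil y he i j
  have hn' : ∀ i j, ((Λ.resData 𝕜 s t e).line i j).val (nil x) = diskOf x e i j :=
    fun i j => blockDisks_val_nil x he i j
  have hf : ∀ i j, ((Λ.resData 𝕜 s t e).line i j).val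
      (single φ) = (Λ.blockDisks (Λ.catData 𝕜 s t) s e i j).val (single φ) := fun i j => rfl
  have hlow : ∀ i j, j < i → (Λ.blockDisks (Λ.catData 𝕜 s t) s e i j).val (single φ) = 0 := by
    intro i j hij
    rw [Λ.blockDisks_catData_lower e hij]
    rfl
  simp only [hl, Coch.neg_val, Coch.sum_val, Coch.mul_single, hs, hn, hn', hf] at h2
  rw [Finset.sum_range_succ, Finset.sum_range_succ, Finset.sum_eq_zero] at h2
  · rw [diskOf_eq_zero ht y he het (le_refl (k + 1)), diskOf_eq_zero ht x he het (le_refl k)] at h2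
    linear_combination h2
  · intro l hl
    simp only [Finset.mem_range] at hl
    rw [hlow k l hl, diskOf_eq_zero ht x he het hl.le]
    simp

theorem DiagIso.intertwine (h : DiagIso x y f) (ht : t ≤ Λ.size) {e : ℕ} (he : s ≤ e) (het : e ≤ t)
    (k : ℕ) : diskAt x y f e k k * diskOf y e k (k + 1) =
      diskOf x e k (k + 1) * diskAt x y f e (k + 1) (k + 1) :=
  intertwine_of_closed h.deg h.closed ht he het k

end Front


namespace Front

open Str AInfCat

variable {Λ : Front} {𝕜 : Type u} [CommRing 𝕜] {s t t' : ℕ}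

/-! ## Extension of isomorphisms over one more event -/

open Classical in
/-- The extension of a morphism by one at a left cusp, and by zero at a crossing. -/
def extendFn (f : Λ.Plus s t → 𝕜) : Λ.Plus s (t + 1) → 𝕜 := fun c =>
  if h : Λ.IsReeb s t 2 ⟨c.1, 0, 1⟩ then f ⟨c.1, h⟩ else if Λ.IsDiag c.1 then 1 else 0

theorem isReeb_mono (h : t ≤ t') {m : ℕ} {l : Letter} (hl : Λ.IsReeb s t m l) : Λ.IsReeb s t' m l := by
  obtain ⟨c, p, q⟩ := l
  cases c with
  | line i j => exact hl
  | ev e => exact ⟨hl.1, hl.2.1, hl.2.2.1, hl.2.2.2.1.trans_le h, hl.2.2.2.2⟩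

theorem cut_apply (h : t ≤ t') (f : Λ.Plus s t' → 𝕜) (c : Λ.Plus s t) :
    cut t f c = f ⟨c.1, isReeb_mono h c.2⟩ := Λ.coord_of_mem f ⟨c.1, isReeb_mono h c.2⟩

theorem cut_extendFn (f : Λ.Plus s t → 𝕜) : cut t (extendFn f) = f := by
  funext c
  rw [cut_apply t.le_succ, extendFn, dif_pos c.2]

theorem eq_last {c : Chord} (h : Λ.IsReeb s (t + 1) 2 ⟨c, 0, 1⟩) (h' : ¬ Λ.IsReeb s t 2 ⟨c, 0, 1⟩) :
    c = .ev t := by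
  cases c with
  | line i j => exact absurd h h'
  | ev e =>
    obtain ⟨h1, h2, h3, h4, h5⟩ := h
    have : e = t := by
      by_contra hne
      exact h' ⟨h1, h2, h3, by omega, h5⟩
    rw [this]

theorem diskAt_extendFn (hst : s ≤ t) (ht : t + 1 ≤ Λ.size) {x y : (Λ.augCat 𝕜 s (t + 1)).Obj}
    (f : Λ.Plus s t → 𝕜) (i j : ℕ) : diskAt x y (extendFn f) t i j =
      diskAt ((Λ.augRes 𝕜 le_rfl hst t.le_succ ht).obj x) ((Λ.augRes 𝕜 le_rfl hst t.le_succ ht).obj y)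
        f t i j := by
  obtain ⟨ψ, hψ⟩ : ∃ ψ : (Λ.augCat 𝕜 s (t + 1)).Hom x y, ψ = extendFn f := ⟨_, rfl⟩
  have h1 := Λ.pullback_blockDisks (𝕜 := 𝕜) le_rfl hst t.le_succ ht hst le_rfl i j
  have h2 := congrArg (fun χ => Coch.val χ (single ψ)) h1
  simp only [AInfFunctor.pullback_single] at h2
  have h3 := augRes_map_single hst t.le_succ ht ψ
  have h4 : cut t (show Λ.Plus s (t + 1) → 𝕜 from ψ) = f :=
    (congrArg (cut t) hψ).trans (cut_extendFn f)
  have h5 := congrArg (fun g : (Λ.augCat 𝕜 s t).Hom _ _ =>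
    (Λ.blockDisks (Λ.catData 𝕜 s t) s t i j).val (single g)) (h3.trans h4)
  have h6 := h2.symm.trans h5
  rw [hψ] at h6
  exact h6

/-- The value of an augmentation at the crossing of an event. -/
def crossOf (x : (Λ.augCat 𝕜 s t).Obj) (e : ℕ) : 𝕜 :=
  Subtype.val (p := Λ.IsAug) x (Λ.gen s t 1 ⟨.ev e, 0, 0⟩)

theorem DiagIso.extendFn (hst : s ≤ t) (ht : t + 1 ≤ Λ.size) {x y : (Λ.augCat 𝕜 s (t + 1)).Obj}
    {f : Λ.Plus s t → 𝕜} (hf : DiagIso ((Λ.augRes 𝕜 le_rfl hst t.le_succ ht).obj x)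
      ((Λ.augRes 𝕜 le_rfl hst t.le_succ ht).obj y) f)
    (hcross : ∀ k, Λ.event t = .cross k →
      diskAt x y (extendFn f) t k (k + 1) + diskAt x y (extendFn f) t k k * crossOf y t =
        sgn (Λ.deg 0 (.ev t)) * (crossOf x t * diskAt x y (extendFn f) t (k + 1) (k + 1))) :
    DiagIso x y (extendFn f) := by
  have hA := Λ.isAInf_augCat (𝕜 := 𝕜) (s := s) ht
  have hdeg : (show (Λ.augCat 𝕜 s (t + 1)).Hom x y from Front.extendFn f) ∈
      (Λ.augCat 𝕜 s (t + 1)).gr x y 0 := by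
    intro c hc
    simp only [Front.extendFn]
    split_ifs with h1 h2
    · exact hf.deg ⟨c.1, h1⟩ hc
    · rw [h2.deg] at hc
      exact absurd rfl hc
    · rfl
  refine ⟨hdeg, ?_, ?_⟩
  · funext c
    obtain ⟨ψ, hψ⟩ : ∃ ψ : (Λ.augCat 𝕜 s (t + 1)).Hom x y, ψ = Front.extendFn f := ⟨_, rfl⟩
    have hψ' := congrArg (fun g : (Λ.augCat 𝕜 s (t + 1)).Hom x y => (Λ.augCat 𝕜 s (t + 1)).b (single g) c) hψ
    refine hψ'.symm.trans ?_
    by_cases h1 : Λ.IsReeb s t 2 ⟨c.1, 0, 1⟩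
    · have hF := Λ.isFunctor_augRes (𝕜 := 𝕜) le_rfl hst t.le_succ ht
      have h2 := hF.map_b_single hA ψ
      have h3 := augRes_map_single hst t.le_succ ht ψ
      have h5 := h3.trans ((congrArg (cut t) hψ).trans (cut_extendFn f))
      have h6 := augRes_map_single hst t.le_succ ht ((Λ.augCat 𝕜 s (t + 1)).b (single ψ))
      have h7 := (h6.symm.trans h2).trans
        ((congrArg (fun g : (Λ.augCat 𝕜 s t).Hom _ _ => (Λ.augCat 𝕜 s t).b (single g)) h5).trans hf.closed)
      have h8 := congrFun h7 ⟨c.1, h1⟩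
      exact (cut_apply t.le_succ (show Λ.Plus s (t + 1) → 𝕜 from (Λ.augCat 𝕜 s (t + 1)).b (single ψ))
        ⟨c.1, h1⟩).symm.trans h8
    · have hc := eq_last c.2 h1
      by_cases hd : Λ.IsDiag c.1
      · exact hd.b_single ht ψ
      · have he := c.2.2.2
        simp only [hc] at he hd
        obtain ⟨k, hk⟩ : ∃ k, Λ.event t = .cross k := by
          rcases hE : Λ.event t with k | k | ⟨k, v⟩ | b
          · exact ⟨k, rfl⟩
          · simp [hE] at he
          · exact absurd ⟨k, v, hE⟩ hd
          · simp [hE] at he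
        refine (Λ.augCat_b ht _ c).trans ?_
        have h2 := hcross k hk
        have h3 : (Λ.catCoch 𝕜 s (t + 1) (.ev t)).val (single ψ) = 0 := by
          rw [catCoch_single]
          have h4 := Λ.coord_of_mem (show Λ.Plus s (t + 1) → 𝕜 from ψ) c
          rw [hc] at h4
          refine (congrArg _ (h4.trans (congrFun hψ c))).trans ?_
          rw [Front.extendFn, dif_neg h1, hc, if_neg hd, mul_zero]
        have h5 : (Λ.catCoch 𝕜 s (t + 1) (.ev t)).val (nil x) = crossOf x t := rfl
        have h6 : (Λ.catCoch 𝕜 s (t + 1) (.ev t)).val (nil y) = crossOf y t := rfl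
        have h8 : ∀ i j, (Λ.blockDisks (Λ.catData 𝕜 s (t + 1)) s t i j).val (single ψ) =
            diskAt x y (Front.extendFn f) t i j := fun i j => by rw [hψ]; rfl
        have h7 : (Λ.blockDiff (Λ.catData 𝕜 s (t + 1)) s c.1).val (single ψ) = 0 := by
          rw [hc]
          simp only [blockDiff, hk, Coch.sub_val, Coch.add_val, Coch.zsmul_val, Coch.mul_single,
            catData_ev, h3, h5, h6, blockDisks_val_nil _ hst, h8]
          rw [diskOf_eq_zero ht _ hst (by omega) le_rfl, diskOf_eq_zero ht _ hst (by omega) le_rfl]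
          simp only [zsmul_eq_mul]
          linear_combination h2
        exact (congrArg _ h7).trans (mul_zero _)
  · intro c hd
    simp only [Front.extendFn]
    split_ifs with h1
    · exact hf.unit ⟨c.1, h1⟩ hd
    · exact isUnit_one

end Front


namespace Front

open Str AInfCat

variable {Λ : Front} {𝕜 : Type u} [CommRing 𝕜] {s t s' t' : ℕ}

theorem diskOf_augRes (h : s ≤ s') (hst : s' ≤ t') (h' : t' ≤ t) (ht : t ≤ Λ.size)
    (x : (Λ.augCat 𝕜 s t).Obj) {e : ℕ} (h1 : s' ≤ e) (h2 : e ≤ t') (i j : ℕ) :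
    diskOf ((Λ.augRes 𝕜 h hst h' ht).obj x) e i j = diskOf x e i j := by
  have h3 := congrArg (fun χ => Coch.val χ (nil x)) (Λ.pullback_blockDisks (𝕜 := 𝕜) h hst h' ht h1 h2 i j)
  simp only [AInfFunctor.pullback_nil] at h3
  rw [← blockDisks_val_nil _ h1, h3, blockDisks_val_nil _ (h.trans h1)]

theorem crossOf_augRes (h : s ≤ s') (hst : s' ≤ t') (h' : t' ≤ t) (ht : t ≤ Λ.size)
    (x : (Λ.augCat 𝕜 s t).Obj) {e : ℕ} (h1 : s' ≤ e) (h2 : e < t') :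
    crossOf ((Λ.augRes 𝕜 h hst h' ht).obj x) e = crossOf x e :=
  Λ.augRes_gen_ev x h1 h2 0 0

theorem diskOf_cross (x : (Λ.augCat 𝕜 s t).Obj) {e k : ℕ} (h1 : s ≤ e) (h2 : e < t)
    (hE : Λ.event e = .cross k) : diskOf x e k (k + 1) = 0 := by
  have hr : Λ.IsReeb s t 1 ⟨.ev e, 0, 0⟩ := ⟨by simp, by simp, h1, h2, by simp [hE]⟩
  have h3 := Λ.aug_dgen (Subtype.property (p := Λ.IsAug) x) hr
  simp only [dgen] at h3
  rw [← Λ.map_chordDisks, Λ.chordDisks_cross _ _ hE] at h3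
  exact h3

theorem diskOf_rcusp (x : (Λ.augCat 𝕜 s t).Obj) {e : ℕ} {b : Bool} (h1 : s ≤ e) (h2 : e < t)
    (hE : Λ.event e = .rcusp b) :
    diskOf x e ((Λ.slice e).n - 2) ((Λ.slice e).n - 2 + 1) + Λ.objMark x e = 0 := by
  have hr : Λ.IsReeb s t 1 ⟨.ev e, 0, 0⟩ := ⟨by simp, by simp, h1, h2, by simp [hE]⟩
  have h3 := Λ.aug_dgen (Subtype.property (p := Λ.IsAug) x) hr
  simp only [dgen] at h3
  rw [← Λ.map_chordDisks, Λ.chordDisks_rcusp _ _ hE] at h3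
  exact h3

theorem crossOf_eq_zero (x : (Λ.augCat 𝕜 s t).Obj) {e : ℕ} (h : Λ.deg 0 (.ev e) ≠ 0) : crossOf x e = 0 :=
  Λ.aug_gen (Subtype.property (p := Λ.IsAug) x) _ h

theorem deg_cross {e k : ℕ} (hE : Λ.event e = .cross k) (h : Λ.deg 0 (.ev e) ≠ 0) :
    (Λ.slice e).pot k ≠ (Λ.slice e).pot (k + 1) := by
  intro h'
  apply h
  simp [deg, hE, h']

/-- The domain of an isomorphism extends over one more event, if the target does. -/
theorem DiagIso.exists_source (hΛ : Λ.BasePointsAtRightCusps) (hst : s ≤ t) (ht : t + 1 ≤ Λ.size)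
    {x' : (Λ.augCat 𝕜 s t).Obj} {y : (Λ.augCat 𝕜 s (t + 1)).Obj} {f : Λ.Plus s t → 𝕜}
    (hf : DiagIso x' ((Λ.augRes 𝕜 le_rfl hst t.le_succ ht).obj y) f) :
    ∃ x, (Λ.augRes 𝕜 le_rfl hst t.le_succ ht).obj x = x' ∧ DiagIso x y (Front.extendFn f) := by
  have ht' : t ≤ Λ.size := by omega
  have hleg := Λ.legal t (by omega)
  have hint := hf.intertwine ht' hst le_rfl
  simp only [diskOf_augRes le_rfl hst t.le_succ ht y hst le_rfl] at hint
  rcases hE : Λ.event t with k | k | ⟨k, v⟩ | b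
  · have hk : k + 1 < (Λ.slice t).n := by rw [hE] at hleg; exact hleg
    obtain ⟨q, hq⟩ := hf.isUnit_diskAt ht' hst le_rfl hk
    obtain ⟨x, hx, hx1, -⟩ := exists_extension x' hst ht
      (sgn (Λ.deg 0 (.ev t)) * ((q⁻¹ : 𝕜ˣ) * (diskAt _ _ f t k (k + 1) + diskAt _ _ f t k k * crossOf y t))) 1
      (fun k' hk' => by
        obtain rfl : k = k' := by rw [hE] at hk'; injection hk'
        refine ⟨fun hd => ?_, ?_⟩
        · rw [crossOf_eq_zero y hd, hf.diskAt_eq_zero hst (deg_cross hE hd)]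
          simp
        · have h1 := hint k
          rw [diskOf_cross y hst (by omega) hE, mul_zero, ← hq, eq_comm, Units.mul_left_eq_zero] at h1
          exact h1)
      (fun b hb => by rw [hE] at hb; cases hb)
    refine ⟨x, hx, DiagIso.extendFn hst ht (hx ▸ hf) fun k' hk' => ?_⟩
    obtain rfl : k = k' := by rw [hE] at hk'; injection hk'
    have h2 : crossOf x t = _ := hx1 k hE
    simp only [diskAt_extendFn hst ht, hx]
    rw [h2, ← hq]
    have h3 := congrArg (Int.cast (R := 𝕜)) (sgn_mul_self (Λ.deg 0 (.ev t)))
    push_cast at h3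
    have h4 : ((q⁻¹ : 𝕜ˣ) : 𝕜) * q = 1 := by simp
    linear_combination -(diskAt _ _ f t k (k + 1) + diskAt _ _ f t k k * crossOf y t) * (h3 + (sgn (Λ.deg 0 (.ev t)) * sgn (Λ.deg 0 (.ev t)) : 𝕜) * h4)
  · obtain ⟨x, hx, -⟩ := exists_extension x' hst ht 0 1 (by simp [hE]) (by simp [hE])
    exact ⟨x, hx, DiagIso.extendFn hst ht (hx ▸ hf) (by simp [hE])⟩
  · obtain ⟨x, hx, -⟩ := exists_extension x' hst ht 0 1 (by simp [hE]) (by simp [hE])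
    exact ⟨x, hx, DiagIso.extendFn hst ht (hx ▸ hf) (by simp [hE])⟩
  · have hb : b = true := by
      cases b
      · exact absurd hE (hΛ t (by omega))
      · rfl
    have hk : 2 ≤ (Λ.slice t).n := by rw [hE] at hleg; exact hleg.1
    have hu : IsUnit (diskOf x' t ((Λ.slice t).n - 2) ((Λ.slice t).n - 2 + 1)) := by
      have h1 := hint ((Λ.slice t).n - 2)
      have h2 := diskOf_rcusp y hst (by omega) hE
      rw [eq_neg_of_add_eq_zero_left h2] at h1
      have h3 := (hf.isUnit_diskAt ht' hst le_rfl (i := (Λ.slice t).n - 2) (by omega)).mul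
        (Λ.objMark y t).isUnit.neg
      rw [h1] at h3
      exact isUnit_of_mul_isUnit_left h3
    obtain ⟨x, hx, -⟩ := exists_extension x' hst ht 0 (- hu.unit) (by simp [hE]) (fun b' hb' => by
      rw [hE] at hb'
      injection hb' with hb'
      exact ⟨hb' ▸ hb, by simp [diskOf]⟩)
    exact ⟨x, hx, DiagIso.extendFn hst ht (hx ▸ hf) (by simp [hE])⟩

/-- The target of an isomorphism extends over one more event, if the domain does. -/
theorem DiagIso.exists_target (hΛ : Λ.BasePointsAtRightCusps) (hst : s ≤ t) (ht : t + 1 ≤ Λ.size)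
    {x : (Λ.augCat 𝕜 s (t + 1)).Obj} {y' : (Λ.augCat 𝕜 s t).Obj} {f : Λ.Plus s t → 𝕜}
    (hf : DiagIso ((Λ.augRes 𝕜 le_rfl hst t.le_succ ht).obj x) y' f) :
    ∃ y, (Λ.augRes 𝕜 le_rfl hst t.le_succ ht).obj y = y' ∧ DiagIso x y (Front.extendFn f) := by
  have ht' : t ≤ Λ.size := by omega
  have hleg := Λ.legal t (by omega)
  have hint := hf.intertwine ht' hst le_rfl
  simp only [diskOf_augRes le_rfl hst t.le_succ ht x hst le_rfl] at hint
  rcases hE : Λ.event t with k | k | ⟨k, v⟩ | b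
  · have hk : k + 1 < (Λ.slice t).n := by rw [hE] at hleg; exact hleg
    obtain ⟨q, hq⟩ := hf.isUnit_diskAt ht' hst le_rfl (i := k) (by omega)
    obtain ⟨y, hy, hy1, -⟩ := exists_extension y' hst ht
      ((q⁻¹ : 𝕜ˣ) * (sgn (Λ.deg 0 (.ev t)) * (crossOf x t * diskAt _ _ f t (k + 1) (k + 1)) -
        diskAt _ _ f t k (k + 1))) 1
      (fun k' hk' => by
        obtain rfl : k = k' := by rw [hE] at hk'; injection hk'
        refine ⟨fun hd => ?_, ?_⟩
        · rw [crossOf_eq_zero x hd, hf.diskAt_eq_zero hst (deg_cross hE hd)]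
          simp
        · have h1 := hint k
          rw [diskOf_cross x hst (by omega) hE, zero_mul, ← hq, Units.mul_right_eq_zero] at h1
          exact h1)
      (fun b hb => by rw [hE] at hb; cases hb)
    refine ⟨y, hy, DiagIso.extendFn hst ht (hy ▸ hf) fun k' hk' => ?_⟩
    obtain rfl : k = k' := by rw [hE] at hk'; injection hk'
    have h2 : crossOf y t = _ := hy1 k hE
    simp only [diskAt_extendFn hst ht, hy]
    rw [h2, ← hq, Units.mul_inv_cancel_left]
    ring
  · obtain ⟨y, hy, -⟩ := exists_extension y' hst ht 0 1 (by simp [hE]) (by simp [hE])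
    exact ⟨y, hy, DiagIso.extendFn hst ht (hy ▸ hf) (by simp [hE])⟩
  · obtain ⟨y, hy, -⟩ := exists_extension y' hst ht 0 1 (by simp [hE]) (by simp [hE])
    exact ⟨y, hy, DiagIso.extendFn hst ht (hy ▸ hf) (by simp [hE])⟩
  · have hb : b = true := by
      cases b
      · exact absurd hE (hΛ t (by omega))
      · rfl
    have hk : 2 ≤ (Λ.slice t).n := by rw [hE] at hleg; exact hleg.1
    have hu : IsUnit (diskOf y' t ((Λ.slice t).n - 2) ((Λ.slice t).n - 2 + 1)) := by
      have h1 := hint ((Λ.slice t).n - 2)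
      have h2 := diskOf_rcusp x hst (by omega) hE
      rw [eq_neg_of_add_eq_zero_left h2] at h1
      have h3 := (Λ.objMark x t).isUnit.neg.mul
        (hf.isUnit_diskAt ht' hst le_rfl (i := (Λ.slice t).n - 2 + 1) (by omega))
      rw [← h1] at h3
      exact isUnit_of_mul_isUnit_right h3
    obtain ⟨y, hy, -⟩ := exists_extension y' hst ht 0 (- hu.unit) (by simp [hE]) (fun b' hb' => by
      rw [hE] at hb'
      injection hb' with hb'
      exact ⟨hb' ▸ hb, by simp [diskOf]⟩)
    exact ⟨y, hy, DiagIso.extendFn hst ht (hy ▸ hf) (by simp [hE])⟩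

end Front


namespace Front

open Str AInfCat

variable {Λ : Front} {𝕜 : Type u} [CommRing 𝕜] {s t s' t' : ℕ}

/-! ## Extension over several events -/

theorem augRes_obj_refl (hst : s ≤ t) (ht : t ≤ Λ.size) (x : (Λ.augCat 𝕜 s t).Obj) :
    (Λ.augRes 𝕜 le_rfl hst le_rfl ht).obj x = x :=
  congrArg (fun F => AInfFunctor.obj F x) (Λ.augRes_refl le_rfl hst le_rfl ht)

theorem augRes_obj_trans {s₁ t₁ s₂ t₂ : ℕ} (h : s ≤ s₁) (hst : s₁ ≤ t₁) (h' : t₁ ≤ t) (ht : t ≤ Λ.size)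
    (h₁ : s₁ ≤ s₂) (hst₁ : s₂ ≤ t₂) (h₁' : t₂ ≤ t₁) (x : (Λ.augCat 𝕜 s t).Obj) :
    (Λ.augRes 𝕜 (h.trans h₁) hst₁ (h₁'.trans h') ht).obj x =
      (Λ.augRes 𝕜 h₁ hst₁ h₁' (h'.trans ht)).obj ((Λ.augRes 𝕜 h hst h' ht).obj x) :=
  congrArg (fun F => AInfFunctor.obj F x) (Λ.augRes_trans h hst h' ht h₁ hst₁ h₁')

theorem cut_self (f : Λ.Plus s t → 𝕜) : cut t f = f := by
  funext c
  rw [cut_apply le_rfl]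

theorem cut_cut {t'' : ℕ} (h : t ≤ t') (h' : t' ≤ t'') (f : Λ.Plus s t'' → 𝕜) : cut t (cut t' f) = cut t f := by
  funext c
  rw [cut_apply h, cut_apply h', cut_apply (h.trans h')]

theorem DiagIso.exists_source_of_le (hΛ : Λ.BasePointsAtRightCusps) (hst : s ≤ t) (h : t ≤ t')
    (ht : t' ≤ Λ.size) {x' : (Λ.augCat 𝕜 s t).Obj} {y : (Λ.augCat 𝕜 s t').Obj} {f : Λ.Plus s t → 𝕜}
    (hf : DiagIso x' ((Λ.augRes 𝕜 le_rfl hst h ht).obj y) f) :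
    ∃ x ψ, (Λ.augRes 𝕜 le_rfl hst h ht).obj x = x' ∧ DiagIso x y ψ ∧ cut t ψ = f := by
  induction t', h using Nat.le_induction with
  | base =>
    rw [augRes_obj_refl] at hf
    exact ⟨x', f, augRes_obj_refl hst ht x', hf, cut_self f⟩
  | succ t' h ih =>
    rw [augRes_obj_trans le_rfl (hst.trans h) t'.le_succ ht le_rfl hst h y] at hf
    obtain ⟨x₁, ψ₁, h1, h2, h3⟩ := ih (by omega) hf
    obtain ⟨x, h4, h5⟩ := h2.exists_source hΛ (hst.trans h) ht
    refine ⟨x, _, ?_, h5, ?_⟩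
    · rw [augRes_obj_trans le_rfl (hst.trans h) t'.le_succ ht le_rfl hst h x, h4, h1]
    · rw [← cut_cut h t'.le_succ, cut_extendFn, h3]

theorem DiagIso.exists_target_of_le (hΛ : Λ.BasePointsAtRightCusps) (hst : s ≤ t) (h : t ≤ t')
    (ht : t' ≤ Λ.size) {x : (Λ.augCat 𝕜 s t').Obj} {y' : (Λ.augCat 𝕜 s t).Obj} {f : Λ.Plus s t → 𝕜}
    (hf : DiagIso ((Λ.augRes 𝕜 le_rfl hst h ht).obj x) y' f) :
    ∃ y ψ, (Λ.augRes 𝕜 le_rfl hst h ht).obj y = y' ∧ DiagIso x y ψ ∧ cut t ψ = f := by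
  induction t', h using Nat.le_induction with
  | base =>
    rw [augRes_obj_refl] at hf
    exact ⟨y', f, augRes_obj_refl hst ht y', hf, cut_self f⟩
  | succ t' h ih =>
    rw [augRes_obj_trans le_rfl (hst.trans h) t'.le_succ ht le_rfl hst h x] at hf
    obtain ⟨y₁, ψ₁, h1, h2, h3⟩ := ih (by omega) hf
    obtain ⟨y, h4, h5⟩ := h2.exists_target hΛ (hst.trans h) ht
    refine ⟨y, _, ?_, h5, ?_⟩
    · rw [augRes_obj_trans le_rfl (hst.trans h) t'.le_succ ht le_rfl hst h y, h4, h1]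
    · rw [← cut_cut h t'.le_succ, cut_extendFn, h3]

/-! ## Gluing of augmentations -/

theorem diskOf_left (x : (Λ.augCat 𝕜 s t).Obj) (i j : ℕ) :
    Subtype.val (p := Λ.IsAug) x (Λ.gen s t 1 ⟨.line i j, 0, 0⟩) = diskOf x s i j := by
  simp [diskOf, evalDisks, elems, sweep, border, Nat.mod_one]

theorem exists_glue_succ (hΛ : Λ.BasePointsAtRightCusps) {a b : ℕ} (hab : a ≤ b) (hbt : b ≤ t) (ht : t + 1 ≤ Λ.size)
    (ξ : (Λ.augCat 𝕜 a t).Obj) (η : (Λ.augCat 𝕜 b (t + 1)).Obj)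
    (h : (Λ.augRes 𝕜 hab hbt le_rfl (t.le_succ.trans ht)).obj ξ =
      (Λ.augRes 𝕜 le_rfl hbt t.le_succ ht).obj η) :
    ∃ x, (Λ.augRes 𝕜 le_rfl (hab.trans hbt) t.le_succ ht).obj x = ξ ∧
      (Λ.augRes 𝕜 hab (hbt.trans t.le_succ) le_rfl ht).obj x = η := by
  have hd : ∀ e, b ≤ e → e ≤ t → ∀ i j, diskOf ξ e i j = diskOf η e i j := by
    intro e h1 h2 i j
    rw [← diskOf_augRes hab hbt le_rfl (t.le_succ.trans ht) ξ h1 h2, h,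
      diskOf_augRes le_rfl hbt t.le_succ ht η h1 h2]
  obtain ⟨x, hx, h1, h2⟩ := exists_extension ξ (hab.trans hbt) ht (crossOf η t) (Λ.objMark η t)
    (fun k hk => ⟨fun h' => crossOf_eq_zero η h',
      (hd t hbt le_rfl _ _).trans (diskOf_cross η hbt (by omega) hk)⟩)
    (fun c hc => ⟨by
        cases c
        · exact absurd hc (hΛ t (by omega))
        · rfl, by
      have h3 := diskOf_rcusp η hbt (by omega) hc
      rw [← hd t hbt le_rfl] at h3
      exact h3⟩)
  refine ⟨x, hx, ?_⟩
  have hdx : ∀ e, a ≤ e → e ≤ t → ∀ i j, diskOf x e i j = diskOf ξ e i j := by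
    intro e h1 h2 i j
    rw [← diskOf_augRes le_rfl (hab.trans hbt) t.le_succ ht x h1 h2, hx]
  apply Λ.augObj_ext
  · intro c hc
    cases c with
    | line i j =>
      refine (diskOf_left ((Λ.augRes 𝕜 hab (hbt.trans t.le_succ) le_rfl ht).obj x) i j).trans
        (Eq.trans ?_ (diskOf_left η i j).symm)
      rw [diskOf_augRes hab _ le_rfl ht x le_rfl (by omega), hdx b hab hbt, hd b le_rfl hbt]
    | ev e =>
      obtain ⟨h3, h4⟩ := hc e rfl
      change crossOf ((Λ.augRes 𝕜 hab (hbt.trans t.le_succ) le_rfl ht).obj x) e = crossOf η e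
      rw [crossOf_augRes hab _ le_rfl ht x h3 h4]
      rcases Nat.lt_or_ge e t with h5 | h5
      · rw [← crossOf_augRes le_rfl (hab.trans hbt) t.le_succ ht x (hab.trans h3) h5, hx,
          ← crossOf_augRes hab hbt le_rfl (t.le_succ.trans ht) ξ h3 h5, h,
          crossOf_augRes le_rfl hbt t.le_succ ht η h3 h5]
      · obtain rfl : e = t := by omega
        rcases hE : Λ.event e with k | k | ⟨k, v⟩ | c
        · exact h1 k hE
        · rw [crossOf, crossOf, gen_eq_zero, gen_eq_zero, map_zero, map_zero] <;> simp [IsReeb, hE]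
        · rw [crossOf, crossOf, gen_eq_zero, gen_eq_zero, map_zero, map_zero] <;> simp [IsReeb, hE]
        · rw [crossOf_eq_zero, crossOf_eq_zero] <;> simp [deg, hE]
  · intro e h3 h4
    refine (Λ.objMark_augRes hab _ le_rfl ht x h3 h4).trans ?_
    rcases Nat.lt_or_ge e t with h5 | h5
    · refine (Λ.objMark_augRes le_rfl (hab.trans hbt) t.le_succ ht x (hab.trans h3) h5).symm.trans ?_
      rw [hx]
      refine (Λ.objMark_augRes hab hbt le_rfl (t.le_succ.trans ht) ξ h3 h5).symm.trans ?_
      rw [h]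
      exact Λ.objMark_augRes le_rfl hbt t.le_succ ht η h3 h5
    · obtain rfl : e = t := by omega
      rcases hE : Λ.event e with k | k | ⟨k, v⟩ | c
      · simp [objMark, markFactor, hE]
      · exact h2 (.inl ⟨k, hE⟩)
      · simp [objMark, markFactor, hE]
      · exact h2 (.inr ⟨c, hE⟩)

theorem exists_glue_of_le (hΛ : Λ.BasePointsAtRightCusps) {a b : ℕ} (hab : a ≤ b) (hbt : b ≤ t)
    (h : t ≤ t') (ht : t' ≤ Λ.size) (ξ : (Λ.augCat 𝕜 a t).Obj) (η : (Λ.augCat 𝕜 b t').Obj)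
    (hξ : (Λ.augRes 𝕜 hab hbt le_rfl (h.trans ht)).obj ξ = (Λ.augRes 𝕜 le_rfl hbt h ht).obj η) :
    ∃ x, (Λ.augRes 𝕜 le_rfl (hab.trans hbt) h ht).obj x = ξ ∧
      (Λ.augRes 𝕜 hab (hbt.trans h) le_rfl ht).obj x = η := by
  induction t', h using Nat.le_induction with
  | base =>
    rw [augRes_obj_refl] at hξ
    exact ⟨ξ, augRes_obj_refl _ ht ξ, hξ⟩
  | succ t' h ih =>
    have ht' := t'.le_succ.trans ht
    rw [augRes_obj_trans le_rfl (hbt.trans h) t'.le_succ ht le_rfl hbt h η] at hξ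
    obtain ⟨x₁, h1, h2⟩ := ih ht' _ hξ
    obtain ⟨x, h3, h4⟩ := exists_glue_succ hΛ hab (hbt.trans h) ht x₁ η h2
    refine ⟨x, ?_, h4⟩
    rw [augRes_obj_trans le_rfl (hab.trans (hbt.trans h)) t'.le_succ ht le_rfl (hab.trans hbt) h x, h3, h1]

/-- Augmentations over two overlapping parts of the front which agree on the overlap can be glued. -/
theorem exists_glue (hΛ : Λ.BasePointsAtRightCusps) {a b t₁ t₂ m M : ℕ} (hab : a ≤ b) (hb : b ≤ m)
    (h1 : m ≤ t₁) (h2 : m ≤ t₂) (h1' : t₁ ≤ M) (h2' : t₂ ≤ M) (hM : M ≤ Λ.size)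
    (hm : (t₁ = m ∧ t₂ = M) ∨ (t₂ = m ∧ t₁ = M))
    (ξ : (Λ.augCat 𝕜 a t₁).Obj) (η : (Λ.augCat 𝕜 b t₂).Obj)
    (hξ : (Λ.augRes 𝕜 hab hb h1 (h1'.trans hM)).obj ξ =
      (Λ.augRes 𝕜 le_rfl hb h2 (h2'.trans hM)).obj η) :
    ∃ x, (Λ.augRes 𝕜 le_rfl (hab.trans (hb.trans h1)) h1' hM).obj x = ξ ∧
      (Λ.augRes 𝕜 hab (hb.trans h2) h2' hM).obj x = η := by
  rcases hm with ⟨rfl, rfl⟩ | ⟨rfl, rfl⟩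
  · exact exists_glue_of_le hΛ hab hb h2 hM ξ η hξ
  · refine ⟨ξ, augRes_obj_refl _ hM ξ, ?_⟩
    rw [augRes_obj_refl] at hξ
    exact hξ

/-! ## Gluing of morphisms -/

theorem augRes_map_ev (h : s ≤ s') (hst : s' ≤ t') (h' : t' ≤ t) (ht : t ≤ Λ.size)
    {x y : (Λ.augCat 𝕜 s t).Obj} (f : (Λ.augCat 𝕜 s t).Hom x y) {e : ℕ}
    (hc : Λ.IsReeb s' t' 2 ⟨.ev e, 0, 1⟩) :
    (Λ.augRes 𝕜 h hst h' ht).map x y (single f) ⟨.ev e, hc⟩ = Λ.coord s t f (.ev e) := by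
  refine (Λ.augRes_map h hst h' ht (single f) (by simp [single]) ⟨.ev e, hc⟩).trans ?_
  change _ * (Λ.catCoch 𝕜 s t (.ev e)).val (single f) = _
  rw [catCoch_single, ← mul_assoc]
  have := congrArg (Int.cast (R := 𝕜)) (sig_mul_self (Λ.deg s (.ev e)))
  push_cast at this
  change (sig (Λ.deg s (.ev e)) * sig (Λ.deg s (.ev e)) : 𝕜) * _ = _
  rw [this, one_mul]

theorem augRes_map_trans {s₁ t₁ s₂ t₂ : ℕ} (h : s ≤ s₁) (hst : s₁ ≤ t₁) (h' : t₁ ≤ t) (ht : t ≤ Λ.size)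
    (h₁ : s₁ ≤ s₂) (hst₁ : s₂ ≤ t₂) (h₁' : t₂ ≤ t₁) {x y : (Λ.augCat 𝕜 s t).Obj}
    (f : (Λ.augCat 𝕜 s t).Hom x y) (c : Λ.Plus s₂ t₂) :
    (Λ.augRes 𝕜 (h.trans h₁) hst₁ (h₁'.trans h') ht).map x y (single f) c =
      (Λ.augRes 𝕜 h₁ hst₁ h₁' (h'.trans ht)).map _ _
        (single ((Λ.augRes 𝕜 h hst h' ht).map x y (single f))) c := by
  have h1 := Λ.augRes_trans (𝕜 := 𝕜) h hst h' ht h₁ hst₁ h₁'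
  have h2 : ∀ F G : AInfFunctor (Λ.augCat 𝕜 s t) (Λ.augCat 𝕜 s₂ t₂), F = G →
      evalHom Λ c _ _ (F.map x y (single f)) = evalHom Λ c _ _ (G.map x y (single f)) := by
    rintro F _ rfl; rfl
  refine (h2 _ _ h1).trans ?_
  simp only [AInfFunctor.comp, single, AInfFunctor.blocks, AInfFunctor.blocksAux, List.map_cons,
    List.map_nil, List.sum_cons, List.sum_nil, add_zero]
  rfl

section

variable {a b t₁ t₂ m M : ℕ} (hab : a ≤ b) (hb : b ≤ m) (h1 : m ≤ t₁) (h2 : m ≤ t₂) (h1' : t₁ ≤ M)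
  (h2' : t₂ ≤ M) (hM : M ≤ Λ.size) {x y : (Λ.augCat 𝕜 a M).Obj}

theorem plus_cases {b t₁ t₂ m : ℕ} (h : t₁ ≤ m ∨ t₂ ≤ m) (c : Λ.Plus b t₂) :
    Λ.IsReeb b m 2 ⟨c.1, 0, 1⟩ ∨ ∃ e, c.1 = .ev e ∧ t₁ ≤ e := by
  obtain ⟨c, hr⟩ := c
  cases c with
  | line i j => exact .inl hr
  | ev e =>
    obtain ⟨r1, r2, r3, r4, r5⟩ := hr
    rcases Nat.lt_or_ge e m with he | he
    · exact .inl ⟨r1, r2, r3, he, r5⟩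
    · exact .inr ⟨e, rfl, by omega⟩

theorem exists_glue_hom (hm : t₁ ≤ m ∨ t₂ ≤ m)
    (f : (Λ.augCat 𝕜 a t₁).Hom
      ((Λ.augRes 𝕜 le_rfl (hab.trans (hb.trans h1)) h1' hM).obj x)
      ((Λ.augRes 𝕜 le_rfl (hab.trans (hb.trans h1)) h1' hM).obj y))
    (g : (Λ.augCat 𝕜 b t₂).Hom ((Λ.augRes 𝕜 hab (hb.trans h2) h2' hM).obj x)
      ((Λ.augRes 𝕜 hab (hb.trans h2) h2' hM).obj y))
    (hfg : ∀ c : Λ.Plus b m, (Λ.augRes 𝕜 hab hb h1 (h1'.trans hM)).map _ _ (single f) c =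
      (Λ.augRes 𝕜 le_rfl hb h2 (h2'.trans hM)).map _ _ (single g) c) :
    ∃ k : (Λ.augCat 𝕜 a M).Hom x y,
      (Λ.augRes 𝕜 le_rfl (hab.trans (hb.trans h1)) h1' hM).map _ _ (single k) = f ∧
      (Λ.augRes 𝕜 hab (hb.trans h2) h2' hM).map _ _ (single k) = g := by
  classical
  let k : Λ.Plus a M → 𝕜 := fun c =>
    if h : Λ.IsReeb a t₁ 2 ⟨c.1, 0, 1⟩ then (show Λ.Plus a t₁ → 𝕜 from f) ⟨c.1, h⟩
    else Λ.coord b t₂ g c.1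
  have hk : (Λ.augRes 𝕜 le_rfl (hab.trans (hb.trans h1)) h1' hM).map _ _
      (single (show (Λ.augCat 𝕜 a M).Hom x y from k)) = f := by
    refine (augRes_map_single _ h1' hM _).trans ?_
    funext c
    refine (cut_apply h1' k c).trans ?_
    exact dif_pos c.2
  refine ⟨k, hk, ?_⟩
  funext c
  rcases plus_cases (m := m) hm c with hc | ⟨e, hc, he⟩
  · have e1 := augRes_map_trans hab (hb.trans h2) h2' hM le_rfl hb h2
      (show (Λ.augCat 𝕜 a M).Hom x y from k) ⟨c.1, hc⟩
    have e2 := augRes_map_trans le_rfl (hab.trans (hb.trans h1)) h1' hM hab hb h1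
      (show (Λ.augCat 𝕜 a M).Hom x y from k) ⟨c.1, hc⟩
    rw [hk] at e2
    have e3 := (e1.symm.trans e2).trans (hfg ⟨c.1, hc⟩)
    have e4 := (congrFun (augRes_map_single hb h2 (h2'.trans hM) ((Λ.augRes 𝕜 hab (hb.trans h2) h2' hM).map _ _
      (single (show (Λ.augCat 𝕜 a M).Hom x y from k)))) ⟨c.1, hc⟩).symm.trans (e3.trans
      (congrFun (augRes_map_single hb h2 (h2'.trans hM) g) ⟨c.1, hc⟩))
    exact (cut_apply h2 _ _).symm.trans (e4.trans (cut_apply h2 _ _))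
  · obtain ⟨c, hr⟩ := c
    subst hc
    refine (augRes_map_ev _ _ _ _ _ hr).trans ?_
    obtain ⟨r1, r2, r3, r4, r5⟩ := hr
    refine (Λ.coord_of_mem k ⟨.ev e, r1, r2, hab.trans r3, lt_of_lt_of_le r4 h2', r5⟩).trans ?_
    refine (dif_neg fun h => ?_).trans (Λ.coord_of_mem g ⟨.ev e, r1, r2, r3, r4, r5⟩)
    have := h.2.2.2.1
    omega

theorem hom_eq_zero_of_glue (hm : M ≤ t₁ ∨ M ≤ t₂) (k : (Λ.augCat 𝕜 a M).Hom x y)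
    (h3 : (Λ.augRes 𝕜 le_rfl (hab.trans (hb.trans h1)) h1' hM).map _ _ (single k) = 0)
    (h4 : (Λ.augRes 𝕜 hab (hb.trans h2) h2' hM).map _ _ (single k) = 0) : k = 0 := by
  have e1 := (augRes_map_single (hab.trans (hb.trans h1)) h1' hM k).symm.trans h3
  funext c
  by_cases hc : Λ.IsReeb a t₁ 2 ⟨c.1, 0, 1⟩
  · exact (cut_apply h1' _ ⟨c.1, hc⟩).symm.trans (congrFun e1 ⟨c.1, hc⟩)
  · obtain ⟨c, hr⟩ := c
    cases c with
    | line i j => exact absurd hr hc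
    | ev e =>
      have hl := IsReeb.lies Λ hr e rfl
      obtain ⟨r1, r2, r3, r4, r5⟩ := hr
      have he : t₁ ≤ e := by
        by_contra h
        exact hc ⟨r1, r2, r3, by omega, r5⟩
      have hr' : Λ.IsReeb b t₂ 2 ⟨.ev e, 0, 1⟩ := ⟨r1, r2, by omega, by omega, r5⟩
      refine Eq.trans ?_ (((augRes_map_ev hab (hb.trans h2) h2' hM k hr').symm).trans
        (congrFun h4 ⟨.ev e, hr'⟩))
      exact (Λ.coord_of_mem k ⟨.ev e, r1, r2, r3, r4, r5⟩).symm

theorem exists_map_eq {s t t' : ℕ} (hst : s ≤ t) (h : t ≤ t') (ht : t' ≤ Λ.size)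
    {x y : (Λ.augCat 𝕜 s t').Obj} (f : Λ.Plus s t → 𝕜) :
    ∃ g : (Λ.augCat 𝕜 s t').Hom x y, (Λ.augRes 𝕜 le_rfl hst h ht).map _ _ (single g) = f := by
  classical
  refine ⟨fun c => Λ.coord s t f c.1, (augRes_map_single hst h ht _).trans ?_⟩
  funext c
  refine (cut_apply h _ c).trans ?_
  exact Λ.coord_of_mem f c

end

end Front


/-! ## A square of complexes -/

section

variable {U L R V : Type*} [AddCommGroup U] [AddCommGroup L] [AddCommGroup R] [AddCommGroup V]
  {dU : U →+ U} {dL : L →+ L} {dR : R →+ R} {dV : V →+ V} {r : U →+ L} {r' : U →+ R} {p : L →+ V} {q : R →+ V}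

/-- If the differences of restrictions fill `V`, and the elements of `U` are the compatible pairs,
then `U` computes the homotopy fibre product: injectivity on cohomology. -/
theorem fibre_square_inj (hr : ∀ f, r (dU f) = dL (r f)) (hr' : ∀ f, r' (dU f) = dR (r' f))
    (hp : ∀ f, p (dL f) = dV (p f)) (hq : ∀ g, q (dR g) = dV (q g))
    (hdL : ∀ f, dL (dL f) = 0) (hdR : ∀ g, dR (dR g) = 0)
    (h1 : ∀ h, ∃ f g, q g - p f = h) (h2 : ∀ f g, p f = q g → ∃ k, r k = f ∧ r' k = g)
    (h3 : ∀ k, r k = 0 → r' k = 0 → k = 0) {f : U} {f₀ : L} {g₀ : R} {h₀ : V}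
    (hf : dL f₀ = r f) (hg : dR g₀ = r' f) (hh : q g₀ - p f₀ - dV h₀ = 0) : ∃ k, dU k = f := by
  obtain ⟨f₁, g₁, e⟩ := h1 h₀
  obtain ⟨k, hk, hk'⟩ := h2 (f₀ - dL f₁) (g₀ - dR g₁) (by
    rw [map_sub, map_sub, hp, hq]
    rw [← e, map_sub] at hh
    rw [← sub_eq_zero, ← neg_eq_zero, ← hh]
    abel)
  refine ⟨k, sub_eq_zero.1 (h3 _ ?_ ?_)⟩
  · rw [map_sub, hr, hk, map_sub, hdL, sub_zero, hf, sub_self]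
  · rw [map_sub, hr', hk', map_sub, hdR, sub_zero, hg, sub_self]

/-- Surjectivity on cohomology. -/
theorem fibre_square_surj (hr : ∀ f, r (dU f) = dL (r f)) (hr' : ∀ f, r' (dU f) = dR (r' f))
    (hp : ∀ f, p (dL f) = dV (p f)) (hq : ∀ g, q (dR g) = dV (q g))
    (hdL : ∀ f, dL (dL f) = 0) (hdR : ∀ g, dR (dR g) = 0)
    (h1 : ∀ h, ∃ f g, q g - p f = h) (h2 : ∀ f g, p f = q g → ∃ k, r k = f ∧ r' k = g)
    (h3 : ∀ k, r k = 0 → r' k = 0 → k = 0) {f : L} {g : R} {h : V}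
    (hf : dL f = 0) (hg : dR g = 0) (hh : q g - p f - dV h = 0) :
    ∃ k, dU k = 0 ∧ ∃ f₀ g₀ h₀, dL f₀ = r k - f ∧ dR g₀ = r' k - g ∧ q g₀ - p f₀ - dV h₀ = 0 - h := by
  obtain ⟨f₁, g₁, e⟩ := h1 h
  obtain ⟨k, hk, hk'⟩ := h2 (f - dL f₁) (g - dR g₁) (by
    rw [map_sub, map_sub, hp, hq]
    rw [← e, map_sub] at hh
    rw [← sub_eq_zero, ← neg_eq_zero, ← hh]
    abel)
  refine ⟨k, h3 _ ?_ ?_, -f₁, -g₁, 0, ?_, ?_, ?_⟩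
  · rw [hr, hk, map_sub, hf, hdL, sub_zero]
  · rw [hr', hk', map_sub, hg, hdR, sub_zero]
  · rw [hk, map_neg]; abel
  · rw [hk', map_neg]; abel
  · rw [← e, map_neg, map_neg, map_zero]; abel

end

namespace AInfCat

open Str

variable {𝕜 : Type u} [CommRing 𝕜] {A B : AInfCat 𝕜}

/-- The differential, as a homomorphism. -/
def IsAInf.diff (hA : A.IsAInf) (x y : A.Obj) : A.Hom x y →+ A.Hom x y where
  toFun f := A.b (single f)
  map_zero' := hA.b_zero
  map_add' f g := by
    have := hA.b_add (nil y) f g (nil x)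
    rwa [nil_append, nil_append, nil_append] at this

theorem IsAInf.b_b_single (hA : A.IsAInf) {x y : A.Obj} (f : A.Hom x y) :
    A.b (single (A.b (single f))) = 0 := by
  have h := hA.b_b (single f)
  rw [sum_bHat] at h
  have h1 := hA.b_zero_right (x := x) (-A.par x y f)
  simp only [single] at h1
  simpa [single, hA.b_nil, hA.b_zero_left, h1] using h

/-- The linear part of a functor. -/
def _root_.AInfFunctor.IsFunctor.linear {F : AInfFunctor A B} (hF : F.IsFunctor) (x y : A.Obj) :
    A.Hom x y →+ B.Hom (F.obj x) (F.obj y) where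
  toFun f := F.map x y (single f)
  map_zero' := hF.map_zero
  map_add' f g := by
    have := hF.map_add (nil y) f g (nil x)
    rwa [nil_append, nil_append, nil_append] at this

end AInfCat

namespace Front

open Str AInfCat

variable {Λ : Front} {𝕜 : Type u} [CommRing 𝕜] {s t s' t' : ℕ}

/-! ## The complex of morphisms in the fibre product -/

theorem evalHom_transOne_left (ht : t ≤ Λ.size) {p q r : (Λ.augCat 𝕜 s t).Obj} (e : q = r)
    (f : (Λ.augCat 𝕜 s t).Hom p q) (c : Λ.Plus s t) :
    evalHom Λ c p r ((Λ.augCat 𝕜 s t).b (cons ((Λ.augCat 𝕜 s t).transOne e) (single f))) =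
      evalHom Λ c p q f := by
  subst e
  rw [transOne, (Λ.isAInf_augCat ht).one_left]

theorem evalHom_transOne_right (ht : t ≤ Λ.size) {p q r : (Λ.augCat 𝕜 s t).Obj} (e : p = q)
    (f : (Λ.augCat 𝕜 s t).Hom q r) (c : Λ.Plus s t) :
    evalHom Λ c p r ((Λ.augCat 𝕜 s t).b (cons f (single ((Λ.augCat 𝕜 s t).transOne e)))) =
      sgn (Λ.deg s c.1 + 1) * evalHom Λ c q r f := by
  subst e
  rw [transOne, (Λ.isAInf_augCat ht).one_right]
  rfl

theorem b_single_congr {p q p' q' : (Λ.augCat 𝕜 s t).Obj} (e : p = p') (e' : q = q')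
    {f : (Λ.augCat 𝕜 s t).Hom p q} {f' : (Λ.augCat 𝕜 s t).Hom p' q'}
    (h : ∀ c, evalHom Λ c p q f = evalHom Λ c p' q' f') (c : Λ.Plus s t) :
    evalHom Λ c p q ((Λ.augCat 𝕜 s t).b (single f)) =
      evalHom Λ c p' q' ((Λ.augCat 𝕜 s t).b (single f')) := by
  subst e e'
  rw [show f = f' from funext h]

theorem augRes_map_par (h : s ≤ s') (hst : s' ≤ t') (h' : t' ≤ t) (ht : t ≤ Λ.size)
    {x y : (Λ.augCat 𝕜 s t).Obj} (f : (Λ.augCat 𝕜 s t).Hom x y) (c : Λ.Plus s' t') :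
    evalHom Λ c _ _ ((Λ.augRes 𝕜 h hst h' ht).map x y (single (- (Λ.augCat 𝕜 s t).par x y f))) =
      sgn (Λ.deg s' c.1) * evalHom Λ c _ _ ((Λ.augRes 𝕜 h hst h' ht).map x y (single f)) := by
  have h1 : (Λ.augCat 𝕜 s t).signHom (Λ.resCoch 𝕜 s t s' c.1) =
      sgn (Λ.deg s' c.1) • Λ.resCoch 𝕜 s t s' c.1 := by
    obtain ⟨c, hc⟩ := c
    cases c with
    | line i j =>
      exact Λ.blockDisks_parity h (fun i j => Λ.catCoch_parity _) (fun e _ _ => Λ.catCoch_parity (.ev e))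
        (fun e _ _ => Λ.signHom_catData_mark e) i j
    | ev e => exact Λ.catCoch_parity (.ev e)
  have h2 := congrArg (fun χ => Coch.val χ (single f)) h1
  simp only [signHom_val, Coch.zsmul_val, single, sgnStr_cons, sgnStr_nil] at h2
  refine (Λ.augRes_map h hst h' ht _ (by simp [single]) c).trans ?_
  refine Eq.trans ?_ (congrArg _ (Λ.augRes_map h hst h' ht (single f) (by simp [single]) c).symm)
  simp only [single]
  rw [h2, zsmul_eq_mul]
  ring

end Front


namespace Front

open Str AInfCat

variable {Λ : Front} {𝕜 : Type u} [CommRing 𝕜]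

/-! ## The gluing functor -/

section

variable {a t a₁ t₁ a₂ t₂ b m : ℕ} (g1 : a ≤ a₁) (s1 : a₁ ≤ t₁) (g1' : t₁ ≤ t) (g2 : a ≤ a₂) (s2 : a₂ ≤ t₂)
  (g2' : t₂ ≤ t) (ht : t ≤ Λ.size) (p1 : a₁ ≤ b) (p2 : a₂ ≤ b) (hs : b ≤ m) (p1' : m ≤ t₁) (p2' : m ≤ t₂)

include g1 g1' ht p1 p1' g2 g2' p2 p2' in
theorem augRes_obj_square (x : (Λ.augCat 𝕜 a t).Obj) :
    (Λ.augRes 𝕜 p1 hs p1' (g1'.trans ht)).obj ((Λ.augRes 𝕜 g1 s1 g1' ht).obj x) =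
      (Λ.augRes 𝕜 p2 hs p2' (g2'.trans ht)).obj ((Λ.augRes 𝕜 g2 s2 g2' ht).obj x) :=
  (augRes_obj_trans g1 s1 g1' ht p1 hs p1' x).symm.trans (augRes_obj_trans g2 s2 g2' ht p2 hs p2' x)

/-- The functor from sections to pairs of sections which are identified on the overlap. -/
def gluing : AInfFunctor (Λ.augCat 𝕜 a t)
    (fibre (Λ.augRes 𝕜 p1 hs p1' (g1'.trans ht)) (Λ.augRes 𝕜 p2 hs p2' (g2'.trans ht))) where
  obj x := ⟨(Λ.augRes 𝕜 g1 s1 g1' ht).obj x, (Λ.augRes 𝕜 g2 s2 g2' ht).obj x,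
    (Λ.augCat 𝕜 b m).transOne (augRes_obj_square g1 s1 g1' g2 s2 g2' ht p1 p2 hs p1' p2' x),
    isIso_transOne (Λ.isAInf_augCat (p1'.trans (g1'.trans ht))) _⟩
  map x y s := ((Λ.augRes 𝕜 g1 s1 g1' ht).map x y s, (Λ.augRes 𝕜 g2 s2 g2' ht).map x y s, 0)

/-- The differential of a morphism between glued sections. -/
theorem fibB_single_apply {X Y : FibObj (Λ.augRes 𝕜 p1 hs p1' (g1'.trans ht)) (Λ.augRes 𝕜 p2 hs p2' (g2'.trans ht))}
    {e e'} (hX : X.iso = (Λ.augCat 𝕜 b m).transOne e) (hY : Y.iso = (Λ.augCat 𝕜 b m).transOne e')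
    (Φ : FibHom _ _ X Y) (c : Λ.Plus b m) :
    evalHom Λ c _ _ (fibB (Λ.augRes 𝕜 p1 hs p1' (g1'.trans ht)) (Λ.augRes 𝕜 p2 hs p2' (g2'.trans ht)) (single Φ)) =
      evalHom Λ c _ _ ((Λ.augRes 𝕜 p2 hs p2' (g2'.trans ht)).map _ _ (single Φ.2.1)) -
      evalHom Λ c _ _ ((Λ.augRes 𝕜 p1 hs p1' (g1'.trans ht)).map _ _ (single Φ.1)) -
      evalHom Λ c _ _ ((Λ.augCat 𝕜 b m).b (single Φ.2.2)) := by
  have hm := p1'.trans (g1'.trans ht)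
  rw [fibB_single, hX, hY, map_neg, map_add, map_add, evalHom_transOne_left hm, evalHom_transOne_right hm]
  rw [augRes_map_par]
  have h1 := congrArg (Int.cast (R := 𝕜)) (sgn_mul_self (Λ.deg b c.1))
  push_cast at h1
  rw [sgn_add, sgn_one]
  push_cast
  linear_combination (evalHom Λ c _ _ ((Λ.augRes 𝕜 p2 hs p2' (g2'.trans ht)).map _ _ (single Φ.2.1))) * h1

variable {g1 s1 g1' g2 s2 g2' ht p1 p2 hs p1' p2'}

/-- Mayer-Vietoris: if restrictions fill the overlap and compatible pairs glue uniquely, then the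
gluing functor is an equivalence. -/
theorem gluing_isEquivalence
    (h1 : ∀ (x y : (Λ.augCat 𝕜 a t).Obj) (h : Λ.Plus b m → 𝕜),
      ∃ (f : (Λ.augCat 𝕜 a₁ t₁).Hom ((Λ.augRes 𝕜 g1 s1 g1' ht).obj x) ((Λ.augRes 𝕜 g1 s1 g1' ht).obj y))
        (g : (Λ.augCat 𝕜 a₂ t₂).Hom ((Λ.augRes 𝕜 g2 s2 g2' ht).obj x) ((Λ.augRes 𝕜 g2 s2 g2' ht).obj y)),
        ∀ c, evalHom Λ c _ _ ((Λ.augRes 𝕜 p2 hs p2' (g2'.trans ht)).map _ _ (single g)) -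
          evalHom Λ c _ _ ((Λ.augRes 𝕜 p1 hs p1' (g1'.trans ht)).map _ _ (single f)) = h c)
    (h2 : ∀ (x y : (Λ.augCat 𝕜 a t).Obj)
      (f : (Λ.augCat 𝕜 a₁ t₁).Hom ((Λ.augRes 𝕜 g1 s1 g1' ht).obj x) ((Λ.augRes 𝕜 g1 s1 g1' ht).obj y))
      (g : (Λ.augCat 𝕜 a₂ t₂).Hom ((Λ.augRes 𝕜 g2 s2 g2' ht).obj x) ((Λ.augRes 𝕜 g2 s2 g2' ht).obj y)),
      (∀ c : Λ.Plus b m, (Λ.augRes 𝕜 p1 hs p1' (g1'.trans ht)).map _ _ (single f) c =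
        (Λ.augRes 𝕜 p2 hs p2' (g2'.trans ht)).map _ _ (single g) c) →
      ∃ k : (Λ.augCat 𝕜 a t).Hom x y, (Λ.augRes 𝕜 g1 s1 g1' ht).map _ _ (single k) = f ∧
        (Λ.augRes 𝕜 g2 s2 g2' ht).map _ _ (single k) = g)
    (h3 : ∀ (x y : (Λ.augCat 𝕜 a t).Obj) (k : (Λ.augCat 𝕜 a t).Hom x y),
      (Λ.augRes 𝕜 g1 s1 g1' ht).map _ _ (single k) = 0 →
      (Λ.augRes 𝕜 g2 s2 g2' ht).map _ _ (single k) = 0 → k = 0)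
    (h4 : ∀ T, ∃ (x : (Λ.augCat 𝕜 a t).Obj) (φ : (fibre _ _).Hom
      ((gluing (𝕜 := 𝕜) g1 s1 g1' g2 s2 g2' ht p1 p2 hs p1' p2').obj x) T), IsIso φ) :
    (gluing (Λ := Λ) (𝕜 := 𝕜) g1 s1 g1' g2 s2 g2' ht p1 p2 hs p1' p2').IsEquivalence := by
  have hm := p1'.trans (g1'.trans ht)
  have hU := Λ.isAInf_augCat (𝕜 := 𝕜) (s := a) ht
  have hA := Λ.isAInf_augCat (𝕜 := 𝕜) (s := a₁) (g1'.trans ht)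
  have hB := Λ.isAInf_augCat (𝕜 := 𝕜) (s := a₂) (g2'.trans ht)
  have hC := Λ.isAInf_augCat (𝕜 := 𝕜) (s := b) hm
  have h1r := Λ.isFunctor_augRes (𝕜 := 𝕜) g1 s1 g1' ht
  have h2r := Λ.isFunctor_augRes (𝕜 := 𝕜) g2 s2 g2' ht
  have hP := Λ.isFunctor_augRes (𝕜 := 𝕜) p1 hs p1' (g1'.trans ht)
  have hQ := Λ.isFunctor_augRes (𝕜 := 𝕜) p2 hs p2' (g2'.trans ht)
  have sq := augRes_obj_square (Λ := Λ) (𝕜 := 𝕜) g1 s1 g1' g2 s2 g2' ht p1 p2 hs p1' p2'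
  let p (x y : (Λ.augCat 𝕜 a t).Obj) : _ →+ (Λ.Plus b m → 𝕜) :=
    hP.linear ((Λ.augRes 𝕜 g1 s1 g1' ht).obj x) ((Λ.augRes 𝕜 g1 s1 g1' ht).obj y)
  let q (x y : (Λ.augCat 𝕜 a t).Obj) : _ →+ (Λ.Plus b m → 𝕜) :=
    hQ.linear ((Λ.augRes 𝕜 g2 s2 g2' ht).obj x) ((Λ.augRes 𝕜 g2 s2 g2' ht).obj y)
  let d (x y : (Λ.augCat 𝕜 a t).Obj) : (Λ.Plus b m → 𝕜) →+ (Λ.Plus b m → 𝕜) :=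
    hC.diff ((Λ.augRes 𝕜 p1 hs p1' (g1'.trans ht)).obj ((Λ.augRes 𝕜 g1 s1 g1' ht).obj x))
      ((Λ.augRes 𝕜 p2 hs p2' (g2'.trans ht)).obj ((Λ.augRes 𝕜 g2 s2 g2' ht).obj y))
  have hp : ∀ x y f, p x y (hA.diff _ _ f) = d x y (p x y f) := fun x y f => funext fun c =>
    (congrArg (evalHom Λ c _ _) (hP.map_b_single hA f)).trans
      (b_single_congr rfl (sq y) (fun _ => rfl) c)
  have hq : ∀ x y f, q x y (hB.diff _ _ f) = d x y (q x y f) := fun x y f => funext fun c =>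
    (congrArg (evalHom Λ c _ _) (hQ.map_b_single hB f)).trans
      (b_single_congr (sq x).symm rfl (fun _ => rfl) c)
  have hb : ∀ (x y : (Λ.augCat 𝕜 a t).Obj) f g h, (fibre _ _).b (single (H := (fibre _ _).Hom)
      (x := (gluing (𝕜 := 𝕜) g1 s1 g1' g2 s2 g2' ht p1 p2 hs p1' p2').obj x)
      (y := (gluing (𝕜 := 𝕜) g1 s1 g1' g2 s2 g2' ht p1 p2 hs p1' p2').obj y) (f, g, h)) =
      (hA.diff _ _ f, hB.diff _ _ g, (q x y g - p x y f - d x y h : Λ.Plus b m → 𝕜)) := by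
    intro x y f g h
    exact (fibre_b_single _).trans (Prod.ext rfl (Prod.ext rfl (funext fun c =>
      fibB_single_apply g1' g2' ht p1 p2 hs p1' p2' rfl rfl (f, g, h) c)))
  have h1' : ∀ x y h, ∃ f g, q x y g - p x y f = h := fun x y h => by
    obtain ⟨f, g, e⟩ := h1 x y h
    exact ⟨f, g, funext e⟩
  refine ⟨fun {x y} f hf hE => ?_, fun {x y} Φ hΦ => ?_, h4⟩
  · obtain ⟨⟨f₀, g₀, h₀⟩, hE⟩ := hE
    have e := (hb x y f₀ g₀ h₀).symm.trans hE
    exact fibre_square_inj (dU := hU.diff x y) (dL := hA.diff _ _) (dR := hB.diff _ _) (r := h1r.linear x y) (r' := h2r.linear x y)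
      (fun f => h1r.map_b_single hU f) (fun f => h2r.map_b_single hU f) (hp x y) (hq x y)
      (fun f => hA.b_b_single f) (fun f => hB.b_b_single f) (h1' x y)
      (fun f g hfg => h2 x y f g (congrFun hfg)) (h3 x y)
      (congrArg Prod.fst e) (congrArg (fun z => z.2.1) e) (congrArg (fun z => z.2.2) e)
  · obtain ⟨f, g, h⟩ := Φ
    have e := (hb x y f g h).symm.trans hΦ
    obtain ⟨k, hk, f₀, g₀, h₀, e1, e2, e3⟩ := fibre_square_surj (dU := hU.diff x y) (dL := hA.diff _ _) (dR := hB.diff _ _) (r := h1r.linear x y)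
      (r' := h2r.linear x y)
      (fun f => h1r.map_b_single hU f) (fun f => h2r.map_b_single hU f) (hp x y) (hq x y)
      (fun f => hA.b_b_single f) (fun f => hB.b_b_single f) (h1' x y)
      (fun f g hfg => h2 x y f g (congrFun hfg)) (h3 x y)
      (congrArg Prod.fst e) (congrArg (fun z => z.2.1) e) (congrArg (fun z => z.2.2) e)
    exact ⟨k, hk, (f₀, g₀, h₀), (hb x y f₀ g₀ h₀).trans (Prod.ext e1 (Prod.ext e2 e3))⟩

end

end Front


namespace Front

open Str AInfCat

variable {Λ : Front} {𝕜 : Type u} [CommRing 𝕜]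

/-! ## The two positions of overlapping intervals -/

section

variable {a b t₁ t₂ m M : ℕ} (hΛ : Λ.BasePointsAtRightCusps) (hab : a ≤ b) (hb : b ≤ m)
    (h1 : m ≤ t₁) (h2 : m ≤ t₂) (h1' : t₁ ≤ M) (h2' : t₂ ≤ M) (hM : M ≤ Λ.size)
    (hm : (t₁ = m ∧ t₂ = M) ∨ (t₂ = m ∧ t₁ = M))

include hΛ hm in
/-- Sections over the first interval and an interval which begins further to the right. -/
theorem gluing_left : (gluing (Λ := Λ) (𝕜 := 𝕜) le_rfl (hab.trans (hb.trans h1)) h1' hab (hb.trans h2) h2' hM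
    hab le_rfl hb h1 h2).IsEquivalence := by
  have ht₁ := h1'.trans hM
  have ht₂ := h2'.trans hM
  have hbm := h1.trans ht₁
  have hA := Λ.isAInf_augCat (𝕜 := 𝕜) (s := a) ht₁
  have hB := Λ.isAInf_augCat (𝕜 := 𝕜) (s := b) ht₂
  have hC := Λ.isAInf_augCat (𝕜 := 𝕜) (s := b) hbm
  have hP := Λ.isFunctor_augRes (𝕜 := 𝕜) hab hb h1 ht₁
  have hQ := Λ.isFunctor_augRes (𝕜 := 𝕜) le_rfl hb h2 ht₂
  refine gluing_isEquivalence (fun x y h => ?_) (fun x y f g hfg => ?_) (fun x y k h3 h4 => ?_) fun ⟨ξ₀, η₀, φ, hφ⟩ => ?_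
  · obtain ⟨g, hg⟩ := exists_map_eq hb h2 ht₂ (x := (Λ.augRes 𝕜 hab (hb.trans h2) h2' hM).obj x)
      (y := (Λ.augRes 𝕜 hab (hb.trans h2) h2' hM).obj y) h
    refine ⟨0, g, fun c => ?_⟩
    rw [hP.map_zero, map_zero, sub_zero]
    exact congrFun hg c
  · exact exists_glue_hom hab hb h1 h2 h1' h2' hM (by omega) f g hfg
  · exact hom_eq_zero_of_glue hab hb h1 h2 h1' h2' hM (by omega) k h3 h4
  · obtain ⟨η, ψ, e, hψ, hc⟩ := DiagIso.exists_source_of_le hΛ hb h2 ht₂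
      (x' := (Λ.augRes 𝕜 hab hb h1 ht₁).obj ξ₀) (y := η₀) (f := φ)
      ⟨hφ.1, hφ.2.1, unitDiag_of_isIso hbm hφ⟩
    obtain ⟨ψ', rfl⟩ : ∃ ψ' : (Λ.augCat 𝕜 b t₂).Hom η η₀, ψ' = ψ := ⟨_, rfl⟩
    obtain ⟨x, hx, hx'⟩ := exists_glue hΛ hab hb h1 h2 h1' h2' hM hm ξ₀ η e.symm
    have key : ∃ Φ : (fibre (Λ.augRes 𝕜 hab hb h1 ht₁) (Λ.augRes 𝕜 le_rfl hb h2 ht₂)).Hom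
        ⟨ξ₀, η, (Λ.augCat 𝕜 b m).transOne e.symm, isIso_transOne hC _⟩ ⟨ξ₀, η₀, φ, hφ⟩, IsIso Φ := by
      refine fibre_isIso_of_right hA hB hC hP hQ (isStrict_augRes hb h2 ht₂) ⟨ξ₀, η₀, φ, hφ⟩ e.symm _ hψ.deg hψ.closed
        (hψ.unit.rightBij ht₂ hψ.deg) (funext fun c => ?_)
      refine (evalHom_transOne_right hbm e.symm _ c).trans ?_
      have e1 := augRes_map_par le_rfl hb h2 ht₂ ψ' c
      rw [hB.par_zero hψ.deg, hQ.map_neg, map_neg] at e1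
      have e2 : evalHom Λ c _ _ ((Λ.augRes 𝕜 le_rfl hb h2 ht₂).map _ _ (single ψ')) = φ c :=
        (congrFun (augRes_map_single hb h2 ht₂ ψ') c).trans (congrFun hc c)
      refine Eq.trans ?_ e2
      rw [sgn_add, sgn_one]
      push_cast
      linear_combination e1
    subst hx hx'
    exact ⟨x, key⟩

include hΛ hm in
/-- Sections over the second interval and an interval which begins further to the left. -/
theorem gluing_right : (gluing (Λ := Λ) (𝕜 := 𝕜) hab (hb.trans h2) h2' le_rfl (hab.trans (hb.trans h1)) h1' hM
    le_rfl hab hb h2 h1).IsEquivalence := by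
  have ht₁ := h1'.trans hM
  have ht₂ := h2'.trans hM
  have hbm := h1.trans ht₁
  have hA := Λ.isAInf_augCat (𝕜 := 𝕜) (s := a) ht₁
  have hB := Λ.isAInf_augCat (𝕜 := 𝕜) (s := b) ht₂
  have hC := Λ.isAInf_augCat (𝕜 := 𝕜) (s := b) hbm
  have hP := Λ.isFunctor_augRes (𝕜 := 𝕜) hab hb h1 ht₁
  have hQ := Λ.isFunctor_augRes (𝕜 := 𝕜) le_rfl hb h2 ht₂
  refine gluing_isEquivalence (fun x y h => ?_) (fun x y f g hfg => ?_) (fun x y k h3 h4 => ?_) fun ⟨ξ₀, η₀, φ, hφ⟩ => ?_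
  · obtain ⟨g, hg⟩ := exists_map_eq hb h2 ht₂ (x := (Λ.augRes 𝕜 hab (hb.trans h2) h2' hM).obj x)
      (y := (Λ.augRes 𝕜 hab (hb.trans h2) h2' hM).obj y) (-h)
    refine ⟨g, 0, fun c => ?_⟩
    rw [hP.map_zero, map_zero, zero_sub]
    refine (congrArg Neg.neg (congrFun hg c)).trans (neg_neg _)
  · obtain ⟨k, hk, hk'⟩ := exists_glue_hom hab hb h1 h2 h1' h2' hM (by omega) g f fun c => (hfg c).symm
    exact ⟨k, hk', hk⟩
  · exact hom_eq_zero_of_glue hab hb h1 h2 h1' h2' hM (by omega) k h4 h3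
  · obtain ⟨ξ, ψ, e, hψ, hc⟩ := DiagIso.exists_target_of_le hΛ hb h2 ht₂
      (x := ξ₀) (y' := (Λ.augRes 𝕜 hab hb h1 ht₁).obj η₀) (f := φ)
      ⟨hφ.1, hφ.2.1, unitDiag_of_isIso hbm hφ⟩
    obtain ⟨ψ', rfl⟩ : ∃ ψ' : (Λ.augCat 𝕜 b t₂).Hom ξ₀ ξ, ψ' = ψ := ⟨_, rfl⟩
    obtain ⟨x, hx, hx'⟩ := exists_glue hΛ hab hb h1 h2 h1' h2' hM hm η₀ ξ e.symm
    have key : ∃ Φ : (fibre (Λ.augRes 𝕜 le_rfl hb h2 ht₂) (Λ.augRes 𝕜 hab hb h1 ht₁)).Hom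
        ⟨ξ, η₀, (Λ.augCat 𝕜 b m).transOne e, isIso_transOne hC _⟩ ⟨ξ₀, η₀, φ, hφ⟩, IsIso Φ := by
      refine fibre_isIso_of_left hB hA hC hQ hP (isStrict_augRes hb h2 ht₂) ⟨ξ₀, η₀, φ, hφ⟩ e _ hψ.deg hψ.closed
        (hψ.unit.leftBij ht₂ hψ.deg) (funext fun c => ?_)
      refine (evalHom_transOne_left hbm e _ c).trans ?_
      exact (congrFun (augRes_map_single hb h2 ht₂ ψ') c).trans (congrFun hc c)
    subst hx hx'
    exact ⟨x, key⟩

end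

end Front


namespace AInfFunctor

variable {𝕜 : Type u} [CommRing 𝕜] {A : AInfCat 𝕜}

theorem id_isEquivalence (hA : A.IsAInf) : (AInfFunctor.id A).IsEquivalence where
  inj _ _ h := h
  surj g hg := ⟨g, hg, 0, hA.b_zero.trans (sub_self g).symm⟩
  ess_surj y := ⟨y, A.transOne rfl, AInfCat.isIso_transOne hA rfl⟩

end AInfFunctor

namespace OpenInterval

variable {U L R V : OpenInterval}

theorem lowerBounds_cases (hU : U.carrier = L.carrier ∪ R.carrier) (hV : V.carrier = L.carrier ∩ R.carrier)
    (h : lowerBounds L.carrier ⊆ lowerBounds R.carrier) :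
    lowerBounds U.carrier = lowerBounds L.carrier ∧ lowerBounds V.carrier = lowerBounds R.carrier := by
  refine ⟨by rw [hU, lowerBounds_union, Set.inter_eq_left.2 h], Set.Subset.antisymm (fun p hp x hx => ?_)
    (lowerBounds_mono_set (hV ▸ Set.inter_subset_right))⟩
  by_contra hxp
  obtain ⟨v, hv⟩ := V.nonempty
  have hpv := hp hv
  rw [hV] at hv
  have hpL : p ∉ lowerBounds L.carrier := fun hpL => hxp (h hpL hx)
  simp only [mem_lowerBounds, not_forall, not_le] at hpL hxp
  obtain ⟨y, hy, hyp⟩ := hpL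
  have hm : max x y < p := max_lt hxp hyp
  refine hm.not_ge (hp ?_)
  rw [hV]
  exact ⟨L.ordConnected.out hy hv.1 ⟨le_max_right _ _, (hm.trans_le hpv).le⟩,
    R.ordConnected.out hx hv.2 ⟨le_max_left _ _, (hm.trans_le hpv).le⟩⟩

theorem lowerClosure_cases (hU : U.carrier = L.carrier ∪ R.carrier) (hV : V.carrier = L.carrier ∩ R.carrier)
    (h : lowerClosure L.carrier ≤ lowerClosure R.carrier) :
    lowerClosure U.carrier = lowerClosure R.carrier ∧ lowerClosure V.carrier = lowerClosure L.carrier := by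
  refine ⟨by rw [hU, lowerClosure_union, sup_eq_right.2 h], le_antisymm
    (lowerClosure_mono (hV ▸ Set.inter_subset_left)) fun p hp => ?_⟩
  obtain ⟨y, hy, hpy⟩ := h hp
  obtain ⟨x, hx, hpx⟩ := hp
  obtain ⟨v, hv⟩ := V.nonempty
  rcases le_total p v with hpv | hvp
  · exact ⟨v, hv, hpv⟩
  · rw [hV] at hv
    refine ⟨p, ?_, le_rfl⟩
    rw [hV]
    exact ⟨L.ordConnected.out hv.1 hx ⟨hvp, hpx⟩, R.ordConnected.out hv.2 hy ⟨hvp, hpy⟩⟩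

end OpenInterval

namespace Front

open AInfCat

variable {Λ : Front} {𝕜 : Type u} [CommRing 𝕜] {U L R V : OpenInterval}

theorem lo_congr (h : lowerBounds U.carrier = lowerBounds V.carrier) : Λ.lo U = Λ.lo V :=
  congrArg (fun s : Set ℝ => by classical exact ((Finset.range Λ.size).filter fun e => Λ.pos e ∈ s).card) h

theorem hi_congr (h : lowerClosure U.carrier = lowerClosure V.carrier) : Λ.hi U = Λ.hi V :=
  congrArg (fun s : LowerSet ℝ => by classical exact ((Finset.range Λ.size).filter fun e => Λ.pos e ∈ s).card) h

theorem lo_cases (hU : U.carrier = L.carrier ∪ R.carrier) (hV : V.carrier = L.carrier ∩ R.carrier) :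
    (Λ.lo L = Λ.lo U ∧ Λ.lo R = Λ.lo V) ∨ (Λ.lo R = Λ.lo U ∧ Λ.lo L = Λ.lo V) := by
  have hl : ∀ s : Set ℝ, IsLowerSet (lowerBounds s) := fun s _ _ h ha _ hx => h.trans (ha hx)
  rcases (hl L.carrier).total (hl R.carrier) with h | h
  · obtain ⟨h1, h2⟩ := OpenInterval.lowerBounds_cases hU hV h
    exact .inl ⟨(lo_congr h1).symm, (lo_congr h2).symm⟩
  · obtain ⟨h1, h2⟩ := OpenInterval.lowerBounds_cases (hU.trans (Set.union_comm _ _))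
      (hV.trans (Set.inter_comm _ _)) h
    exact .inr ⟨(lo_congr h1).symm, (lo_congr h2).symm⟩

theorem hi_cases (hU : U.carrier = L.carrier ∪ R.carrier) (hV : V.carrier = L.carrier ∩ R.carrier) :
    (Λ.hi L = Λ.hi V ∧ Λ.hi R = Λ.hi U) ∨ (Λ.hi R = Λ.hi V ∧ Λ.hi L = Λ.hi U) := by
  rcases (lowerClosure L.carrier).lower.total (lowerClosure R.carrier).lower with h | h
  · obtain ⟨h1, h2⟩ := OpenInterval.lowerClosure_cases hU hV h
    exact .inl ⟨(hi_congr h2).symm, (hi_congr h1).symm⟩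
  · obtain ⟨h1, h2⟩ := OpenInterval.lowerClosure_cases (hU.trans (Set.union_comm _ _))
      (hV.trans (Set.inter_comm _ _)) h
    exact .inr ⟨(hi_congr h2).symm, (hi_congr h1).symm⟩

theorem gluing_isEquivalence_of_cases (hΛ : Λ.BasePointsAtRightCusps) {a t a₁ t₁ a₂ t₂ b m : ℕ} (g1 : a ≤ a₁)
    (s1 : a₁ ≤ t₁) (g1' : t₁ ≤ t) (g2 : a ≤ a₂) (s2 : a₂ ≤ t₂) (g2' : t₂ ≤ t) (ht : t ≤ Λ.size) (p1 : a₁ ≤ b)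
    (p2 : a₂ ≤ b) (hs : b ≤ m) (p1' : m ≤ t₁) (p2' : m ≤ t₂)
    (hlo : (a₁ = a ∧ a₂ = b) ∨ (a₂ = a ∧ a₁ = b)) (hhi : (t₁ = m ∧ t₂ = t) ∨ (t₂ = m ∧ t₁ = t)) :
    (gluing (Λ := Λ) (𝕜 := 𝕜) g1 s1 g1' g2 s2 g2' ht p1 p2 hs p1' p2').IsEquivalence := by
  rcases hlo with ⟨rfl, rfl⟩ | ⟨rfl, rfl⟩
  · exact gluing_left hΛ p1 hs p1' p2' g1' g2' ht hhi
  · exact gluing_right hΛ p2 hs p2' p1' g2' g1' ht hhi.symm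

theorem augRes_isEquivalence_of_eq {s t s' t' : ℕ} (h : s ≤ s') (hst : s' ≤ t') (h' : t' ≤ t) (ht : t ≤ Λ.size)
    (hs : s = s') (ht' : t' = t) : (Λ.augRes 𝕜 h hst h' ht).IsEquivalence := by
  subst hs ht'
  rw [augRes_refl]
  exact AInfFunctor.id_isEquivalence (Λ.isAInf_augCat ht)

theorem lo_eq_of_eventPoints (h : V.carrier ⊆ U.carrier) (hZ : Λ.eventPoints ∩ U.carrier ⊆ V.carrier) :
    Λ.lo U = Λ.lo V := by
  classical
  unfold lo
  refine congrArg Finset.card (Finset.filter_congr fun e he => ⟨fun H x hx => H x (h hx), fun H x hx => ?_⟩)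
  by_contra hxe
  rw [not_le] at hxe
  obtain ⟨v, hv⟩ := V.nonempty
  have he' := hZ ⟨⟨e, Finset.mem_range.1 he, rfl⟩, U.ordConnected.out hx (h hv) ⟨hxe.le, H v hv⟩⟩
  obtain ⟨y, hy, hyV⟩ := mem_nhdsLT_iff_exists_Ioo_subset.1 (mem_nhdsWithin_of_mem_nhds (V.isOpen.mem_nhds he'))
  obtain ⟨z, hz⟩ := exists_between (Set.mem_Iio.1 hy)
  exact (H z (hyV hz)).not_gt hz.2

theorem hi_eq_of_eventPoints (h : V.carrier ⊆ U.carrier) (hZ : Λ.eventPoints ∩ U.carrier ⊆ V.carrier) :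
    Λ.hi V = Λ.hi U := by
  classical
  unfold hi
  refine congrArg Finset.card (Finset.filter_congr fun e he => ⟨fun ⟨x, hx, hex⟩ => ⟨x, h hx, hex⟩,
    fun ⟨x, hx, hex⟩ => ?_⟩)
  obtain ⟨v, hv⟩ := V.nonempty
  rcases le_total (Λ.pos e) v with hev | hve
  · exact ⟨v, hv, hev⟩
  · exact ⟨_, hZ ⟨⟨e, Finset.mem_range.1 he, rfl⟩, U.ordConnected.out (h hv) hx ⟨hve, hex⟩⟩, le_rfl⟩

end Front

end

/-- If a front diagram has base points at all right cusps, then the presheaf of its augmentation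
categories over the line is a sheaf, constructible with respect to the positions of the crossings,
cusps and base points. -/
theorem mainTheorem8 {𝕜 : Type*} [CommRing 𝕜] (Λ : Front) (hΛ : Λ.BasePointsAtRightCusps) :
    (Λ.augPresheaf 𝕜).IsSheaf ∧ (Λ.augPresheaf 𝕜).IsConstructible Λ.eventPoints :=
  ⟨⟨Λ.isPresheaf_augPresheaf, fun U L R V hL hR hVL hVR hU hV =>
    Front.gluing_isEquivalence_of_cases hΛ (Λ.lo_mono hL) (Λ.lo_le_hi L) (Λ.hi_mono hL) (Λ.lo_mono hR)
      (Λ.lo_le_hi R) (Λ.hi_mono hR) (Λ.hi_le U) (Λ.lo_mono hVL) (Λ.lo_mono hVR) (Λ.lo_le_hi V)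
      (Λ.hi_mono hVL) (Λ.hi_mono hVR) (Front.lo_cases hU hV) (Front.hi_cases hU hV)⟩,
  fun U V h hZ => Front.augRes_isEquivalence_of_eq (Λ.lo_mono h) (Λ.lo_le_hi V) (Λ.hi_mono h) (Λ.hi_le U)
    (Front.lo_eq_of_eventPoints h hZ) (Front.hi_eq_of_eventPoints h hZ)⟩
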